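/- Let $K$ be a field of characteristic zero and let $n\geq 3$ be odd. Let $\mathrm{GC}_n$ be Kontsevich's graph complex: the dg Lie algebra of formal series of connected graphs all of whose vertices have valence at least three (multiple edges allowed; graphs with tadpoles vanish for $n$ odd), where a graph with $N$ vertices and $k$ edges has degree $n(N-1)-(n-1)k$, orientations are given by an ordering of the vertices and directions of the edges (up to sign), the bracket is the graded commutator of graph insertion, and the differential $\delta=[\bullet\!\!-\!\!\bullet,-]$ is vertex splitting. Let $H(B\mathit{SO}(n))=K[p_4,p_8,\dots,p_{2n-2}]$ with Pontryagin classes $p_{4i}$ of degree $4i$, and let $\mathsf{BGC}_n=\mathrm{GC}_n\hat\otimes H(B\mathit{SO}(n))$ be the completed tensor product. Write $\Theta_k$ for the graph with two vertices joined by $k$ edges (as an invariant element: the signed sum over all labellings of the vertices). Call a graph very loopy if for every vertex $v$ the graph obtained by deleting $v$ and all edges at $v$ contains a loop (a closed cycle; a double edge counts as a cycle). (a) Let $m\in\mathsf{BGC}_n$ be a Maurer–Cartan element (of degree $1$, $\delta m+\frac12[m,m]=0$) whose part on graphs with two vertices is $$m_0=\sum_{j\geq 1}\frac{p_{2n-2}^{\,j}}{4^j}\,\frac{1}{2(2j+1)!}\,\Theta_{2j+1}.$$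 Then there is a Maurer–Cartan element $m'\in\mathsf{BGC}_n$ that is gauge equivalent to $m$, i.e. $$m'=\sum_{j\ge 0}\tfrac1{j!}\,\mathrm{ad}_\xi^j\,m-\sum_{j\ge 0}\tfrac1{(j+1)!}\,\mathrm{ad}_\xi^j\,\delta\xi$$ for some $\xi\in\mathsf{BGC}_n$ of degree $0$, such that the two-vertex part of $m'$ is $m_0$ and all other graphs occurring in $m'$ are very loopy. (b) Let $\mathrm{GC}_n^{vl}\subset\mathrm{GC}_n$ be the subcomplex of series of very loopy graphs. The odd-degree cohomology of the quotient $\mathrm{GC}_n/\mathrm{GC}_n^{vl}$ is one-dimensional, spanned by the class of the theta graph $\Theta_3$ (of degree $3-2n$). -/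

import Mathlib

open Equiv Finset

noncomputable section

namespace OddGC

/-! ### Labelled multigraphs -/

/-- Possible positions of an edge between labelled vertices `0, …, N - 1`; the edge is directed
from the smaller to the larger label. -/
abbrev Edge (N : ℕ) : Type := {p : Fin N × Fin N // p.1 < p.2}

/-- A multigraph on the vertices `0, …, N - 1`, without tadpoles: `Γ p` is the multiplicity of the
edge `p`. -/
abbrev Multigraph (N : ℕ) : Type := Edge N →₀ ℕ

namespace Multigraph

variable {N : ℕ} (Γ : Multigraph N)

/-- The number of edges between `i` and `j`. -/
def mult (i j : Fin N) : ℕ :=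
  if h : i < j then Γ ⟨(i, j), h⟩ else if h : j < i then Γ ⟨(j, i), h⟩ else 0

theorem mult_comm (i j : Fin N) : Γ.mult i j = Γ.mult j i := by
  unfold mult
  rcases lt_trichotomy i j with h | h | h
  · simp [h, h.not_gt]
  · subst h; rfl
  · simp [h, h.not_gt]

theorem mult_self (i : Fin N) : Γ.mult i i = 0 := by simp [mult]

/-- The number of edges. -/
def numEdges : ℕ := ∑ p, Γ p

/-- The number of half-edges at `v`. -/
def valence (v : Fin N) : ℕ := ∑ j, Γ.mult v j

/-- The simple graph obtained by forgetting multiplicities. -/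
def toSimple : SimpleGraph (Fin N) where
  Adj i j := Γ.mult i j ≠ 0
  symm := ⟨fun i j h => by rwa [Γ.mult_comm j i]⟩
  loopless := ⟨fun i h => h (Γ.mult_self i)⟩

/-- The graph that remains after deleting the vertex `v` and all edges at `v` contains a loop
(a closed cycle; two parallel edges form a cycle of length two). -/
def ComplementHasLoop (v : Fin N) : Prop :=
  ¬ (Γ.toSimple.induce {v}ᶜ).IsAcyclic ∨ ∃ i j, i ≠ v ∧ j ≠ v ∧ 2 ≤ Γ.mult i j

/-- The complement of every vertex has at least one loop. -/
def VeryLoopy : Prop := ∀ v, Γ.ComplementHasLoop v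

end Multigraph

/-! ### The graph operad for odd `n` -/

/-- `Gra_n(N)` for odd `n`, with coefficients in `A`.  Edges have even degree and reversing the
direction of an edge changes the sign, so that graphs on `N` labelled vertices are the monomials of
a polynomial ring in the variables `e i j = - e j i`; in particular graphs with tadpoles vanish. -/
abbrev Gra (A : Type*) [CommRing A] (N : ℕ) : Type _ := MvPolynomial (Edge N) A

variable {A : Type*} [CommRing A]

/-- The graph with a single edge, directed from `i` to `j`. -/
def e {N : ℕ} (i j : Fin N) : Gra A N :=
  if h : i < j then MvPolynomial.X ⟨(i, j), h⟩
  else if h : j < i then - MvPolynomial.X ⟨(j, i), h⟩ else 0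

/-- Replace the label `i` of each vertex by `φ i`. -/
def relabel {N L : ℕ} (φ : Fin N → Fin L) : Gra A N →ₐ[A] Gra A L :=
  MvPolynomial.aeval fun p : Edge N => e (φ p.1.1) (φ p.1.2)

/-- The sum over all labellings of a graph, with signs (the vertices are odd, since `n` is odd).
This is the invariant element that a picture of an unlabelled graph stands for. -/
def symm {N : ℕ} (x : Gra A N) : Gra A N :=
  ∑ σ : Perm (Fin N), (Perm.sign σ : ℤ) • relabel σ x

theorem symm_zero {N : ℕ} : symm (0 : Gra A N) = 0 := by simp [symm]

/-- The operadic composition `f ∘ g` at the vertex `0` of `f`: this vertex is replaced by the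
graph `g`, and each edge at it is reconnected to a vertex of `g`, in all possible ways.  In the
result the vertices of `g` come first, followed by the vertices `1, 2, …` of `f`. -/
def insert {M a L : ℕ} (h : M + a = L) (f : Gra A (a + 1)) (g : Gra A M) : Gra A L :=
  let old : Fin a → Fin L := fun j => Fin.cast h (Fin.natAdd M j)
  let new : Fin M → Fin L := fun i => Fin.cast h (Fin.castAdd a i)
  MvPolynomial.aeval
      (fun p : Edge (a + 1) =>
        Fin.cases (motive := fun _ => Gra A L)
          (Fin.cases (motive := fun _ => Gra A L) 0 (fun j => ∑ i, e (new i) (old j)) p.1.2)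
          (fun i => Fin.cases (motive := fun _ => Gra A L) 0 (fun j => e (old i) (old j)) p.1.2)
          p.1.1) f
    * relabel new g

variable [Algebra ℚ A]

/-- The pre-Lie product of components: the signed sum of `insert f g` over all `(M, a)`-shuffles of
the labels.  On `f`, `g` that are antisymmetric in the labels it equals the antisymmetrization over
all permutations divided by `M! a!`. -/
def circ {M a L : ℕ} (h : M + a = L) (f : Gra A (a + 1)) (g : Gra A M) : Gra A L :=
  ((M.factorial * a.factorial : ℕ) : ℚ)⁻¹ • symm (insert h f g)

/-! ### The full graph complex as a graded Lie algebra -/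

/-- Series of graphs: `f N k` is the part with `N` vertices and `k` edges. -/
abbrev Cochain (A : Type*) [CommRing A] : Type _ := ∀ N : ℕ, ℕ → Gra A N

/-- The Lie bracket `[f, g] = f ∘ g - (-1)^{|f||g|} g ∘ f` of the deformation complex; for odd `n`
the degree of a graph with `N` vertices has the parity of `N - 1` (and the coefficients are of even
degree). -/
def bracket (f g : Cochain A) : Cochain A := fun L k =>
  ∑ x : antidiagonal L, ∑ y ∈ antidiagonal k,
    (circ (mem_antidiagonal.mp x.2) (f (x.1.2 + 1) y.1) (g x.1.1 y.2)
      - (-1 : ℤ) ^ (x.1.2 * (x.1.1 + 1)) •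
        circ (mem_antidiagonal.mp x.2) (g (x.1.2 + 1) y.1) (f x.1.1 y.2))

/-- The image of the generating bracket of `Lie_n` in the graph operad: two vertices, one edge. -/
def edge : Cochain A
  | 2, 1 => e 0 1
  | _, _ => 0

/-- The differential (vertex splitting). -/
def delta (f : Cochain A) : Cochain A := bracket edge f

/-- The Maurer–Cartan equation. -/
def IsMaurerCartan (m : Cochain A) : Prop := delta m + (2⁻¹ : ℚ) • bracket m m = 0

/-- The gauge action
`exp(ξ) • m = ∑ (ad ξ)^j m / j! - ∑ (ad ξ)^j (δ ξ) / (j + 1)!`.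
If `ξ` has no graphs with fewer than two vertices, then `ad ξ` raises the number of vertices, and
all terms with `N ≤ j` vanish on graphs with `N` vertices; see `ad_iterate_eq_zero`. -/
def gaugeAct (ξ m : Cochain A) : Cochain A := fun N k =>
  ∑ j ∈ range N, (j.factorial : ℚ)⁻¹ • ((bracket ξ)^[j] m) N k
    - ∑ j ∈ range N, ((j + 1).factorial : ℚ)⁻¹ • ((bracket ξ)^[j] (delta ξ)) N k

/-! ### The graph complexes `GC_n` and `BGC_n` -/

/-- The underlying graphical conditions: the components are antisymmetric in the labels of the
vertices, and all graphs are connected with all vertices at least trivalent. -/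
structure IsGraphSeries (f : Cochain A) : Prop where
  numEdges_eq : ∀ N k, ∀ Γ ∈ (f N k).support, Multigraph.numEdges Γ = k
  antisymm : ∀ N k (σ : Perm (Fin N)), relabel σ (f N k) = (Perm.sign σ : ℤ) • f N k
  connected : ∀ N k, ∀ Γ ∈ (f N k).support, (Multigraph.toSimple Γ).Connected
  trivalent : ∀ N k, ∀ Γ ∈ (f N k).support, ∀ v, 3 ≤ Multigraph.valence Γ v

/-- All graphs that occur in `f` are very loopy. -/
def IsVeryLoopy (f : Cochain A) : Prop :=
  ∀ N k, ∀ Γ ∈ (f N k).support, Multigraph.VeryLoopy Γ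

/-- The cohomological degree of a graph with `N` vertices and `k` edges. -/
def graphDegree (n N k : ℕ) : ℤ := n * ((N : ℤ) - 1) - ((n : ℤ) - 1) * k

/-- The part of degree `D` of `GC_n`. -/
structure IsGC {K : Type*} [Field K] [CharZero K] (n : ℕ) (D : ℤ) (f : Cochain K) : Prop
    extends IsGraphSeries f where
  degree_eq : ∀ N k, f N k ≠ 0 → graphDegree n N k = D

/-- The theta graph: two vertices joined by three edges. -/
def theta (A : Type*) [CommRing A] : Cochain A
  | 2, 3 => symm (e 0 1 ^ 3)
  | _, _ => 0

/-- `H(BSO(n); K)` for odd `n`: the polynomial ring in the Pontryagin classes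
`p_4, p_8, …, p_{2n-2}`. -/
abbrev HBSO (K : Type*) [Field K] (n : ℕ) : Type _ := MvPolynomial (Fin (n / 2)) K

/-- The cohomological degrees of the Pontryagin classes. -/
def pontryaginDegree (n : ℕ) (i : Fin (n / 2)) : ℤ := 4 * ((i : ℤ) + 1)

/-- The top Pontryagin class `p_{2n-2}`. -/
def topPontryagin (K : Type*) [Field K] (n : ℕ) (hn : 3 ≤ n) : HBSO K n :=
  MvPolynomial.X ⟨n / 2 - 1, by omega⟩

/-- The part of degree `D` of `BGC_n`, the completed tensor product of `GC_n` and `H(BSO(n))`: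
series of graphs with coefficients in `H(BSO(n))`, where the coefficient of a graph of degree `d`
has degree `D - d`. -/
structure IsBGC {K : Type*} [Field K] [CharZero K] (n : ℕ) (D : ℤ) (f : Cochain (HBSO K n)) : Prop
    extends IsGraphSeries f where
  degree_eq : ∀ N k (Γ : Multigraph N),
    MvPolynomial.IsWeightedHomogeneous (pontryaginDegree n) (MvPolynomial.coeff Γ (f N k))
      (D - graphDegree n N k)

/-- The theta series
`∑_{j ≥ 1} (p_{2n-2}^j / 4^j) (1 / (2 (2j+1)!)) (two vertices joined by 2j+1 edges)`. -/
def thetaSeries (K : Type*) [Field K] [CharZero K] (n : ℕ) (hn : 3 ≤ n) : Cochain (HBSO K n)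
  | 2, k => if Odd k ∧ 3 ≤ k then
      ((4 : ℚ) ^ (k / 2) * (2 * k.factorial))⁻¹ •
        (topPontryagin K n hn ^ (k / 2) • symm (e 0 1 ^ k))
      else 0
  | _, _ => 0

/-- Gauge equivalence of elements of degree one of `BGC_n`. -/
def GaugeEquivalent {K : Type*} [Field K] [CharZero K] (n : ℕ) (m m' : Cochain (HBSO K n)) : Prop :=
  ∃ ξ : Cochain (HBSO K n), IsBGC n 0 ξ ∧ m' = gaugeAct ξ m

/-! ### The sums in the gauge action are complete -/

theorem bracket_eq_zero {ξ f : Cochain A} {a : ℕ} (hξ : ∀ N < 2, ∀ k, ξ N k = 0)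
    (hf : ∀ N < a, ∀ k, f N k = 0) : ∀ N < a + 1, ∀ k, bracket ξ f N k = 0 := by
  intro N hN k
  unfold bracket
  refine Finset.sum_eq_zero fun x _ => Finset.sum_eq_zero fun y _ => ?_
  have hx : x.1.1 + x.1.2 = N := mem_antidiagonal.mp x.2
  have h1 : circ (mem_antidiagonal.mp x.2) (ξ (x.1.2 + 1) y.1) (f x.1.1 y.2) = 0 := by
    by_cases h : x.1.1 < a
    · simp [circ, insert, hf _ h, symm_zero]
    · simp [circ, insert, hξ (x.1.2 + 1) (by omega), symm_zero]
  have h2 : circ (mem_antidiagonal.mp x.2) (f (x.1.2 + 1) y.1) (ξ x.1.1 y.2) = 0 := by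
    by_cases h : x.1.1 < 2
    · simp [circ, insert, hξ _ h, symm_zero]
    · simp [circ, insert, hf (x.1.2 + 1) (by omega), symm_zero]
  rw [h1, h2]; simp

theorem ad_iterate_eq_zero {ξ : Cochain A} (hξ : ∀ N < 2, ∀ k, ξ N k = 0) (m : Cochain A)
    (h0 : ∀ k, m 0 k = 0) (N j : ℕ) (h : N ≤ j) (k : ℕ) : ((bracket ξ)^[j] m) N k = 0 := by
  have key : ∀ j, ∀ N < j + 1, ∀ k, ((bracket ξ)^[j] m) N k = 0 := by
    intro j
    induction j with
    | zero =>
      intro N hN k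
      obtain rfl : N = 0 := by omega
      exact h0 k
    | succ j ih =>
      rw [Function.iterate_succ_apply']
      exact bracket_eq_zero hξ ih
  exact key j N (by omega) k

end OddGC

end

/-!
Call a vertex of a graph an *apex* if its complement is a forest, so that a graph is very loopy if
and only if it has no apex (`not_veryLoopy_iff`). Both parts of the theorem rest on one fact: an
element on an even number `≥ 4` of vertices whose differential is very loopy is very loopy up to a
differential (`exists_sub_split_veryLoopy`). Since `n` is odd and the Pontryagin classes have even
degree, an even number of vertices means odd degree.

**Vertex splitting.** Graphs are monomials in the edges `e i j`. For the pairing `pair`,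
multiplication by an edge is adjoint to the derivation `D i j` that removes it, and `expand`, which
reconnects edges in all possible ways, is adjoint to `relabel`. Hence vertex splitting is adjoint to
edge contraction (`pair_split`), except for splitting off uni- and bivalent vertices, the ways of
which cancel (`split_trivalent`). All coefficients are computed by pairing with single graphs.

**The homotopy.** If all other vertices are at least trivalent, a graph with at least three vertices
has at most one apex (`IsApex.unique`), which antisymmetry allows to be the vertex `0`. The
homotopy is minus the adjoint of `pull`, which takes two edges between `0` and another vertex `w` and
pulls them out of `w` to a new vertex, a *fork*: it is joined to `w` by an edge and to `0` by a
double edge. Pulling out forks commutes with edge contraction up to a few correction terms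
(`pull_relabel_contr`, `pull_relabel_contr_zero`). On an element whose differential is very loopy,
the differential of the homotopy is therefore triangular (`pair_split_homotopy`): with respect to the
number of *large* vertices, those with `m` edges to `0` and `t` other edges where `2 t + m ≥ 5`, it is
diagonal up to graphs with fewer large vertices. Its diagonal entries
(`eigenvalue`) are natural numbers, and they are positive, except on the star of triple edges, which
has an odd symmetry (`one_le_eigenvalue`). Removing eigenvalue after eigenvalue and then passing to
more large vertices (`exists_kill_eigenvalues`, `exists_kill_level`) proves the fact. The
construction only involves rational scalars, so it preserves the degrees of the coefficients.

**Maurer–Cartan elements.** Graph insertion is a pre-Lie product (`assoc_swap`), which makes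
bracketing with an element of even degree a derivation of the bracket (`bracket_anticommutator`). It follows
that the differential squares to zero and that the gauge action, which is the exponential of `ad ξ`
applied to the sum of `m` and the edge (`gaugeAct_eq`), preserves Maurer–Cartan elements
(`gaugeAct_isMaurerCartan`). The gauge is fixed by induction on the number of edges
(`exists_gauge_step`). Very loopy graphs form an ideal (`IsInsertion.not_veryLoopy`), and the product
of two graphs on two vertices has three vertices. So by the Maurer–Cartan equation the next part has
a very loopy differential in even numbers `≥ 4` of vertices. The fact above provides `η` such that
subtracting `δ η` makes this part very loopy, and this is what adding `η` to `ξ` does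
(`gaugeAct_add`). The part with two vertices never changes (`gaugeAct_two`), as there are no
trivalent graphs with one vertex.

**Cohomology.** For even numbers `≥ 4` of vertices the fact says that the quotient complex is exact.
On two vertices, `k` parallel edges are excluded by antisymmetry for `k` even, and by a non-vanishing
differential for odd `k ≥ 5` (`eq_zero_of_split_veryLoopy`), which leaves the theta graph. It is
closed for lack of trivalent graphs with three vertices and four edges, and not exact for lack of
trivalent graphs with one vertex.
-/

open Equiv Finset

noncomputable section

namespace OddGC

/-! ### Edge variables, relabelling and expansion -/

section Algebra

variable {A : Type*} [CommRing A] {N L T : ℕ}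

@[simp] theorem e_self (i : Fin N) : (e i i : Gra A N) = 0 := by simp [e]

theorem e_swap (i j : Fin N) : (e j i : Gra A N) = -e i j := by
  unfold e
  rcases lt_trichotomy i j with h | h | h
  · simp [h, h.not_gt]
  · subst h; simp
  · simp [h, h.not_gt]

theorem X_eq_e (p : Edge N) : (MvPolynomial.X p : Gra A N) = e p.1.1 p.1.2 := by
  simp [e, p.2]

theorem e_of_lt {i j : Fin N} (h : i < j) : (e i j : Gra A N) = MvPolynomial.X ⟨(i, j), h⟩ := by
  simp [e, h]

/-- An algebra map out of `Gra A N` is determined by its values on the edges. -/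
theorem algHom_ext_e {B : Type*} [CommRing B] [Algebra A B] {F G : Gra A N →ₐ[A] B}
    (h : ∀ i j, i ≠ j → F (e i j) = G (e i j)) : F = G := by
  apply MvPolynomial.algHom_ext
  intro p
  rw [X_eq_e]
  exact h _ _ p.2.ne

@[simp] theorem relabel_e (φ : Fin N → Fin L) (i j : Fin N) :
    relabel φ (e i j : Gra A N) = e (φ i) (φ j) := by
  rcases lt_trichotomy i j with h | h | h
  · rw [e_of_lt h]; simp [relabel]
  · subst h; simp
  · rw [e_swap, e_of_lt h, map_neg, e_swap (φ j) (φ i)]; simp [relabel]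

theorem relabel_relabel (ψ : Fin L → Fin T) (φ : Fin N → Fin L) (x : Gra A N) :
    relabel ψ (relabel φ x) = relabel (ψ ∘ φ) x := by
  have : (relabel ψ).comp (relabel φ) = (relabel (ψ ∘ φ) : Gra A N →ₐ[A] _) :=
    algHom_ext_e fun i j _ => by simp
  exact DFunLike.congr_fun this x

theorem relabel_id (x : Gra A N) : relabel id x = x := by
  have : relabel id = AlgHom.id A (Gra A N) := algHom_ext_e fun i j _ => by simp
  exact DFunLike.congr_fun this x

/-- The transpose of `relabel κ`: every vertex `p` is replaced by the set of vertices `κ ⁻¹ p`, and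
the edges at `p` are reconnected to these in all possible ways. -/
def expand (κ : Fin L → Fin N) : Gra A N →ₐ[A] Gra A L :=
  MvPolynomial.aeval fun p : Edge N => ∑ i with κ i = p.1.1, ∑ j with κ j = p.1.2, e i j

theorem sum_e_swap (s t : Finset (Fin L)) :
    ∑ i ∈ s, ∑ j ∈ t, (e i j : Gra A L) = -∑ i ∈ t, ∑ j ∈ s, e i j := by
  rw [Finset.sum_comm, ← Finset.sum_neg_distrib]
  refine Finset.sum_congr rfl fun i _ => ?_
  rw [← Finset.sum_neg_distrib]
  exact Finset.sum_congr rfl fun j _ => e_swap i j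

theorem eq_zero_of_eq_neg {B : Type*} [AddCommGroup B] [Module ℚ B] {x : B} (h : x = -x) :
    x = 0 := by
  have h2 : (2 : ℚ) • x = 0 := by
    rw [two_smul]; nth_rewrite 1 [h]; exact neg_add_cancel x
  have h3 : (2 : ℚ)⁻¹ • (2 : ℚ) • x = x := by rw [smul_smul]; norm_num
  rw [← h3, h2, smul_zero]

theorem expand_e {p q : Fin N} (κ : Fin L → Fin N) (h : p ≠ q) :
    expand κ (e p q : Gra A N) = ∑ i with κ i = p, ∑ j with κ j = q, e i j := by
  rcases lt_or_gt_of_ne h with h | h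
  · rw [e_of_lt h]; simp [expand]
  · rw [e_swap, e_of_lt h, map_neg, sum_e_swap]; simp [expand]

theorem expand_e' [Algebra ℚ A] (κ : Fin L → Fin N) (p q : Fin N) :
    expand κ (e p q : Gra A N) = ∑ i with κ i = p, ∑ j with κ j = q, e i j := by
  by_cases h : p = q
  · subst h; rw [e_self, map_zero]; exact (eq_zero_of_eq_neg (sum_e_swap _ _)).symm
  · exact expand_e κ h

theorem expand_expand [Algebra ℚ A] (κ : Fin T → Fin L) (κ' : Fin L → Fin N) (x : Gra A N) :
    expand κ (expand κ' x) = expand (κ' ∘ κ) x := by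
  have : (expand κ).comp (expand κ') = (expand (κ' ∘ κ) : Gra A N →ₐ[A] _) := by
    refine algHom_ext_e fun p q h => ?_
    rw [AlgHom.comp_apply, expand_e _ h, expand_e _ h]
    simp only [map_sum, expand_e']
    have key : ∀ (r : Fin N) (F : Fin T → Gra A T),
        ∑ i with κ' i = r, ∑ s with κ s = i, F s = ∑ s with (κ' ∘ κ) s = r, F s := by
      intro r F
      rw [Finset.sum_sigma']
      refine Finset.sum_bij' (fun x _ => x.2) (fun s _ => ⟨κ s, s⟩) ?_ ?_ ?_ ?_ ?_ <;>
        simp +contextual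
    rw [← key p]
    refine Finset.sum_congr rfl fun i _ => ?_
    rw [Finset.sum_comm]
    refine Finset.sum_congr rfl fun s _ => ?_
    rw [key q]
  exact DFunLike.congr_fun this x

theorem expand_perm (σ : Perm (Fin N)) (x : Gra A N) :
    expand σ x = relabel (σ.symm : Perm (Fin N)) x := by
  have : expand σ = (relabel σ.symm : Gra A N →ₐ[A] _) := by
    refine algHom_ext_e fun p q h => ?_
    have : ∀ p, (univ.filter fun i => σ i = p) = {σ.symm p} := by
      intro p; ext i; simp [Equiv.eq_symm_apply]
    rw [expand_e _ h, relabel_e, this, this]; simp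
  exact DFunLike.congr_fun this x

/-- Base change: restricting to the vertices of a block commutes with expansion. -/
theorem expand_relabel [Algebra ℚ A] {M R : ℕ} (κ : Fin T → Fin L) (ι : Fin M → Fin L)
    (κ' : Fin R → Fin M) (ι' : Fin R → Fin T) (hι : Function.Injective ι)
    (hι' : Function.Injective ι') (hc : ∀ r, κ (ι' r) = ι (κ' r))
    (hs : ∀ t m, κ t = ι m → ∃ r, ι' r = t) (x : Gra A M) :
    expand κ (relabel ι x) = relabel ι' (expand κ' x) := by
  have : (expand κ).comp (relabel ι) = ((relabel ι').comp (expand κ') : Gra A M →ₐ[A] _) := by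
    refine algHom_ext_e fun p q h => ?_
    have key : ∀ (p : Fin M), (univ.filter fun t => κ t = ι p) =
        (univ.filter fun r => κ' r = p).map ⟨ι', hι'⟩ := by
      intro p
      ext t
      simp only [mem_filter, mem_univ, true_and, mem_map, Function.Embedding.coeFn_mk]
      constructor
      · intro ht
        obtain ⟨r, rfl⟩ := hs t p ht
        exact ⟨r, hι (by rw [← hc, ht]), rfl⟩
      · rintro ⟨r, rfl, rfl⟩; exact hc r
    simp only [AlgHom.comp_apply, relabel_e, expand_e', key, Finset.sum_map, map_sum,
      Function.Embedding.coeFn_mk]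
  exact DFunLike.congr_fun this x

theorem insert_eq {M a L : ℕ} (h : M + a = L) (f : Gra A (a + 1)) (g : Gra A M)
    (κ : Fin L → Fin (a + 1)) (hκ : ∀ i : Fin L, (κ i : ℕ) = i + 1 - M) :
    insert h f g = expand κ f * relabel (fun i => Fin.cast h (Fin.castAdd a i)) g := by
  unfold insert
  have hz : ∀ i : Fin L, κ i = 0 ↔ ∃ j, Fin.cast h (Fin.castAdd a j) = i := by
    intro i
    rw [Fin.ext_iff, hκ]
    constructor
    · intro hi
      exact ⟨⟨i, by simp at hi; omega⟩, rfl⟩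
    · rintro ⟨j, rfl⟩; have := j.2; simp
  have hs : ∀ (i : Fin L) (j : Fin a), κ i = j.succ ↔ i = Fin.cast h (Fin.natAdd M j) := by
    intro i j
    simp only [Fin.ext_iff, hκ, Fin.val_succ, Fin.val_cast, Fin.val_natAdd]
    omega
  have fz : (univ.filter fun i => κ i = 0) = univ.map
      ⟨fun j : Fin M => Fin.cast h (Fin.castAdd a j), fun _ _ hij => by
        simpa [Fin.ext_iff] using hij⟩ := by
    ext i; simp [hz]; rfl
  have fs : ∀ j : Fin a, (univ.filter fun i => κ i = j.succ) = {Fin.cast h (Fin.natAdd M j)} := by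
    intro j; ext i; simp [hs]
  rw [expand]
  dsimp only
  congr 2
  congr 1
  funext p
  obtain ⟨⟨p, q⟩, hpq⟩ := p
  dsimp only at hpq ⊢
  refine Fin.cases (fun hpq => ?_) (fun p hpq => ?_) p hpq <;>
    refine Fin.cases (fun hpq => ?_) (fun q hpq => ?_) q hpq
  · exact absurd hpq (lt_irrefl _)
  · simp only [Fin.cases_zero, Fin.cases_succ, fz, fs]; simp; rfl
  · exact absurd hpq (by simp)
  · simp only [Fin.cases_succ, fs]; simp

end Algebra

section Pairing

variable {A : Type*} [CommRing A] {N L T : ℕ}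

/-! ### Edge derivations and the pairing of graphs -/

/-- The derivation that removes an edge directed from `i` to `j`. -/
def D (i j : Fin N) : Derivation A (Gra A N) (Gra A N) :=
  MvPolynomial.mkDerivation A fun p : Edge N =>
    (if i = p.1.1 ∧ j = p.1.2 then 1 else 0) - (if i = p.1.2 ∧ j = p.1.1 then 1 else 0)

theorem D_e (i j k l : Fin N) : D i j (e k l : Gra A N) =
    (if i = k ∧ j = l then 1 else 0) - (if i = l ∧ j = k then 1 else 0) := by
  rcases lt_trichotomy k l with h | h | h
  · rw [e_of_lt h]; simp [D]
  · subst h; simp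
  · rw [e_swap, e_of_lt h, map_neg]; simp [D]

theorem derivation_ext_e {B : Type*} [AddCommGroup B] [Module A B] [Module (Gra A N) B]
    {d d' : Derivation A (Gra A N) B} (h : ∀ i j, i ≠ j → d (e i j) = d' (e i j)) : d = d' := by
  apply MvPolynomial.derivation_ext
  intro p
  rw [X_eq_e]
  exact h _ _ p.2.ne

theorem D_swap (i j : Fin N) (x : Gra A N) : D j i x = -D i j x := by
  have : D j i = (-D i j : Derivation A (Gra A N) _) := by
    refine derivation_ext_e fun k l _ => ?_
    simp only [Derivation.neg_apply, D_e, and_comm (a := j = k), and_comm (a := j = l)]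
    ring
  rw [this, Derivation.neg_apply]

theorem D_comm (i j k l : Fin N) (x : Gra A N) : D i j (D k l x) = D k l (D i j x) := by
  have : ⁅(D i j : Derivation A (Gra A N) (Gra A N)), (D k l : Derivation A (Gra A N) (Gra A N))⁆ = 0 := by
    refine derivation_ext_e fun a b _ => ?_
    rw [Derivation.commutator_apply, D_e, D_e]
    simp only [map_sub, apply_ite (D _ _), Derivation.map_one_eq_zero, map_zero, ite_self,
      Derivation.coe_zero, Pi.zero_apply, sub_zero]
  have h := DFunLike.congr_fun this x
  rw [Derivation.commutator_apply] at h
  exact sub_eq_zero.mp h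

theorem D_eq_pderiv {i j : Fin N} (h : i < j) (x : Gra A N) :
    D i j x = MvPolynomial.pderiv ⟨(i, j), h⟩ x := by
  have : D i j = (MvPolynomial.pderiv ⟨(i, j), h⟩ : Derivation A (Gra A N) _) := by
    apply MvPolynomial.derivation_ext
    rintro ⟨⟨k, l⟩, hkl⟩
    rw [X_eq_e, D_e, ← X_eq_e, MvPolynomial.pderiv_X]
    dsimp only at hkl ⊢
    have : ¬ (i = l ∧ j = k) := by rintro ⟨rfl, rfl⟩; exact h.not_gt hkl
    simp only [this, if_false, sub_zero, Pi.single_apply, Subtype.mk.injEq, Prod.mk.injEq]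
    congr 1
    simp [eq_comm]
  rw [this]

theorem gra_induction {P : Gra A N → Prop} (hC : ∀ a, P (MvPolynomial.C a))
    (hadd : ∀ x y, P x → P y → P (x + y)) (he : ∀ x i j, i < j → P x → P (e i j * x)) (x : Gra A N) :
    P x := by
  induction x using MvPolynomial.induction_on with
  | C a => exact hC a
  | add x y hx hy => exact hadd x y hx hy
  | mul_X x p hx =>
    rw [mul_comm, X_eq_e]; exact he x _ _ p.2 hx

theorem D_mul (i j : Fin N) (x y : Gra A N) : D i j (x * y) = D i j x * y + x * D i j y := by
  rw [Derivation.leibniz, smul_eq_mul, smul_eq_mul]; ring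

theorem sum_sum_ite_and {B : Type*} [AddCommMonoidWithOne B] (s t : Finset (Fin L)) (k l : Fin L) :
    (∑ i ∈ s, ∑ j ∈ t, if i = k ∧ j = l then (1 : B) else 0) = if k ∈ s ∧ l ∈ t then 1 else 0 := by
  simp only [ite_and, Finset.sum_ite_irrel, Finset.sum_ite_eq', Finset.sum_const_zero]

/-- The chain rule for relabelling. -/
theorem D_relabel (κ : Fin L → Fin N) (p q : Fin N) (x : Gra A L) :
    D p q (relabel κ x) = ∑ i with κ i = p, ∑ j with κ j = q, relabel κ (D i j x) := by
  induction x using gra_induction with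
  | hC a => simp [MvPolynomial.algHom_C, ← MvPolynomial.algebraMap_eq]
  | hadd x y hx hy => simp only [map_add, hx, hy, Finset.sum_add_distrib]
  | he x k l hkl hx =>
    rw [map_mul, D_mul, hx]
    simp only [D_mul, map_add, map_mul, Finset.sum_add_distrib, ← Finset.mul_sum,
      ← Finset.sum_mul]
    congr 2
    rw [relabel_e, D_e]
    simp only [D_e, map_sub, apply_ite (relabel κ), map_one, map_zero, Finset.sum_sub_distrib,
      sum_sum_ite_and, mem_filter, mem_univ, true_and]
    simp only [eq_comm]


/-- The pairing of a graph with itself: the number of permutations of its edges that keep the ends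
of every edge. -/
def multFactorial (Γ : Multigraph N) : ℕ := ∏ p, (Γ p).factorial

/-- The symmetric pairing of graphs for which distinct monomials are orthogonal and multiplication
by an edge is adjoint to its removal. -/
def pair : Gra A N →ₗ[A] Gra A N →ₗ[A] A :=
  (MvPolynomial.basisMonomials (Edge N) A).constr A fun Γ =>
    (MvPolynomial.basisMonomials (Edge N) A).constr A fun Γ' =>
      if Γ = Γ' then (multFactorial Γ : A) else 0

theorem pair_monomial_monomial (Γ Γ' : Multigraph N) (a b : A) :
    pair (MvPolynomial.monomial Γ a : Gra A N) (MvPolynomial.monomial Γ' b) =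
      if Γ = Γ' then a * b * multFactorial Γ else 0 := by
  have h : ∀ (Γ : Multigraph N) (a : A), (MvPolynomial.monomial Γ a : Gra A N) =
      a • MvPolynomial.basisMonomials (Edge N) A Γ := by
    intro Γ a; simp [MvPolynomial.smul_monomial]
  rw [h, h, map_smul, map_smul, LinearMap.smul_apply, pair, Module.Basis.constr_basis,
    Module.Basis.constr_basis]
  split_ifs <;> simp; ring

theorem pair_monomial (x : Gra A N) (Γ : Multigraph N) (b : A) :
    pair x (MvPolynomial.monomial Γ b) = MvPolynomial.coeff Γ x * b * multFactorial Γ := by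
  induction x using MvPolynomial.induction_on' with
  | monomial Γ' a =>
    rw [pair_monomial_monomial, MvPolynomial.coeff_monomial]
    split_ifs with h
    · rw [h]
    · simp
  | add x y hx hy => rw [map_add, LinearMap.add_apply, hx, hy, MvPolynomial.coeff_add]; ring

theorem pair_comm (x P : Gra A N) : pair x P = pair P x := by
  induction x using MvPolynomial.induction_on' with
  | monomial Γ a =>
    induction P using MvPolynomial.induction_on' with
    | monomial Γ' b =>
      simp only [pair_monomial_monomial, eq_comm (a := Γ)]
      split_ifs with h
      · rw [h]; ring
      · rfl
    | add x y hx hy => rw [map_add, map_add, LinearMap.add_apply, hx, hy]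
  | add x y hx hy => rw [map_add, map_add, LinearMap.add_apply, hx, hy]

theorem multFactorial_ne_zero (Γ : Multigraph N) : multFactorial Γ ≠ 0 :=
  Finset.prod_ne_zero_iff.mpr fun _ _ => Nat.factorial_ne_zero _

theorem pair_X_mul (p : Edge N) (x P : Gra A N) :
    pair (MvPolynomial.X p * x) P = pair x (MvPolynomial.pderiv p P) := by
  induction P using MvPolynomial.induction_on' with
  | monomial Γ b =>
    rw [MvPolynomial.pderiv_monomial, pair_monomial, pair_monomial, MvPolynomial.coeff_X_mul']
    split_ifs with h
    · have h1 : multFactorial Γ = Γ p * multFactorial (Γ - Finsupp.single p 1) := by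
        have h0 : Γ p ≠ 0 := Finsupp.mem_support_iff.mp h
        unfold multFactorial
        rw [← Finset.mul_prod_erase _ _ (mem_univ p), ← Finset.mul_prod_erase _ _ (mem_univ p),
          ← mul_assoc]
        congr 1
        · simp [Nat.mul_factorial_pred h0]
        · refine Finset.prod_congr rfl fun q hq => ?_
          simp [(Finset.ne_of_mem_erase hq).symm]
      rw [h1]; push_cast; ring
    · rw [Finsupp.notMem_support_iff.mp h]; simp
  | add P Q hP hQ => simp only [map_add, hP, hQ]

theorem pair_e_mul (i j : Fin N) (x P : Gra A N) : pair (e i j * x) P = pair x (D i j P) := by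
  rcases lt_trichotomy i j with h | h | h
  · rw [e_of_lt h, pair_X_mul, D_eq_pderiv h]
  · subst h
    have : D i i = (0 : Derivation A (Gra A N) (Gra A N)) :=
      derivation_ext_e fun k l _ => by simp [D_e, and_comm]
    simp [this]
  · rw [e_swap, e_of_lt h, neg_mul, map_neg, LinearMap.neg_apply, pair_X_mul, D_swap,
      D_eq_pderiv h, map_neg]

/-- Expansion is adjoint to relabelling. -/
theorem pair_expand [Algebra ℚ A] (κ : Fin L → Fin N) (x : Gra A N) (P : Gra A L) :
    pair (expand κ x) P = pair x (relabel κ P) := by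
  induction x using gra_induction generalizing P with
  | hC a =>
    have h : ∀ {K : ℕ} (Q : Gra A K), pair (MvPolynomial.C a) Q = a * MvPolynomial.coeff 0 Q := by
      intro K Q
      rw [pair_comm, MvPolynomial.C_apply, pair_monomial]
      simp [multFactorial, mul_comm]
    have h0 : MvPolynomial.coeff 0 (relabel κ P) = MvPolynomial.coeff 0 P := by
      induction P using gra_induction with
      | hC a => rw [← MvPolynomial.algebraMap_eq, AlgHom.commutes]; simp
      | hadd x y hx hy => simp [hx, hy]
      | he x i j hij hx =>
        have hz : ∀ {K : ℕ} (i j : Fin K) (Q : Gra A K),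
            MvPolynomial.coeff 0 (e i j * Q) = 0 := by
          intro K i j Q
          rcases lt_trichotomy i j with h | h | h
          · rw [e_of_lt h]; simp [MvPolynomial.coeff_X_mul']
          · subst h; simp
          · rw [e_swap, e_of_lt h]; simp [MvPolynomial.coeff_X_mul']
        rw [map_mul, relabel_e, hz, hz]
    rw [← MvPolynomial.algebraMap_eq, AlgHom.commutes, MvPolynomial.algebraMap_eq,
      MvPolynomial.algebraMap_eq, h, h, h0]
  | hadd x y hx hy => simp only [map_add, LinearMap.add_apply, hx, hy]
  | he x p q hpq hx =>
    rw [map_mul, expand_e _ hpq.ne, pair_e_mul, D_relabel]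
    simp only [Finset.sum_mul, map_sum, LinearMap.sum_apply, pair_e_mul, hx]

theorem pair_relabel [Algebra ℚ A] (κ : Fin L → Fin N) (x : Gra A L) (P : Gra A N) :
    pair (relabel κ x) P = pair x (expand κ P) := by
  rw [pair_comm, ← pair_expand, pair_comm]

theorem coeff_eq_zero_iff_pair [Algebra ℚ A] (Γ : Multigraph N) (x : Gra A N) :
    MvPolynomial.coeff Γ x = 0 ↔ pair x (MvPolynomial.monomial Γ 1) = 0 := by
  rw [pair_monomial, mul_one]
  constructor
  · intro h; rw [h, zero_mul]
  · intro h
    have h2 : ((multFactorial Γ : ℚ)⁻¹) • (MvPolynomial.coeff Γ x * (multFactorial Γ : A)) =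
        MvPolynomial.coeff Γ x := by
      have : (multFactorial Γ : A) = algebraMap ℚ A (multFactorial Γ) := by simp
      rw [Algebra.smul_def, this, mul_left_comm, ← map_mul,
        inv_mul_cancel₀ (by exact_mod_cast multFactorial_ne_zero Γ), map_one, mul_one]
    rw [← h2, h, smul_zero]

/-! ### Antisymmetrization -/

/-- Antisymmetry in the labels of the vertices. -/
def IsAntisymm (x : Gra A N) : Prop :=
  ∀ σ : Perm (Fin N), relabel σ x = (Perm.sign σ : ℤ) • x

theorem symm_add (x y : Gra A N) : symm (x + y) = symm x + symm y := by
  simp [symm, Finset.sum_add_distrib]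

theorem symm_smul (a : A) (x : Gra A N) : symm (a • x) = a • symm x := by
  simp only [symm, Finset.smul_sum, map_smul, smul_comm a]

theorem symm_zsmul (a : ℤ) (x : Gra A N) : symm (a • x) = a • symm x := by
  simp only [symm, Finset.smul_sum, map_zsmul, smul_comm a]

theorem relabel_qsmul [Algebra ℚ A] (φ : Fin N → Fin L) (a : ℚ) (x : Gra A N) :
    relabel φ (a • x) = a • relabel φ x := map_rat_smul _ _ _

theorem symm_qsmul [Algebra ℚ A] (a : ℚ) (x : Gra A N) : symm (a • x) = a • symm x := by
  simp only [symm, Finset.smul_sum, relabel_qsmul, smul_comm a]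

theorem symm_neg (x : Gra A N) : symm (-x) = -symm x := by
  simp [symm]

theorem symm_sum {ι : Type*} (s : Finset ι) (x : ι → Gra A N) :
    symm (∑ i ∈ s, x i) = ∑ i ∈ s, symm (x i) := by
  simp only [symm, map_sum, Finset.smul_sum]
  exact Finset.sum_comm

theorem sign_mul_self (σ : Perm (Fin N)) : (Perm.sign σ : ℤ) * (Perm.sign σ : ℤ) = 1 := by
  rw [← Units.val_mul, Int.units_mul_self, Units.val_one]

theorem relabel_perm_mul (σ τ : Perm (Fin N)) (x : Gra A N) :
    relabel σ (relabel τ x) = relabel (σ * τ : Perm (Fin N)) x := relabel_relabel _ _ _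

theorem symm_isAntisymm (x : Gra A N) : IsAntisymm (symm x) := by
  intro τ
  simp only [symm, map_sum, map_zsmul, relabel_perm_mul, Finset.smul_sum, smul_smul]
  refine Fintype.sum_equiv (Equiv.mulLeft τ) _ _ fun σ => ?_
  rw [Equiv.coe_mulLeft, Perm.sign_mul, Units.val_mul, ← mul_assoc, sign_mul_self, one_mul]

theorem symm_relabel (τ : Perm (Fin N)) (x : Gra A N) :
    symm (relabel τ x) = (Perm.sign τ : ℤ) • symm x := by
  simp only [symm, relabel_perm_mul, Finset.smul_sum, smul_smul]
  refine Fintype.sum_equiv (Equiv.mulRight τ) _ _ fun σ => ?_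
  rw [Equiv.coe_mulRight, Perm.sign_mul, Units.val_mul, mul_left_comm, sign_mul_self, mul_one]

theorem IsAntisymm.symm_eq {x : Gra A N} (hx : IsAntisymm x) : symm x = N.factorial • x := by
  unfold symm
  rw [Finset.sum_congr rfl fun σ _ => by rw [hx σ, smul_smul, sign_mul_self, one_smul]]
  simp [Fintype.card_perm]

theorem IsAntisymm.pair_relabel [Algebra ℚ A] {x : Gra A N} (hx : IsAntisymm x)
    (σ : Perm (Fin N)) (P : Gra A N) :
    pair x (relabel σ P) = (Perm.sign σ : ℤ) • pair x P := by
  rw [← pair_expand, expand_perm, ← Perm.inv_def, hx, Perm.sign_inv, map_zsmul,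
    LinearMap.smul_apply]

theorem pair_symm [Algebra ℚ A] (x P : Gra A N) :
    pair (symm x) P = ∑ σ : Perm (Fin N), (Perm.sign σ : ℤ) • pair x (relabel σ P) := by
  simp only [symm, map_sum, LinearMap.sum_apply, map_zsmul, LinearMap.smul_apply]
  refine Fintype.sum_equiv (Equiv.inv _) _ _ fun σ => ?_
  rw [OddGC.pair_relabel, expand_perm, Equiv.inv_apply, Perm.sign_inv, ← Perm.inv_def]

end Pairing

section PreLie

variable {A : Type*} [CommRing A]

/-! ### The pre-Lie identity for components -/

/-- The permutation of `M + a` vertices that permutes the first `M` and the last `a` of them. -/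
def blockPerm {M a L : ℕ} (h : M + a = L) (τ : Perm (Fin M)) (ρ : Perm (Fin a)) : Perm (Fin L) :=
  (finCongr h).permCongr (finSumFinEquiv.permCongr (Perm.sumCongr τ ρ))

theorem sign_blockPerm {M a L : ℕ} (h : M + a = L) (τ : Perm (Fin M)) (ρ : Perm (Fin a)) :
    Perm.sign (blockPerm h τ ρ) = Perm.sign τ * Perm.sign ρ := by
  simp [blockPerm, Perm.sign_permCongr]

theorem blockPerm_left {M a L : ℕ} (h : M + a = L) (τ : Perm (Fin M)) (ρ : Perm (Fin a))
    (i : Fin M) : blockPerm h τ ρ (Fin.cast h (Fin.castAdd a i)) =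
      Fin.cast h (Fin.castAdd a (τ i)) := by
  simp [blockPerm]

theorem blockPerm_right {M a L : ℕ} (h : M + a = L) (τ : Perm (Fin M)) (ρ : Perm (Fin a))
    (j : Fin a) : blockPerm h τ ρ (Fin.cast h (Fin.natAdd M j)) =
      Fin.cast h (Fin.natAdd M (ρ j)) := by
  simp [blockPerm]

theorem cast_cases {M a L : ℕ} (h : M + a = L) (t : Fin L) :
    (∃ i : Fin M, t = Fin.cast h (Fin.castAdd a i)) ∨
      ∃ j : Fin a, t = Fin.cast h (Fin.natAdd M j) := by
  by_cases ht : (t : ℕ) < M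
  · exact Or.inl ⟨⟨t, ht⟩, rfl⟩
  · refine Or.inr ⟨⟨t - M, by omega⟩, ?_⟩
    ext; simp; omega

/-- The map that collapses the first block of `M` vertices to the vertex `0`. -/
def collapse (M a L : ℕ) (h : M + a = L) (t : Fin L) : Fin (a + 1) := ⟨t + 1 - M, by omega⟩

@[simp] theorem collapse_left {M a L : ℕ} (h : M + a = L) (i : Fin M) :
    collapse M a L h (Fin.cast h (Fin.castAdd a i)) = 0 := by
  ext; simp [collapse]; try omega

@[simp] theorem collapse_right {M a L : ℕ} (h : M + a = L) (j : Fin a) :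
    collapse M a L h (Fin.cast h (Fin.natAdd M j)) = j.succ := by
  ext; simp [collapse]; omega

theorem insert_eq_collapse {M a L : ℕ} (h : M + a = L) (f : Gra A (a + 1)) (g : Gra A M) :
    insert h f g = expand (collapse M a L h) f *
      relabel (fun i => Fin.cast h (Fin.castAdd a i)) g :=
  insert_eq h f g _ fun _ => rfl

theorem relabel_perm_expand [Algebra ℚ A] {N L : ℕ} (σ : Perm (Fin L)) (κ : Fin L → Fin N)
    (x : Gra A N) : relabel σ (expand κ x) = expand (κ ∘ σ.symm) x := by
  rw [← expand_expand, expand_perm, Equiv.symm_symm]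

theorem expand_relabel_perm [Algebra ℚ A] {N L : ℕ} (κ : Fin L → Fin N) (σ : Perm (Fin N))
    (x : Gra A N) : expand κ (relabel σ x) = expand (σ.symm ∘ κ) x := by
  rw [← expand_expand, expand_perm, Equiv.symm_symm]

/-- Relabelling an insertion by a block permutation relabels the inserted graph and the other
vertices of the ambient graph separately; the vertex `0` of the ambient graph stays fixed. -/
theorem relabel_blockPerm_insert [Algebra ℚ A] {M a L : ℕ} (h : M + a = L) (τ : Perm (Fin M))
    (ρ : Perm (Fin a)) (f : Gra A (a + 1)) (g : Gra A M) :
    relabel (blockPerm h τ ρ) (insert h f g) =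
      insert h (relabel (Perm.decomposeFin.symm (0, ρ)) f) (relabel τ g) := by
  rw [insert_eq_collapse, insert_eq_collapse, map_mul, relabel_perm_expand, expand_relabel_perm,
    relabel_relabel, relabel_relabel]
  congr 2
  · congr 1
    funext t
    simp only [Function.comp_apply, Equiv.eq_symm_apply]
    obtain ⟨s, rfl⟩ := (blockPerm h τ ρ).surjective t
    rw [Equiv.symm_apply_apply]
    rcases cast_cases h s with ⟨i, rfl⟩ | ⟨j, rfl⟩
    · rw [blockPerm_left]; simp
    · rw [blockPerm_right]; simp [Perm.decomposeFin_symm_apply_succ]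
  · congr 1
    funext i
    exact blockPerm_left h τ ρ i

theorem insert_smul_left [Algebra ℚ A] {M a L : ℕ} (h : M + a = L) (c : ℚ) (f : Gra A (a + 1))
    (g : Gra A M) : insert h (c • f) g = c • insert h f g := by
  simp only [insert, map_rat_smul, smul_mul_assoc]

theorem insert_smul_right [Algebra ℚ A] {M a L : ℕ} (h : M + a = L) (c : ℚ) (f : Gra A (a + 1))
    (g : Gra A M) : insert h f (c • g) = c • insert h f g := by
  simp only [insert, map_rat_smul, mul_smul_comm]

theorem insert_zsmul_left {M a L : ℕ} (h : M + a = L) (c : ℤ) (f : Gra A (a + 1))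
    (g : Gra A M) : insert h (c • f) g = c • insert h f g := by
  simp only [insert, map_zsmul, smul_mul_assoc]

theorem insert_zsmul_right {M a L : ℕ} (h : M + a = L) (c : ℤ) (f : Gra A (a + 1))
    (g : Gra A M) : insert h f (c • g) = c • insert h f g := by
  simp only [insert, map_zsmul, mul_smul_comm]

theorem insert_add_left {M a L : ℕ} (h : M + a = L) (f f' : Gra A (a + 1))
    (g : Gra A M) : insert h (f + f') g = insert h f g + insert h f' g := by
  simp only [insert, map_add, add_mul]

theorem insert_add_right {M a L : ℕ} (h : M + a = L) (f : Gra A (a + 1))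
    (g g' : Gra A M) : insert h f (g + g') = insert h f g + insert h f g' := by
  simp only [insert, map_add, mul_add]

theorem insert_sum_left {ι : Type*} {M a L : ℕ} (h : M + a = L) (s : Finset ι)
    (f : ι → Gra A (a + 1)) (g : Gra A M) :
    insert h (∑ i ∈ s, f i) g = ∑ i ∈ s, insert h (f i) g := by
  simp only [insert, map_sum, Finset.sum_mul]

theorem insert_sum_right {ι : Type*} {M a L : ℕ} (h : M + a = L) (s : Finset ι)
    (f : Gra A (a + 1)) (g : ι → Gra A M) :
    insert h f (∑ i ∈ s, g i) = ∑ i ∈ s, insert h f (g i) := by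
  simp only [insert, map_sum, Finset.mul_sum]

theorem relabel_perm_one {N : ℕ} (x : Gra A N) : relabel (1 : Perm (Fin N)) x = x := relabel_id x

/-- Antisymmetrizing the inserted graph beforehand only repeats the antisymmetrization of the
insertion, once for every permutation of the inserted vertices. -/
theorem symm_insert_symm [Algebra ℚ A] {M a L : ℕ} (h : M + a = L) (f : Gra A (a + 1))
    (u : Gra A M) : symm (insert h f (symm u)) = M.factorial • symm (insert h f u) := by
  have h1 : ∀ τ : Perm (Fin M), symm (insert h f ((Perm.sign τ : ℤ) • relabel τ u)) =
      symm (insert h f u) := by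
    intro τ
    have := relabel_blockPerm_insert h τ 1 f u
    rw [show (Perm.decomposeFin.symm (0, 1) : Perm (Fin (a + 1))) = 1 by
      rw [Perm.decomposeFin_symm_of_one, swap_self]; rfl, relabel_perm_one] at this
    rw [insert_zsmul_right, ← this, symm_zsmul, symm_relabel, sign_blockPerm, smul_smul]
    simp [← Units.val_mul]
  have h2 : insert h f (symm u) = ∑ τ : Perm (Fin M), insert h f ((Perm.sign τ : ℤ) • relabel τ u) :=
    insert_sum_right _ _ _ _
  rw [h2, symm_sum]
  rw [Finset.sum_congr rfl fun τ _ => h1 τ]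
  simp [Fintype.card_perm]

/-- A sum over permutations of a function that only depends on one value. -/
theorem sum_perm_apply_zero {B : Type*} [AddCommMonoid B] {c : ℕ} (g : Fin (c + 1) → B) :
    ∑ σ : Perm (Fin (c + 1)), g (σ 0) = c.factorial • ∑ p, g p := by
  rw [← Perm.decomposeFin.symm.sum_comp, Fintype.sum_prod_type]
  simp [Fintype.card_perm, Finset.smul_sum]

/-- A sum over all permutations `σ` of a function that is invariant under left multiplication by the
stabilizer of `0` only depends on the vertex that `σ` sends to `0`; here `τ p` is a representative
of the permutations that send `p` to `0`. -/
theorem sum_perm_of_stab_invariant {B : Type*} [AddCommMonoid B] {c : ℕ}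
    (G : Perm (Fin (c + 1)) → B) (τ : Fin (c + 1) → Perm (Fin (c + 1))) (hτ : ∀ p, τ p p = 0)
    (hG : ∀ ε σ, ε 0 = 0 → G (ε * σ) = G σ) :
    ∑ σ, G σ = c.factorial • ∑ p, G (τ p) := by
  rw [← sum_perm_apply_zero fun p => G (τ p), ← Equiv.sum_comp (Equiv.inv (Perm (Fin (c + 1))))]
  refine Finset.sum_congr rfl fun σ _ => ?_
  have := hG (σ⁻¹ * (τ (σ 0))⁻¹) (τ (σ 0)) (by
    rw [Perm.mul_apply, Perm.inv_eq_iff_eq.mpr (hτ (σ 0)).symm]; simp)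
  rw [← this]; simp

/-- A permutation that fixes `0` comes from a permutation of the other vertices. -/
theorem exists_decomposeFin_zero {c : ℕ} (ε : Perm (Fin (c + 1))) (h : ε 0 = 0) :
    ∃ ρ, ε = Perm.decomposeFin.symm (0, ρ) := by
  refine ⟨(Perm.decomposeFin ε).2, ?_⟩
  rw [Equiv.eq_symm_apply]
  refine Prod.ext ?_ rfl
  have := Perm.decomposeFin_symm_apply_zero (Perm.decomposeFin ε).1 (Perm.decomposeFin ε).2
  rw [Prod.mk.eta, Equiv.symm_apply_apply] at this
  rw [← this, h]

/-- Relabelling the vertices other than `0` of the graph into which `w` is inserted is absorbed by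
the antisymmetrization. -/
theorem symm_insert_stab [Algebra ℚ A] {Q c T : ℕ} (h : Q + c = T) (F : Gra A (c + 1)) (w : Gra A Q)
    (ε : Perm (Fin (c + 1))) (hε : ε 0 = 0) :
    symm (insert h (relabel ε F) w) = (Perm.sign ε : ℤ) • symm (insert h F w) := by
  obtain ⟨ρ, rfl⟩ := exists_decomposeFin_zero ε hε
  have := relabel_blockPerm_insert h 1 ρ F w
  rw [relabel_perm_one] at this
  rw [← this, symm_relabel, sign_blockPerm, Perm.decomposeFin.symm_sign]
  simp

/-- Insertion of `w` into a composition: `w` is inserted either into a vertex of `g`, or into a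
vertex of `f`; up to antisymmetry there is just one vertex of each kind. -/
theorem symm_insert_symm_insert [Algebra ℚ A] {M a c Q T : ℕ} (h1 : M + a = c + 1) (hM : 0 < M)
    (h2 : Q + c = T) (σ : Perm (Fin (c + 1))) (hσ : ∀ j : Fin (c + 1), (j : ℕ) = M → σ j = 0)
    {f : Gra A (a + 1)} {g : Gra A M} (hf : IsAntisymm f) (hg : IsAntisymm g) (w : Gra A Q) :
    symm (insert h2 (symm (insert h1 f g)) w) = c.factorial • (M • symm (insert h2 (insert h1 f g) w)
      + a • (Perm.sign σ : ℤ) • symm (insert h2 (relabel σ (insert h1 f g)) w)) := by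
  set G : Perm (Fin (c + 1)) → Gra A T := fun σ =>
    (Perm.sign σ : ℤ) • symm (insert h2 (relabel σ (insert h1 f g)) w) with hGdef
  have hsum : symm (insert h2 (symm (insert h1 f g)) w) = ∑ σ, G σ := by
    have h2 : insert h2 (symm (insert h1 f g)) w = ∑ σ : Perm (Fin (c + 1)),
        insert h2 ((Perm.sign σ : ℤ) • relabel σ (insert h1 f g)) w := insert_sum_left _ _ _ _
    rw [h2, symm_sum]
    simp only [insert_zsmul_left, symm_zsmul, hGdef]
  have hleft : ∀ ε σ, ε 0 = 0 → G (ε * σ) = G σ := by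
    intro ε σ hε
    simp only [hGdef]
    rw [← relabel_perm_mul, symm_insert_stab _ _ _ _ hε, smul_smul, Perm.sign_mul, Units.val_mul,
      mul_right_comm, sign_mul_self, one_mul]
  have hright : ∀ σ τ ρ, G (σ * blockPerm h1 τ ρ) = G σ := by
    intro σ τ ρ
    simp only [hGdef]
    rw [← relabel_perm_mul, relabel_blockPerm_insert, hf, hg, insert_zsmul_left,
      insert_zsmul_right, map_zsmul, map_zsmul, insert_zsmul_left, insert_zsmul_left, symm_zsmul,
      symm_zsmul, Perm.decomposeFin.symm_sign, Perm.sign_mul, sign_blockPerm, if_pos rfl, one_mul]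
    simp only [smul_smul, ← Units.val_mul]
    congr 2
    rw [mul_assoc, mul_assoc, ← mul_assoc (Perm.sign ρ) (Perm.sign ρ), Int.units_mul_self, one_mul,
      Int.units_mul_self, mul_one]
  -- Representatives of the permutations that send `p` to `0`. Up to block permutations, which do
  -- not change `G` by the antisymmetry of `f` and `g`, there are only two of them: the identity if
  -- `p` is a vertex of `g`, and `σ` if `p` is a vertex of `f`.
  let τ : Fin (c + 1) → Perm (Fin (c + 1)) := fun p =>
    if hp : (p : ℕ) < M then blockPerm h1 (swap ⟨0, hM⟩ ⟨p, hp⟩) 1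
    else σ * blockPerm h1 1 (swap ⟨0, by omega⟩ ⟨p - M, by omega⟩)
  have hτ : ∀ p, τ p p = 0 := by
    intro p
    simp only [τ]
    rcases cast_cases h1 p with ⟨i, rfl⟩ | ⟨j, rfl⟩
    · rw [dif_pos (by simp), blockPerm_left]
      ext; simp
    · rw [dif_neg (by simp), Perm.mul_apply, blockPerm_right]
      apply hσ
      simp
  have hGτ : ∀ p, G (τ p) = if (p : ℕ) < M then G 1 else G σ := by
    intro p
    simp only [τ]
    split_ifs
    · rw [← one_mul (blockPerm _ _ _), hright]
    · rw [hright]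
  rw [hsum, sum_perm_of_stab_invariant G τ hτ hleft, Finset.sum_congr rfl fun p _ => hGτ p]
  congr 1
  rw [Finset.sum_ite, Finset.sum_const, Finset.sum_const]
  have hc1 : #{p : Fin (c + 1) | (p : ℕ) < M} = M ∧ #{p : Fin (c + 1) | ¬ (p : ℕ) < M} = a := by
    have h3 : #{p : Fin (c + 1) | (p : ℕ) < M} = M := by
      rw [Fin.card_filter_val_lt]; omega
    have h4 := Finset.card_filter_add_card_filter_not (s := (univ : Finset (Fin (c + 1))))
      (fun p => (p : ℕ) < M)
    rw [h3, Finset.card_univ, Fintype.card_fin] at h4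
    exact ⟨h3, by omega⟩
  rw [hc1.1, hc1.2]
  simp only [hGdef, Perm.sign_one, Units.val_one, one_smul, relabel_perm_one]


/-- Inserting `w` into the first vertex of `g` inside `f` is inserting the insertion of `w` into
`g`. -/
theorem insert_insert [Algebra ℚ A] {b a c Q T R : ℕ} (h1 : b + 1 + a = c + 1) (h2 : Q + c = T)
    (h3 : Q + b = R) (h4 : R + a = T) (f : Gra A (a + 1)) (g : Gra A (b + 1)) (w : Gra A Q) :
    insert h2 (insert h1 f g) w = insert h4 f (insert h3 g w) := by
  simp only [insert_eq_collapse, map_mul, expand_expand, relabel_relabel]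
  rw [mul_assoc]
  congr 2
  · congr 1
    funext t
    ext
    simp [collapse]
    omega
  · apply expand_relabel
    · intro i j hij; simpa [Fin.ext_iff] using hij
    · intro i j hij; simpa [Fin.ext_iff] using hij
    · intro r; ext; simp [collapse]
    · intro t m htm
      have : (t : ℕ) < R := by
        have := m.2
        simp [Fin.ext_iff, collapse] at htm
        omega
      exact ⟨⟨t, this⟩, rfl⟩

/-- The insertion of `g` and `w` into the vertices `0` and `1` of `f`; the vertices of `w` come
first, followed by those of `g` and the remaining vertices of `f`. -/
def doubleInsert {M a Q T : ℕ} (h : Q + M + a = T) (f : Gra A (a + 2)) (g : Gra A M)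
    (w : Gra A Q) : Gra A T :=
  expand (fun t : Fin T => if (t : ℕ) < Q then (1 : Fin (a + 2)) else
      ⟨(if (t : ℕ) < Q + M then 0 else t + 2 - (Q + M)), by split_ifs <;> omega⟩) f *
    (relabel (fun i : Fin M => (⟨Q + i, by omega⟩ : Fin T)) g *
      relabel (fun i : Fin Q => (⟨i, by omega⟩ : Fin T)) w)

/-- Insertion of `w` into a vertex of `f` other than the one that has been replaced by `g`: the
cycle moves the vertex after the block of `g`, which is the vertex `1` of `f`, to the place `0` at
which `w` is inserted. -/
theorem insert_relabel_insert [Algebra ℚ A] {M a c Q T : ℕ} (h1 : M + (a + 1) = c + 1)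
    (h2 : Q + c = T) (h : Q + M + a = T) (f : Gra A (a + 2)) (g : Gra A M) (w : Gra A Q) :
    insert h2 (relabel (Fin.cycleRange ⟨M, by omega⟩) (insert h1 f g)) w = doubleInsert h f g w := by
  rw [insert_eq_collapse, insert_eq_collapse, map_mul, relabel_perm_expand, map_mul,
    expand_expand, relabel_relabel, doubleInsert, mul_assoc]
  have hc : ∀ t : Fin T, ((Fin.cycleRange (⟨M, by omega⟩ : Fin (c + 1))).symm
      (collapse Q c T h2 t) : ℕ) = if (t : ℕ) < Q then M else
        if (t : ℕ) < Q + M then t - Q else t - Q + 1 := by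
    intro t
    split_ifs with ht ht'
    · have : collapse Q c T h2 t = 0 := by ext; simp [collapse]; omega
      rw [this, Fin.cycleRange_symm_zero]
    · have : collapse Q c T h2 t = (⟨t - Q, by omega⟩ : Fin c).succ := by
        ext; simp [collapse]; omega
      rw [this, Fin.cycleRange_symm_succ, Fin.succAbove_of_castSucc_lt]
      · rfl
      · rw [Fin.lt_def]; simp; omega
    · have : collapse Q c T h2 t = (⟨t - Q, by omega⟩ : Fin c).succ := by
        ext; simp [collapse]; omega
      rw [this, Fin.cycleRange_symm_succ, Fin.succAbove_of_le_castSucc]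
      · rfl
      · rw [Fin.le_def]; simp; omega
  have hcM : ∀ i : Fin M, (Fin.cycleRange (⟨M, by omega⟩ : Fin (c + 1))
      (Fin.cast h1 (Fin.castAdd (a + 1) i)) : ℕ) = i + 1 := by
    intro i
    rw [Fin.coe_cycleRange_of_lt]
    · rfl
    · rw [Fin.lt_def]; simp
  congr 2
  · congr 1
    funext t
    ext
    have := hc t
    simp only [collapse] at this
    simp only [Function.comp_apply, collapse]
    rw [this]
    split_ifs with h1 h2
    · simp
    · simp; omega
    · simp; omega
  · rw [expand_relabel (κ' := id) (ι' := fun i : Fin M => (⟨Q + i, by omega⟩ : Fin T))]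
    · rw [show (id : Fin M → Fin M) = (1 : Perm (Fin M)) from rfl, expand_perm]
      congr 1
      exact relabel_id g
    · intro i j hij
      simp only [Function.comp_apply, EmbeddingLike.apply_eq_iff_eq] at hij
      simpa [Fin.ext_iff] using hij
    · intro i j hij; simpa [Fin.ext_iff] using hij
    · intro r; ext; simp only [Function.comp_apply]; rw [hcM]; simp [collapse]; omega
    · intro t m htm
      rw [Fin.ext_iff] at htm
      simp only [Function.comp_apply] at htm
      rw [hcM] at htm
      simp [collapse] at htm
      exact ⟨⟨t - Q, by omega⟩, by ext; simp; omega⟩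

theorem coe_finRotate_pow {n : ℕ} (k : ℕ) (i : Fin (n + 1)) :
    (((finRotate (n + 1)) ^ k) i : ℕ) = (i + k) % (n + 1) := by
  induction k with
  | zero => simp [Nat.mod_eq_of_lt i.2]
  | succ k ih =>
    rw [pow_succ', Perm.mul_apply, finRotate_apply, Fin.val_add, ih, Fin.val_one',
      ← Nat.add_mod, add_assoc]

theorem sign_finRotate_pow (M Q : ℕ) (n : ℕ) (h : n + 1 = Q + M) :
    Perm.sign ((finRotate (n + 1)) ^ M) = (-1) ^ (M * Q) := by
  rw [map_pow, sign_finRotate, ← pow_mul]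
  refine neg_one_pow_congr ?_
  obtain rfl : n = Q + M - 1 := by omega
  rcases M with _ | M
  · simp
  · simp only [← add_assoc, Nat.add_sub_cancel, Nat.even_mul, Nat.even_add, Nat.even_add_one]
    tauto

/-- Double insertion is symmetric in the two inserted graphs up to sign: exchanging the blocks of
`Q` and `M` vertices contributes `(-1) ^ (M * Q)`, and exchanging the vertices `0` and `1` of the
antisymmetric `f` contributes the minus sign. -/
theorem symm_doubleInsert_swap [Algebra ℚ A] {M a Q T : ℕ} (hM : 0 < M) (h : Q + M + a = T)
    (h' : M + Q + a = T) {f : Gra A (a + 2)} (hf : IsAntisymm f) (g : Gra A M) (w : Gra A Q) :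
    symm (doubleInsert h f g w) = -(-1 : ℤ) ^ (M * Q) • symm (doubleInsert h' f w g) := by
  obtain ⟨n, hn⟩ : ∃ n, n + 1 = Q + M := ⟨Q + M - 1, by omega⟩
  have h0 : n + 1 + a = T := by omega
  set π := blockPerm h0 ((finRotate (n + 1)) ^ M) 1 with hπ
  have hπl : ∀ t : Fin T, (t : ℕ) < Q + M → (π t : ℕ) = (t + M) % (Q + M) := by
    intro t ht
    have : t = Fin.cast h0 (Fin.castAdd a ⟨t, by omega⟩) := rfl
    rw [this, hπ, blockPerm_left]
    simp [coe_finRotate_pow, hn]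
  have hπr : ∀ t : Fin T, Q + M ≤ (t : ℕ) → π t = t := by
    intro t ht
    have : t = Fin.cast h0 (Fin.natAdd (n + 1) ⟨t - (n + 1), by omega⟩) := by
      ext; simp; omega
    rw [this, hπ, blockPerm_right]
    simp
  have hπ1 : ∀ t : Fin T, (t : ℕ) < Q → (π t : ℕ) = t + M := by
    intro t ht
    rw [hπl t (by omega), Nat.mod_eq_of_lt (by omega)]
  have hπ2 : ∀ t : Fin T, Q ≤ (t : ℕ) → (t : ℕ) < Q + M → (π t : ℕ) = t - Q := by
    intro t ht ht'
    rw [hπl t ht', show (t : ℕ) + M = t - Q + (Q + M) by omega, Nat.add_mod_right,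
      Nat.mod_eq_of_lt (by omega)]
  have key : relabel π (doubleInsert h f g w) = -doubleInsert h' f w g := by
    have hfs : -f = relabel (swap (0 : Fin (a + 2)) 1) f := by
      rw [hf, Perm.sign_swap (by simp)]; simp
    unfold doubleInsert
    rw [map_mul, map_mul, relabel_perm_expand, relabel_relabel, relabel_relabel, ← neg_mul,
      ← map_neg, hfs, expand_relabel_perm, mul_comm (relabel _ g)]
    congr 2
    · congr 1
      funext t
      obtain ⟨s, rfl⟩ := π.surjective t
      rw [Function.comp_apply, Equiv.symm_apply_apply, Function.comp_apply, symm_swap]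
      by_cases hs : (s : ℕ) < Q
      · have := hπ1 s hs
        have e1 : ¬ (π s : ℕ) < M := by omega
        have e2 : (π s : ℕ) < M + Q := by omega
        simp [hs, e1, e2]
      · by_cases hs' : (s : ℕ) < Q + M
        · have := hπ2 s (by omega) hs'
          have e1 : (π s : ℕ) < M := by omega
          simp [hs, hs', e1]
        · rw [hπr s (by omega)]
          have e1 : ¬ (s : ℕ) < M := by omega
          have e2 : ¬ (s : ℕ) < M + Q := by omega
          simp only [hs, hs', e1, if_false, add_comm M Q]
          rw [swap_apply_of_ne_of_ne] <;> simp [Fin.ext_iff] <;> omega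
    · congr 2
      funext i
      ext
      simp only [Function.comp_apply]
      rw [hπ1 _ (by simp)]
      simp [add_comm]
    · congr 2
      funext i
      ext
      simp only [Function.comp_apply]
      rw [hπ2 _ (by simp) (by simp)]
      simp
  have h1 := symm_relabel π (doubleInsert h f g w)
  rw [key, symm_neg, hπ, sign_blockPerm, sign_finRotate_pow M Q n hn, Perm.sign_one, mul_one] at h1
  have h2 : symm (doubleInsert h f g w) =
      (-1 : ℤ) ^ (M * Q) • (-1 : ℤ) ^ (M * Q) • symm (doubleInsert h f g w) := by
    rw [smul_smul, ← pow_add, ← two_mul, pow_mul]; simp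
  rw [h2, neg_smul, ← smul_neg, h1]
  simp

end PreLie

section Star

set_option linter.unusedSectionVars false

variable {A : Type*} [CommRing A] [Algebra ℚ A]

/-! ### The pre-Lie product of series -/

/-- If `f` has a single vertex, there is no room for inserting into two different vertices, and the
product is associative. -/
theorem circ_circ_of_zero {b c Q T R : ℕ} (h1 : b + 1 + 0 = c + 1) (h2 : Q + c = T)
    (h3 : Q + b = R) (h4 : R + 0 = T) {f : Gra A (0 + 1)} {g : Gra A (b + 1)} (hf : IsAntisymm f)
    (hg : IsAntisymm g) (w : Gra A Q) :
    circ h2 (circ h1 f g) w = circ h4 f (circ h3 g w) := by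
  unfold circ
  rw [insert_smul_left, symm_qsmul, symm_insert_symm_insert h1 (Nat.succ_pos b) h2
    (Fin.cycleRange (Fin.last c)) (fun j hj => by omega) hf hg w, insert_smul_right, symm_qsmul,
    symm_insert_symm, insert_insert h1 h2 h3 h4]
  rw [zero_smul, add_zero]
  simp only [smul_smul, ← Nat.cast_smul_eq_nsmul ℚ, Nat.factorial_succ]
  congr 1
  have e1 : (Q.factorial : ℚ) ≠ 0 := by positivity
  have e2 : (c.factorial : ℚ) ≠ 0 := by positivity
  have e3 : (b.factorial : ℚ) ≠ 0 := by positivity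
  have e4 : (R.factorial : ℚ) ≠ 0 := by positivity
  have e5 : (b : ℚ) + 1 ≠ 0 := by positivity
  push_cast
  field_simp

/-- The associator of components is the insertion into two different vertices. -/
theorem circ_circ_of_succ {b a c Q T R : ℕ} (h1 : b + 1 + (a + 1) = c + 1) (h2 : Q + c = T)
    (h3 : Q + b = R) (h4 : R + (a + 1) = T) (h : Q + (b + 1) + a = T) {f : Gra A (a + 1 + 1)}
    {g : Gra A (b + 1)} (hf : IsAntisymm f) (hg : IsAntisymm g) (w : Gra A Q) :
    circ h2 (circ h1 f g) w - circ h4 f (circ h3 g w) =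
      ((Q.factorial * (b + 1).factorial * a.factorial : ℕ) : ℚ)⁻¹ • (-1 : ℤ) ^ (b + 1) •
        symm (doubleInsert h f g w) := by
  unfold circ
  rw [insert_smul_left, symm_qsmul, symm_insert_symm_insert h1 (Nat.succ_pos b) h2
    (Fin.cycleRange ⟨b + 1, by omega⟩)
    (fun j hj => by rw [show j = ⟨b + 1, by omega⟩ from Fin.ext hj, Fin.cycleRange_self]) hf hg w,
    insert_smul_right, symm_qsmul,
    symm_insert_symm, insert_insert h1 h2 h3 h4, insert_relabel_insert h1 h2 h]
  simp only [smul_add, smul_smul, ← Nat.cast_smul_eq_nsmul ℚ, Nat.factorial_succ,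
    Fin.sign_cycleRange]
  have e1 : (Q.factorial : ℚ) ≠ 0 := by positivity
  have e2 : (c.factorial : ℚ) ≠ 0 := by positivity
  have e3 : (b.factorial : ℚ) ≠ 0 := by positivity
  have e4 : (R.factorial : ℚ) ≠ 0 := by positivity
  have e5 : (b : ℚ) + 1 ≠ 0 := by positivity
  have e6 : (a.factorial : ℚ) ≠ 0 := by positivity
  have e7 : (a : ℚ) + 1 ≠ 0 := by positivity
  have h5 : ∀ (x y z : ℚ) (u v : Gra A T), x = y → x • u + z • v - y • u = z • v := by
    intro x y z u v hxy; rw [hxy]; abel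
  rw [h5 _ _ _ _ _ (by push_cast; field_simp)]
  push_cast
  congr 1
  field_simp

/-- The pre-Lie product of series of graphs. -/
def star (f g : Cochain A) : Cochain A := fun L k =>
  ∑ x : antidiagonal L, ∑ y ∈ antidiagonal k,
    circ (mem_antidiagonal.mp x.2) (f (x.1.2 + 1) y.1) (g x.1.1 y.2)

theorem circ_add_left {M a L : ℕ} (h : M + a = L) (f f' : Gra A (a + 1)) (g : Gra A M) :
    circ h (f + f') g = circ h f g + circ h f' g := by
  simp only [circ, insert_add_left, symm_add, smul_add]

theorem circ_add_right {M a L : ℕ} (h : M + a = L) (f : Gra A (a + 1)) (g g' : Gra A M) :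
    circ h f (g + g') = circ h f g + circ h f g' := by
  simp only [circ, insert_add_right, symm_add, smul_add]

theorem circ_smul_left {M a L : ℕ} (h : M + a = L) (c : ℚ) (f : Gra A (a + 1)) (g : Gra A M) :
    circ h (c • f) g = c • circ h f g := by
  simp only [circ, insert_smul_left, symm_qsmul, smul_comm c]

theorem circ_smul_right {M a L : ℕ} (h : M + a = L) (c : ℚ) (f : Gra A (a + 1)) (g : Gra A M) :
    circ h f (c • g) = c • circ h f g := by
  simp only [circ, insert_smul_right, symm_qsmul, smul_comm c]

theorem circ_zero_left {M a L : ℕ} (h : M + a = L) (g : Gra A M) :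
    circ h (0 : Gra A (a + 1)) g = 0 := by
  simpa using circ_smul_left h 0 0 g

theorem circ_zero_right {M a L : ℕ} (h : M + a = L) (f : Gra A (a + 1)) :
    circ h f (0 : Gra A M) = 0 := by
  simpa using circ_smul_right h 0 f 0

theorem circ_isAntisymm {M a L : ℕ} (h : M + a = L) (f : Gra A (a + 1)) (g : Gra A M) :
    IsAntisymm (circ h f g) := by
  intro σ
  rw [circ, relabel_qsmul, symm_isAntisymm, smul_comm]

theorem star_add_left (f f' g : Cochain A) : star (f + f') g = star f g + star f' g := by
  funext L k; simp [star, circ_add_left, Finset.sum_add_distrib]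

theorem star_add_right (f g g' : Cochain A) : star f (g + g') = star f g + star f g' := by
  funext L k; simp [star, circ_add_right, Finset.sum_add_distrib]

theorem star_smul_left (c : ℚ) (f g : Cochain A) : star (c • f) g = c • star f g := by
  funext L k; simp [star, circ_smul_left, Finset.smul_sum]

theorem star_smul_right (c : ℚ) (f g : Cochain A) : star f (c • g) = c • star f g := by
  funext L k; simp [star, circ_smul_right, Finset.smul_sum]

theorem star_zero_left (g : Cochain A) : star 0 g = 0 := by simpa using star_smul_left 0 0 g

theorem star_zero_right (f : Cochain A) : star f 0 = 0 := by simpa using star_smul_right 0 f 0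

theorem star_neg_left (f g : Cochain A) : star (-f) g = -star f g := by
  simpa using star_smul_left (-1) f g

theorem star_neg_right (f g : Cochain A) : star f (-g) = -star f g := by
  simpa using star_smul_right (-1) f g

theorem star_sub_left (f f' g : Cochain A) : star (f - f') g = star f g - star f' g := by
  rw [sub_eq_add_neg, star_add_left, star_neg_left, sub_eq_add_neg]

theorem star_sub_right (f g g' : Cochain A) : star f (g - g') = star f g - star f g' := by
  rw [sub_eq_add_neg, star_add_right, star_neg_right, sub_eq_add_neg]

theorem star_congr {f f' g g' : Cochain A} {L k : ℕ}
    (hf : ∀ N ≤ L + 1, ∀ l ≤ k, f N l = f' N l) (hg : ∀ N ≤ L, ∀ l ≤ k, g N l = g' N l) :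
    star f g L k = star f' g' L k := by
  refine Finset.sum_congr rfl fun x _ => Finset.sum_congr rfl fun y hy => ?_
  have hx := mem_antidiagonal.mp x.2
  have hy := mem_antidiagonal.mp hy
  rw [hf _ (by omega) _ (by omega), hg _ (by omega) _ (by omega)]

/-- The series that consists of a single component. -/
def single (N k : ℕ) (x : Gra A N) : Cochain A := Pi.single N (Pi.single k x)

theorem single_same (N k : ℕ) (x : Gra A N) : single N k x N k = x := by simp [single]

theorem single_of_ne {N k N' k' : ℕ} (x : Gra A N) (h : ¬ (N' = N ∧ k' = k)) :
    single N k x N' k' = 0 := by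
  unfold single
  by_cases h1 : N' = N
  · subst h1; simp [show k' ≠ k from fun h2 => h ⟨rfl, h2⟩]
  · rw [Pi.single_eq_of_ne h1]; rfl

theorem single_zero (N k : ℕ) : single N k (0 : Gra A N) = 0 := by simp [single]

theorem single_zsmul (N k : ℕ) (c : ℤ) (x : Gra A N) : single N k (c • x) = c • single N k x := by
  simp only [single, Pi.single_smul]

theorem single_sub (N k : ℕ) (x y : Gra A N) : single N k (x - y) = single N k x - single N k y := by
  simp [single, Pi.single_sub]

theorem star_single {a M L : ℕ} (h : M + a = L) (k l : ℕ) (f : Gra A (a + 1)) (g : Gra A M) :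
    star (single (a + 1) k f) (single M l g) = single L (k + l) (circ h f g) := by
  subst h
  funext L K
  unfold star
  by_cases hL : L = M + a ∧ K = k + l
  · obtain ⟨rfl, rfl⟩ := hL
    rw [Finset.sum_eq_single ⟨(M, a), by simp⟩, Finset.sum_eq_single (k, l)]
    · simp only [single_same]
    · intro y hy hne
      have hy := mem_antidiagonal.mp hy
      rw [single_of_ne f, circ_zero_left]
      rintro ⟨-, h1⟩
      exact hne (Prod.ext h1 (by dsimp only; omega))
    · intro h; exact absurd (by simp) h
    · rintro ⟨⟨m, b⟩, hx⟩ - hne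
      have hx' := mem_antidiagonal.mp hx
      refine Finset.sum_eq_zero fun y _ => ?_
      rw [single_of_ne f, circ_zero_left]
      rintro ⟨h1, -⟩
      dsimp only at h1 hx'
      obtain rfl : b = a := by omega
      obtain rfl : m = M := by omega
      exact hne rfl
    · intro h; exact absurd (mem_univ _) h
  · rw [single_of_ne _ hL]
    refine Finset.sum_eq_zero fun x _ => Finset.sum_eq_zero fun y hy => ?_
    have hx := mem_antidiagonal.mp x.2
    have hy := mem_antidiagonal.mp hy
    by_cases h1 : x.1.2 + 1 = a + 1 ∧ y.1 = k
    · rw [single_of_ne g, circ_zero_right]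
      rintro ⟨h2, h3⟩
      exact hL ⟨by omega, by omega⟩
    · rw [single_of_ne f h1, circ_zero_left]

theorem star_single_zero (k : ℕ) (f : Gra A 0) (g : Cochain A) : star (single 0 k f) g = 0 := by
  funext L K
  refine Finset.sum_eq_zero fun x _ => Finset.sum_eq_zero fun y hy => ?_
  rw [single_of_ne _ (by simp), circ_zero_left]

/-- The finite part of a series with fewer than `B` vertices and fewer than `B` edges. -/
def truncate (B : ℕ) (f : Cochain A) : Cochain A :=
  ∑ p ∈ range B ×ˢ range B, single p.1 p.2 (f p.1 p.2)

theorem truncate_apply {B N k : ℕ} (f : Cochain A) (hN : N < B) (hk : k < B) :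
    truncate B f N k = f N k := by
  unfold truncate
  simp only [Finset.sum_apply]
  rw [Finset.sum_eq_single (N, k), single_same]
  · intro p _ hp; exact single_of_ne _ fun h => hp (Prod.ext h.1.symm h.2.symm)
  · intro h; exact absurd (mem_product.mpr ⟨mem_range.mpr hN, mem_range.mpr hk⟩) h

/-- The associator of the pre-Lie product. -/
def assoc (f g w : Cochain A) : Cochain A := star (star f g) w - star f (star g w)

theorem assoc_sum₁ {ι : Type*} (s : Finset ι) (f : ι → Cochain A) (g w : Cochain A) :
    assoc (∑ i ∈ s, f i) g w = ∑ i ∈ s, assoc (f i) g w := by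
  induction s using Finset.cons_induction with
  | empty => simp [assoc, star_zero_left]
  | cons i s hi ih =>
    rw [Finset.sum_cons, Finset.sum_cons, ← ih]
    simp only [assoc, star_add_left]; abel

theorem assoc_sum₂ {ι : Type*} (s : Finset ι) (f : Cochain A) (g : ι → Cochain A) (w : Cochain A) :
    assoc f (∑ i ∈ s, g i) w = ∑ i ∈ s, assoc f (g i) w := by
  induction s using Finset.cons_induction with
  | empty => simp [assoc, star_zero_left, star_zero_right]
  | cons i s hi ih =>
    rw [Finset.sum_cons, Finset.sum_cons, ← ih]
    simp only [assoc, star_add_left, star_add_right]; abel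

theorem assoc_sum₃ {ι : Type*} (s : Finset ι) (f g : Cochain A) (w : ι → Cochain A) :
    assoc f g (∑ i ∈ s, w i) = ∑ i ∈ s, assoc f g (w i) := by
  induction s using Finset.cons_induction with
  | empty => simp [assoc, star_zero_right]
  | cons i s hi ih =>
    rw [Finset.sum_cons, Finset.sum_cons, ← ih]
    simp only [assoc, star_add_right]; abel

theorem assoc_congr {f f' g g' w w' : Cochain A} {T K : ℕ}
    (hf : ∀ N ≤ T + 2, ∀ l ≤ K, f N l = f' N l) (hg : ∀ N ≤ T + 2, ∀ l ≤ K, g N l = g' N l)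
    (hw : ∀ N ≤ T + 2, ∀ l ≤ K, w N l = w' N l) : assoc f g w T K = assoc f' g' w' T K := by
  have h1 : star (star f g) w T K = star (star f' g') w' T K :=
    star_congr (fun N hN l hl => star_congr (fun N' hN' l' hl' => hf _ (by omega) _ (by omega))
      fun N' hN' l' hl' => hg _ (by omega) _ (by omega)) fun N hN l hl => hw _ (by omega) _ hl
  have h2 : star f (star g w) T K = star f' (star g' w') T K :=
    star_congr (fun N hN l hl => hf _ (by omega) _ hl) fun N hN l hl =>
      star_congr (fun N' hN' l' hl' => hg _ (by omega) _ (by omega))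
        fun N' hN' l' hl' => hw _ (by omega) _ (by omega)
  change star (star f g) w T K - star f (star g w) T K = _
  rw [h1, h2]; rfl

/-- The graded pre-Lie identity for single components, which is the symmetry of the double
insertion. -/
theorem assoc_single {a b Q k l m : ℕ} {f : Gra A (a + 1)} {g : Gra A (b + 1)} {w : Gra A (Q + 1)}
    (hf : IsAntisymm f) (hg : IsAntisymm g) (hw : IsAntisymm w) :
    assoc (single (a + 1) k f) (single (b + 1) l g) (single (Q + 1) m w) =
      (-1 : ℤ) ^ ((b + 1 + 1) * (Q + 1 + 1)) •
        assoc (single (a + 1) k f) (single (Q + 1) m w) (single (b + 1) l g) := by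
  have e : k + l + m = k + m + l := by omega
  have e' : k + (m + l) = k + m + l := by omega
  have e'' : k + (l + m) = k + m + l := by omega
  unfold assoc
  rw [star_single (L := b + a + 1) (by omega), star_single (L := b + Q + a + 1) (by omega),
    star_single (L := b + Q + 1) (by omega), star_single (L := b + Q + a + 1) (by omega),
    star_single (L := Q + a + 1) (by omega), star_single (L := b + Q + a + 1) (by omega),
    star_single (L := b + Q + 1) (by omega), star_single (L := b + Q + a + 1) (by omega),
    e, e', e'', ← single_sub, ← single_sub, ← single_zsmul]
  congr 1
  rcases a with _ | a
  · rw [circ_circ_of_zero (R := b + Q + 1) _ _ (by omega) (by omega) hf hg,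
      circ_circ_of_zero (R := b + Q + 1) _ _ (by omega) (by omega) hf hw]
    simp
  · rw [circ_circ_of_succ _ _ _ _ (by omega) hf hg, circ_circ_of_succ _ _ _ _ (by omega) hf hw,
      symm_doubleInsert_swap (Nat.succ_pos b) _ (by omega) hf, smul_comm ((-1 : ℤ) ^ _) (_ : ℚ)]
    congr 1
    · congr 2; ring
    · rw [smul_smul, smul_smul]
      congr 1
      have : ∀ x : ℕ, ((-1 : ℤ) ^ x * (-1 : ℤ) ^ x) = 1 := by
        intro x; rw [← pow_add, ← two_mul, pow_mul]; simp
      calc (-1 : ℤ) ^ (b + 1) * -(-1) ^ ((b + 1) * (Q + 1))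
          = (-1) ^ ((b + 1) * (Q + 1) + (b + 1) + 1) * 1 := by ring
        _ = (-1) ^ ((b + 1) * (Q + 1) + (b + 1) + 1) * ((-1) ^ (Q + 1) * (-1) ^ (Q + 1)) := by
          rw [this]
        _ = _ := by ring

/-- The graded pre-Lie identity: the associator is symmetric, up to the sign `ε`, in its last two
arguments. -/
theorem assoc_swap {f g w : Cochain A} (ε : ℤ) (hf : ∀ N k, IsAntisymm (f N k))
    (hg : ∀ N k, IsAntisymm (g N k)) (hw : ∀ N k, IsAntisymm (w N k)) (hg0 : ∀ k, g 0 k = 0)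
    (hw0 : ∀ k, w 0 k = 0)
    (hε : ∀ M Q k l, g M k ≠ 0 → w Q l ≠ 0 → (-1 : ℤ) ^ ((M + 1) * (Q + 1)) = ε) :
    assoc f g w = ε • assoc f w g := by
  funext T K
  -- A given component only depends on finitely many components of the factors, so these may be
  -- replaced by finite sums of single components.
  have ht : ∀ (f : Cochain A), ∀ N ≤ T + 2, ∀ l ≤ K, f N l = truncate (T + K + 3) f N l :=
    fun f N hN l hl => (truncate_apply f (by omega) (by omega)).symm
  change _ = ε • assoc f w g T K
  rw [assoc_congr (ht f) (ht g) (ht w), assoc_congr (ht f) (ht w) (ht g)]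
  suffices h : ∀ B, assoc (truncate B f) (truncate B g) (truncate B w) =
      ε • assoc (truncate B f) (truncate B w) (truncate B g) by
    rw [h]; rfl
  intro B
  have key : ∀ N k M l Q m, assoc (single N k (f N k)) (single M l (g M l)) (single Q m (w Q m)) =
      ε • assoc (single N k (f N k)) (single Q m (w Q m)) (single M l (g M l)) := by
    intro N k M l Q m
    by_cases h1 : g M l = 0
    · simp [h1, single_zero, assoc, star_zero_left, star_zero_right]
    by_cases h2 : w Q m = 0
    · simp [h2, single_zero, assoc, star_zero_left, star_zero_right]
    rcases N with _ | a
    · simp [assoc, star_single_zero, star_zero_left]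
    rcases M with _ | b
    · exact absurd (hg0 l) h1
    rcases Q with _ | Q
    · exact absurd (hw0 m) h2
    rw [assoc_single (hf _ _) (hg _ _) (hw _ _), hε _ _ _ _ h1 h2]
  have hs : ∀ f g w : Cochain A, assoc (truncate B f) (truncate B g) (truncate B w) =
      ∑ p ∈ range B ×ˢ range B, ∑ q ∈ range B ×ˢ range B, ∑ r ∈ range B ×ˢ range B,
        assoc (single p.1 p.2 (f p.1 p.2)) (single q.1 q.2 (g q.1 q.2))
          (single r.1 r.2 (w r.1 r.2)) := by
    intro f g w
    unfold truncate
    rw [assoc_sum₁]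
    refine Finset.sum_congr rfl fun p _ => ?_
    rw [assoc_sum₂]
    exact Finset.sum_congr rfl fun q _ => assoc_sum₃ _ _ _ _
  rw [hs, hs, Finset.smul_sum]
  refine Finset.sum_congr rfl fun p _ => ?_
  rw [Finset.sum_comm, Finset.smul_sum]
  refine Finset.sum_congr rfl fun q _ => ?_
  rw [Finset.smul_sum]
  exact Finset.sum_congr rfl fun r _ => key _ _ _ _ _ _

end Star

section Jacobi

set_option linter.unusedSectionVars false

variable {A : Type*} [CommRing A] [Algebra ℚ A]

/-! ### The Jacobi identity and the gauge action -/

/-- Antisymmetric series of odd degree: all graphs have a positive even number of vertices. -/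
structure IsOddSeries (f : Cochain A) : Prop where
  antisymm : ∀ N k, IsAntisymm (f N k)
  even : ∀ N k, f N k ≠ 0 → Even N
  zero : ∀ k, f 0 k = 0

/-- Antisymmetric series of even degree: all graphs have an odd number of vertices. -/
structure IsEvenSeries (f : Cochain A) : Prop where
  antisymm : ∀ N k, IsAntisymm (f N k)
  odd : ∀ N k, f N k ≠ 0 → Odd N

theorem IsEvenSeries.zero {f : Cochain A} (hf : IsEvenSeries f) (k : ℕ) : f 0 k = 0 := by
  by_contra h
  exact absurd (hf.odd 0 k h) (by simp)

theorem isAntisymm_zero {N : ℕ} : IsAntisymm (0 : Gra A N) := fun σ => by simp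

theorem IsAntisymm.add {N : ℕ} {x y : Gra A N} (hx : IsAntisymm x) (hy : IsAntisymm y) :
    IsAntisymm (x + y) := fun σ => by rw [map_add, hx, hy, smul_add]

theorem IsAntisymm.sub {N : ℕ} {x y : Gra A N} (hx : IsAntisymm x) (hy : IsAntisymm y) :
    IsAntisymm (x - y) := fun σ => by rw [map_sub, hx, hy, smul_sub]

theorem IsAntisymm.qsmul {N : ℕ} {x : Gra A N} (c : ℚ) (hx : IsAntisymm x) :
    IsAntisymm (c • x) := fun σ => by rw [relabel_qsmul, hx, smul_comm]

theorem IsAntisymm.sum {ι : Type*} {N : ℕ} (s : Finset ι) {x : ι → Gra A N}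
    (hx : ∀ i ∈ s, IsAntisymm (x i)) : IsAntisymm (∑ i ∈ s, x i) := fun σ => by
  rw [map_sum, Finset.smul_sum]
  exact Finset.sum_congr rfl fun i hi => hx i hi σ

theorem star_isAntisymm (f g : Cochain A) (L k : ℕ) : IsAntisymm (star f g L k) :=
  IsAntisymm.sum _ fun _ _ => IsAntisymm.sum _ fun _ _ => circ_isAntisymm _ _ _

theorem exists_of_star_ne_zero {f g : Cochain A} {L k : ℕ} (h : star f g L k ≠ 0) :
    ∃ a M k₁ k₂, M + a = L ∧ k₁ + k₂ = k ∧ f (a + 1) k₁ ≠ 0 ∧ g M k₂ ≠ 0 := by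
  obtain ⟨x, -, h⟩ := Finset.exists_ne_zero_of_sum_ne_zero h
  obtain ⟨y, hy, h⟩ := Finset.exists_ne_zero_of_sum_ne_zero h
  refine ⟨x.1.2, x.1.1, y.1, y.2, mem_antidiagonal.mp x.2, mem_antidiagonal.mp hy, ?_, ?_⟩
  · intro h0; exact h (by rw [h0, circ_zero_left])
  · intro h0; exact h (by rw [h0, circ_zero_right])

theorem IsEvenSeries.star_odd {f g : Cochain A} (hf : IsEvenSeries f) (hg : IsOddSeries g) :
    IsOddSeries (OddGC.star f g) where
  antisymm := star_isAntisymm f g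
  even L k h := by
    obtain ⟨a, M, k₁, k₂, rfl, rfl, h1, h2⟩ := exists_of_star_ne_zero h
    have h1 := hf.odd _ _ h1
    have h2 := hg.even _ _ h2
    rw [Nat.odd_iff] at *; rw [Nat.even_iff] at *; omega
  zero k := by
    by_contra h
    obtain ⟨a, M, k₁, k₂, h0, rfl, h1, h2⟩ := exists_of_star_ne_zero h
    obtain rfl : M = 0 := by omega
    exact h2 (hg.zero _)

theorem IsOddSeries.star_even {f g : Cochain A} (hf : IsOddSeries f) (hg : IsEvenSeries g) :
    IsOddSeries (OddGC.star f g) where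
  antisymm := star_isAntisymm f g
  even L k h := by
    obtain ⟨a, M, k₁, k₂, rfl, rfl, h1, h2⟩ := exists_of_star_ne_zero h
    have h1 := hf.even _ _ h1
    have h2 := hg.odd _ _ h2
    rw [Nat.odd_iff] at *; rw [Nat.even_iff] at *; omega
  zero k := by
    by_contra h
    obtain ⟨a, M, k₁, k₂, h0, rfl, h1, h2⟩ := exists_of_star_ne_zero h
    obtain rfl : M = 0 := by omega
    exact h2 (hg.zero _)

theorem IsOddSeries.add {f g : Cochain A} (hf : IsOddSeries f) (hg : IsOddSeries g) :
    IsOddSeries (f + g) where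
  antisymm N k := (hf.antisymm N k).add (hg.antisymm N k)
  even N k h := by
    by_cases h1 : f N k = 0
    · by_cases h2 : g N k = 0
      · exact absurd (show f N k + g N k = 0 by rw [h1, h2, add_zero]) h
      · exact hg.even _ _ h2
    · exact hf.even _ _ h1
  zero k := by change f 0 k + g 0 k = 0; rw [hf.zero, hg.zero, add_zero]

theorem IsOddSeries.qsmul {f : Cochain A} (c : ℚ) (hf : IsOddSeries f) : IsOddSeries (c • f) where
  antisymm N k := (hf.antisymm N k).qsmul c
  even N k h := hf.even _ _ fun h1 => h (by change c • f N k = 0; rw [h1, smul_zero])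
  zero k := by change c • f 0 k = 0; rw [hf.zero, smul_zero]

theorem IsOddSeries.sub {f g : Cochain A} (hf : IsOddSeries f) (hg : IsOddSeries g) :
    IsOddSeries (f - g) := by
  have := hf.add (hg.qsmul (-1))
  rwa [neg_one_smul, ← sub_eq_add_neg] at this

theorem bracket_eq_star_sub {f g : Cochain A} (ε : ℤ)
    (h : ∀ N M k l, f M k ≠ 0 → g N l ≠ 0 → (-1 : ℤ) ^ ((N + 1) * (M + 1)) = ε) :
    bracket f g = star f g - ε • star g f := by
  funext L k
  simp only [bracket, Finset.sum_sub_distrib, Pi.sub_apply, Pi.smul_apply]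
  congr 1
  unfold star
  simp only [Finset.smul_sum]
  refine Finset.sum_congr rfl fun x _ => Finset.sum_congr rfl fun y _ => ?_
  by_cases h1 : g (x.1.2 + 1) y.1 = 0
  · rw [h1, circ_zero_left, smul_zero, smul_zero]
  by_cases h2 : f x.1.1 y.2 = 0
  · rw [h2, circ_zero_right, smul_zero, smul_zero]
  rw [← h _ _ _ _ h2 h1]
  congr 1
  rw [show x.1.2 + 1 + 1 = x.1.2 + 2 from rfl, add_mul, pow_add, pow_mul (-1 : ℤ) 2]; simp

theorem IsEvenSeries.bracket_eq {f : Cochain A} (hf : IsEvenSeries f) (g : Cochain A) :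
    bracket f g = OddGC.star f g - OddGC.star g f := by
  have := bracket_eq_star_sub (f := f) (g := g) 1 fun N M k l hM _ => by
    have := hf.odd _ _ hM
    rw [pow_mul, pow_right_comm]
    simp [Even.neg_one_pow (Odd.add_one this)]
  rwa [one_smul] at this

theorem IsOddSeries.bracket_eq {f g : Cochain A} (hf : IsOddSeries f) (hg : IsOddSeries g) :
    bracket f g = OddGC.star f g + OddGC.star g f := by
  have := bracket_eq_star_sub (f := f) (g := g) (-1) fun N M k l hM hN =>
    Odd.neg_one_pow (((hg.even _ _ hN).add_one).mul ((hf.even _ _ hM).add_one))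
  rwa [neg_smul, one_smul, sub_neg_eq_add] at this

theorem bracket_even_right (f : Cochain A) {g : Cochain A} (hg : IsEvenSeries g) :
    bracket f g = OddGC.star f g - OddGC.star g f := by
  have := bracket_eq_star_sub (f := f) (g := g) 1 fun N M k l hM hN =>
    Even.neg_one_pow (((hg.odd _ _ hN).add_one).mul_right _)
  rwa [one_smul] at this

theorem IsEvenSeries.bracket_odd {f g : Cochain A} (hf : IsEvenSeries f) (hg : IsOddSeries g) :
    IsOddSeries (bracket f g) := by
  rw [hf.bracket_eq]; exact (hf.star_odd hg).sub (hg.star_even hf)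

/-- For `ξ` of even degree, `[ξ, -]` is a derivation of the bracket of series of odd degree. -/
theorem bracket_anticommutator {ξ a b : Cochain A} (hξ : IsEvenSeries ξ) (ha : IsOddSeries a)
    (hb : IsOddSeries b) :
    bracket ξ (star a b + star b a) =
      (star (bracket ξ a) b + star b (bracket ξ a)) +
        (star a (bracket ξ b) + star (bracket ξ b) a) := by
  -- The difference of the two sides is a combination of these three pre-Lie identities.
  have h1 : assoc ξ a b = (-1 : ℤ) • assoc ξ b a :=
    assoc_swap (-1) hξ.antisymm ha.antisymm hb.antisymm ha.zero hb.zero fun M Q k l hM hQ =>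
      Odd.neg_one_pow (((ha.even _ _ hM).add_one).mul ((hb.even _ _ hQ).add_one))
  have h2 : assoc a ξ b = (1 : ℤ) • assoc a b ξ :=
    assoc_swap 1 ha.antisymm hξ.antisymm hb.antisymm hξ.zero hb.zero fun M Q k l hM hQ =>
      Even.neg_one_pow (((hξ.odd _ _ hM).add_one).mul_right _)
  have h3 : assoc b ξ a = (1 : ℤ) • assoc b a ξ :=
    assoc_swap 1 hb.antisymm hξ.antisymm ha.antisymm hξ.zero ha.zero fun M Q k l hM hQ =>
      Even.neg_one_pow (((hξ.odd _ _ hM).add_one).mul_right _)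
  simp only [assoc, one_smul, neg_smul] at h1 h2 h3
  rw [hξ.bracket_eq, hξ.bracket_eq, hξ.bracket_eq]
  simp only [star_add_left, star_add_right, star_sub_left, star_sub_right]
  have h1' := sub_eq_zero.mpr h1
  have h2' := sub_eq_zero.mpr h2
  have h3' := sub_eq_zero.mpr h3
  rw [← sub_eq_zero, ← neg_eq_zero]
  calc _ = (star (star ξ a) b - star ξ (star a b) - -(star (star ξ b) a - star ξ (star b a)))
        - (star (star a ξ) b - star a (star ξ b) - (star (star a b) ξ - star a (star b ξ)))
        - (star (star b ξ) a - star b (star ξ a) - (star (star b a) ξ - star b (star a ξ))) := by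
        abel
    _ = 0 := by rw [h1', h2', h3']; simp

theorem edge_eq_single : (edge : Cochain A) = single 2 1 (e 0 1) := by
  funext N k
  by_cases h : N = 2 ∧ k = 1
  · obtain ⟨rfl, rfl⟩ := h; rw [single_same]; rfl
  · rw [single_of_ne _ h]
    unfold edge
    split
    · simp at h
    · rfl

theorem symm_eq_zero_of_relabel {N : ℕ} (σ : Perm (Fin N)) (hσ : Perm.sign σ = -1) (x : Gra A N)
    (h : relabel σ x = x) : symm x = 0 := by
  apply eq_zero_of_eq_neg
  have := symm_relabel σ x
  rw [h, hσ] at this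
  simpa using this

theorem isAntisymm_edge : IsAntisymm (e 0 1 : Gra A 2) := by
  intro σ
  have : σ = 1 ∨ σ = swap 0 1 := by revert σ; decide
  rcases this with rfl | rfl
  · simp
  · rw [Perm.sign_swap (by decide), relabel_e, swap_apply_left, swap_apply_right, e_swap]; simp

theorem isOddSeries_edge : IsOddSeries (edge : Cochain A) where
  antisymm N k := by
    rw [edge_eq_single]
    by_cases h : N = 2 ∧ k = 1
    · obtain ⟨rfl, rfl⟩ := h; rw [single_same]; exact isAntisymm_edge
    · rw [single_of_ne _ h]; exact isAntisymm_zero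
  even N k h := by
    by_contra hN
    refine h ?_
    rw [edge_eq_single, single_of_ne]
    rintro ⟨rfl, -⟩
    exact hN (by decide)
  zero k := by rw [edge_eq_single, single_of_ne]; simp

theorem star_edge_edge : star (edge : Cochain A) edge = 0 := by
  rw [edge_eq_single, star_single (show 2 + 1 = 3 by rfl)]
  have : insert (A := A) (show 2 + 1 = 3 by rfl) (e 0 1) (e 0 1) =
      e 0 2 * e 0 1 + e 1 2 * e 0 1 := by
    rw [← add_mul]
    unfold insert
    dsimp only
    rw [relabel_e]
    congr 1
    rw [e_of_lt (show (0 : Fin 2) < 1 by decide), MvPolynomial.aeval_X]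
    exact Fin.sum_univ_two _
  rw [circ, this, symm_add, symm_eq_zero_of_relabel (swap 1 2) (Perm.sign_swap (by decide)),
    symm_eq_zero_of_relabel (swap 0 2) (Perm.sign_swap (by decide))]
  · simp [single_zero]
  · rw [map_mul, relabel_e, relabel_e, swap_apply_left, swap_apply_right,
      swap_apply_of_ne_of_ne (by decide) (by decide), e_swap 0 1, e_swap 1 2]; ring
  · rw [map_mul, relabel_e, relabel_e, swap_apply_left, swap_apply_right,
      swap_apply_of_ne_of_ne (by decide) (by decide)]; ring

theorem IsEvenSeries.delta_eq {ξ : Cochain A} (hξ : IsEvenSeries ξ) :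
    delta ξ = -bracket ξ edge := by
  rw [hξ.bracket_eq, delta, bracket_even_right _ hξ, neg_sub]

/-- Series of odd degree are Maurer–Cartan elements if the sum with the edge squares to zero. -/
theorem IsOddSeries.isMaurerCartan_iff {m : Cochain A} (hm : IsOddSeries m) :
    IsMaurerCartan m ↔ OddGC.star (edge + m) (edge + m) = 0 := by
  unfold IsMaurerCartan
  rw [delta, isOddSeries_edge.bracket_eq hm, hm.bracket_eq hm, ← two_smul ℚ (OddGC.star m m),
    smul_smul, inv_mul_cancel₀ (by norm_num), one_smul, star_add_left, star_add_right,
    star_add_right, star_edge_edge, zero_add, add_assoc]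

/-- The differential squares to zero on series of even degree. -/
theorem IsEvenSeries.delta_delta {ξ : Cochain A} (hξ : IsEvenSeries ξ) : delta (delta ξ) = 0 := by
  have h := bracket_anticommutator hξ isOddSeries_edge isOddSeries_edge
  rw [star_edge_edge, add_zero, hξ.bracket_eq 0, star_zero_left, star_zero_right, sub_zero] at h
  have hb := hξ.bracket_odd isOddSeries_edge
  have h2 : delta (delta ξ) =
      -(OddGC.star (bracket ξ edge) edge + OddGC.star edge (bracket ξ edge)) := by
    have hd : IsOddSeries (delta ξ) := by
      rw [hξ.delta_eq, ← neg_one_smul ℚ]; exact hb.qsmul _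
    rw [delta, isOddSeries_edge.bracket_eq hd, hξ.delta_eq, star_neg_left, star_neg_right]
    abel
  have h3 : delta (delta ξ) = -delta (delta ξ) := by
    rw [← sub_eq_zero, sub_neg_eq_add, h2, ← neg_add, neg_eq_zero, h]
    abel
  exact eq_zero_of_eq_neg h3

theorem IsEvenSeries.bracket_smul {ξ : Cochain A} (hξ : IsEvenSeries ξ) (c : ℚ) (a : Cochain A) :
    bracket ξ (c • a) = c • bracket ξ a := by
  rw [hξ.bracket_eq, hξ.bracket_eq, star_smul_left, star_smul_right, smul_sub]

theorem IsEvenSeries.bracket_add {ξ : Cochain A} (hξ : IsEvenSeries ξ) (a b : Cochain A) :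
    bracket ξ (a + b) = bracket ξ a + bracket ξ b := by
  rw [hξ.bracket_eq, hξ.bracket_eq, hξ.bracket_eq, star_add_left, star_add_right]; abel

/-- `[ξ, -]` as a linear map. -/
def IsEvenSeries.ad {ξ : Cochain A} (hξ : IsEvenSeries ξ) : Cochain A →ₗ[ℚ] Cochain A where
  toFun := bracket ξ
  map_add' := hξ.bracket_add
  map_smul' := hξ.bracket_smul

theorem IsEvenSeries.iterate_bracket {ξ a : Cochain A} (hξ : IsEvenSeries ξ)
    (ha : IsOddSeries a) (j : ℕ) : IsOddSeries ((bracket ξ)^[j] a) := by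
  induction j with
  | zero => exact ha
  | succ j ih => rw [Function.iterate_succ_apply']; exact hξ.bracket_odd ih

theorem star_sum_sum {ι : Type*} (s : Finset ι) (f g : ι → Cochain A) :
    star (∑ i ∈ s, f i) (∑ i ∈ s, g i) = ∑ i ∈ s, ∑ j ∈ s, star (f i) (g j) := by
  have h1 : ∀ (s : Finset ι) (g : Cochain A), star (∑ i ∈ s, f i) g = ∑ i ∈ s, star (f i) g := by
    intro s g
    induction s using Finset.cons_induction with
    | empty => simp [star_zero_left]
    | cons i s hi ih => rw [Finset.sum_cons, Finset.sum_cons, ← ih, star_add_left]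
  have h2 : ∀ (s : Finset ι) (f : Cochain A), star f (∑ i ∈ s, g i) = ∑ i ∈ s, star f (g i) := by
    intro s f
    induction s using Finset.cons_induction with
    | empty => simp [star_zero_right]
    | cons i s hi ih => rw [Finset.sum_cons, Finset.sum_cons, ← ih, star_add_right]
  rw [h1]
  exact Finset.sum_congr rfl fun i _ => h2 _ _

/-- The terms of `exp (ad ξ) a ⋆ exp (ad ξ) a` of a given order in `ξ` cancel if `a ⋆ a = 0`. -/
theorem sum_star_iterate_eq_zero {ξ a : Cochain A} (hξ : IsEvenSeries ξ) (ha : IsOddSeries a)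
    (haa : star a a = 0) (n : ℕ) :
    ∑ p ∈ antidiagonal n, ((p.1.factorial : ℚ)⁻¹ * (p.2.factorial : ℚ)⁻¹) •
      star ((bracket ξ)^[p.1] a) ((bracket ξ)^[p.2] a) = 0 := by
  set b : ℕ → Cochain A := fun j => (bracket ξ)^[j] a with hb
  have hbs : ∀ j, bracket ξ (b j) = b (j + 1) := fun j => by
    simp only [hb, Function.iterate_succ_apply']
  have hbo : ∀ j, IsOddSeries (b j) := hξ.iterate_bracket ha
  have key : ∀ n, ∑ p ∈ antidiagonal n, n.choose p.1 •
      (star (b p.1) (b p.2) + star (b p.2) (b p.1)) = 0 := by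
    intro n
    induction n with
    | zero => simp [hb, haa]
    | succ n ih =>
      rw [Finset.sum_antidiagonal_choose_succ_nsmul
        fun i j => star (b i) (b j) + star (b j) (b i), ← Finset.sum_add_distrib]
      have h := congrArg hξ.ad ih
      rw [map_sum, map_zero] at h
      rw [← h]
      refine Finset.sum_congr rfl fun p hp => ?_
      have hp : p.1 + p.2 = n := by simpa using hp
      rw [← Nat.choose_symm_of_eq_add hp.symm, ← smul_add, map_nsmul]
      congr 1
      change _ = bracket ξ _
      rw [bracket_anticommutator hξ (hbo _) (hbo _), hbs, hbs]
      abel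
  have h2 : (2 : ℚ) • ∑ p ∈ antidiagonal n, (n.choose p.1 : ℚ) • star (b p.1) (b p.2) = 0 := by
    have := key n
    simp only [smul_add, Finset.sum_add_distrib] at this
    rw [← Finset.Nat.sum_antidiagonal_swap (f := fun p => n.choose p.1 • star (b p.2) (b p.1))]
      at this
    rw [two_smul, ← this]
    congr 1
    · exact Finset.sum_congr rfl fun p _ => by rw [Nat.cast_smul_eq_nsmul]
    · refine Finset.sum_congr rfl fun p hp => ?_
      have hp : p.1 + p.2 = n := by simpa using hp
      rw [Nat.cast_smul_eq_nsmul, Nat.choose_symm_of_eq_add hp.symm]; rfl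
  have h3 : ∑ p ∈ antidiagonal n, (n.choose p.1 : ℚ) • star (b p.1) (b p.2) = 0 := by
    have := congrArg (fun x => (2 : ℚ)⁻¹ • x) h2
    simpa [smul_smul] using this
  have h4 := congrArg (fun x => (n.factorial : ℚ)⁻¹ • x) h3
  simp only [smul_zero, Finset.smul_sum, smul_smul] at h4
  rw [← h4]
  refine Finset.sum_congr rfl fun p hp => ?_
  have hp : p.1 + p.2 = n := by simpa using hp
  congr 1
  subst hp
  rw [Nat.cast_add_choose]
  field_simp

theorem iterate_ad {ξ : Cochain A} (hξ : IsEvenSeries ξ) (j : ℕ) (a : Cochain A) :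
    (bracket ξ)^[j] a = (hξ.ad ^ j) a := by
  rw [Module.End.pow_apply]; rfl

/-- The gauge action is the exponential of `ad ξ`, applied to the sum with the edge. -/
theorem gaugeAct_eq {ξ m : Cochain A} (hξ : IsEvenSeries ξ) (hξ2 : ∀ N < 2, ∀ k, ξ N k = 0)
    (N k : ℕ) :
    (edge + gaugeAct ξ m : Cochain A) N k =
      ∑ j ∈ range N, (j.factorial : ℚ)⁻¹ • ((bracket ξ)^[j] (edge + m)) N k := by
  have h1 : ∀ j, (bracket ξ)^[j] (delta ξ) = -(bracket ξ)^[j + 1] edge := by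
    intro j
    rw [hξ.delta_eq, iterate_ad hξ, map_neg, ← iterate_ad hξ, Function.iterate_succ_apply]
  have h2 : ∀ j, ((bracket ξ)^[j] (edge + m)) N k =
      ((bracket ξ)^[j] edge) N k + ((bracket ξ)^[j] m) N k := by
    intro j
    simp only [iterate_ad hξ, map_add]; rfl
  have h3 : ∑ j ∈ range (N + 1), (j.factorial : ℚ)⁻¹ • ((bracket ξ)^[j] edge) N k =
      ∑ j ∈ range N, (j.factorial : ℚ)⁻¹ • ((bracket ξ)^[j] edge) N k := by
    rw [Finset.sum_range_succ, ad_iterate_eq_zero hξ2 _ isOddSeries_edge.zero N N le_rfl, smul_zero,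
      add_zero]
  rw [Pi.add_apply, Pi.add_apply, gaugeAct]
  simp only [h2, smul_add, Finset.sum_add_distrib, ← h3, h1, Finset.sum_range_succ']
  simp [sub_eq_add_neg]
  abel

/-- The gauge action preserves Maurer–Cartan elements. -/
theorem gaugeAct_isMaurerCartan {ξ m : Cochain A} (hξ : IsEvenSeries ξ)
    (hξ2 : ∀ N < 2, ∀ k, ξ N k = 0) (hm : IsOddSeries m) (hm' : IsOddSeries (gaugeAct ξ m))
    (h : IsMaurerCartan m) : IsMaurerCartan (gaugeAct ξ m) := by
  rw [hm.isMaurerCartan_iff] at h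
  rw [hm'.isMaurerCartan_iff]
  have ha : IsOddSeries (edge + m) := isOddSeries_edge.add hm
  set b : ℕ → Cochain A := fun j => (bracket ξ)^[j] (edge + m) with hb
  have hb0 : ∀ j N, N ≤ j → ∀ k, b j N k = 0 := fun j N hN k =>
    ad_iterate_eq_zero hξ2 _ ha.zero N j hN k
  funext T K
  -- In bounded numbers of vertices the exponential series is a finite sum.
  have hE : ∀ N ≤ T + 1, ∀ k, (edge + gaugeAct ξ m : Cochain A) N k =
      (∑ j ∈ range (T + 2), (j.factorial : ℚ)⁻¹ • b j) N k := by
    intro N hN k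
    rw [gaugeAct_eq hξ hξ2]
    simp only [Finset.sum_apply, Pi.smul_apply]
    refine Finset.sum_subset (by simp; omega) fun j _ hj => ?_
    have : ((bracket ξ)^[j] (edge + m)) N k = 0 := hb0 j N (by simpa using hj) k
    rw [this, smul_zero]
  rw [star_congr (fun N hN l _ => hE N hN l) (fun N hN l _ => hE N (by omega) l), star_sum_sum]
  simp only [Finset.sum_apply, star_smul_left, star_smul_right, smul_smul, Pi.smul_apply]
  -- Each bracket with `ξ` adds at least one vertex, so that terms of high order in `ξ` do not
  -- contribute to the component with `T` vertices.
  have hz : ∀ i j, T + 2 ≤ i + j → star (b i) (b j) T K = 0 := by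
    intro i j hij
    by_contra h
    obtain ⟨x, M, k₁, k₂, h0, rfl, h1, h2⟩ := exists_of_star_ne_zero h
    have h1 : i < x + 1 := by by_contra h3; exact h1 (hb0 _ _ (by omega) _)
    have h2 : j < M := by by_contra h3; exact h2 (hb0 _ _ (by omega) _)
    omega
  -- The remaining terms are sorted by their order in `ξ`, and each order vanishes.
  have hflip := Finset.sum_range_diag_flip (T + 2)
    fun i j => ((j.factorial : ℚ)⁻¹ * (i.factorial : ℚ)⁻¹) • star (b i) (b j) T K
  have hn : ∀ n, ∑ i ∈ range (n + 1), (((n - i).factorial : ℚ)⁻¹ * (i.factorial : ℚ)⁻¹) •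
      star (b i) (b (n - i)) T K = 0 := by
    intro n
    have := congrFun (congrFun (sum_star_iterate_eq_zero hξ ha h n) T) K
    rw [Finset.Nat.sum_antidiagonal_eq_sum_range_succ_mk] at this
    simp only [Finset.sum_apply, Pi.smul_apply] at this
    rw [← show (0 : Cochain A) T K = 0 from rfl, ← this]
    exact Finset.sum_congr rfl fun i _ => by rw [mul_comm]
  rw [Finset.sum_congr rfl fun n _ => hn n, Finset.sum_const_zero] at hflip
  refine Eq.trans (Finset.sum_congr rfl fun i _ => ?_) hflip.symm
  refine (Finset.sum_subset (Finset.range_mono (Nat.sub_le _ _)) fun j _ hj => ?_).symm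
  rw [hz _ _ (by simp at hj; omega), smul_zero]

end Jacobi

namespace Multigraph

variable {N L : ℕ}

/-! ### Loops, forests and connectedness in terms of numbers of edges -/

theorem mult_of_lt (Γ : Multigraph N) {i j : Fin N} (h : i < j) : mult Γ i j = Γ ⟨(i, j), h⟩ := by
  simp [mult, h]

theorem ext_mult {Γ Γ' : Multigraph N} (h : ∀ i j, i ≠ j → mult Γ i j = mult Γ' i j) : Γ = Γ' := by
  ext ⟨⟨i, j⟩, hij⟩
  have := h i j hij.ne
  rwa [mult_of_lt _ hij, mult_of_lt _ hij] at this

theorem mult_add (Γ Γ' : Multigraph N) (i j : Fin N) :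
    mult (Γ + Γ') i j = mult Γ i j + mult Γ' i j := by
  unfold mult; split_ifs <;> simp

theorem mult_zero (i j : Fin N) : mult (0 : Multigraph N) i j = 0 := by
  unfold mult; split_ifs <;> simp

/-- Twice the number of edges between vertices of `T`. -/
def twoEdges (Γ : Multigraph N) (T : Finset (Fin N)) : ℕ := ∑ i ∈ T, ∑ j ∈ T, mult Γ i j

theorem twoEdges_mono (Γ : Multigraph N) {S T : Finset (Fin N)} (h : S ⊆ T) :
    twoEdges Γ S ≤ twoEdges Γ T := by
  unfold twoEdges
  refine (Finset.sum_le_sum fun i _ => Finset.sum_le_sum_of_subset h).trans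
    (Finset.sum_le_sum_of_subset h)

/-- The vertex `v` is an apex if its complement is a forest: every nonempty set `T` of other vertices
spans less than `#T` edges. -/
def IsApex (Γ : Multigraph N) (v : Fin N) : Prop :=
  ∀ T : Finset (Fin N), T.Nonempty → v ∉ T → twoEdges Γ T + 2 ≤ 2 * #T

/-- A forest on `T` extends to a tree on `T`, which has `#T - 1` edges. -/
theorem twoEdges_add_two_le_of_isAcyclic (Γ : Multigraph N) (T : Finset (Fin N)) (hT : T.Nonempty)
    (h : (toSimple Γ).induce (T : Set (Fin N)) |>.IsAcyclic)
    (h1 : ∀ i ∈ T, ∀ j ∈ T, mult Γ i j ≤ 1) : twoEdges Γ T + 2 ≤ 2 * #T := by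
  classical
  have hne : Nonempty (T : Set (Fin N)) := hT.coe_sort
  obtain ⟨F, hF, -, hFT⟩ := SimpleGraph.Connected.exists_isTree_le_of_le_of_isAcyclic
    (G := (⊤ : SimpleGraph (T : Set (Fin N)))) SimpleGraph.connected_top le_top h
  have hc := hFT.card_edgeFinset
  have hcard : Fintype.card (T : Set (Fin N)) = #T := by simp
  have h2 := SimpleGraph.two_mul_card_edgeFinset (G := F)
  have h3 : twoEdges Γ T ≤ #(univ.filter fun p : ↥(T : Set (Fin N)) × ↥(T : Set (Fin N)) =>
      F.Adj p.1 p.2) := by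
    rw [Finset.card_filter, ← Finset.univ_product_univ, Finset.sum_product]
    unfold twoEdges
    rw [← Finset.sum_coe_sort T]
    refine Finset.sum_le_sum fun i _ => ?_
    rw [← Finset.sum_coe_sort T]
    refine Finset.sum_le_sum fun j _ => ?_
    split_ifs with hadj
    · exact h1 _ i.2 _ j.2
    · have : ¬ ((toSimple Γ).induce (T : Set (Fin N))).Adj i j := fun h => hadj (hF h)
      simp [toSimple] at this
      simp [this]
  rw [hcard] at hc
  have h2' : 2 * #F.edgeFinset = #(univ.filter fun p : ↥(T : Set (Fin N)) × ↥(T : Set (Fin N)) =>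
      F.Adj p.1 p.2) := h2
  omega

/-- The edge count of an apex characterizes forests: a loop violates it on the vertices of a cycle,
at each of which two edges of the cycle end, or on the two ends of a double edge. -/
theorem isApex_iff (Γ : Multigraph N) (v : Fin N) : IsApex Γ v ↔ ¬ ComplementHasLoop Γ v := by
  constructor
  · rintro h (hc | ⟨i, j, hi, hj, hij⟩)
    · simp only [SimpleGraph.IsAcyclic, not_forall, not_not] at hc
      obtain ⟨u, c, hc⟩ := hc
      classical
      set T : Finset (Fin N) := c.support.toFinset.image Subtype.val with hT
      have huT : ∀ x : ({v}ᶜ : Set (Fin N)), x.1 ∈ T ↔ x ∈ c.support := by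
        intro x
        rw [hT, Finset.mem_image]
        exact ⟨fun ⟨y, hy, hyx⟩ => by rwa [← Subtype.ext hyx, ← List.mem_toFinset],
          fun hx => ⟨x, List.mem_toFinset.mpr hx, rfl⟩⟩
      have h0 := h T ⟨u.1, (huT u).2 c.start_mem_support⟩ (by simp [hT])
      have h1 : 2 * #T ≤ twoEdges Γ T := by
        unfold twoEdges
        rw [mul_comm, ← smul_eq_mul, ← Finset.sum_const]
        refine Finset.sum_le_sum fun x hx => ?_
        obtain ⟨x, hx, rfl⟩ := Finset.mem_image.mp hx
        have hx : x ∈ c.support := (huT x).1 hx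
        have h2 := hc.ncard_neighborSet_toSubgraph_eq_two hx
        rw [Set.ncard_eq_two] at h2
        obtain ⟨y, z, hyz, h2⟩ := h2
        have hy : c.toSubgraph.Adj x y := by
          rw [← SimpleGraph.Subgraph.mem_neighborSet, h2]; simp
        have hz : c.toSubgraph.Adj x z := by
          rw [← SimpleGraph.Subgraph.mem_neighborSet, h2]; simp
        have hmem : ∀ y, c.toSubgraph.Adj x y → y.1 ∈ T ∧ 1 ≤ mult Γ x y := by
          intro y hy
          refine ⟨(huT y).2 ?_, ?_⟩
          · exact (SimpleGraph.Walk.mem_verts_toSubgraph _).mp hy.snd_mem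
          · have := hy.adj_sub
            simp only [SimpleGraph.comap_adj, Function.Embedding.subtype_apply, toSimple] at this
            exact Nat.one_le_iff_ne_zero.mpr this
        have hsub : ({y.1, z.1} : Finset (Fin N)) ⊆ T := by
          intro t ht
          rcases Finset.mem_insert.mp ht with rfl | ht
          · exact (hmem y hy).1
          · rw [Finset.mem_singleton.mp ht]; exact (hmem z hz).1
        refine le_trans ?_ (Finset.sum_le_sum_of_subset hsub)
        rw [Finset.sum_pair (fun h => hyz (Subtype.ext h))]
        have := (hmem y hy).2
        have := (hmem z hz).2
        omega
      omega
    · have hne : i ≠ j := by rintro rfl; rw [mult_self] at hij; omega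
      have := h {i, j} (by simp) (by simp [hi.symm, hj.symm])
      rw [Finset.card_pair hne, twoEdges, Finset.sum_pair hne, Finset.sum_pair hne,
        Finset.sum_pair hne, mult_comm Γ j i] at this
      omega
  · intro h T hT hv
    rw [ComplementHasLoop, not_or, not_not] at h
    obtain ⟨h1, h2⟩ := h
    push Not at h2
    refine twoEdges_add_two_le_of_isAcyclic Γ T hT ?_ ?_
    · have hsub : (T : Set (Fin N)) ⊆ {v}ᶜ := fun x hx => by
        rintro rfl; exact hv hx
      exact h1.comap (SimpleGraph.induceHomOfLE (toSimple Γ) hsub).toHom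
        (SimpleGraph.induceHomOfLE (toSimple Γ) hsub).injective
    · intro i hi j hj
      have := h2 i j (by rintro rfl; exact hv hi) (by rintro rfl; exact hv hj)
      omega

theorem not_veryLoopy_iff (Γ : Multigraph N) : ¬ VeryLoopy Γ ↔ ∃ v, IsApex Γ v := by
  simp only [VeryLoopy, not_forall, isApex_iff]

/-- A multigraph is connected if and only if there are edges between each proper nonempty set of
vertices and its complement. -/
theorem connected_iff (Γ : Multigraph N) : (toSimple Γ).Connected ↔
    0 < N ∧ ∀ T : Finset (Fin N), T.Nonempty → T ≠ univ → ∃ i ∈ T, ∃ j, j ∉ T ∧ mult Γ i j ≠ 0 := by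
  classical
  constructor
  · intro h
    refine ⟨Fin.pos_iff_nonempty.mpr h.nonempty, fun T ⟨i, hi⟩ hT => ?_⟩
    obtain ⟨j, hj⟩ : ∃ j, j ∉ T := by
      by_contra hc; push Not at hc; exact hT (Finset.eq_univ_iff_forall.mpr hc)
    obtain ⟨p⟩ := h.preconnected i j
    obtain ⟨d, -, hd1, hd2⟩ := p.exists_boundary_dart (T : Set (Fin N)) hi hj
    exact ⟨d.fst, hd1, d.snd, hd2, d.adj⟩
  · rintro ⟨hN, h⟩
    have : Nonempty (Fin N) := Fin.pos_iff_nonempty.mp hN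
    refine ⟨fun i j => ?_⟩
    by_contra hij
    obtain ⟨a, ha, b, hb, hab⟩ := h (univ.filter fun j => (toSimple Γ).Reachable i j)
      ⟨i, by simp⟩ (fun h => hij (by simpa using Finset.eq_univ_iff_forall.mp h j))
    simp only [mem_filter, mem_univ, true_and] at ha hb
    exact hb (ha.trans (SimpleGraph.Adj.reachable hab))

/-- A connected graph has at least as many edges as a spanning tree. -/
theorem le_twoEdges_of_connected (Γ : Multigraph N) (h : (toSimple Γ).Connected) :
    2 * N ≤ twoEdges Γ univ + 2 := by
  classical
  have h1 := h.card_vert_le_card_edgeSet_add_one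
  have h2 := SimpleGraph.two_mul_card_edgeFinset (G := toSimple Γ)
  have h4 : #((univ : Finset (Fin N × Fin N)).filter fun p => (toSimple Γ).Adj p.1 p.2) ≤
      twoEdges Γ univ := by
    rw [Finset.card_filter, ← Finset.univ_product_univ, Finset.sum_product]
    refine Finset.sum_le_sum fun i _ => Finset.sum_le_sum fun j _ => ?_
    split_ifs with h
    · exact Nat.one_le_iff_ne_zero.mpr h
    · exact Nat.zero_le _
  have h2' : 2 * #(toSimple Γ).edgeFinset =
    #((univ : Finset (Fin N × Fin N)).filter fun p => (toSimple Γ).Adj p.1 p.2) := h2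
  rw [Nat.card_eq_fintype_card, Nat.card_eq_fintype_card, ← SimpleGraph.edgeFinset_card,
    Fintype.card_fin] at h1
  omega

theorem sum_valence (Γ : Multigraph N) : ∑ v, valence Γ v = 2 * numEdges Γ := by
  have h : ∑ v, valence Γ v = ∑ p : Fin N × Fin N, mult Γ p.1 p.2 := by
    rw [← Finset.univ_product_univ, Finset.sum_product]; rfl
  have hu : (univ : Finset (Fin N × Fin N)) = univ.filter (fun p => p.1 < p.2) ∪
      (univ.filter (fun p => p.2 < p.1) ∪ univ.filter (fun p => p.1 = p.2)) := by
    ext p; simp; rcases lt_trichotomy p.1 p.2 with h | h | h <;> simp [h]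
  have hsum : ∑ p ∈ univ.filter (fun p : Fin N × Fin N => p.1 < p.2), mult Γ p.1 p.2 =
      numEdges Γ := by
    unfold numEdges
    rw [← Finset.sum_subtype_eq_sum_filter]
    simp only [Finset.subtype_univ]
    exact Finset.sum_congr rfl fun p _ => mult_of_lt Γ p.2
  rw [h, hu, Finset.sum_union, Finset.sum_union, hsum]
  · have h1 : ∑ p ∈ univ.filter (fun p : Fin N × Fin N => p.2 < p.1), mult Γ p.1 p.2 =
        numEdges Γ := by
      rw [← hsum]
      refine Finset.sum_nbij' Prod.swap Prod.swap ?_ ?_ ?_ ?_ ?_ <;> simp [mult_comm]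
    have h2 : ∑ p ∈ univ.filter (fun p : Fin N × Fin N => p.1 = p.2), mult Γ p.1 p.2 = 0 :=
      Finset.sum_eq_zero fun p hp => by
        rw [(Finset.mem_filter.mp hp).2, mult_self]
    rw [h1, h2]; ring
  · rw [Finset.disjoint_filter]; intro p _ h1 h2; rw [h2] at h1; exact lt_irrefl _ h1
  · rw [Finset.disjoint_left]
    intro p h1 h2
    simp only [mem_filter, mem_univ, true_and, mem_union] at h1 h2
    rcases h2 with h2 | h2
    · exact h1.not_gt h2
    · exact h1.ne h2

/-- If the vertices of `T` are only joined to `T` and to `v`, the sum of their valences counts the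
edges within `T` twice and those to `v` once. -/
theorem sum_mult_eq_twoEdges (Γ : Multigraph N) (T : Finset (Fin N)) (v : Fin N) (hv : v ∉ T)
    (hT : ∀ i ∈ T, ∀ j, j ∉ T → j ≠ v → mult Γ i j = 0) :
    ∑ i ∈ T, valence Γ i = twoEdges Γ T + ∑ i ∈ T, mult Γ v i := by
  classical
  unfold twoEdges
  rw [← Finset.sum_add_distrib]
  refine Finset.sum_congr rfl fun i hi => ?_
  unfold valence
  rw [← Finset.sum_subset (Finset.subset_univ (Insert.insert v T)), Finset.sum_insert hv,
    mult_comm, add_comm]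
  intro j _ hj
  simp only [Finset.mem_insert, not_or] at hj
  exact hT i hi j hj.2 hj.1

/-- A graph with an apex all of whose other vertices are at least trivalent is connected. -/
theorem IsApex.connected {Γ : Multigraph N} {v : Fin N} (h : IsApex Γ v)
    (h3 : ∀ u, u ≠ v → 3 ≤ valence Γ u) : (toSimple Γ).Connected := by
  classical
  rw [connected_iff]
  refine ⟨v.pos, ?_⟩
  have key : ∀ T : Finset (Fin N), T.Nonempty → v ∉ T → ∃ i ∈ T, ∃ j, j ∉ T ∧ mult Γ i j ≠ 0 := by
    intro T hT hv
    by_contra hc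
    push Not at hc
    -- If no edges leave a set `T` of vertices other than `v`, then trivalence gives `3 * #T ≤
    -- twoEdges Γ T`, whereas the forest bounds this by `2 * #T - 2`.
    have h1 := sum_mult_eq_twoEdges Γ T v hv fun i hi j hj _ => hc i hi j hj
    have h2 : ∑ i ∈ T, mult Γ v i = 0 := Finset.sum_eq_zero fun i hi => by
      rw [mult_comm]; exact hc i hi v hv
    have h4 : ∑ i ∈ T, 3 ≤ ∑ i ∈ T, valence Γ i :=
      Finset.sum_le_sum fun i hi => h3 i (by rintro rfl; exact hv hi)
    have h5 := h T hT hv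
    rw [Finset.sum_const, smul_eq_mul] at h4
    omega
  intro T hT hne
  by_cases hv : v ∈ T
  · obtain ⟨i, hi, j, hj, hij⟩ := key Tᶜ (by
      rw [Finset.nonempty_iff_ne_empty]; intro h0; exact hne (Finset.compl_eq_empty_iff T |>.mp h0))
      (by simpa using hv)
    exact ⟨j, by simpa using hj, i, by simpa using hi, by rwa [mult_comm]⟩
  · exact key T hT hv

/-- If there are at least three vertices, there is at most one apex. -/
theorem IsApex.unique {Γ : Multigraph N} {v w : Fin N} (hN : 3 ≤ N) (hv : IsApex Γ v)
    (hw : IsApex Γ w) (h3 : ∀ u, u ≠ v → u ≠ w → 3 ≤ valence Γ u) : v = w := by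
  classical
  by_contra hne
  -- With two apices `v` and `w`, the forests on the complements of `v` and of `w` have together
  -- too few edges for the remaining vertices, the set `R`, to be trivalent.
  set R : Finset (Fin N) := univ.filter fun u => u ≠ v ∧ u ≠ w with hR
  have hvR : v ∉ R := by simp [hR]
  have hwR : w ∉ R := by simp [hR]
  have hcov : ∀ u, u ∉ R → u = v ∨ u = w := by
    intro u hu; simp [hR] at hu; tauto
  have hRw : #R + 2 = N := by
    have : (univ : Finset (Fin N)) = Insert.insert v (Insert.insert w R) := by
      ext u; have := hcov u; simp only [mem_univ, Finset.mem_insert, true_iff]; tauto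
    have := congrArg Finset.card this
    rw [Finset.card_insert_of_notMem (by simp [hne, hvR]), Finset.card_insert_of_notMem hwR,
      Finset.card_univ, Fintype.card_fin] at this
    omega
  have h1 := hv (Insert.insert w R) (by simp) (by simp [hne, hvR])
  have h2 := hw (Insert.insert v R) (by simp) (by simp [Ne.symm hne, hwR])
  rw [Finset.card_insert_of_notMem hwR] at h1
  rw [Finset.card_insert_of_notMem hvR] at h2
  have h4 : ∀ a, a ∉ R → twoEdges Γ (Insert.insert a R) = twoEdges Γ R + 2 * ∑ i ∈ R, mult Γ a i := by
    intro a ha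
    unfold twoEdges
    rw [Finset.sum_insert ha, Finset.sum_insert ha, mult_self]
    simp only [Finset.sum_insert ha, Finset.sum_add_distrib, mult_comm Γ _ a]
    ring
  rw [h4 w hwR] at h1
  rw [h4 v hvR] at h2
  have h5 : ∑ i ∈ R, valence Γ i = twoEdges Γ R + ∑ i ∈ R, mult Γ v i + ∑ i ∈ R, mult Γ w i := by
    unfold twoEdges
    rw [← Finset.sum_add_distrib, ← Finset.sum_add_distrib]
    refine Finset.sum_congr rfl fun i hi => ?_
    unfold valence
    rw [← Finset.sum_subset (Finset.subset_univ (Insert.insert v (Insert.insert w R)))]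
    · rw [Finset.sum_insert (by simp [hne, hvR]), Finset.sum_insert hwR, mult_comm Γ v,
        mult_comm Γ w]
      ring
    · intro j _ hj
      simp only [Finset.mem_insert, not_or] at hj
      exact absurd (hcov j hj.2.2) (by tauto)
  have h6 : ∑ i ∈ R, 3 ≤ ∑ i ∈ R, valence Γ i :=
    Finset.sum_le_sum fun i hi => h3 i (by rintro rfl; exact hvR hi) (by rintro rfl; exact hwR hi)
  rw [Finset.sum_const, smul_eq_mul] at h6
  omega

end Multigraph

namespace Multigraph

variable {N L T : ℕ}

/-! ### Single edges and contractions -/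

/-- The multigraph with a single edge between `i` and `j` (without edges if `i = j`). -/
def single (i j : Fin N) : Multigraph N :=
  if h : i < j then Finsupp.single ⟨(i, j), h⟩ 1
  else if h : j < i then Finsupp.single ⟨(j, i), h⟩ 1 else 0

theorem single_comm (i j : Fin N) : single i j = single j i := by
  unfold single
  rcases lt_trichotomy i j with h | h | h
  · simp [h, h.not_gt]
  · subst h; rfl
  · simp [h, h.not_gt]

theorem single_of_lt {i j : Fin N} (h : i < j) : single i j = Finsupp.single ⟨(i, j), h⟩ 1 := by
  simp [single, h]

theorem mult_single {i j : Fin N} (hij : i ≠ j) (p q : Fin N) :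
    mult (single i j) p q = (if p = i ∧ q = j then 1 else 0) + (if p = j ∧ q = i then 1 else 0) := by
  wlog h : i < j generalizing i j
  · rw [single_comm, this hij.symm (lt_of_le_of_ne (not_lt.mp h) hij.symm), add_comm]
  rw [single_of_lt h]
  rcases lt_trichotomy p q with hpq | hpq | hpq
  · rw [mult_of_lt _ hpq, Finsupp.single_apply]
    have : ¬ (p = j ∧ q = i) := by rintro ⟨rfl, rfl⟩; exact h.not_gt hpq
    simp only [this, if_false, add_zero, Subtype.mk.injEq, Prod.mk.injEq]
    simp [eq_comm]
  · subst hpq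
    rw [mult_self]
    have h1 : ¬ (p = i ∧ p = j) := by rintro ⟨rfl, rfl⟩; exact hij rfl
    have h2 : ¬ (p = j ∧ p = i) := fun h => h1 h.symm
    simp [h1, h2]
  · rw [mult_comm, mult_of_lt _ hpq, Finsupp.single_apply]
    have : ¬ (p = i ∧ q = j) := by rintro ⟨rfl, rfl⟩; exact h.not_gt hpq
    simp only [this, if_false, zero_add, Subtype.mk.injEq, Prod.mk.injEq]
    simp [eq_comm, and_comm]

theorem valence_add (Γ Γ' : Multigraph N) (v : Fin N) :
    valence (Γ + Γ') v = valence Γ v + valence Γ' v := by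
  simp only [valence, mult_add, Finset.sum_add_distrib]

theorem twoEdges_add (Γ Γ' : Multigraph N) (T : Finset (Fin N)) :
    twoEdges (Γ + Γ') T = twoEdges Γ T + twoEdges Γ' T := by
  simp only [twoEdges, mult_add, Finset.sum_add_distrib]

theorem numEdges_add (Γ Γ' : Multigraph N) : numEdges (Γ + Γ') = numEdges Γ + numEdges Γ' := by
  simp only [numEdges, Finsupp.add_apply, Finset.sum_add_distrib]

theorem valence_single {i j : Fin N} (hij : i ≠ j) (v : Fin N) :
    valence (single i j) v = (if v = i then 1 else 0) + (if v = j then 1 else 0) := by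
  simp only [valence, mult_single hij, Finset.sum_add_distrib, ite_and]
  congr 1 <;> split_ifs <;> simp

theorem numEdges_single {i j : Fin N} (hij : i ≠ j) : numEdges (single i j) = 1 := by
  wlog h : i < j generalizing i j
  · rw [single_comm, this hij.symm (lt_of_le_of_ne (not_lt.mp h) hij.symm)]
  rw [single_of_lt h, numEdges]
  simp [Finsupp.single_apply]

theorem exists_eq_add_single {Γ : Multigraph N} {i j : Fin N} (h : mult Γ i j ≠ 0) :
    ∃ Γ₀, Γ = Γ₀ + single i j := by
  wlog hij : i < j generalizing i j
  · rcases eq_or_lt_of_le (not_lt.mp hij) with rfl | hij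
    · exact absurd (mult_self Γ _) h
    · rw [single_comm]; exact this (by rwa [mult_comm]) hij
  refine ⟨Γ - single i j, (tsub_add_cancel_of_le ?_).symm⟩
  rw [mult_of_lt _ hij] at h
  rw [single_of_lt hij, Finsupp.single_le_iff]
  omega

/-- The multigraph obtained by mapping vertices along `φ`; edges between vertices with the same
image are dropped. -/
def contract (φ : Fin N → Fin L) (Γ : Multigraph N) : Multigraph L :=
  Finsupp.equivFunOnFinite.symm fun p =>
    ∑ i with φ i = p.1.1, ∑ j with φ j = p.1.2, mult Γ i j

theorem mult_contract (φ : Fin N → Fin L) (Γ : Multigraph N) {p q : Fin L} (h : p ≠ q) :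
    mult (contract φ Γ) p q = ∑ i with φ i = p, ∑ j with φ j = q, mult Γ i j := by
  rcases lt_or_gt_of_ne h with h | h
  · rw [mult_of_lt _ h]; rfl
  · rw [mult_comm, mult_of_lt _ h, Finset.sum_comm]
    simp only [contract, Finsupp.equivFunOnFinite_symm_apply_apply, mult_comm Γ]

theorem contract_add (φ : Fin N → Fin L) (Γ Γ' : Multigraph N) :
    contract φ (Γ + Γ') = contract φ Γ + contract φ Γ' :=
  ext_mult fun i j h => by
    simp only [mult_contract _ _ h, mult_add, Finset.sum_add_distrib]

theorem contract_zero (φ : Fin N → Fin L) : contract φ (0 : Multigraph N) = 0 :=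
  ext_mult fun i j h => by simp [mult_contract _ _ h, mult_zero]

theorem contract_single (φ : Fin N → Fin L) {i j : Fin N} (h : φ i ≠ φ j) :
    contract φ (single i j) = single (φ i) (φ j) :=
  ext_mult fun p q hpq => by
    have hij : i ≠ j := fun hij => h (congrArg φ hij)
    simp only [mult_contract _ _ hpq, mult_single h, mult_single hij, Finset.sum_add_distrib, ite_and]
    congr 1
    · rw [Finset.sum_filter, Finset.sum_eq_single i]
      · simp [eq_comm]
      · intro b _ hb; simp [hb]
      · simp
    · rw [Finset.sum_filter, Finset.sum_eq_single j]
      · simp [eq_comm]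
      · intro b _ hb; simp [hb]
      · simp

/-- No edge of `Γ` becomes a tadpole under `φ`. -/
def NoCollapse (φ : Fin N → Fin L) (Γ : Multigraph N) : Prop :=
  ∀ i j, φ i = φ j → mult Γ i j = 0

theorem NoCollapse.mult_contract {φ : Fin N → Fin L} {Γ : Multigraph N} (h : NoCollapse φ Γ)
    (p q : Fin L) :
    mult (contract φ Γ) p q = ∑ i with φ i = p, ∑ j with φ j = q, mult Γ i j := by
  by_cases hpq : p = q
  · subst hpq
    rw [mult_self]
    refine (Finset.sum_eq_zero fun i hi => Finset.sum_eq_zero fun j hj => ?_).symm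
    exact h i j ((Finset.mem_filter.mp hi).2.trans (Finset.mem_filter.mp hj).2.symm)
  · exact Multigraph.mult_contract φ Γ hpq

theorem NoCollapse.twoEdges_contract {φ : Fin N → Fin L} {Γ : Multigraph N} (h : NoCollapse φ Γ)
    (T : Finset (Fin L)) :
    twoEdges (contract φ Γ) T = twoEdges Γ (univ.filter fun i => φ i ∈ T) := by
  have key : ∀ g : Fin N → ℕ, ∑ p ∈ T, ∑ i with φ i = p, g i = ∑ i with φ i ∈ T, g i := by
    intro g
    rw [← Finset.sum_fiberwise_of_maps_to (s := univ.filter fun i => φ i ∈ T) (t := T) (g := φ)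
      (by simp)]
    refine Finset.sum_congr rfl fun p hp => Finset.sum_congr ?_ fun _ _ => rfl
    ext i
    simp only [mem_filter, mem_univ, true_and]
    exact ⟨fun h => ⟨h ▸ hp, h⟩, fun h => h.2⟩
  unfold twoEdges
  simp only [h.mult_contract]
  rw [← key]
  refine Finset.sum_congr rfl fun p _ => ?_
  rw [Finset.sum_comm]
  refine Finset.sum_congr rfl fun i _ => ?_
  rw [← key]

theorem NoCollapse.valence_contract {φ : Fin N → Fin L} {Γ : Multigraph N} (h : NoCollapse φ Γ)
    (p : Fin L) : valence (contract φ Γ) p = ∑ i with φ i = p, valence Γ i := by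
  unfold valence
  simp only [h.mult_contract]
  rw [Finset.sum_comm]
  refine Finset.sum_congr rfl fun i _ => ?_
  exact Finset.sum_fiberwise univ φ _

theorem NoCollapse.numEdges_contract {φ : Fin N → Fin L} {Γ : Multigraph N} (h : NoCollapse φ Γ) :
    numEdges (contract φ Γ) = numEdges Γ := by
  have h1 := sum_valence (contract φ Γ)
  have h2 := sum_valence Γ
  simp only [h.valence_contract] at h1
  rw [Finset.sum_fiberwise] at h1
  omega

theorem noCollapse_of_injective {φ : Fin N → Fin L} (hφ : Function.Injective φ) (Γ : Multigraph N) :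
    NoCollapse φ Γ := fun i j h => by rw [hφ h, mult_self]

end Multigraph

open Multigraph

section Monomials

variable {A : Type*} [CommRing A] {N L : ℕ}

/-! ### Multiples of a graph -/

/-- `P` is a multiple of the graph `Γ`. -/
def IsMono (Γ : Multigraph N) (P : Gra A N) : Prop := ∃ c, P = MvPolynomial.monomial Γ c

theorem isMono_monomial (Γ : Multigraph N) (c : A) : IsMono Γ (MvPolynomial.monomial Γ c) := ⟨c, rfl⟩

theorem isMono_zero (Γ : Multigraph N) : IsMono Γ (0 : Gra A N) := ⟨0, by simp⟩

theorem IsMono.neg {Γ : Multigraph N} {P : Gra A N} (h : IsMono Γ P) : IsMono Γ (-P) := by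
  obtain ⟨c, rfl⟩ := h; exact ⟨-c, by simp⟩

theorem IsMono.mul {Γ Γ' : Multigraph N} {P P' : Gra A N} (h : IsMono Γ P) (h' : IsMono Γ' P') :
    IsMono (Γ + Γ') (P * P') := by
  obtain ⟨c, rfl⟩ := h; obtain ⟨c', rfl⟩ := h'
  exact ⟨c * c', MvPolynomial.monomial_mul⟩

theorem IsMono.pow {Γ : Multigraph N} {P : Gra A N} (h : IsMono Γ P) (k : ℕ) :
    IsMono (k • Γ) (P ^ k) := by
  obtain ⟨c, rfl⟩ := h
  exact ⟨c ^ k, MvPolynomial.monomial_pow⟩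

theorem isMono_C (c : A) : IsMono (0 : Multigraph N) (MvPolynomial.C c) := ⟨c, rfl⟩

theorem isMono_e (i j : Fin N) : IsMono (Multigraph.single i j) (e i j : Gra A N) := by
  rcases lt_trichotomy i j with h | h | h
  · rw [e_of_lt h, single_of_lt h]; exact ⟨1, rfl⟩
  · subst h; rw [e_self]; exact isMono_zero _
  · rw [e_swap, e_of_lt h, single_comm, single_of_lt h]
    exact IsMono.neg ⟨1, rfl⟩

theorem IsMono.pair_eq_zero {Γ : Multigraph N} {P x : Gra A N} (h : IsMono Γ P)
    (h0 : MvPolynomial.coeff Γ x = 0) : pair x P = 0 := by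
  obtain ⟨c, rfl⟩ := h
  rw [pair_monomial, h0]; simp

theorem IsMono.mem_support {Γ Γ' : Multigraph N} {P : Gra A N} (h : IsMono Γ P)
    (hΓ : Γ' ∈ P.support) : Γ' = Γ := by
  obtain ⟨c, rfl⟩ := h
  exact Finset.mem_singleton.mp (MvPolynomial.support_monomial_subset hΓ)

/-- Euler's identity for the variable `e i j`. -/
theorem IsMono.e_mul_D {Γ : Multigraph N} {P : Gra A N} (h : IsMono Γ P) (i j : Fin N) :
    e i j * D i j P = (mult Γ i j : ℕ) • P := by
  obtain ⟨c, rfl⟩ := h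
  rcases lt_trichotomy i j with h | h | h
  · rw [D_eq_pderiv h, e_of_lt h, MvPolynomial.X_mul_pderiv_monomial, mult_of_lt _ h]
  · subst h; simp [mult_self]
  · rw [e_swap, D_swap, neg_mul_neg, D_eq_pderiv h, e_of_lt h, MvPolynomial.X_mul_pderiv_monomial,
      mult_comm, mult_of_lt _ h]

@[simp] theorem D_self (i : Fin N) (P : Gra A N) : D i i P = 0 := by
  have : D i i = (0 : Derivation A (Gra A N) (Gra A N)) :=
    derivation_ext_e fun k l _ => by rw [D_e]; simp [and_comm]
  rw [this]; rfl

theorem IsMono.D_eq_zero {Γ : Multigraph N} {P : Gra A N} (h : IsMono Γ P) {i j : Fin N}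
    (h0 : mult Γ i j = 0) : D i j P = 0 := by
  obtain ⟨c, rfl⟩ := h
  have key : ∀ {i j : Fin N} (h : i < j), mult Γ i j = 0 →
      D i j (MvPolynomial.monomial Γ c : Gra A N) = 0 := by
    intro i j h h0
    rw [mult_of_lt _ h] at h0
    rw [D_eq_pderiv h, MvPolynomial.pderiv_monomial, h0]; simp
  rcases lt_trichotomy i j with h | h | h
  · exact key h h0
  · subst h
    rw [D_self]
  · rw [D_swap, key h (by rwa [mult_comm]), neg_zero]

theorem IsMono.D_add_single {Γ : Multigraph N} {P : Gra A N} {i j : Fin N}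
    (h : IsMono (Γ + Multigraph.single i j) P) : IsMono Γ (D i j P) := by
  obtain ⟨c, rfl⟩ := h
  have key : ∀ {i j : Fin N} (h : i < j), IsMono Γ (D i j
      (MvPolynomial.monomial (Γ + Multigraph.single i j) c : Gra A N)) := by
    intro i j h
    rw [D_eq_pderiv h, MvPolynomial.pderiv_monomial, single_of_lt h, add_tsub_cancel_right]
    exact isMono_monomial _ _
  rcases lt_trichotomy i j with h | h | h
  · exact key h
  · subst h
    rw [(isMono_monomial _ _).D_eq_zero (mult_self _ _)]; exact isMono_zero _
  · rw [D_swap, single_comm]; exact (key h).neg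

theorem monomial_add_single (Γ : Multigraph N) (p : Edge N) (c : A) :
    (MvPolynomial.monomial (Γ + Finsupp.single p 1) c : Gra A N) =
      e p.1.1 p.1.2 * MvPolynomial.monomial Γ c := by
  rw [← X_eq_e, add_comm, ← one_mul c, ← MvPolynomial.monomial_mul, one_mul]; rfl

@[elab_as_elim]
theorem multigraph_induction {motive : Multigraph N → Prop} (zero : motive 0)
    (add_single : ∀ Γ (p : Edge N), motive Γ → motive (Γ + Finsupp.single p 1)) (Γ : Multigraph N) :
    motive Γ := by
  induction Γ using Finsupp.induction₂ with
  | zero => exact zero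
  | add_single a b f _ _ ih =>
    clear * - ih add_single
    induction b with
    | zero => simpa using ih
    | succ b hb => rw [Finsupp.single_add, ← add_assoc]; exact add_single _ _ hb

theorem IsMono.relabel {Γ : Multigraph N} {P : Gra A N} (h : IsMono Γ P) (φ : Fin N → Fin L) :
    IsMono (contract φ Γ) (relabel φ P) := by
  obtain ⟨c, rfl⟩ := h
  induction Γ using multigraph_induction with
  | zero =>
    rw [contract_zero]
    change IsMono 0 (OddGC.relabel φ (MvPolynomial.C c))
    rw [← MvPolynomial.algebraMap_eq, AlgHom.commutes]
    exact isMono_C c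
  | add_single Γ p ih =>
    rw [monomial_add_single, map_mul, relabel_e, ← Subtype.coe_eta p p.2, ← single_of_lt, add_comm,
      contract_add]
    by_cases hp : φ p.1.1 = φ p.1.2
    · rw [hp, e_self, zero_mul]; exact isMono_zero _
    · rw [contract_single _ hp]
      exact (isMono_e _ _).mul ih

theorem IsMono.relabel_eq_zero {Γ : Multigraph N} {P : Gra A N} (h : IsMono Γ P) {φ : Fin N → Fin L}
    (hφ : ¬ NoCollapse φ Γ) : OddGC.relabel φ P = 0 := by
  obtain ⟨c, rfl⟩ := h
  simp only [NoCollapse, not_forall] at hφ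
  obtain ⟨i, j, hij, h0⟩ := hφ
  have key : ∀ {i j : Fin N} (h : i < j), φ i = φ j → mult Γ i j ≠ 0 →
      OddGC.relabel φ (MvPolynomial.monomial Γ c : Gra A N) = 0 := by
    intro i j h hij h0
    obtain ⟨Γ₀, rfl⟩ := exists_eq_add_single h0
    rw [single_of_lt h, monomial_add_single, map_mul, relabel_e, hij, e_self, zero_mul]
  rcases lt_trichotomy i j with h | h | h
  · exact key h hij h0
  · exact absurd (by rw [h, mult_self]) h0
  · exact key h hij.symm (by rwa [mult_comm])

theorem IsMono.relabel_congr {Γ : Multigraph N} {P : Gra A N} (h : IsMono Γ P) {φ ψ : Fin N → Fin L}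
    (hφ : ∀ i, valence Γ i ≠ 0 → φ i = ψ i) : OddGC.relabel φ P = OddGC.relabel ψ P := by
  obtain ⟨c, rfl⟩ := h
  induction Γ using multigraph_induction with
  | zero =>
    change OddGC.relabel φ (MvPolynomial.C c) = OddGC.relabel ψ (MvPolynomial.C c)
    rw [← MvPolynomial.algebraMap_eq, AlgHom.commutes, AlgHom.commutes]
  | add_single Γ p ih =>
    have hp : (Finsupp.single p 1 : Multigraph N) = Multigraph.single p.1.1 p.1.2 :=
      (single_of_lt p.2).symm
    simp only [hp, valence_add, valence_single p.2.ne] at hφ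
    rw [monomial_add_single, map_mul, map_mul, relabel_e, relabel_e, ih, hφ, hφ]
    · simp
    · simp
    · exact fun i hi => hφ i (by omega)

end Monomials

open Multigraph

section Split

set_option linter.unusedSectionVars false

variable {A : Type*} [CommRing A] [Algebra ℚ A]

/-! ### Vertex splitting as the adjoint of edge contraction -/

/-- Vertex splitting on graphs with `a + 1` vertices. -/
def split {a : ℕ} (y : Gra A (a + 1)) : Gra A (a + 2) :=
  circ (M := a + 1) (a := 1) rfl (e 0 1) y - (-1 : ℤ) ^ a • circ (M := 2) (a := a) (add_comm _ _) y (e 0 1)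

theorem edge_apply_of_ne {N k : ℕ} (h : ¬ (N = 2 ∧ k = 1)) : (edge : Cochain A) N k = 0 := by
  rw [edge_eq_single, single_of_ne _ h]

theorem delta_apply {f : Cochain A} (a k : ℕ) :
    delta f (a + 2) (k + 1) = split (f (a + 1) k) := by
  unfold delta bracket split
  simp only [Finset.sum_sub_distrib]
  congr 1
  · rw [Finset.sum_eq_single ⟨(a + 1, 1), by simp⟩, Finset.sum_eq_single (1, k)]
    · rfl
    · intro y hy hne
      rw [edge_apply_of_ne, circ_zero_left]
      rintro ⟨-, h⟩
      have := mem_antidiagonal.mp hy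
      exact hne (Prod.ext h (by simp only at *; omega))
    · intro h; exact absurd (mem_antidiagonal.mpr (add_comm _ _)) h
    · intro x _ hne
      refine Finset.sum_eq_zero fun y _ => ?_
      rw [edge_apply_of_ne, circ_zero_left]
      rintro ⟨h, -⟩
      have := mem_antidiagonal.mp x.2
      exact hne (Subtype.ext (Prod.ext (by simp only at *; omega) (by simp only at *; omega)))
    · intro h; exact absurd (Finset.mem_univ _) h
  · rw [Finset.sum_eq_single ⟨(2, a), by simp [add_comm]⟩, Finset.sum_eq_single (k, 1)]
    · have : (-1 : ℤ) ^ (a * (2 + 1)) = (-1) ^ a := by rw [mul_comm, pow_mul]; norm_num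
      rw [← this]; rfl
    · intro y hy hne
      rw [edge_apply_of_ne, circ_zero_right, smul_zero]
      rintro ⟨-, h⟩
      have := mem_antidiagonal.mp hy
      exact hne (Prod.ext (by simp only at *; omega) h)
    · intro h; simp at h
    · intro x _ hne
      refine Finset.sum_eq_zero fun y _ => ?_
      rw [edge_apply_of_ne, circ_zero_right, smul_zero]
      rintro ⟨h, -⟩
      have := mem_antidiagonal.mp x.2
      exact hne (Subtype.ext (Prod.ext (by simp only at *; omega) (by simp only at *; omega)))
    · intro h; exact absurd (Finset.mem_univ _) h

theorem delta_edges_zero (f : Cochain A) (N : ℕ) : delta f N 0 = 0 := by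
  unfold delta bracket
  refine Finset.sum_eq_zero fun x _ => Finset.sum_eq_zero fun y hy => ?_
  have := mem_antidiagonal.mp hy
  rw [edge_apply_of_ne (by omega), edge_apply_of_ne (by omega), circ_zero_left, circ_zero_right]
  simp

theorem delta_of_lt_two {f : Cochain A} (hf : ∀ k, f 0 k = 0) {N : ℕ} (hN : N < 2) (k : ℕ) :
    delta f N k = 0 := by
  unfold delta bracket
  refine Finset.sum_eq_zero fun x _ => Finset.sum_eq_zero fun y hy => ?_
  have := mem_antidiagonal.mp x.2
  rw [edge_apply_of_ne (N := x.1.1) (by omega), circ_zero_right, smul_zero, sub_zero]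
  by_cases h : x.1.1 = 0
  · have h2 : ∀ M, M = 0 → f M y.2 = 0 := by rintro M rfl; exact hf _
    rw [h2 _ h, circ_zero_right]
  · rw [edge_apply_of_ne (by omega), circ_zero_left]

/-! ### Removing a vertex from a permutation -/

/-- The map that identifies the vertex `j` with the vertex `j.succAbove v`. -/
def merge {N : ℕ} (j : Fin (N + 1)) (v : Fin N) : Fin (N + 1) → Fin N :=
  Fin.insertNth (α := fun _ => Fin N) j v id

@[simp] theorem merge_same {N : ℕ} (j : Fin (N + 1)) (v : Fin N) : merge j v j = v := by
  simp [merge]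

@[simp] theorem merge_succAbove {N : ℕ} (j : Fin (N + 1)) (v u : Fin N) :
    merge j v (j.succAbove u) = u := by
  simp [merge]

/-- A permutation is determined by its value `j` at `0` and a permutation of the other vertices. -/
theorem sum_perm_succ {B : Type*} [AddCommMonoid B] {N : ℕ} (G : Perm (Fin (N + 1)) → B) :
    ∑ σ, G σ = ∑ j, ∑ π, G ((Fin.cycleRange j).symm * Perm.decomposeFin.symm (0, π)) := by
  rw [← Perm.decomposeFin.symm.sum_comp, Fintype.sum_prod_type]
  refine Finset.sum_congr rfl fun j _ => ?_
  obtain ⟨ρ, hρ⟩ := exists_decomposeFin_zero (Fin.cycleRange j * swap 0 j) (by simp)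
  have h1 : ∀ π : Perm (Fin N), Perm.decomposeFin.symm (j, π) =
      swap 0 j * Perm.decomposeFin.symm (0, π) := by
    intro π
    ext t
    refine Fin.cases ?_ (fun t => ?_) t
    · simp
    · simp [Perm.decomposeFin_symm_apply_succ]
  have h2 : ∀ π : Perm (Fin N), Perm.decomposeFin.symm (0, ρ) * Perm.decomposeFin.symm (0, π) =
      Perm.decomposeFin.symm (0, ρ * π) := by
    intro π
    ext t
    refine Fin.cases ?_ (fun t => ?_) t
    · simp
    · simp [Perm.decomposeFin_symm_apply_succ]
  refine Eq.trans ?_ (Equiv.sum_comp (Equiv.mulLeft ρ) fun π =>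
    G ((Fin.cycleRange j).symm * Perm.decomposeFin.symm (0, π)))
  refine Finset.sum_congr rfl fun π _ => ?_
  rw [Equiv.coe_mulLeft, ← h2, ← hρ, h1]
  congr 1
  ext t; simp

/-- A sum over permutations of a function that only depends on two values. -/
theorem sum_perm_zero_one {B : Type*} [AddCommMonoid B] {N : ℕ}
    (G : Fin (N + 2) → Fin (N + 2) → B) :
    ∑ σ : Perm (Fin (N + 2)), G (σ 0) (σ 1) = N.factorial • ∑ j, ∑ v, G j (j.succAbove v) := by
  rw [sum_perm_succ, Finset.smul_sum]
  refine Finset.sum_congr rfl fun j _ => ?_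
  rw [← sum_perm_apply_zero]
  refine Finset.sum_congr rfl fun π _ => ?_
  congr 1
  · simp
  · rw [← Fin.succ_zero_eq_one, Perm.mul_apply, Perm.decomposeFin_symm_apply_succ]
    simp

/-- Removing the vertex `j` from a permutation that sends it to `0`. -/
theorem exists_remove {N : ℕ} (σ : Perm (Fin (N + 1))) (j : Fin (N + 1)) (hj : σ j = 0) :
    ∃ π : Perm (Fin N), (∀ u, σ (j.succAbove u) = (π u).succ) ∧
      (Perm.sign σ : ℤ) = Perm.sign π * (-1) ^ (j : ℕ) := by
  obtain ⟨π, hπ⟩ := exists_decomposeFin_zero (σ * (Fin.cycleRange j).symm) (by simp [hj])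
  have hσ : σ = Perm.decomposeFin.symm (0, π) * Fin.cycleRange j := by rw [← hπ]; ext; simp
  refine ⟨π, fun u => ?_, ?_⟩
  · rw [hσ, Perm.mul_apply, Fin.cycleRange_succAbove, Perm.decomposeFin_symm_apply_succ]; simp
  · rw [hσ, Perm.sign_mul, Fin.sign_cycleRange, Perm.decomposeFin.symm_sign]; simp

theorem D_relabel_perm {N : ℕ} (σ : Perm (Fin N)) (p q : Fin N) (x : Gra A N) :
    D p q (relabel σ x) = relabel σ (D (σ.symm p) (σ.symm q) x) := by
  have h : ∀ p, univ.filter (fun i => σ i = p) = {σ.symm p} := by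
    intro p; ext i; simp [Equiv.eq_symm_apply]
  rw [D_relabel, h, h, Finset.sum_singleton, Finset.sum_singleton]

/-! ### Contraction of edges -/

/-- The map that identifies the vertex `j` with `i` and keeps the order of the other vertices. -/
def contr {N : ℕ} (i j : Fin (N + 2)) : Fin (N + 2) → Fin (N + 1) := merge j (merge j 0 i)

@[simp] theorem contr_succAbove {N : ℕ} (i j : Fin (N + 2)) (u : Fin (N + 1)) :
    contr i j (j.succAbove u) = u := merge_succAbove _ _ _

theorem contr_same {N : ℕ} {i j : Fin (N + 2)} (h : i ≠ j) : contr i j j = contr i j i := by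
  obtain ⟨v, rfl⟩ := Fin.exists_succAbove_eq h
  rw [contr_succAbove, contr, merge_same, merge_succAbove]

/-- The term of the differential that contracts the edges between `i` and `j`. -/
def contractTerm {a : ℕ} (y : Gra A (a + 1)) (w : Gra A (a + 2)) (i j : Fin (a + 2)) : A :=
  (-1 : ℤ) ^ (j : ℕ) • pair y (relabel (contr i j) (D i j w))

/-- Contracting the edge between `0` and `1` after relabelling by `σ` is, up to sign, contracting
the edge between the vertices that `σ` sends to `0` and `1`. -/
theorem pair_merge_zero {a : ℕ} {y : Gra A (a + 1)} (hy : IsAntisymm y) (w : Gra A (a + 2))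
    (σ : Perm (Fin (a + 2))) : (Perm.sign σ : ℤ) • pair y (relabel (merge 0 0 ∘ σ)
      (D (σ.symm 0) (σ.symm 1) w)) = -contractTerm y w (σ.symm 1) (σ.symm 0) := by
  set j := σ.symm 0 with hj
  set i := σ.symm 1 with hi
  have hij : i ≠ j := by
    rw [hi, hj]; intro h; simpa using σ.symm.injective h
  obtain ⟨v, hv⟩ := Fin.exists_succAbove_eq hij
  obtain ⟨π, hπ, hsgn⟩ := exists_remove σ j (by simp [hj])
  have hfun : merge (0 : Fin (a + 2)) 0 ∘ σ = π ∘ contr i j := by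
    rw [contr, ← hv, merge_succAbove]
    funext t
    by_cases ht : t = j
    · have h2 := hπ v
      rw [hv, hi, Equiv.apply_symm_apply, ← Fin.succ_zero_eq_one] at h2
      rw [ht, Function.comp_apply, Function.comp_apply, merge_same, hj, Equiv.apply_symm_apply,
        merge_same]
      exact Fin.succ_injective _ h2
    · obtain ⟨u, rfl⟩ := Fin.exists_succAbove_eq ht
      simp only [Function.comp_apply, merge_succAbove, hπ]
      rw [← Fin.succAbove_zero_apply, merge_succAbove]
  rw [hfun, ← relabel_relabel, hy.pair_relabel, hsgn, D_swap i j, contractTerm]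
  simp only [map_neg, smul_neg, smul_smul]
  rw [mul_comm (Perm.sign π : ℤ), mul_assoc, sign_mul_self, mul_one]

theorem contractTerm_self {a : ℕ} (y : Gra A (a + 1)) (w : Gra A (a + 2)) (i : Fin (a + 2)) :
    contractTerm y w i i = 0 := by
  simp [contractTerm]

/-- The order of the ends of the contracted edge does not matter: the edge changes its direction and
the sign of the vertex order changes as well. -/
theorem contractTerm_comm {a : ℕ} {y : Gra A (a + 1)} (hy : IsAntisymm y) (w : Gra A (a + 2))
    (i j : Fin (a + 2)) : contractTerm y w i j = contractTerm y w j i := by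
  by_cases hij : i = j
  · rw [hij]
  obtain ⟨σ, hσ0, hσ1⟩ : ∃ σ : Perm (Fin (a + 2)), σ.symm 0 = j ∧ σ.symm 1 = i := by
    obtain ⟨v, rfl⟩ := Fin.exists_succAbove_eq hij
    refine ⟨((Fin.cycleRange j).symm * Perm.decomposeFin.symm (0, swap 0 v)).symm, by simp, ?_⟩
    rw [Equiv.symm_symm, ← Fin.succ_zero_eq_one, Perm.mul_apply, Perm.decomposeFin_symm_apply_succ]
    simp
  have h1 := pair_merge_zero hy w σ
  have h2 := pair_merge_zero hy w (swap 0 1 * σ)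
  have h3 : (merge 0 0 : Fin (a + 2) → Fin (a + 1)) ∘ (swap 0 1 * σ : Perm _) = merge 0 0 ∘ σ := by
    funext t
    simp only [Function.comp_apply, Perm.mul_apply]
    generalize σ t = s
    have h01 : merge (0 : Fin (a + 2)) (0 : Fin (a + 1)) 1 = 0 := by
      rw [← Fin.succ_zero_eq_one, ← Fin.succAbove_zero_apply, merge_succAbove]
    by_cases hs : s = 0
    · rw [hs, swap_apply_left, merge_same, h01]
    by_cases hs : s = 1
    · rw [hs, swap_apply_right, merge_same, h01]
    · rw [swap_apply_of_ne_of_ne ‹_› ‹_›]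
  have h4 : (swap 0 1 * σ).symm 0 = i := by
    rw [← Perm.inv_def, mul_inv_rev, Perm.mul_apply, swap_inv, swap_apply_left, Perm.inv_def, hσ1]
  have h5 : (swap 0 1 * σ).symm 1 = j := by
    rw [← Perm.inv_def, mul_inv_rev, Perm.mul_apply, swap_inv, swap_apply_right, Perm.inv_def, hσ0]
  rw [h3, h4, h5, Perm.sign_mul, Perm.sign_swap (by simp), D_swap j i] at h2
  rw [hσ0, hσ1] at h1
  rw [← neg_inj, ← h1, ← h2]
  simp

/-- Insertion of the edge into a vertex is adjoint to the contraction of edges. -/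
theorem pair_circ_edge_right {a : ℕ} {y : Gra A (a + 1)} (hy : IsAntisymm y) (w : Gra A (a + 2)) :
    pair (circ (M := 2) (a := a) (add_comm _ _) y (e 0 1)) w =
      -∑ j, ∑ i with i < j, contractTerm y w i j := by
  have hterm : ∀ σ : Perm (Fin (a + 2)), (Perm.sign σ : ℤ) •
      pair (insert (M := 2) (a := a) (add_comm _ _) y (e 0 1)) (relabel σ w) =
      -contractTerm y w (σ.symm 1) (σ.symm 0) := by
    intro σ
    have hcol : collapse 2 a (a + 2) (add_comm _ _) = merge 0 0 := by
      funext t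
      refine Fin.cases ?_ (fun t => ?_) t
      · simp [collapse]
      · rw [← Fin.succAbove_zero_apply, merge_succAbove, Fin.succAbove_zero_apply]
        ext; simp [collapse]
    rw [insert_eq_collapse, mul_comm, relabel_e, pair_e_mul, pair_expand, hcol]
    have h0 : (Fin.cast (add_comm 2 a) (Fin.castAdd a 0)) = 0 := rfl
    have h1 : (Fin.cast (add_comm 2 a) (Fin.castAdd a 1)) = 1 := rfl
    rw [h0, h1, D_relabel_perm, relabel_relabel, pair_merge_zero hy]
  have hadj : pair (circ (M := 2) (a := a) (add_comm _ _) y (e 0 1)) w =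
      (((2 : ℕ).factorial * a.factorial : ℕ) : ℚ)⁻¹ •
        pair (symm (insert (M := 2) (a := a) (add_comm _ _) y (e 0 1))) w := by
    rw [circ, LinearMap.map_smul_of_tower, LinearMap.smul_apply]
  have hsum : ∑ j, ∑ v : Fin (a + 1), contractTerm y w (j.succAbove v) j =
      (2 : ℚ) • ∑ j, ∑ i with i < j, contractTerm y w i j := by
    have h1 : ∑ j, ∑ v : Fin (a + 1), contractTerm y w (j.succAbove v) j =
        ∑ j, ∑ i, contractTerm y w i j := by
      refine Finset.sum_congr rfl fun j _ => ?_
      rw [Fin.sum_univ_succAbove _ j, contractTerm_self, zero_add]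
    have h2 : ∀ j, ∑ i, contractTerm y w i j = ∑ i with i < j, contractTerm y w i j +
        ∑ i with j < i, contractTerm y w i j := by
      intro j
      rw [Finset.sum_filter, Finset.sum_filter, ← Finset.sum_add_distrib]
      refine Finset.sum_congr rfl fun i _ => ?_
      rcases lt_trichotomy i j with h | h | h
      · simp [h, h.not_gt]
      · subst h; simp [contractTerm_self]
      · simp [h, h.not_gt]
    rw [h1, Finset.sum_congr rfl fun j _ => h2 j, Finset.sum_add_distrib, two_smul]
    congr 1
    simp only [Finset.sum_filter]
    rw [Finset.sum_comm]
    refine Finset.sum_congr rfl fun j _ => Finset.sum_congr rfl fun i _ => ?_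
    rw [contractTerm_comm hy]
  rw [hadj, pair_symm, Finset.sum_congr rfl fun σ _ => hterm σ,
    ← Equiv.sum_comp (Equiv.inv (Perm (Fin (a + 2))))]
  simp only [Equiv.inv_apply, ← Perm.inv_def, inv_inv]
  rw [sum_perm_zero_one (fun j i : Fin (a + 2) => -contractTerm y w i j)]
  simp only [Finset.sum_neg_distrib, smul_neg, hsum]
  rw [← Nat.cast_smul_eq_nsmul ℚ, smul_smul, smul_smul]
  have : (a.factorial : ℚ) ≠ 0 := by exact_mod_cast a.factorial_ne_zero
  rw [show (((2 : ℕ).factorial * a.factorial : ℕ) : ℚ)⁻¹ * a.factorial * 2 = 1 by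
    push_cast; field_simp; simp, one_smul]

end Split

open Multigraph

section Support

variable {A : Type*} [CommRing A] {N L : ℕ}

/-! ### Supports -/

theorem exists_of_mem_support_relabel {φ : Fin N → Fin L} {y : Gra A N} {Γ : Multigraph L}
    (h : Γ ∈ (relabel φ y).support) :
    ∃ Γ₀ ∈ y.support, NoCollapse φ Γ₀ ∧ Γ = contract φ Γ₀ := by
  classical
  rw [y.as_sum, map_sum] at h
  obtain ⟨Γ₀, h0, h1⟩ := Finset.mem_biUnion.mp (MvPolynomial.support_sum h)
  have hm := isMono_monomial Γ₀ (MvPolynomial.coeff Γ₀ y)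
  refine ⟨Γ₀, h0, ?_, (hm.relabel φ).mem_support h1⟩
  by_contra hc
  rw [hm.relabel_eq_zero hc] at h1
  simp at h1

theorem pair_eq_zero_of_forall {x P : Gra A N} (h : ∀ Γ ∈ P.support, Γ ∉ x.support) :
    pair x P = 0 := by
  rw [P.as_sum, map_sum]
  refine Finset.sum_eq_zero fun Γ hΓ => ?_
  rw [pair_monomial, MvPolynomial.notMem_support_iff.mp (h Γ hΓ), zero_mul, zero_mul]

theorem IsMono.D_cases {Γ : Multigraph N} {P : Gra A N} (h : IsMono Γ P) (i j : Fin N) :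
    D i j P = 0 ∨ i ≠ j ∧ ∃ Γ₀, Γ = Γ₀ + Multigraph.single i j ∧ IsMono Γ₀ (D i j P) := by
  by_cases h0 : mult Γ i j = 0
  · exact Or.inl (h.D_eq_zero h0)
  · refine Or.inr ⟨?_, ?_⟩
    · rintro rfl; exact h0 (mult_self _ _)
    · obtain ⟨Γ₀, rfl⟩ := exists_eq_add_single h0
      exact ⟨Γ₀, rfl, h.D_add_single⟩

theorem mult_le_valence (Γ : Multigraph N) (i j : Fin N) : mult Γ i j ≤ valence Γ i :=
  Finset.single_le_sum (f := fun j => mult Γ i j) (fun _ _ => Nat.zero_le _) (Finset.mem_univ j)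

end Support

section SplitSupport

variable {A : Type*} [CommRing A] [Algebra ℚ A]

set_option linter.unusedSectionVars false

/-! ### Valences of the graphs in the differential -/

theorem expand_relabel_castSucc {N : ℕ} (x : Gra A N) :
    expand Fin.castSucc (relabel (Fin.castSucc : Fin N → Fin (N + 1)) x) = x := by
  have : (expand (Fin.castSucc : Fin N → Fin (N + 1))).comp (relabel Fin.castSucc) =
      AlgHom.id A (Gra A N) := by
    refine algHom_ext_e fun i j hij => ?_
    have h : ∀ p : Fin N, univ.filter (fun i : Fin N => i.castSucc = p.castSucc) = {p} := by
      intro p; ext i; simp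
    rw [AlgHom.comp_apply, relabel_e, expand_e _ (by simpa using hij), h, h]
    simp
  exact DFunLike.congr_fun this x

/-- The pairing of `circ edge y` with a graph, before summation over permutations. -/
theorem sign_smul_pair_insert_edge {a : ℕ} (y : Gra A (a + 1)) (P : Gra A (a + 2)) :
    pair (insert (M := a + 1) (a := 1) rfl (e 0 1) y) P =
      ∑ i : Fin (a + 1), pair (relabel Fin.castSucc y) (D i.castSucc (Fin.last (a + 1)) P) := by
  rw [insert_eq_collapse, expand_e _ (by simp)]
  have h0 : univ.filter (fun t => collapse (a + 1) 1 (a + 2) rfl t = 0) =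
      univ.image (Fin.castSucc : Fin (a + 1) → Fin (a + 2)) := by
    ext t
    simp only [mem_filter, mem_univ, true_and, mem_image]
    constructor
    · intro h
      have := congrArg Fin.val h
      simp only [collapse, Fin.val_zero] at this
      exact ⟨⟨t, by omega⟩, by ext; simp⟩
    · rintro ⟨i, rfl⟩
      ext; simp [collapse]; omega
  have h1 : univ.filter (fun t => collapse (a + 1) 1 (a + 2) rfl t = 1) = {Fin.last (a + 1)} := by
    ext t
    simp only [mem_filter, mem_univ, true_and, mem_singleton]
    constructor
    · intro h
      have := congrArg Fin.val h
      simp only [collapse, Fin.val_one] at this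
      ext; simp; omega
    · rintro rfl
      ext; simp [collapse]
  rw [h0, h1, Finset.sum_image (Fin.castSucc_injective _).injOn, Finset.sum_mul, map_sum, LinearMap.sum_apply]
  refine Finset.sum_congr rfl fun i _ => ?_
  rw [Finset.sum_singleton, pair_e_mul]
  rfl

theorem pair_relabel_castSucc_eq_zero {a : ℕ} {y : Gra A (a + 1)} {P : Gra A (a + 2)}
    (h : ∀ Γ ∈ P.support, valence Γ (Fin.last (a + 1)) ≠ 0) :
    pair (relabel Fin.castSucc y) P = 0 := by
  refine pair_eq_zero_of_forall fun Γ hΓ hy => h Γ hΓ ?_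
  obtain ⟨Γ₀, -, hn, rfl⟩ := exists_of_mem_support_relabel hy
  rw [hn.valence_contract]
  exact Finset.sum_eq_zero fun i hi => absurd (Finset.mem_filter.mp hi).2 (Fin.castSucc_ne_last i)

theorem pair_relabel_castSucc_eq_zero' {a : ℕ} {y : Gra A (a + 1)}
    (hy : ∀ Γ ∈ y.support, ∀ v, 3 ≤ valence Γ v) {P : Gra A (a + 2)} {u : Fin (a + 1)}
    (h : ∀ Γ ∈ P.support, valence Γ u.castSucc < 3) :
    pair (relabel Fin.castSucc y) P = 0 := by
  refine pair_eq_zero_of_forall fun Γ hΓ hy' => ?_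
  obtain ⟨Γ₀, h0, hn, rfl⟩ := exists_of_mem_support_relabel hy'
  have h1 := h _ hΓ
  have h2 : univ.filter (fun i : Fin (a + 1) => i.castSucc = u.castSucc) = {u} := by ext; simp
  rw [hn.valence_contract, h2, Finset.sum_singleton] at h1
  have := hy _ h0 u
  omega

theorem pair_circ_edge_left {a : ℕ} (y : Gra A (a + 1)) (w : Gra A (a + 2)) :
    pair (circ (M := a + 1) (a := 1) rfl (e 0 1) y) w = (((a + 1).factorial : ℕ) : ℚ)⁻¹ •
      ∑ σ : Perm (Fin (a + 2)), (Perm.sign σ : ℤ) •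
        ∑ i : Fin (a + 1), pair (relabel Fin.castSucc y)
          (relabel σ (D (σ.symm i.castSucc) (σ.symm (Fin.last (a + 1))) w)) := by
  rw [circ, LinearMap.map_smul_of_tower, LinearMap.smul_apply, pair_symm]
  simp only [sign_smul_pair_insert_edge, D_relabel_perm, Nat.factorial_one, mul_one]

theorem valence_contract_perm {N : ℕ} (σ : Perm (Fin N)) (Γ : Multigraph N) (v : Fin N) :
    valence (contract σ Γ) (σ v) = valence Γ v := by
  rw [(noCollapse_of_injective σ.injective Γ).valence_contract]
  have : univ.filter (fun i => σ i = σ v) = {v} := by ext; simp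
  rw [this, Finset.sum_singleton]

/-- The adjoint of the differential on graphs all of whose vertices are at least bivalent: the terms
that attach a new univalent vertex do not contribute, and only the contraction of edges is left. -/
theorem pair_split {a : ℕ} {y : Gra A (a + 1)} (hy : IsAntisymm y) {w : Gra A (a + 2)}
    (hw : ∀ Γ ∈ w.support, ∀ v, 2 ≤ valence Γ v) :
    pair (split y) w = (-1 : ℤ) ^ a • ∑ j, ∑ i with i < j, contractTerm y w i j := by
  have h0 : pair (circ (M := a + 1) (a := 1) rfl (e 0 1) y) w = 0 := by
    rw [w.as_sum, map_sum]
    refine Finset.sum_eq_zero fun Γ hΓ => ?_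
    have hm := isMono_monomial Γ (MvPolynomial.coeff Γ w)
    rw [pair_circ_edge_left]
    refine smul_eq_zero_of_right _ (Finset.sum_eq_zero fun σ _ => smul_eq_zero_of_right _
      (Finset.sum_eq_zero fun i _ => ?_))
    refine pair_relabel_castSucc_eq_zero fun Γ' hΓ' => ?_
    rcases hm.D_cases (σ.symm i.castSucc) (σ.symm (Fin.last (a + 1))) with h | ⟨hne, Γ₀, rfl, h⟩
    · rw [h] at hΓ'; simp at hΓ'
    · have hv := valence_contract_perm σ Γ₀ (σ.symm (Fin.last (a + 1)))
      rw [σ.apply_symm_apply] at hv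
      rw [(h.relabel σ).mem_support hΓ', hv]
      have := hw _ hΓ (σ.symm (Fin.last (a + 1)))
      rw [valence_add, valence_single hne, if_pos rfl, if_neg hne.symm] at this
      omega
  rw [split, map_sub, LinearMap.sub_apply, h0, zero_sub, ← Int.cast_smul_eq_zsmul A, map_smul,
    LinearMap.smul_apply, pair_circ_edge_right hy, smul_neg, neg_neg, Int.cast_smul_eq_zsmul]

theorem contr_eq_contr_iff {N : ℕ} {i j : Fin (N + 2)} (hij : i ≠ j) (s t : Fin (N + 2)) :
    contr i j s = contr i j t ↔ s = t ∨ (s = i ∧ t = j) ∨ (s = j ∧ t = i) := by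
  have key : ∀ s t, s ≠ j → (contr i j s = contr i j t ↔ s = t ∨ (s = i ∧ t = j) ∨ (s = j ∧ t = i)) := by
    intro s t hs
    obtain ⟨v, rfl⟩ := Fin.exists_succAbove_eq hs
    obtain ⟨w, rfl⟩ := Fin.exists_succAbove_eq hij
    by_cases ht : t = j
    · rw [ht, contr_same hij, contr_succAbove, contr_succAbove]
      simp [hs]
    · obtain ⟨u, rfl⟩ := Fin.exists_succAbove_eq ht
      rw [contr_succAbove, contr_succAbove]
      simp [hs, ht]
  by_cases hs : s = j
  · by_cases ht : t = j
    · rw [hs, ht]; simp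
    · rw [eq_comm, key t s ht]; tauto
  · exact key s t hs

theorem exists_remove_last {N : ℕ} (σ : Perm (Fin (N + 1))) (hσ : σ (Fin.last N) = Fin.last N) :
    ∃ π : Perm (Fin N), (∀ u, σ u.castSucc = (π u).castSucc) ∧ Perm.sign σ = Perm.sign π := by
  obtain ⟨π, h1, h2⟩ := exists_remove (Fin.cycleRange (Fin.last N) * σ) (Fin.last N) (by simp [hσ])
  refine ⟨π, fun u => ?_, ?_⟩
  · have h3 := h1 u
    rw [Fin.succAbove_last, Perm.mul_apply, ← Fin.cycleRange_succAbove (Fin.last N),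
      Fin.succAbove_last] at h3
    exact (Fin.cycleRange (Fin.last N)).injective h3
  · rw [Perm.sign_mul, Fin.sign_cycleRange] at h2
    refine Units.ext ?_
    push_cast at h2
    rw [mul_comm] at h2
    exact mul_right_cancel₀ (pow_ne_zero _ (by norm_num)) h2

theorem sum_perm_last {B : Type*} [AddCommMonoid B] {N : ℕ} (b : B) :
    ∑ σ : Perm (Fin (N + 1)), (if σ (Fin.last N) = Fin.last N then b else 0) = N.factorial • b := by
  have h := sum_perm_apply_zero (c := N) (fun p => if p = 0 then b else 0)
  rw [Finset.sum_ite_eq' univ (0 : Fin (N + 1)), if_pos (Finset.mem_univ _)] at h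
  rw [← h, ← Equiv.sum_comp ((Equiv.mulLeft (swap 0 (Fin.last N))).trans
    (Equiv.mulRight (swap 0 (Fin.last N))))]
  refine Finset.sum_congr rfl fun σ _ => ?_
  congr 1
  simp [Equiv.swap_apply_eq_iff]

theorem split_isAntisymm {a : ℕ} (y : Gra A (a + 1)) : IsAntisymm (split y) := by
  unfold split
  refine (circ_isAntisymm _ _ _).sub ?_
  intro σ
  rw [map_zsmul, circ_isAntisymm _ _ _ σ, smul_comm]

variable {a : ℕ} {y : Gra A (a + 1)} {Γ : Multigraph (a + 2)} {P : Gra A (a + 2)}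

/-- If the last vertex is at most bivalent, then only the contractions of its own edges contribute
to the pairing with at least trivalent graphs, since all other contractions leave it as it is. -/
theorem contractTerm_eq_zero (hy3 : ∀ Γ ∈ y.support, ∀ v, 3 ≤ valence Γ v) (hP : IsMono Γ P)
    (hΓ : valence Γ (Fin.last (a + 1)) ≤ 2) {i j : Fin (a + 2)} (hi : i ≠ Fin.last (a + 1))
    (hj : j ≠ Fin.last (a + 1)) : contractTerm y P i j = 0 := by
  refine smul_eq_zero_of_right _ ?_
  refine pair_eq_zero_of_forall fun Γ' hΓ' hy' => ?_
  rcases hP.D_cases i j with h | ⟨hne, Γ₀, rfl, h⟩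
  · rw [h] at hΓ'; simp at hΓ'
  obtain ⟨Γ₁, h1, hn, rfl⟩ := exists_of_mem_support_relabel hΓ'
  obtain rfl := h.mem_support h1
  have h2 := hy3 _ hy' (contr i j (Fin.last (a + 1)))
  have h3 : univ.filter (fun t => contr i j t = contr i j (Fin.last (a + 1))) =
      {Fin.last (a + 1)} := by
    ext t
    simp only [mem_filter, mem_univ, true_and, mem_singleton, contr_eq_contr_iff hne, hi.symm,
      hj.symm, and_false, or_false]
  rw [hn.valence_contract, h3, Finset.sum_singleton] at h2
  rw [valence_add] at hΓ
  omega

theorem relabel_contr_last (i : Fin (a + 1)) (hP : IsMono Γ P)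
    (hΓ : valence Γ (Fin.last (a + 1)) = 0) :
    relabel Fin.castSucc (relabel (contr i.castSucc (Fin.last (a + 1))) P) = P := by
  rw [relabel_relabel]
  refine (hP.relabel_congr (ψ := id) fun t ht => ?_).trans (relabel_id P)
  have ht : t ≠ Fin.last (a + 1) := by rintro rfl; exact ht hΓ
  obtain ⟨u, rfl⟩ := Fin.exists_succAbove_eq ht
  rw [Function.comp_apply, contr_succAbove, Fin.succAbove_last, id]

/-- The part of the differential that attaches a new univalent vertex. -/
theorem pair_circ_edge_left_of_le_one (hy : IsAntisymm y)
    (hy3 : ∀ Γ ∈ y.support, ∀ v, 3 ≤ valence Γ v) (hP : IsMono Γ P)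
    (hΓ : valence Γ (Fin.last (a + 1)) ≤ 1) :
    pair (circ (M := a + 1) (a := 1) rfl (e 0 1) y) P = ∑ i : Fin (a + 1),
      pair y (relabel (contr i.castSucc (Fin.last (a + 1))) (D i.castSucc (Fin.last (a + 1)) P)) := by
  set S := ∑ i : Fin (a + 1),
      pair y (relabel (contr i.castSucc (Fin.last (a + 1))) (D i.castSucc (Fin.last (a + 1)) P))
    with hS
  have hterm : ∀ σ : Perm (Fin (a + 2)), (Perm.sign σ : ℤ) •
        ∑ i : Fin (a + 1), pair (relabel Fin.castSucc y)
          (relabel σ (D (σ.symm i.castSucc) (σ.symm (Fin.last (a + 1))) P)) =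
      if σ (Fin.last (a + 1)) = Fin.last (a + 1) then S else 0 := by
    intro σ
    split_ifs with hσ
    · obtain ⟨π, hπ, hsgn⟩ := exists_remove_last σ hσ
      have hσ' : σ.symm (Fin.last (a + 1)) = Fin.last (a + 1) := by
        rw [Equiv.symm_apply_eq, hσ]
      rw [← Equiv.sum_comp π, Finset.smul_sum, hS]
      refine Finset.sum_congr rfl fun i _ => ?_
      rw [← hπ, Equiv.symm_apply_apply, hσ']
      rcases hP.D_cases i.castSucc (Fin.last (a + 1)) with h | ⟨hne, Γ₀, rfl, h⟩
      · rw [h]; simp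
      have h0 : valence Γ₀ (Fin.last (a + 1)) = 0 := by
        rw [valence_add, valence_single hne, if_pos rfl] at hΓ
        omega
      have h1 := relabel_contr_last i h h0
      set Q := relabel (contr i.castSucc (Fin.last (a + 1))) (D i.castSucc (Fin.last (a + 1)) P)
      have h2 : (σ ∘ Fin.castSucc : Fin (a + 1) → Fin (a + 2)) = Fin.castSucc ∘ π := funext hπ
      rw [← h1, relabel_relabel, h2, ← relabel_relabel, pair_relabel, expand_relabel_castSucc,
        hy.pair_relabel, hsgn, smul_smul, sign_mul_self, one_smul]
    · refine smul_eq_zero_of_right _ (Finset.sum_eq_zero fun i _ => ?_)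
      obtain ⟨u, hu⟩ := Fin.exists_succAbove_eq hσ
      rw [Fin.succAbove_last] at hu
      refine pair_relabel_castSucc_eq_zero' hy3 (u := u) fun Γ' hΓ' => ?_
      rcases hP.D_cases (σ.symm i.castSucc) (σ.symm (Fin.last (a + 1))) with h | ⟨hne, Γ₀, rfl, h⟩
      · rw [h] at hΓ'; simp at hΓ'
      · rw [(h.relabel σ).mem_support hΓ', hu, valence_contract_perm]
        rw [valence_add] at hΓ
        omega
  rw [pair_circ_edge_left, Finset.sum_congr rfl fun σ _ => hterm σ, sum_perm_last,
    ← Nat.cast_smul_eq_nsmul ℚ, smul_smul, inv_mul_cancel₀ (by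
      exact_mod_cast (a + 1).factorial_ne_zero), one_smul]

/-- Attaching a univalent vertex to an at least trivalent graph does not produce bivalent vertices.
-/
theorem pair_circ_edge_left_of_eq_two
    (hy3 : ∀ Γ ∈ y.support, ∀ v, 3 ≤ valence Γ v) (hP : IsMono Γ P)
    (hΓ : valence Γ (Fin.last (a + 1)) = 2) :
    pair (circ (M := a + 1) (a := 1) rfl (e 0 1) y) P = 0 := by
  rw [pair_circ_edge_left]
  refine smul_eq_zero_of_right _ (Finset.sum_eq_zero fun σ _ => smul_eq_zero_of_right _
    (Finset.sum_eq_zero fun i _ => ?_))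
  rcases hP.D_cases (σ.symm i.castSucc) (σ.symm (Fin.last (a + 1))) with h | ⟨hne, Γ₀, rfl, h⟩
  · rw [h]; simp
  by_cases hσ : σ (Fin.last (a + 1)) = Fin.last (a + 1)
  · refine pair_relabel_castSucc_eq_zero fun Γ' hΓ' => ?_
    have hσ' : σ.symm (Fin.last (a + 1)) = Fin.last (a + 1) := by
      rw [Equiv.symm_apply_eq, hσ]
    have hv := valence_contract_perm σ Γ₀ (Fin.last (a + 1))
    rw [hσ] at hv
    rw [(h.relabel σ).mem_support hΓ', hv]
    rw [hσ'] at hne hΓ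
    rw [valence_add, valence_single hne, if_pos rfl, if_neg hne.symm] at hΓ
    omega
  · obtain ⟨u, hu⟩ := Fin.exists_succAbove_eq hσ
    rw [Fin.succAbove_last] at hu
    refine pair_relabel_castSucc_eq_zero' hy3 (u := u) fun Γ' hΓ' => ?_
    rw [(h.relabel σ).mem_support hΓ', hu, valence_contract_perm]
    rw [valence_add] at hΓ
    omega

/-- The two ways of attaching the edges of a bivalent vertex cancel. -/
theorem sum_pair_contr_last_eq_zero (hP : IsMono Γ P) (hΓ : valence Γ (Fin.last (a + 1)) = 2) :
    ∑ i : Fin (a + 1), pair y (relabel (contr i.castSucc (Fin.last (a + 1)))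
      (D i.castSucc (Fin.last (a + 1)) P)) = 0 := by
  set l := Fin.last (a + 1) with hl
  have h1 : ∀ i : Fin (a + 1), relabel (contr i.castSucc l) (D i.castSucc l P) =
      ∑ j : Fin (a + 1), e j i * relabel (contr 0 l) (D j.castSucc l (D i.castSucc l P)) := by
    intro i
    rcases hP.D_cases i.castSucc l with h | ⟨hne, Γ₀, rfl, h⟩
    · rw [h]; simp
    have h2 : D i.castSucc l P = ∑ j : Fin (a + 1), e j.castSucc l * D j.castSucc l (D i.castSucc l P) := by
      have h3 : ∑ j : Fin (a + 1), mult Γ₀ j.castSucc l = 1 := by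
        rw [valence_add, valence_single hne, if_pos rfl, if_neg hne.symm] at hΓ
        rw [valence, Fin.sum_univ_castSucc, mult_self] at hΓ
        simp only [mult_comm Γ₀ _ l]
        omega
      simp only [h.e_mul_D]
      rw [← Finset.sum_smul, h3, one_smul]
    conv_lhs => rw [h2]
    rw [map_sum]
    refine Finset.sum_congr rfl fun j _ => ?_
    have hc : ∀ i u : Fin (a + 1), contr i.castSucc l u.castSucc = u := by
      intro i u
      have := contr_succAbove i.castSucc l u
      rwa [hl, Fin.succAbove_last] at this
    rw [map_mul, relabel_e, hc, contr_same hne, hc]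
    congr 1
    rcases h.D_cases j.castSucc l with h' | ⟨hne', Γ₁, rfl, h'⟩
    · rw [h']; simp
    refine h'.relabel_congr fun t ht => ?_
    have ht : t ≠ l := by
      rintro rfl
      rw [valence_add, valence_add, valence_single hne, valence_single hne', if_pos rfl] at hΓ
      omega
    obtain ⟨u, rfl⟩ := Fin.exists_succAbove_eq ht
    rw [contr_succAbove, contr_succAbove]
  simp only [h1, map_sum]
  refine eq_zero_of_eq_neg ?_
  conv_lhs => rw [Finset.sum_comm]
  rw [← Finset.sum_neg_distrib]
  refine Finset.sum_congr rfl fun i _ => ?_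
  rw [← Finset.sum_neg_distrib]
  refine Finset.sum_congr rfl fun j _ => ?_
  rw [e_swap, D_comm, neg_mul, map_neg]

theorem sum_sum_lt_last {B : Type*} [AddCommMonoid B] (G : Fin (a + 2) → Fin (a + 2) → B)
    (hG : ∀ i j, i ≠ Fin.last (a + 1) → j ≠ Fin.last (a + 1) → G i j = 0) :
    ∑ j, ∑ i with i < j, G i j = ∑ i : Fin (a + 1), G i.castSucc (Fin.last (a + 1)) := by
  rw [Fin.sum_univ_castSucc, Finset.sum_eq_zero, zero_add]
  · rw [Finset.sum_filter, Fin.sum_univ_castSucc]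
    simp [Fin.castSucc_lt_last]
  · intro j _
    refine Finset.sum_eq_zero fun i hi => hG i _ ?_ (Fin.castSucc_ne_last j)
    exact ((Finset.mem_filter.mp hi).2.trans (Fin.castSucc_lt_last j)).ne

/-- The differential of a series of at least trivalent graphs again consists of such graphs: the
ways of splitting off a uni- or bivalent vertex cancel. -/
theorem pair_split_eq_zero (hy : IsAntisymm y) (hy3 : ∀ Γ ∈ y.support, ∀ v, 3 ≤ valence Γ v)
    (hP : IsMono Γ P) (hΓ : valence Γ (Fin.last (a + 1)) ≤ 2) : pair (split y) P = 0 := by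
  rw [split, map_sub, LinearMap.sub_apply, ← Int.cast_smul_eq_zsmul A, map_smul,
    LinearMap.smul_apply, pair_circ_edge_right hy, Int.cast_smul_eq_zsmul,
    sum_sum_lt_last _ fun i j hi hj => contractTerm_eq_zero hy3 hP hΓ hi hj]
  simp only [contractTerm, Fin.val_last, ← Finset.smul_sum, smul_neg, smul_smul, sub_neg_eq_add]
  rw [← pow_add, show a + (a + 1) = 2 * a + 1 by ring, pow_succ, pow_mul]
  norm_num
  rcases Nat.lt_or_eq_of_le hΓ with hΓ | hΓ
  · rw [pair_circ_edge_left_of_le_one hy hy3 hP (by omega), add_neg_cancel]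
  · rw [pair_circ_edge_left_of_eq_two hy3 hP hΓ, sum_pair_contr_last_eq_zero hP hΓ]; simp

theorem split_trivalent (hy : IsAntisymm y) (hy3 : ∀ Γ ∈ y.support, ∀ v, 3 ≤ valence Γ v) :
    ∀ Γ ∈ (split y).support, ∀ v, 3 ≤ valence Γ v := by
  intro Γ hΓ v
  by_contra hv
  rw [MvPolynomial.mem_support_iff, ne_eq, coeff_eq_zero_iff_pair] at hΓ
  refine hΓ ?_
  -- By antisymmetry the vertex `v` can be moved to the last place.
  set σ : Perm (Fin (a + 2)) := swap v (Fin.last (a + 1))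
  have h := pair_split_eq_zero hy hy3 ((isMono_monomial Γ (1 : A)).relabel σ) (by
    rw [show Fin.last (a + 1) = σ v by simp [σ], valence_contract_perm]; omega)
  rw [(split_isAntisymm y).pair_relabel] at h
  have h2 := congrArg (fun z => (Perm.sign σ : ℤ) • z) h
  simpa only [smul_smul, sign_mul_self, one_smul, smul_zero] using h2

end SplitSupport

namespace Multigraph

variable {N L : ℕ}

/-! ### Relabelling of multigraphs -/

theorem mult_contract_perm (σ : Perm (Fin N)) (Γ : Multigraph N) (i j : Fin N) :
    mult (contract σ Γ) (σ i) (σ j) = mult Γ i j := by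
  have h : ∀ v, univ.filter (fun i => σ i = σ v) = {v} := by intro v; ext; simp
  rw [(noCollapse_of_injective σ.injective Γ).mult_contract, h, h, Finset.sum_singleton,
    Finset.sum_singleton]

theorem numEdges_contract_perm (σ : Perm (Fin N)) (Γ : Multigraph N) :
    numEdges (contract σ Γ) = numEdges Γ :=
  (noCollapse_of_injective σ.injective Γ).numEdges_contract

theorem IsApex.of_contract_perm {σ : Perm (Fin N)} {Γ : Multigraph N} {v : Fin N}
    (h : IsApex (contract σ Γ) (σ v)) : IsApex Γ v := by
  intro T hT hv
  have h1 := h (T.map σ.toEmbedding) (by simpa using hT) (by simpa using hv)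
  rw [(noCollapse_of_injective σ.injective Γ).twoEdges_contract, Finset.card_map] at h1
  simpa using h1

theorem veryLoopy_contract_perm {σ : Perm (Fin N)} {Γ : Multigraph N} (h : VeryLoopy Γ) :
    VeryLoopy (contract σ Γ) := by
  by_contra hc
  obtain ⟨v, hv⟩ := (not_veryLoopy_iff _).mp hc
  rw [← σ.apply_symm_apply v] at hv
  exact (not_veryLoopy_iff _).mpr ⟨_, hv.of_contract_perm⟩ h

theorem connected_contract_perm {σ : Perm (Fin N)} {Γ : Multigraph N} (h : (toSimple Γ).Connected) :
    (toSimple (contract σ Γ)).Connected := by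
  rw [connected_iff] at h ⊢
  refine ⟨h.1, fun T hT hT' => ?_⟩
  obtain ⟨i, hi, j, hj, hij⟩ := h.2 (T.map σ.symm.toEmbedding) (by simpa using hT) (by
    intro h; apply hT'; rw [Finset.eq_univ_iff_forall] at h ⊢
    intro t; simpa using h (σ.symm t))
  simp only [mem_map_equiv, Equiv.symm_symm] at hi hj
  exact ⟨σ i, hi, σ j, hj, by rwa [mult_contract_perm]⟩

/-! ### The graphs in an insertion -/

/-- `Γ` arises by inserting the graph `Γg` into the vertex `0` of the graph `Γf`. -/
def IsInsertion {M a L : ℕ} (h : M + a = L) (Γf : Multigraph (a + 1)) (Γg : Multigraph M)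
    (Γ : Multigraph L) : Prop :=
  ∃ Γ₁ : Multigraph L, NoCollapse (collapse M a L h) Γ₁ ∧ Γf = contract (collapse M a L h) Γ₁ ∧
    Γ = Γ₁ + contract (fun i => Fin.cast h (Fin.castAdd a i)) Γg

section Insertion

variable {M a : ℕ} {h : M + a = L} {Γf : Multigraph (a + 1)} {Γg : Multigraph M} {Γ : Multigraph L}

theorem injective_cast_castAdd (h : M + a = L) :
    Function.Injective (fun i : Fin M => Fin.cast h (Fin.castAdd a i)) := by
  intro i j hij; simpa [Fin.ext_iff] using hij

theorem collapse_eq_succ_iff (h : M + a = L) (t : Fin L) (j : Fin a) :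
    collapse M a L h t = j.succ ↔ t = Fin.cast h (Fin.natAdd M j) := by
  rcases cast_cases h t with ⟨i, rfl⟩ | ⟨i, rfl⟩
  · rw [collapse_left]
    simp [Fin.ext_iff]
    intro h; omega
  · rw [collapse_right]
    simp [Fin.ext_iff]

theorem mult_contract_inj {φ : Fin M → Fin L} (hφ : Function.Injective φ) (Γ : Multigraph M)
    (i j : Fin M) : mult (contract φ Γ) (φ i) (φ j) = mult Γ i j := by
  have h : ∀ v, univ.filter (fun i => φ i = φ v) = {v} := by intro v; ext; simp [hφ.eq_iff]
  rw [(noCollapse_of_injective hφ Γ).mult_contract, h, h, Finset.sum_singleton,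
    Finset.sum_singleton]

theorem valence_contract_inj {φ : Fin M → Fin L} (hφ : Function.Injective φ) (Γ : Multigraph M)
    (i : Fin M) : valence (contract φ Γ) (φ i) = valence Γ i := by
  have h : ∀ v, univ.filter (fun i => φ i = φ v) = {v} := by intro v; ext; simp [hφ.eq_iff]
  rw [(noCollapse_of_injective hφ Γ).valence_contract, h, Finset.sum_singleton]

theorem twoEdges_contract_inj {φ : Fin M → Fin L} (hφ : Function.Injective φ) (Γ : Multigraph M)
    (T : Finset (Fin M)) : twoEdges (contract φ Γ) (T.map ⟨φ, hφ⟩) = twoEdges Γ T := by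
  rw [(noCollapse_of_injective hφ Γ).twoEdges_contract]
  congr 1
  ext i; simp

theorem IsInsertion.numEdges (hΓ : IsInsertion h Γf Γg Γ) :
    numEdges Γ = numEdges Γf + numEdges Γg := by
  obtain ⟨Γ₁, hn, rfl, rfl⟩ := hΓ
  rw [numEdges_add, hn.numEdges_contract,
    (noCollapse_of_injective (injective_cast_castAdd h) Γg).numEdges_contract]

theorem IsInsertion.trivalent (hΓ : IsInsertion h Γf Γg Γ) (hf : ∀ v, 3 ≤ valence Γf v)
    (hg : ∀ v, 3 ≤ valence Γg v) (v : Fin L) : 3 ≤ valence Γ v := by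
  obtain ⟨Γ₁, hn, rfl, rfl⟩ := hΓ
  rw [valence_add]
  rcases cast_cases h v with ⟨i, rfl⟩ | ⟨j, rfl⟩
  · have h1 := valence_contract_inj (injective_cast_castAdd h) Γg i
    have := hg i
    omega
  · have h1 := hf j.succ
    have h2 : univ.filter (fun t => collapse M a L h t = j.succ) =
        {Fin.cast h (Fin.natAdd M j)} := by ext; simp [collapse_eq_succ_iff]
    rw [hn.valence_contract, h2, Finset.sum_singleton] at h1
    omega

theorem IsInsertion.connected (hΓ : IsInsertion h Γf Γg Γ) (hf : (toSimple Γf).Connected)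
    (hg : (toSimple Γg).Connected) : (toSimple Γ).Connected := by
  classical
  obtain ⟨Γ₁, hn, rfl, rfl⟩ := hΓ
  rw [connected_iff] at hf hg ⊢
  refine ⟨by omega, fun T hT hT' => ?_⟩
  set ι : Fin M → Fin L := fun i => Fin.cast h (Fin.castAdd a i) with hι
  by_cases hsplit : (∃ i, ι i ∈ T) ∧ ∃ i, ι i ∉ T
  · obtain ⟨⟨i, hi⟩, ⟨j, hj⟩⟩ := hsplit
    obtain ⟨p, hp, q, hq, hpq⟩ := hg.2 (univ.filter fun i => ι i ∈ T) ⟨i, by simpa using hi⟩ (by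
      intro h; rw [Finset.eq_univ_iff_forall] at h; exact hj (by simpa using h j))
    refine ⟨ι p, by simpa using hp, ι q, by simpa using hq, ?_⟩
    rw [mult_add, mult_contract_inj (injective_cast_castAdd h)]
    omega
  · have hsat : ∀ s t, collapse M a L h s = collapse M a L h t → s ∈ T → t ∈ T := by
      intro s t hst hs
      rcases cast_cases h s with ⟨i, rfl⟩ | ⟨i, rfl⟩
      · rcases cast_cases h t with ⟨j, rfl⟩ | ⟨j, rfl⟩
        · by_contra hc; exact hsplit ⟨⟨i, hs⟩, ⟨j, hc⟩⟩
        · rw [collapse_left, collapse_right] at hst; exact absurd hst.symm (Fin.succ_ne_zero _)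
      · rw [collapse_right, eq_comm, collapse_eq_succ_iff] at hst
        rwa [hst]
    have hmem : ∀ t, collapse M a L h t ∈ T.image (collapse M a L h) ↔ t ∈ T := by
      intro t
      rw [Finset.mem_image]
      exact ⟨fun ⟨s, hs, hst⟩ => hsat s t hst hs, fun ht => ⟨t, ht, rfl⟩⟩
    obtain ⟨p, hp, q, hq, hpq⟩ := hf.2 (T.image (collapse M a L h)) (hT.image _) (by
      intro h'
      apply hT'
      rw [Finset.eq_univ_iff_forall] at h' ⊢
      intro t; exact (hmem t).1 (h' _))
    rw [hn.mult_contract] at hpq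
    obtain ⟨i, hi, hi'⟩ := Finset.exists_ne_zero_of_sum_ne_zero hpq
    obtain ⟨j, hj, hij⟩ := Finset.exists_ne_zero_of_sum_ne_zero hi'
    rw [Finset.mem_filter] at hi hj
    refine ⟨i, (hmem i).1 (by rwa [hi.2]), j, fun hc => hq ?_, ?_⟩
    · rw [← hj.2]; exact (hmem j).2 hc
    · rw [mult_add]; omega

/-- Very loopy graphs form an ideal with respect to insertion: an apex `v` of `Γ` maps to an apex of
`Γf`, and `v`, or any vertex if `v` is not in `Γg`, is an apex of `Γg`. -/
theorem IsInsertion.not_veryLoopy (hΓ : IsInsertion h Γf Γg Γ) (hg : (toSimple Γg).Connected)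
    (hv : ¬ VeryLoopy Γ) : ¬ VeryLoopy Γf ∧ ¬ VeryLoopy Γg := by
  classical
  obtain ⟨Γ₁, hn, rfl, rfl⟩ := hΓ
  simp only [not_veryLoopy_iff] at hv ⊢
  obtain ⟨v, hv⟩ := hv
  set ι : Fin M → Fin L := fun i => Fin.cast h (Fin.castAdd a i) with hι
  have hinj : Function.Injective ι := injective_cast_castAdd h
  constructor
  -- The preimage `T'` of a set `T` spans the edges of `Γf` within `T`, and those of `Γg` if `0 ∈
  -- T`. In the latter case it has `M - 1` vertices more than `T`, and the connected graph `Γg` has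
  -- at least `M - 1` edges.
  · refine ⟨collapse M a L h v, fun T hT hvT => ?_⟩
    rw [hn.twoEdges_contract]
    set T' : Finset (Fin L) := univ.filter fun t => collapse M a L h t ∈ T with hT'
    have hvT' : v ∉ T' := by simpa [hT'] using hvT
    have hcard : #T' = ∑ p ∈ T, if p = 0 then M else 1 := by
      rw [hT', Finset.card_eq_sum_card_fiberwise (f := collapse M a L h) (t := T)
        (by intro t; simp)]
      refine Finset.sum_congr rfl fun p hp => ?_
      revert hp
      refine Fin.cases ?_ (fun j => ?_) p
      · intro hp
        rw [if_pos rfl]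
        have : (univ.filter fun t => collapse M a L h t ∈ T).filter
            (fun t => collapse M a L h t = 0) = univ.map ⟨ι, hinj⟩ := by
          ext t
          rcases cast_cases h t with ⟨i, rfl⟩ | ⟨i, rfl⟩
          · simp only [mem_filter, mem_univ, true_and, collapse_left, hp, mem_map, and_self,
              true_iff]
            exact ⟨i, rfl⟩
          · simp only [mem_filter, mem_univ, true_and, collapse_right, mem_map, Fin.succ_ne_zero,
              and_false, false_iff, not_exists]
            intro j hj
            have := congrArg Fin.val hj
            simp [hι] at this
            omega
        rw [this, Finset.card_map, Finset.card_univ, Fintype.card_fin]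
      · intro hp
        rw [if_neg (Fin.succ_ne_zero j)]
        have : (univ.filter fun t => collapse M a L h t ∈ T).filter
            (fun t => collapse M a L h t = j.succ) = {Fin.cast h (Fin.natAdd M j)} := by
          ext t
          simp only [mem_filter, mem_univ, true_and, mem_singleton, collapse_eq_succ_iff]
          constructor
          · exact fun h => h.2
          · rintro rfl; exact ⟨by rwa [collapse_right], rfl⟩
        rw [this, Finset.card_singleton]
    have hM : 0 < M := ((connected_iff _).mp hg).1
    have hne : T'.Nonempty := by
      rw [← Finset.card_pos, hcard]
      obtain ⟨p, hp⟩ := hT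
      refine Finset.sum_pos (fun p _ => ?_) ⟨p, hp⟩
      split_ifs <;> omega
    have h1 := hv T' hne hvT'
    rw [twoEdges_add] at h1
    by_cases h0 : (0 : Fin (a + 1)) ∈ T
    · have h2 : #T' + 1 = M + #T := by
        rw [hcard, ← Finset.add_sum_erase _ _ h0, if_pos rfl, Finset.sum_congr rfl fun p hp =>
          if_neg (Finset.ne_of_mem_erase hp), Finset.sum_const, smul_eq_mul, mul_one,
          Finset.card_erase_of_mem h0]
        have := Finset.card_pos.mpr ⟨_, h0⟩
        omega
      have h3 : twoEdges Γg univ ≤ twoEdges (contract ι Γg) T' := by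
        rw [← twoEdges_contract_inj hinj]
        refine twoEdges_mono _ fun t ht => ?_
        obtain ⟨i, -, rfl⟩ := Finset.mem_map.mp ht
        simp [hT', hι, h0]
      have h4 := le_twoEdges_of_connected Γg hg
      omega
    · have h2 : #T' = #T := by
        rw [hcard, Finset.sum_congr rfl fun p hp =>
          if_neg (by rintro rfl; exact h0 hp), Finset.sum_const, smul_eq_mul, mul_one]
      omega
  · have key : ∀ T : Finset (Fin M), T.Nonempty → (∀ i ∈ T, ι i ≠ v) →
        twoEdges Γg T + 2 ≤ 2 * #T := by
      intro T hT hvT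
      have h1 := hv (T.map ⟨ι, hinj⟩) (by simpa using hT) (by
        intro hc
        obtain ⟨i, hi, hiv⟩ := Finset.mem_map.mp hc
        exact hvT i hi hiv)
      rw [Finset.card_map, twoEdges_add, twoEdges_contract_inj hinj] at h1
      omega
    by_cases hvι : ∃ i, ι i = v
    · obtain ⟨i, rfl⟩ := hvι
      exact ⟨i, fun T hT hi => key T hT fun j hj hji => hi (hinj hji ▸ hj)⟩
    · push Not at hvι
      exact ⟨⟨0, ((connected_iff _).mp hg).1⟩, fun T hT _ => key T hT fun j _ => hvι j⟩

end Insertion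

end Multigraph

open Multigraph

section CircSupport

set_option linter.unusedSectionVars false

variable {A : Type*} [CommRing A] [Algebra ℚ A]

theorem exists_of_mem_support_symm {N : ℕ} {x : Gra A N} {Γ : Multigraph N}
    (hΓ : Γ ∈ (symm x).support) : ∃ Γ' ∈ x.support, ∃ σ : Perm (Fin N), Γ = contract σ Γ' := by
  classical
  obtain ⟨σ, -, h⟩ := Finset.mem_biUnion.mp (MvPolynomial.support_sum hΓ)
  obtain ⟨Γ', h1, -, h2⟩ := exists_of_mem_support_relabel
    (Finsupp.support_smul (b := (Perm.sign σ : ℤ)) h)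
  exact ⟨Γ', h1, σ, h2⟩

theorem exists_of_mem_support_insert {M a L : ℕ} {h : M + a = L} {f : Gra A (a + 1)} {g : Gra A M}
    {Γ : Multigraph L} (hΓ : Γ ∈ (insert h f g).support) :
    ∃ Γf ∈ f.support, ∃ Γg ∈ g.support, IsInsertion h Γf Γg Γ := by
  classical
  rw [insert_eq_collapse] at hΓ
  obtain ⟨Γ₁, h1, Γ₂, h2, rfl⟩ := Finset.mem_add.mp (MvPolynomial.support_mul _ _ hΓ)
  obtain ⟨Γg, hg, -, rfl⟩ := exists_of_mem_support_relabel h2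
  rw [MvPolynomial.mem_support_iff, ne_eq, coeff_eq_zero_iff_pair, pair_expand] at h1
  have hm := isMono_monomial Γ₁ (1 : A)
  refine ⟨contract (collapse M a L h) Γ₁, ?_, Γg, hg, Γ₁, ?_, rfl, rfl⟩
  · rw [MvPolynomial.mem_support_iff]
    exact fun hc => h1 ((hm.relabel _).pair_eq_zero hc)
  · by_contra hc
    exact h1 (by rw [hm.relabel_eq_zero hc, map_zero])

theorem exists_of_mem_support_circ {M a L : ℕ} {h : M + a = L} {f : Gra A (a + 1)} {g : Gra A M}
    {Γ : Multigraph L} (hΓ : Γ ∈ (circ h f g).support) :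
    ∃ Γf ∈ f.support, ∃ Γg ∈ g.support, ∃ Γ', IsInsertion h Γf Γg Γ' ∧
      ∃ σ : Perm (Fin L), Γ = contract σ Γ' := by
  obtain ⟨Γ', h1, σ, h2⟩ := exists_of_mem_support_symm
    (Finsupp.support_smul hΓ)
  obtain ⟨Γf, hf, Γg, hg, h3⟩ := exists_of_mem_support_insert h1
  exact ⟨Γf, hf, Γg, hg, Γ', h3, σ, h2⟩

theorem exists_of_mem_support_bracket {f g : Cochain A} {L k : ℕ} {Γ : Multigraph L}
    (hΓ : Γ ∈ (bracket f g L k).support) : ∃ (M a k₁ k₂ : ℕ) (h : M + a = L), k₁ + k₂ = k ∧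
      (Γ ∈ (circ h (f (a + 1) k₁) (g M k₂)).support ∨
        Γ ∈ (circ h (g (a + 1) k₁) (f M k₂)).support) := by
  classical
  obtain ⟨x, -, h⟩ := Finset.mem_biUnion.mp (MvPolynomial.support_sum hΓ)
  obtain ⟨y, hy, h⟩ := Finset.mem_biUnion.mp (MvPolynomial.support_sum h)
  refine ⟨x.1.1, x.1.2, y.1, y.2, mem_antidiagonal.mp x.2, mem_antidiagonal.mp hy, ?_⟩
  rcases Finset.mem_union.mp (MvPolynomial.support_sub _ _ _ h) with h | h
  · exact Or.inl h
  · exact Or.inr (Finsupp.support_smul h)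

end CircSupport

namespace Multigraph

variable {n : ℕ}

/-! ### Contracting an edge and pulling out a fork -/

theorem filter_contr_eq {N : ℕ} {B : Type*} [AddCommMonoid B] {i j : Fin (N + 2)} (hij : i ≠ j)
    (p : Fin (N + 1)) (g : Fin (N + 2) → B) :
    ∑ t with contr i j t = p, g t =
      g (j.succAbove p) + if p = contr i j i then g j else 0 := by
  rw [Finset.sum_filter, Fin.sum_univ_succAbove _ j, add_comm]
  simp only [contr_succAbove, contr_same hij, Finset.sum_ite_eq', mem_univ, if_true]
  simp only [eq_comm]

theorem valence_contract_contr {i j : Fin (n + 2)} (hij : i ≠ j) {Γ : Multigraph (n + 2)}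
    (hn : NoCollapse (contr i j) Γ) (v : Fin (n + 1)) :
    valence (contract (contr i j) Γ) v =
      valence Γ (j.succAbove v) + if v = contr i j i then valence Γ j else 0 := by
  rw [hn.valence_contract, filter_contr_eq hij]

theorem mult_contract_contr {i j : Fin (n + 2)} (hij : i ≠ j) {Γ : Multigraph (n + 2)}
    (hn : NoCollapse (contr i j) Γ) (p q : Fin (n + 1)) :
    mult (contract (contr i j) Γ) p q = mult Γ (j.succAbove p) (j.succAbove q) +
      (if q = contr i j i then mult Γ (j.succAbove p) j else 0) +
      if p = contr i j i then mult Γ j (j.succAbove q) else 0 := by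
  rw [hn.mult_contract, filter_contr_eq hij, filter_contr_eq hij, filter_contr_eq hij, mult_self]
  split_ifs <;> simp

theorem contr_zero {i j : Fin (n + 2)} (hj : j ≠ 0) : contr i j 0 = 0 := by
  rw [← Fin.succAbove_ne_zero_zero hj, contr_succAbove]

theorem contr_eq_zero_iff {i j : Fin (n + 2)} (hj : j ≠ 0) (hij : i ≠ j) :
    contr i j i = 0 ↔ i = 0 := by
  rw [← contr_zero (i := i) hj, contr_eq_contr_iff hij]
  constructor
  · rintro (h | ⟨-, h⟩ | ⟨h, -⟩)
    · exact h
    · exact absurd h.symm hj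
    · exact absurd h hij
  · exact Or.inl

/-- Contraction of an edge preserves the apex `0`. -/
theorem IsApex.contract_contr {i j : Fin (n + 2)} (hj : j ≠ 0) (hij : i ≠ j)
    {Γ Γ₀ R : Multigraph (n + 2)} (hΓ : Γ = Γ₀ + R + single i j) (h : IsApex Γ 0)
    (hn : NoCollapse (contr i j) Γ₀) : IsApex (contract (contr i j) Γ₀) 0 := by
  classical
  intro T hT h0
  rw [hn.twoEdges_contract]
  set T' := univ.filter fun t => contr i j t ∈ T with hT'
  have hcard : #T' = #T + if contr i j i ∈ T then 1 else 0 := by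
    rw [hT', Finset.card_filter, Fin.sum_univ_succAbove _ j, contr_same hij, add_comm]
    simp only [contr_succAbove]
    congr 1
    simp
  have h0' : (0 : Fin (n + 2)) ∉ T' := by
    simpa [hT', contr_zero hj] using h0
  have hne : T'.Nonempty := by
    rw [← Finset.card_pos, hcard]
    have := Finset.card_pos.mpr hT
    omega
  have h1 := h T' hne h0'
  rw [hΓ, twoEdges_add, twoEdges_add] at h1
  have h2 : contr i j i ∈ T → 2 ≤ twoEdges (single i j) T' := by
    intro hi
    have hi' : i ∈ T' := by simpa [hT'] using hi
    have hj' : j ∈ T' := by simpa [hT', contr_same hij] using hi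
    have : ({i, j} : Finset (Fin (n + 2))) ⊆ T' := by
      intro t ht
      rcases Finset.mem_insert.mp ht with rfl | ht
      · exact hi'
      · rwa [Finset.mem_singleton.mp ht]
    refine le_trans ?_ (twoEdges_mono _ this)
    rw [twoEdges, Finset.sum_pair hij, Finset.sum_pair hij, Finset.sum_pair hij]
    simp [mult_single hij, hij, hij.symm]
  split_ifs at hcard with hi
  · have := h2 hi; omega
  · omega

/-- Attach a new last vertex to `Γ` by an edge to `w` and a double edge to `0`. -/
def attach (w : Fin (n + 1)) (Γ : Multigraph (n + 1)) : Multigraph (n + 2) :=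
  contract Fin.castSucc Γ + (single w.castSucc (Fin.last (n + 1)) +
    2 • single 0 (Fin.last (n + 1)))

theorem valence_smul {N : ℕ} (c : ℕ) (Γ : Multigraph N) (v : Fin N) :
    valence (c • Γ) v = c * valence Γ v := by
  induction c with
  | zero => simp [valence, mult_zero]
  | succ c ih => rw [succ_nsmul, valence_add, ih]; ring

theorem mult_smul {N : ℕ} (c : ℕ) (Γ : Multigraph N) (v w : Fin N) :
    mult (c • Γ) v w = c * mult Γ v w := by
  induction c with
  | zero => simp [mult_zero]
  | succ c ih => rw [succ_nsmul, mult_add, ih]; ring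

theorem twoEdges_smul {N : ℕ} (c : ℕ) (Γ : Multigraph N) (T : Finset (Fin N)) :
    twoEdges (c • Γ) T = c * twoEdges Γ T := by
  simp [twoEdges, mult_smul, Finset.mul_sum]

theorem valence_castSucc_last {N : ℕ} (Γ : Multigraph N) :
    valence (contract Fin.castSucc Γ) (Fin.last N) = 0 := by
  rw [(noCollapse_of_injective (Fin.castSucc_injective _) Γ).valence_contract]
  exact Finset.sum_eq_zero fun i hi => absurd (Finset.mem_filter.mp hi).2 (Fin.castSucc_ne_last i)

theorem zero_ne_last : (0 : Fin (n + 2)) ≠ Fin.last (n + 1) := (Fin.last_pos).ne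

theorem valence_attach_castSucc (w : Fin (n + 1)) (Γ : Multigraph (n + 1)) {v : Fin (n + 1)}
    (hv : v ≠ 0) : valence (attach w Γ) v.castSucc = valence Γ v + if v = w then 1 else 0 := by
  have h0 : v.castSucc ≠ 0 := by simpa using hv
  rw [attach, valence_add, valence_add, valence_smul, valence_single (Fin.castSucc_ne_last _),
    valence_single zero_ne_last, valence_contract_inj (Fin.castSucc_injective _)]
  simp [Fin.castSucc_ne_last, h0]

theorem valence_attach_last (w : Fin (n + 1)) (Γ : Multigraph (n + 1)) :
    valence (attach w Γ) (Fin.last (n + 1)) = 3 := by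
  rw [attach, valence_add, valence_add, valence_smul, valence_single (Fin.castSucc_ne_last _),
    valence_single zero_ne_last, valence_castSucc_last]
  simp [(Fin.castSucc_ne_last _).symm, zero_ne_last.symm]

theorem mult_attach_castSucc (w : Fin (n + 1)) (Γ : Multigraph (n + 1)) (v : Fin (n + 1)) :
    mult (attach w Γ) 0 v.castSucc = mult Γ 0 v := by
  have := mult_contract_inj (Fin.castSucc_injective _) Γ 0 v
  rw [Fin.castSucc_zero] at this
  rw [attach, mult_add, mult_add, mult_smul, mult_single (Fin.castSucc_ne_last _),
    mult_single zero_ne_last, this]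
  simp [Fin.castSucc_ne_last]

theorem mult_attach_last (w : Fin (n + 1)) (Γ : Multigraph (n + 1)) :
    2 ≤ mult (attach w Γ) 0 (Fin.last (n + 1)) := by
  rw [attach, mult_add, mult_add, mult_smul, mult_single zero_ne_last]
  simp
  omega

theorem isApex_attach {w : Fin (n + 1)} {Γ : Multigraph (n + 1)} (h : IsApex Γ 0) :
    IsApex (attach w Γ) 0 := by
  classical
  intro T hT h0
  set T' := univ.filter fun t : Fin (n + 1) => t.castSucc ∈ T with hT'
  have h1 : twoEdges (contract Fin.castSucc Γ) T = twoEdges Γ T' :=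
    (noCollapse_of_injective (Fin.castSucc_injective _) Γ).twoEdges_contract T
  have h2 : #T = #T' + if Fin.last (n + 1) ∈ T then 1 else 0 := by
    rw [hT', Finset.card_filter, ← Fin.sum_univ_castSucc (fun t => if t ∈ T then 1 else 0)]
    simp
  have h3 : twoEdges (single 0 (Fin.last (n + 1))) T = 0 := by
    refine Finset.sum_eq_zero fun i hi => Finset.sum_eq_zero fun j hj => ?_
    have hi0 : i ≠ 0 := by rintro rfl; exact h0 hi
    have hj0 : j ≠ 0 := by rintro rfl; exact h0 hj
    rw [mult_single zero_ne_last]; simp [hi0, hj0]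
  have h4 : twoEdges (single w.castSucc (Fin.last (n + 1))) T ≤
      if Fin.last (n + 1) ∈ T ∧ w ∈ T' then 2 else 0 := by
    simp only [twoEdges, mult_single (Fin.castSucc_ne_last w), Finset.sum_add_distrib, ite_and]
    simp only [hT', mem_filter, mem_univ, true_and]
    split_ifs <;> simp_all
  have h5 : (0 : Fin (n + 1)) ∉ T' := by simpa [hT'] using h0
  rw [attach, twoEdges_add, twoEdges_add, twoEdges_smul, h1, h3, h2]
  by_cases hne : T'.Nonempty
  · have := h T' hne h5
    split_ifs at h4 ⊢ <;> simp_all <;> omega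
  · rw [Finset.not_nonempty_iff_eq_empty] at hne
    have hl : Fin.last (n + 1) ∈ T := by
      by_contra hl
      rw [if_neg hl, hne] at h2
      exact hT.ne_empty (Finset.card_eq_zero.mp h2)
    rw [hne] at h4 ⊢
    simp only [hl, notMem_empty, and_false, if_false, Nat.le_zero, if_true, card_empty] at h4 ⊢
    rw [h4]
    simp [twoEdges]

/-- A vertex with `t` edges to vertices other than `0` and `m` edges to `0` is called large if `2 t
+ m` is at least five. Since its valence is `t + m`, this means `5 + m ≤ 2 (t + m)`. -/
def IsLarge (Γ : Multigraph (n + 2)) (u : Fin (n + 2)) : Prop := 5 + mult Γ 0 u ≤ 2 * valence Γ u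

open Classical in
/-- The number of large vertices. -/
def numLarge (Γ : Multigraph (n + 2)) : ℕ := ∑ u : Fin (n + 1), if IsLarge Γ u.succ then 1 else 0

/-- Contracting an edge at a large vertex `j` and attaching a fork lowers the number of large
vertices, provided that no other vertex becomes large, since the new fork is not large. -/
theorem numLarge_attach_lt {Γ : Multigraph (n + 2)} {Γ' : Multigraph (n + 1)} {w : Fin (n + 1)}
    {j : Fin (n + 2)} (hj0 : j ≠ 0) (hj : IsLarge Γ j)
    (h : ∀ v, v ≠ 0 → IsLarge (attach w Γ') v.castSucc → IsLarge Γ (j.succAbove v)) :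
    numLarge (attach w Γ') < numLarge Γ := by
  classical
  have h2 : ∀ (Γ : Multigraph (n + 2)), numLarge Γ = ∑ u with u ≠ 0, if IsLarge Γ u then 1 else 0 := by
    intro Γ
    rw [Finset.sum_filter, Fin.sum_univ_succ]
    simp [numLarge]
  rw [h2, h2, Finset.sum_filter, Finset.sum_filter, Fin.sum_univ_castSucc,
    Fin.sum_univ_succAbove _ j, if_pos hj0, if_pos hj, add_comm 1]
  have h3 : ¬ IsLarge (attach w Γ') (Fin.last (n + 1)) := by
    unfold IsLarge
    have := mult_attach_last w Γ'
    rw [valence_attach_last]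
    omega
  rw [if_neg h3, ite_self, add_zero, Nat.lt_add_one_iff]
  refine Finset.sum_le_sum fun v _ => ?_
  by_cases hv : v = 0
  · simp [hv]
  · have hv' : j.succAbove v ≠ 0 := Fin.succAbove_ne_zero hj0 hv
    rw [if_pos hv', if_pos (by simpa using hv)]
    by_cases hl : IsLarge (attach w Γ') v.castSucc
    · rw [if_pos hl, if_pos (h v hv hl)]
    · rw [if_neg hl]; exact Nat.zero_le _

/-- A vertex with one edge to a vertex other than `0` and a double edge to `0`. -/
def IsFork (Γ : Multigraph (n + 2)) (u : Fin (n + 2)) : Prop := mult Γ 0 u = 2 ∧ valence Γ u = 3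

/-- A vertex with a triple edge to `0` and no other edges. -/
def IsTriple (Γ : Multigraph (n + 2)) (u : Fin (n + 2)) : Prop := mult Γ 0 u = 3 ∧ valence Γ u = 3

theorem mult_add_mult_le_valence {N : ℕ} (Γ : Multigraph N) (u : Fin N) {p q : Fin N} (h : p ≠ q) :
    mult Γ p u + mult Γ q u ≤ valence Γ u := by
  rw [mult_comm Γ p, mult_comm Γ q, ← Finset.sum_pair (f := fun t => mult Γ u t) h]
  exact Finset.sum_le_sum_of_subset (Finset.subset_univ _)

/-- An at least trivalent vertex with an edge to a vertex other than `0` is a fork or large. -/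
theorem isLarge_of_not_isFork {Γ : Multigraph (n + 2)} {i j : Fin (n + 2)} (hi : i ≠ 0)
    (h3 : 3 ≤ valence Γ j) (hij : mult Γ i j ≠ 0) (hf : ¬ IsFork Γ j) :
    IsLarge Γ j := by
  have := mult_add_mult_le_valence Γ j hi
  unfold IsFork at hf
  unfold IsLarge
  omega

end Multigraph

open Multigraph

section Pull

variable {A : Type*} [CommRing A] [Algebra ℚ A] {n : ℕ}

set_option linter.unusedSectionVars false

/-! ### Pulling out forks -/

/-- The graph in which the new last vertex is joined to `w` by an edge and to `0` by a double edge. -/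
def forkTerm (w : Fin (n + 1)) (P : Gra A (n + 1)) : Gra A (n + 2) :=
  e w.castSucc (Fin.last (n + 1)) * e 0 (Fin.last (n + 1)) ^ 2 * relabel Fin.castSucc P

/-- Half the sum over all ways of moving two edges from `0` to `w` to a new vertex that is joined to
`w`. -/
def pull : Gra A (n + 1) →ₗ[A] Gra A (n + 2) :=
  (2 : ℚ)⁻¹ • ∑ w : Fin (n + 1),
    (LinearMap.mulLeft A (e w.castSucc (Fin.last (n + 1)) * e 0 (Fin.last (n + 1)) ^ 2)) ∘ₗ
      (relabel Fin.castSucc).toLinearMap ∘ₗ ((D 0 w).toLinearMap ∘ₗ (D 0 w).toLinearMap)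

theorem pull_apply (P : Gra A (n + 1)) :
    pull P = (2 : ℚ)⁻¹ • ∑ w : Fin (n + 1), forkTerm w (D 0 w (D 0 w P)) := by
  simp [pull, forkTerm, mul_assoc]

theorem forkTerm_add (w : Fin (n + 1)) (P Q : Gra A (n + 1)) :
    forkTerm w (P + Q) = forkTerm w P + forkTerm w Q := by
  simp [forkTerm, mul_add]

theorem forkTerm_zero (w : Fin (n + 1)) : forkTerm w (0 : Gra A (n + 1)) = 0 := by
  simp [forkTerm]

theorem forkTerm_neg (w : Fin (n + 1)) (P : Gra A (n + 1)) : forkTerm w (-P) = -forkTerm w P := by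
  simp [forkTerm]

theorem forkTerm_nsmul (w : Fin (n + 1)) (c : ℕ) (P : Gra A (n + 1)) :
    forkTerm w (c • P) = c • forkTerm w P := by
  rw [forkTerm, map_nsmul, mul_smul_comm, forkTerm]

theorem castSucc_inj_filter {N : ℕ} (i : Fin N) :
    univ.filter (fun t : Fin N => t.castSucc = i.castSucc) = {i} := by ext; simp

theorem D_relabel_castSucc {N : ℕ} (i j : Fin N) (P : Gra A N) :
    D i.castSucc j.castSucc (relabel Fin.castSucc P) = relabel Fin.castSucc (D i j P) := by
  rw [D_relabel, castSucc_inj_filter, castSucc_inj_filter, Finset.sum_singleton,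
    Finset.sum_singleton]

theorem D_relabel_castSucc_last {N : ℕ} (i : Fin (N + 1)) (P : Gra A N) :
    D i (Fin.last N) (relabel Fin.castSucc P) = 0 := by
  rw [D_relabel]
  refine Finset.sum_eq_zero fun t _ => Finset.sum_eq_zero fun s hs => ?_
  exact absurd (Finset.mem_filter.mp hs).2 (Fin.castSucc_ne_last s)

theorem D_pow_two {N : ℕ} (i j : Fin N) (x : Gra A N) : D i j (x ^ 2) = 2 * x * D i j x := by
  rw [sq, D_mul]; ring

theorem D_forkTerm (i j w : Fin (n + 1)) (P : Gra A (n + 1)) :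
    D i.castSucc j.castSucc (forkTerm w P) = forkTerm w (D i j P) := by
  have h : ∀ v : Fin (n + 2), D i.castSucc j.castSucc (e v (Fin.last (n + 1)) : Gra A (n + 2)) = 0 := by
    intro v
    rw [D_e]; simp [Fin.castSucc_ne_last]
  rw [forkTerm, D_mul, D_mul, D_pow_two, h, h, D_relabel_castSucc, forkTerm]
  ring

theorem D_pull (i j : Fin (n + 1)) (P : Gra A (n + 1)) :
    D i.castSucc j.castSucc (pull P) = pull (D i j P) := by
  rw [pull_apply, pull_apply, Derivation.map_smul_of_tower, map_sum]
  congr 1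
  refine Finset.sum_congr rfl fun w _ => ?_
  rw [D_forkTerm, D_comm i j, D_comm i j]

theorem contr_castSucc (i j t : Fin (n + 2)) :
    contr i.castSucc j.castSucc t.castSucc = (contr i j t).castSucc := by
  by_cases hij : i = j
  · subst hij
    by_cases ht : t = i
    · subst ht
      simp [contr]
    · obtain ⟨u, rfl⟩ := Fin.exists_succAbove_eq ht
      rw [contr_succAbove, ← Fin.castSucc_succAbove_castSucc, contr_succAbove]
  have key : ∀ t, t ≠ j → contr i.castSucc j.castSucc t.castSucc = (contr i j t).castSucc := by
    intro t ht
    obtain ⟨u, rfl⟩ := Fin.exists_succAbove_eq ht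
    rw [contr_succAbove, ← Fin.castSucc_succAbove_castSucc, contr_succAbove]
  by_cases ht : t = j
  · rw [ht, contr_same hij, contr_same (by simpa using hij), key i hij]
  · exact key t ht

theorem contr_castSucc_last (i j : Fin (n + 2)) :
    contr i.castSucc j.castSucc (Fin.last (n + 2)) = Fin.last (n + 1) := by
  have h : j.castSucc.succAbove (Fin.last (n + 1)) = Fin.last (n + 2) := by
    rw [Fin.succAbove_of_le_castSucc _ _ (Fin.castSucc_le_castSucc_iff.mpr (Fin.le_last j)),
      Fin.succ_last]
  rw [← h, contr_succAbove]

theorem relabel_contr_forkTerm {i j : Fin (n + 2)} (hj : j ≠ 0) (w : Fin (n + 2))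
    (P : Gra A (n + 2)) : relabel (contr i.castSucc j.castSucc) (forkTerm w P) =
      forkTerm (contr i j w) (relabel (contr i j) P) := by
  have h0 : contr i.castSucc j.castSucc 0 = 0 := contr_zero (by simpa using hj)
  rw [forkTerm, map_mul, map_mul, map_pow, relabel_e, relabel_e, contr_castSucc,
    contr_castSucc_last, h0, forkTerm, relabel_relabel, relabel_relabel]
  congr 2
  exact congrArg relabel (funext fun t => contr_castSucc i j t)

/-- Pulling out forks commutes with the contraction of an edge not at `0`, except that the fork can
take one edge from each of the two ends of the contracted edge. -/
theorem pull_relabel_contr {i j : Fin (n + 2)} (hj : j ≠ 0) (hi : i ≠ 0) (hij : i ≠ j)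
    (P : Gra A (n + 2)) : pull (relabel (contr i j) P) =
      relabel (contr i.castSucc j.castSucc) (pull P) +
        forkTerm (contr i j i) (relabel (contr i j) (D 0 i (D 0 j P))) := by
  set κ := contr i j with hκ
  have hfib : univ.filter (fun t => κ t = 0) = {0} := by
    ext t
    simp only [mem_filter, mem_univ, true_and, mem_singleton]
    rw [← contr_zero (i := i) hj, contr_eq_contr_iff hij]
    simp [hi.symm, hj.symm]
  obtain ⟨v, rfl⟩ := Fin.exists_succAbove_eq hij
  have hv : κ (j.succAbove v) = v := contr_succAbove _ _ _
  have hD : ∀ w (Q : Gra A (n + 2)), D 0 w (relabel κ Q) = relabel κ (D 0 (j.succAbove w) Q) +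
      if w = v then relabel κ (D 0 j Q) else 0 := by
    intro w Q
    rw [D_relabel, hfib, Finset.sum_singleton, filter_contr_eq hij]
    rw [← hκ, hv]
  have h1 : ∀ w, forkTerm w (D 0 w (D 0 w (relabel κ P))) =
      forkTerm w (relabel κ (D 0 (j.succAbove w) (D 0 (j.succAbove w) P))) + if w = v then
        (2 • forkTerm w (relabel κ (D 0 (j.succAbove w) (D 0 j P))) +
          forkTerm w (relabel κ (D 0 j (D 0 j P)))) else 0 := by
    intro w
    rw [hD]
    split_ifs with hw
    · rw [map_add, hD, hD, if_pos hw, if_pos hw, forkTerm_add, forkTerm_add, forkTerm_add,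
        D_comm 0 j 0 (j.succAbove w)]
      abel
    · rw [add_zero, hD, if_neg hw, add_zero, add_zero]
  rw [pull_apply, Finset.sum_congr rfl fun w _ => h1 w, Finset.sum_add_distrib, Finset.sum_ite_eq',
    if_pos (Finset.mem_univ _), pull_apply, relabel_qsmul, map_sum]
  simp only [relabel_contr_forkTerm hj, ← hκ]
  rw [Fin.sum_univ_succAbove _ j, hκ, contr_same hij, ← hκ, hv]
  simp only [hκ, contr_succAbove, smul_add]
  rw [← Nat.cast_smul_eq_nsmul ℚ, smul_smul]
  norm_num
  abel

/-- Pulling out forks and the contraction of an edge at `0`. -/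
theorem pull_relabel_contr_zero {j : Fin (n + 2)} (hj : j ≠ 0) (P : Gra A (n + 2)) :
    pull (relabel (contr 0 j) P) = relabel (contr (0 : Fin (n + 2)).castSucc j.castSucc) (pull P) +
      ∑ u : Fin n, (forkTerm u.succ (relabel (contr 0 j)
        (D 0 (j.succAbove u.succ) (D j (j.succAbove u.succ) P))) +
        (2 : ℚ)⁻¹ • forkTerm u.succ (relabel (contr 0 j)
        (D j (j.succAbove u.succ) (D j (j.succAbove u.succ) P)))) -
      (2 : ℚ)⁻¹ • forkTerm 0 (relabel (contr 0 j) (D 0 j (D 0 j P))) := by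
  set κ := contr 0 j with hκ
  have hfib : univ.filter (fun t => κ t = 0) = {0, j} := by
    ext t
    simp only [mem_filter, mem_univ, true_and, mem_insert, mem_singleton]
    rw [← contr_zero (i := 0) hj, contr_eq_contr_iff hj.symm]
    simp [hj.symm]
  have hκ0 : κ 0 = 0 := contr_zero hj
  have hs0 : j.succAbove 0 = 0 := Fin.succAbove_ne_zero_zero hj
  have hD : ∀ (u : Fin n) (Q : Gra A (n + 2)), D 0 u.succ (relabel κ Q) =
      relabel κ (D 0 (j.succAbove u.succ) Q) + relabel κ (D j (j.succAbove u.succ) Q) := by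
    intro u Q
    rw [D_relabel, hfib, Finset.sum_pair hj.symm, filter_contr_eq hj.symm, filter_contr_eq hj.symm,
      ← hκ, hκ0, if_neg (Fin.succ_ne_zero u), if_neg (Fin.succ_ne_zero u), add_zero, add_zero]
  have h1 : ∀ u : Fin n, forkTerm u.succ (D 0 u.succ (D 0 u.succ (relabel κ P))) =
      forkTerm u.succ (relabel κ (D 0 (j.succAbove u.succ) (D 0 (j.succAbove u.succ) P))) +
      (2 • forkTerm u.succ (relabel κ (D 0 (j.succAbove u.succ) (D j (j.succAbove u.succ) P))) +
      forkTerm u.succ (relabel κ (D j (j.succAbove u.succ) (D j (j.succAbove u.succ) P)))) := by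
    intro u
    rw [hD, map_add, hD, hD, forkTerm_add, forkTerm_add, forkTerm_add,
      D_comm j (j.succAbove u.succ) 0 (j.succAbove u.succ)]
    abel
  rw [pull_apply, Fin.sum_univ_succ, D_self, forkTerm_zero, zero_add,
    Finset.sum_congr rfl fun w _ => h1 w, Finset.sum_add_distrib, pull_apply, relabel_qsmul, map_sum]
  simp only [relabel_contr_forkTerm hj, ← hκ]
  rw [Fin.sum_univ_succAbove _ j, hκ, contr_same hj.symm, ← hκ, hκ0, Fin.sum_univ_succ, hs0, D_self,
    map_zero, forkTerm_zero, zero_add]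
  simp only [hκ, contr_succAbove, smul_add, Finset.sum_add_distrib, Finset.smul_sum]
  simp only [← Nat.cast_smul_eq_nsmul ℚ, smul_smul]
  norm_num
  abel

/-- Contracting the edge at the new vertex of a fork. -/
theorem sum_contr_last_pull {Γ : Multigraph (n + 1)} {P : Gra A (n + 1)} (hP : IsMono Γ P) :
    ∑ u : Fin (n + 1), relabel (contr u.castSucc (Fin.last (n + 1)))
      (D u.castSucc (Fin.last (n + 1)) (pull P)) = (∑ w, (mult Γ 0 w).choose 2) • P := by
  have hc : ∀ u v : Fin (n + 1), contr u.castSucc (Fin.last (n + 1)) v.castSucc = v := by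
    intro u v
    have := contr_succAbove u.castSucc (Fin.last (n + 1)) v
    rwa [Fin.succAbove_last] at this
  have hl : ∀ u : Fin (n + 1), contr u.castSucc (Fin.last (n + 1)) (Fin.last (n + 1)) = u := by
    intro u; rw [contr_same (Fin.castSucc_ne_last u), hc]
  have hr : ∀ (u : Fin (n + 1)) (Q : Gra A (n + 1)),
      relabel (contr u.castSucc (Fin.last (n + 1))) (relabel Fin.castSucc Q) = Q := by
    intro u Q
    rw [relabel_relabel]
    exact (congrArg (fun φ => relabel φ Q) (funext (hc u))).trans (relabel_id Q)
  have hc0 : ∀ u : Fin (n + 1), contr u.castSucc (Fin.last (n + 1)) 0 = 0 := fun u => hc u 0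
  have hterm : ∀ u w : Fin (n + 1), relabel (contr u.castSucc (Fin.last (n + 1)))
      (D u.castSucc (Fin.last (n + 1)) (forkTerm w (D 0 w (D 0 w P)))) =
      if u = w then (2 * (mult Γ 0 w).choose 2) • P else 0 := by
    intro u w
    have hEuler : e 0 w ^ 2 * D 0 w (D 0 w P) = (2 * (mult Γ 0 w).choose 2) • P := by
      rw [Nat.choose_two_right, Nat.mul_div_cancel' (Nat.even_mul_pred_self _).two_dvd]
      rcases hP.D_cases 0 w with h | ⟨hne, Γ₀, rfl, h⟩
      · have := hP.e_mul_D 0 w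
        rw [h, mul_zero] at this
        rw [h, map_zero, mul_zero, mul_comm, mul_smul, ← this, smul_zero]
      · have h2 : mult (Γ₀ + Multigraph.single 0 w) 0 w = mult Γ₀ 0 w + 1 := by
          rw [mult_add, mult_single hne]; simp [hne]
        have h1 := hP.e_mul_D 0 w
        rw [h2] at h1 ⊢
        rw [sq, mul_assoc, h.e_mul_D, mul_smul_comm, h1, smul_smul, mul_comm, Nat.add_sub_cancel]
    have hd1 : D u.castSucc (Fin.last (n + 1)) (e w.castSucc (Fin.last (n + 1)) : Gra A (n + 2)) =
        if u = w then 1 else 0 := by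
      rw [D_e]; simp [Fin.castSucc_ne_last]
    have hd2 : D u.castSucc (Fin.last (n + 1)) (e 0 (Fin.last (n + 1)) : Gra A (n + 2)) =
        if u = 0 then 1 else 0 := by
      rw [← Fin.castSucc_zero, D_e]; simp [Fin.castSucc_ne_last]
    rw [forkTerm, D_mul, D_mul, D_pow_two, D_relabel_castSucc_last, hd1, hd2]
    simp only [mul_zero, add_zero, map_mul, map_add, map_pow, relabel_e, hc, hl, hc0, hr, map_ofNat]
    by_cases hu : u = 0
    · subst hu
      by_cases hw : 0 = w
      · subst hw; simp [mult_self]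
      · simp [hw]
    · by_cases hw : u = w
      · subst hw
        simp only [if_true, if_neg hu, map_one, map_zero, mul_zero, one_mul, hEuler, add_zero]
      · simp [hu, hw]
  simp only [pull_apply, Derivation.map_smul_of_tower, map_sum, relabel_qsmul, hterm,
    ← Finset.smul_sum, Finset.sum_ite_eq, Finset.mem_univ, if_true]
  rw [← Finset.sum_smul, ← Finset.mul_sum, ← Nat.cast_smul_eq_nsmul ℚ, ← Nat.cast_smul_eq_nsmul ℚ,
    smul_smul]
  congr 1
  push_cast
  ring

end Pull

open Multigraph

section Evaluate

variable {A : Type*} [CommRing A] [Algebra ℚ A] {n : ℕ}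

set_option linter.unusedSectionVars false

/-! ### The correction terms -/

/-- The permutation that makes `j` the last vertex and keeps the order of the other vertices. -/
def slide (j : Fin (n + 2)) : Perm (Fin (n + 2)) :=
  (Fin.cycleRange (Fin.last (n + 1))).symm * Fin.cycleRange j

theorem slide_same (j : Fin (n + 2)) : slide j j = Fin.last (n + 1) := by
  rw [slide, Perm.mul_apply, Fin.cycleRange_self, Fin.cycleRange_symm_zero]

theorem slide_of_ne {i j t : Fin (n + 2)} (ht : t ≠ j) : slide j t = (contr i j t).castSucc := by
  obtain ⟨u, rfl⟩ := Fin.exists_succAbove_eq ht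
  rw [contr_succAbove, slide, Perm.mul_apply, Fin.cycleRange_succAbove, Fin.cycleRange_symm_succ,
    Fin.succAbove_last]

theorem sign_slide (j : Fin (n + 2)) :
    (Perm.sign (slide j) : ℤ) = (-1) ^ (n + 1) * (-1) ^ (j : ℕ) := by
  simp [slide, Perm.sign_mul, Fin.sign_cycleRange]

theorem sign_cancel {B : Type*} [AddCommGroup B] (a b c : ℕ) (z : B) :
    (-1 : ℤ) ^ b • c • ((-1 : ℤ) ^ a * (-1) ^ b) • z = (-1 : ℤ) ^ a • c • z := by
  rw [smul_comm _ c, smul_comm _ c, smul_smul, mul_left_comm, ← pow_add, Even.neg_one_pow ⟨b, rfl⟩,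
    mul_one]

theorem IsMono.forkTerm {Γ : Multigraph (n + 1)} {P : Gra A (n + 1)} (h : IsMono Γ P)
    (w : Fin (n + 1)) : IsMono (attach w Γ) (forkTerm w P) := by
  rw [OddGC.forkTerm, mul_comm]
  exact (h.relabel _).mul ((isMono_e _ _).mul ((isMono_e _ _).pow 2))

variable {Γ : Multigraph (n + 2)} {P x : Gra A (n + 2)}

/-- The correction term for an edge between `i` and `j`, neither of which is `0`. -/
def edgeTerm (i j : Fin (n + 2)) (P : Gra A (n + 2)) : Gra A (n + 2) :=
  forkTerm (contr i j i) (relabel (contr i j) (D 0 i (D 0 j (D i j P))))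

theorem mult_single_zero_left {j : Fin (n + 2)} (hj : 0 ≠ j) {u : Fin (n + 2)} (hu : u ≠ 0) :
    mult (Multigraph.single 0 j) 0 u = if u = j then 1 else 0 := by
  rw [mult_single hj]; simp [hu]

theorem mult_single_zero_of_ne {i j : Fin (n + 2)} (hi : i ≠ 0) (hj : j ≠ 0) (hij : i ≠ j)
    (u : Fin (n + 2)) : mult (Multigraph.single i j) 0 u = 0 := by
  rw [mult_single hij]; simp [hi.symm, hj.symm]

/-- If no end of the edge is a fork, both ends are large. Then the correction term has fewer large
vertices, and does not contribute. -/
theorem pair_edgeTerm_eq_zero {i j : Fin (n + 2)} (hi : i ≠ 0) (hj : j ≠ 0) (hij : i ≠ j)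
    (hP : IsMono Γ P) (hap : IsApex Γ 0) (h3 : ∀ v, 3 ≤ valence Γ v)
    (hx : ∀ Γ', IsApex Γ' 0 → numLarge Γ' < numLarge Γ → MvPolynomial.coeff Γ' x = 0)
    (hfi : ¬ IsFork Γ i) (hfj : ¬ IsFork Γ j) : pair x (edgeTerm i j P) = 0 := by
  unfold edgeTerm
  rcases hP.D_cases i j with h | ⟨-, Γ₁, h1, hP1⟩
  · simp [h, forkTerm_zero]
  rcases hP1.D_cases 0 j with h | ⟨-, Γ₂, h2, hP2⟩
  · simp [h, forkTerm_zero]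
  rcases hP2.D_cases 0 i with h | ⟨-, Γ₃, h3', hP3⟩
  · simp [h, forkTerm_zero]
  by_cases hn : NoCollapse (contr i j) Γ₃
  swap
  · rw [hP3.relabel_eq_zero hn, forkTerm_zero, map_zero]
  refine ((hP3.relabel _).forkTerm _).pair_eq_zero (hx _ ?_ ?_)
  · exact isApex_attach (hap.contract_contr hj hij (R := Multigraph.single 0 i + Multigraph.single 0 j)
      (by rw [h1, h2, h3']; abel) hn)
  · have hm : mult Γ i j ≠ 0 := by rw [h1, mult_add, mult_single hij]; simp
    have hli : IsLarge Γ i := isLarge_of_not_isFork hj (h3 i) (by rwa [mult_comm]) hfi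
    refine numLarge_attach_lt hj (isLarge_of_not_isFork hi (h3 j) hm hfj) fun v hv hl => ?_
    by_cases hvi : v = contr i j i
    · have : j.succAbove v = i := by
        obtain ⟨w, rfl⟩ := Fin.exists_succAbove_eq hij
        rw [hvi, contr_succAbove]
      rwa [this]
    · have hv0 : j.succAbove v ≠ 0 := Fin.succAbove_ne_zero hj hv
      have hvi' : j.succAbove v ≠ i := by
        rintro rfl; rw [contr_succAbove] at hvi; exact hvi rfl
      have hvj : j.succAbove v ≠ j := Fin.succAbove_ne j v
      have h0i : (0 : Fin (n + 1)) ≠ contr i j i := fun h =>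
        hi ((contr_eq_zero_iff hj hij).mp h.symm)
      unfold IsLarge at hl ⊢
      rw [mult_attach_castSucc, valence_attach_castSucc _ _ hv, mult_contract_contr hij hn,
        valence_contract_contr hij hn, Fin.succAbove_ne_zero_zero hj] at hl
      simp only [hvi, h0i, if_false, add_zero] at hl
      rw [h1, h2, h3']
      simp only [mult_add, valence_add, mult_single_zero_left hi.symm hv0,
        mult_single_zero_left hj.symm hv0, mult_single_zero_of_ne hi hj hij,
        valence_single hij, valence_single hi.symm, valence_single hj.symm, hv0, hvi', hvj, if_false]
      omega

/-- If `j` is a fork, the new fork replaces the contracted one, and the correction term is a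
multiple of `P` with its vertices relabelled. -/
theorem pair_edgeTerm_of_isFork {i j : Fin (n + 2)} (hi : i ≠ 0) (hj : j ≠ 0) (hij : i ≠ j)
    (hP : IsMono Γ P) (hx : IsAntisymm x) (hm : mult Γ i j ≠ 0) (hf : IsFork Γ j) :
    (-1 : ℤ) ^ (j : ℕ) • pair x (edgeTerm i j P) =
      (-1 : ℤ) ^ (n + 1) • (mult Γ 0 i * mult Γ 0 j) • pair x P := by
  unfold edgeTerm
  have key := mult_add_mult_le_valence Γ j hi
  have hm1 : mult Γ i j = 1 := by have := hf.1; have := hf.2; omega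
  rw [hf.1]
  obtain ⟨Γ₁, rfl⟩ := exists_eq_add_single hm
  have hm0 : mult Γ₁ 0 j = 2 := by
    have := hf.1
    rwa [mult_add, mult_single_zero_of_ne hi hj hij, add_zero] at this
  obtain ⟨Γ₂, rfl⟩ := exists_eq_add_single (Γ := Γ₁) (i := 0) (j := j) (by omega)
  have hm0' : mult Γ₂ 0 j = 1 := by
    rw [mult_add, mult_single_zero_left hj.symm hj, if_pos rfl] at hm0; omega
  obtain ⟨Γ₃, rfl⟩ := exists_eq_add_single (Γ := Γ₂) (i := 0) (j := j) (by omega)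
  have hP1 := hP.D_add_single
  have hP2 := hP1.D_add_single
  have hP3 := hP2.D_add_single
  have hv : valence Γ₃ j = 0 := by
    have := hf.2
    simp only [valence_add, valence_single hij, valence_single hj.symm, if_true] at this
    omega
  set Q := D 0 j (D 0 j (D i j P)) with hQ
  have e1 : e i j * D i j P = P := by rw [hP.e_mul_D, hm1, one_smul]
  have e2 : e 0 j * D 0 j (D i j P) = 2 • D i j P := by rw [hP1.e_mul_D, hm0]
  have e3 : e 0 j * Q = D 0 j (D i j P) := by rw [hQ, hP2.e_mul_D, hm0', one_smul]
  have hP2Q : (2 : ℕ) • P = e i j * e 0 j ^ 2 * Q := by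
    rw [sq, mul_assoc, mul_assoc, e3, e2, mul_smul_comm, e1]
  have hκj : contr i j j = contr i j i := contr_same hij
  have hmi : mult Γ₃ 0 i = mult (Γ₃ + Multigraph.single 0 j + Multigraph.single 0 j + Multigraph.single i j) 0 i := by
    simp [mult_add, mult_single_zero_of_ne hi hj hij, mult_single_zero_left hj.symm hi, hij]
  have hD : relabel (contr i j) (D 0 i (D 0 j (D i j P))) =
      mult (Γ₃ + Multigraph.single 0 j + Multigraph.single 0 j + Multigraph.single i j) 0 i • relabel (contr i j) Q := by
    have : D 0 i (e 0 j : Gra A (n + 2)) = 0 := by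
      rw [D_e]; simp [hij, hi]
    rw [← e3, D_mul, this, zero_mul, zero_add, map_mul, relabel_e, hκj, ← relabel_e, ← map_mul,
      hP3.e_mul_D, map_nsmul, hmi]
  have hρ : (2 : ℕ) • relabel (slide j) P = forkTerm (contr i j i) (relabel (contr i j) Q) := by
    have h0 : slide j 0 = 0 := by
      rw [slide_of_ne (i := i) hj.symm, contr_zero hj, Fin.castSucc_zero]
    have hcong : relabel (slide j) Q = relabel (Fin.castSucc ∘ contr i j) Q := by
      refine hP3.relabel_congr fun t ht => ?_
      have htj : t ≠ j := fun h => ht (by rw [h]; exact hv)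
      exact slide_of_ne htj
    rw [← map_nsmul, hP2Q, map_mul, map_mul, map_pow, relabel_e, relabel_e, slide_same,
      slide_of_ne (i := i) hij, h0, forkTerm, relabel_relabel, hcong]
  rw [hD, forkTerm_nsmul, ← hρ, smul_smul, map_nsmul, hx.pair_relabel, sign_slide, sign_cancel]

/-- The correction term is antisymmetric under the exchange of the two ends of the edge. -/
theorem edgeTerm_swap {i j : Fin (n + 2)} (hi : i ≠ 0) (hj : j ≠ 0) (hij : i ≠ j)
    (P : Gra A (n + 2)) : edgeTerm i j (relabel (swap i j) P) = -edgeTerm i j P := by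
  have h0 : (swap i j).symm 0 = 0 := by
    rw [Equiv.symm_swap, swap_apply_of_ne_of_ne hi.symm hj.symm]
  have hκ : contr i j ∘ swap i j = contr i j := by
    funext t
    by_cases h1 : t = i
    · rw [h1, Function.comp_apply, swap_apply_left, contr_same hij]
    by_cases h2 : t = j
    · rw [h2, Function.comp_apply, swap_apply_right, contr_same hij]
    · rw [Function.comp_apply, swap_apply_of_ne_of_ne h1 h2]
  unfold edgeTerm
  rw [D_relabel_perm, D_relabel_perm, D_relabel_perm, relabel_relabel, hκ, h0, Equiv.symm_swap,
    swap_apply_left, swap_apply_right, D_swap i j, map_neg, map_neg, map_neg, D_comm 0 j 0 i,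
    forkTerm_neg]

open Classical in
/-- The coefficient contributed by an edge one end of which is a fork. -/
def edgeWeight (Γ : Multigraph (n + 2)) (i j : Fin (n + 2)) : ℕ :=
  if mult Γ i j ≠ 0 ∧ (IsFork Γ i ∨ IsFork Γ j) then mult Γ 0 i * mult Γ 0 j else 0

/-- The correction term of an edge, up to graphs with fewer large vertices, is a multiple of `P`. -/
theorem pair_edgeTerm {i j : Fin (n + 2)} (hi : i ≠ 0) (hj : j ≠ 0) (hij : i ≠ j)
    (hP : IsMono Γ P) (hxa : IsAntisymm x) (hap : IsApex Γ 0) (h3 : ∀ v, 3 ≤ valence Γ v)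
    (hx : ∀ Γ', IsApex Γ' 0 → numLarge Γ' < numLarge Γ → MvPolynomial.coeff Γ' x = 0) :
    (-1 : ℤ) ^ (j : ℕ) • pair x (edgeTerm i j P) =
      (-1 : ℤ) ^ (n + 1) • edgeWeight Γ i j • pair x P := by
  unfold edgeWeight
  by_cases hm : mult Γ i j = 0
  · simp [edgeTerm, hP.D_eq_zero hm, forkTerm_zero, hm]
  by_cases hfj : IsFork Γ j
  · rw [if_pos ⟨hm, Or.inr hfj⟩]
    exact pair_edgeTerm_of_isFork hi hj hij hP hxa hm hfj
  by_cases hfi : IsFork Γ i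
  · rw [if_pos ⟨hm, Or.inl hfi⟩]
    set τ : Perm (Fin (n + 2)) := swap i j with hτ
    have h0 : τ 0 = 0 := swap_apply_of_ne_of_ne hi.symm hj.symm
    have hi' : τ i = j := swap_apply_left _ _
    have hj' : τ j = i := swap_apply_right _ _
    have hmi : mult (contract τ Γ) 0 j = mult Γ 0 i := by
      have := mult_contract_perm τ Γ 0 i; rwa [h0, hi'] at this
    have hmj : mult (contract τ Γ) 0 i = mult Γ 0 j := by
      have := mult_contract_perm τ Γ 0 j; rwa [h0, hj'] at this
    have h := pair_edgeTerm_of_isFork hi hj hij (hP.relabel τ) hxa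
      (by
        have := mult_contract_perm τ Γ j i
        rw [hi', hj', mult_comm Γ] at this
        rwa [this])
      ⟨by rw [hmi]; exact hfi.1, by
        have := valence_contract_perm τ Γ i
        rw [hi'] at this
        rw [this]; exact hfi.2⟩
    rw [hxa.pair_relabel, hτ, edgeTerm_swap hi hj hij, Perm.sign_swap hij, ← hτ, hmi, hmj, map_neg] at h
    simp only [smul_neg, Units.val_neg, Units.val_one, neg_smul, one_smul, neg_inj] at h
    rw [h, mul_comm]
  · rw [pair_edgeTerm_eq_zero hi hj hij hP hap h3 hx hfi hfj, if_neg (by tauto)]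
    simp

/-- The correction term in which the contraction of the edge between `0` and `j` has turned an edge
between `j` and `q` into one of the two edges that the fork takes from `q`. The contracted vertex
`j` is large, because it has only one edge to `0`, so that the correction term has fewer large
vertices. -/
theorem pair_zeroEdgeTerm_eq_zero {j q : Fin (n + 2)} {v : Fin (n + 1)} (hj : j ≠ 0) (hq : q ≠ 0)
    (hqv : j.succAbove v = q)
    (hP : IsMono Γ P) (hap : IsApex Γ 0) (h3 : ∀ v, 3 ≤ valence Γ v)
    (hx : ∀ Γ', IsApex Γ' 0 → numLarge Γ' < numLarge Γ → MvPolynomial.coeff Γ' x = 0) :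
    pair x (forkTerm v (relabel (contr 0 j) (D 0 q (D j q (D 0 j P))))) = 0 := by
  have hjq : j ≠ q := by rw [← hqv]; exact (Fin.succAbove_ne j v).symm
  rcases hP.D_cases 0 j with h | ⟨-, Γ₁, h1, hP1⟩
  · simp [h, forkTerm_zero]
  rcases hP1.D_cases j q with h | ⟨-, Γ₂, h2, hP2⟩
  · simp [h, forkTerm_zero]
  rcases hP2.D_cases 0 q with h | ⟨-, Γ₃, h3', hP3⟩
  · simp [h, forkTerm_zero]
  by_cases hn : NoCollapse (contr 0 j) Γ₃
  swap
  · rw [hP3.relabel_eq_zero hn, forkTerm_zero, map_zero]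
  refine ((hP3.relabel _).forkTerm _).pair_eq_zero (hx _ ?_ ?_)
  · exact isApex_attach (hap.contract_contr hj hj.symm
      (R := Multigraph.single 0 q + Multigraph.single j q) (by rw [h1, h2, h3']; abel) hn)
  · have h0j : mult Γ₃ 0 j = 0 := hn 0 j (contr_same hj.symm).symm
    have hlj : IsLarge Γ j := by
      have hm : mult Γ 0 j = 1 := by
        rw [h1, h2, h3']
        simp only [mult_add, mult_single_zero_left hj.symm hj, mult_single_zero_left hq.symm hj,
          mult_single_zero_of_ne hj hq hjq, hjq, if_true, if_false, h0j]
      have := h3 j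
      unfold IsLarge
      omega
    refine numLarge_attach_lt hj hlj fun u hu hl => ?_
    have hu0 : j.succAbove u ≠ 0 := Fin.succAbove_ne_zero hj hu
    have huj : j.succAbove u ≠ j := Fin.succAbove_ne j u
    have huv : u = v ↔ j.succAbove u = q := by rw [← hqv, Fin.succAbove_right_inj]
    have hc0 : contr 0 j 0 = 0 := contr_zero hj
    unfold IsLarge at hl ⊢
    rw [mult_attach_castSucc, valence_attach_castSucc _ _ hu, mult_contract_contr hj.symm hn,
      valence_contract_contr hj.symm hn, Fin.succAbove_ne_zero_zero hj, hc0] at hl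
    simp only [hu, if_false, if_true, add_zero] at hl
    rw [h1, h2, h3']
    simp only [mult_add, valence_add, mult_single_zero_left hj.symm hu0,
      mult_single_zero_left hq.symm hu0, mult_single_zero_of_ne hj hq hjq, valence_single hjq,
      valence_single hj.symm, valence_single hq.symm, hu0, huj, if_false, huv] at hl ⊢
    split_ifs at hl ⊢ <;> omega

/-- There are no double edges in the complement of the apex. -/
theorem D_D_eq_zero {j q : Fin (n + 2)} (hj : j ≠ 0) (hq : q ≠ 0) (hjq : j ≠ q)
    (hP : IsMono Γ P) (hap : IsApex Γ 0) : D j q (D j q (D 0 j P)) = 0 := by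
  have hm : mult Γ j q ≤ 1 := by
    have := hap {j, q} (by simp) (by simp [hj.symm, hq.symm])
    rw [Finset.card_pair hjq, twoEdges, Finset.sum_pair hjq, Finset.sum_pair hjq,
      Finset.sum_pair hjq, mult_comm Γ q j] at this
    omega
  rcases hP.D_cases 0 j with h | ⟨-, Γ₁, rfl, hP1⟩
  · simp [h]
  rcases hP1.D_cases j q with h | ⟨-, Γ₂, rfl, hP2⟩
  · simp [h]
  refine hP2.D_eq_zero ?_
  rw [mult_add, mult_add, mult_single hjq] at hm
  simp at hm
  omega

/-- The correction term that comes from the fork attached to `j` when another edge between `0` and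
`j` is contracted. Unless `j` has no edges other than three to `0`, it is large and the correction
term has fewer large vertices. -/
theorem pair_tripleTerm_eq_zero {j : Fin (n + 2)} (hj : j ≠ 0)
    (hP : IsMono Γ P) (hap : IsApex Γ 0) (h3 : ∀ v, 3 ≤ valence Γ v)
    (hx : ∀ Γ', IsApex Γ' 0 → numLarge Γ' < numLarge Γ → MvPolynomial.coeff Γ' x = 0)
    (hf : ¬ IsTriple Γ j) :
    pair x (forkTerm 0 (relabel (contr 0 j) (D 0 j (D 0 j (D 0 j P))))) = 0 := by
  rcases hP.D_cases 0 j with h | ⟨-, Γ₁, h1, hP1⟩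
  · simp [h, forkTerm_zero]
  rcases hP1.D_cases 0 j with h | ⟨-, Γ₂, h2, hP2⟩
  · simp [h, forkTerm_zero]
  rcases hP2.D_cases 0 j with h | ⟨-, Γ₃, h3', hP3⟩
  · simp [h, forkTerm_zero]
  by_cases hn : NoCollapse (contr 0 j) Γ₃
  swap
  · rw [hP3.relabel_eq_zero hn, forkTerm_zero, map_zero]
  refine ((hP3.relabel _).forkTerm _).pair_eq_zero (hx _ ?_ ?_)
  · exact isApex_attach (hap.contract_contr hj hj.symm
      (R := Multigraph.single 0 j + Multigraph.single 0 j) (by rw [h1, h2, h3']; abel) hn)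
  · have h0j : mult Γ₃ 0 j = 0 := hn 0 j (contr_same hj.symm).symm
    have hlj : IsLarge Γ j := by
      have hm : mult Γ 0 j = 3 := by
        rw [h1, h2, h3']
        simp only [mult_add, mult_single_zero_left hj.symm hj, if_true, h0j]
      have := h3 j
      unfold IsTriple at hf
      unfold IsLarge
      omega
    refine numLarge_attach_lt hj hlj fun u hu hl => ?_
    have hu0 : j.succAbove u ≠ 0 := Fin.succAbove_ne_zero hj hu
    have huj : j.succAbove u ≠ j := Fin.succAbove_ne j u
    have hc0 : contr 0 j 0 = 0 := contr_zero hj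
    unfold IsLarge at hl ⊢
    rw [mult_attach_castSucc, valence_attach_castSucc _ _ hu, mult_contract_contr hj.symm hn,
      valence_contract_contr hj.symm hn, Fin.succAbove_ne_zero_zero hj, hc0] at hl
    simp only [hu, if_false, if_true, add_zero] at hl
    rw [h1, h2, h3']
    simp only [mult_add, valence_add, mult_single_zero_left hj.symm hu0,
      valence_single hj.symm, hu0, huj, if_false]
    omega

/-- If `j` has no edges other than three to `0`, the correction term is a multiple of `P` with its
vertices relabelled. -/
theorem pair_tripleTerm_of_isTriple {j : Fin (n + 2)} (hj : j ≠ 0)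
    (hP : IsMono Γ P) (hx : IsAntisymm x) (hf : IsTriple Γ j) :
    (-1 : ℤ) ^ (j : ℕ) • pair x (forkTerm 0 (relabel (contr 0 j) (D 0 j (D 0 j (D 0 j P))))) =
      (-1 : ℤ) ^ (n + 1) • (6 : ℕ) • pair x P := by
  obtain ⟨hm, hv⟩ := hf
  obtain ⟨Γ₁, rfl⟩ := exists_eq_add_single (Γ := Γ) (i := 0) (j := j) (by omega)
  have hm1 : mult Γ₁ 0 j = 2 := by
    rw [mult_add, mult_single_zero_left hj.symm hj, if_pos rfl] at hm; omega
  obtain ⟨Γ₂, rfl⟩ := exists_eq_add_single (Γ := Γ₁) (i := 0) (j := j) (by omega)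
  have hm2 : mult Γ₂ 0 j = 1 := by
    rw [mult_add, mult_single_zero_left hj.symm hj, if_pos rfl] at hm1; omega
  obtain ⟨Γ₃, rfl⟩ := exists_eq_add_single (Γ := Γ₂) (i := 0) (j := j) (by omega)
  have hP1 := hP.D_add_single
  have hP2 := hP1.D_add_single
  have hP3 := hP2.D_add_single
  have hv3 : valence Γ₃ j = 0 := by
    simp only [valence_add, valence_single hj.symm, if_true] at hv
    omega
  set Q := D 0 j (D 0 j (D 0 j P)) with hQ
  have e1 : e 0 j * D 0 j P = 3 • P := by rw [hP.e_mul_D, hm]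
  have e2 : e 0 j * D 0 j (D 0 j P) = 2 • D 0 j P := by rw [hP1.e_mul_D, hm1]
  have e3 : e 0 j * Q = D 0 j (D 0 j P) := by rw [hQ, hP2.e_mul_D, hm2, one_smul]
  have hPQ : (6 : ℕ) • P = e 0 j * e 0 j ^ 2 * Q := by
    rw [sq, mul_assoc, mul_assoc, e3, e2, mul_smul_comm, e1, smul_smul]
    norm_num
  have h0 : slide j 0 = 0 := by
    rw [slide_of_ne (i := 0) hj.symm, contr_zero hj, Fin.castSucc_zero]
  have hρ : (6 : ℕ) • relabel (slide j) P = forkTerm 0 (relabel (contr 0 j) Q) := by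
    have hcong : relabel (slide j) Q = relabel (Fin.castSucc ∘ contr 0 j) Q := by
      refine hP3.relabel_congr fun t ht => ?_
      have htj : t ≠ j := fun h => ht (by rw [h]; exact hv3)
      exact slide_of_ne htj
    rw [← map_nsmul, hPQ, map_mul, map_mul, map_pow, relabel_e, slide_same, h0, forkTerm,
      relabel_relabel, hcong, Fin.castSucc_zero]
  rw [← hρ, map_nsmul, hx.pair_relabel, sign_slide, sign_cancel]

end Evaluate

open Multigraph

section Eigenvalue

variable {A : Type*} [CommRing A] [Algebra ℚ A] {n : ℕ}

set_option linter.unusedSectionVars false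

/-! ### The homotopy acts diagonally up to graphs with fewer large vertices -/

theorem IsApex.of_add {N : ℕ} {Γ R : Multigraph N} {v : Fin N} (h : IsApex (Γ + R) v) : IsApex Γ v := by
  intro T hT hv
  have := h T hT hv
  rw [twoEdges_add] at this
  omega

theorem exists_of_mem_support_pull {Γ : Multigraph (n + 1)} {P : Gra A (n + 1)} (hP : IsMono Γ P)
    {Γ' : Multigraph (n + 2)} (h : Γ' ∈ (pull P).support) :
    ∃ w Γ₀, 0 ≠ w ∧ Γ = Γ₀ + 2 • Multigraph.single 0 w ∧ Γ' = attach w Γ₀ := by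
  classical
  rw [pull_apply] at h
  obtain ⟨w, -, h⟩ := Finset.mem_biUnion.mp (MvPolynomial.support_sum (Finsupp.support_smul h))
  rcases hP.D_cases 0 w with h1 | ⟨hne, Γ₁, rfl, h1⟩
  · simp [h1, forkTerm_zero] at h
  rcases h1.D_cases 0 w with h2 | ⟨-, Γ₂, rfl, h2⟩
  · simp [h2, forkTerm_zero] at h
  exact ⟨w, Γ₂, hne, by rw [two_smul, add_assoc], (h2.forkTerm w).mem_support h⟩

open Classical in
/-- The factor by which the differential of the homotopy acts on `Γ`. -/
def eigenvalue (Γ : Multigraph (n + 2)) : ℕ :=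
  ∑ w, (if IsTriple Γ w then 0 else (mult Γ 0 w).choose 2) +
    ∑ j, ∑ i with i < j, if i = 0 then 0 else edgeWeight Γ i j

variable {Γ : Multigraph (n + 2)} {P x : Gra A (n + 2)}

/-- Contracting an edge that is not at `0` commutes with pulling out forks up to the contribution of
the edge to the eigenvalue and graphs with fewer large vertices. -/
theorem pair_pull_contr (hP : IsMono Γ P) (hxa : IsAntisymm x) (hap : IsApex Γ 0)
    (h3 : ∀ v, 3 ≤ valence Γ v)
    (hx : ∀ Γ', IsApex Γ' 0 → numLarge Γ' < numLarge Γ → MvPolynomial.coeff Γ' x = 0)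
    {i j : Fin (n + 2)} (hi : i ≠ 0) (hj : j ≠ 0) (hij : i ≠ j) :
    (-1 : ℤ) ^ (j : ℕ) • pair x (pull (relabel (contr i j) (D i j P))) =
      contractTerm x (pull P) i.castSucc j.castSucc +
        (-1 : ℤ) ^ (n + 1) • edgeWeight Γ i j • pair x P := by
  rw [pull_relabel_contr hj hi hij, map_add, smul_add, contractTerm, D_pull, Fin.val_castSucc,
    ← pair_edgeTerm hi hj hij hP hxa hap h3 hx]
  rfl

open Classical in
/-- Contracting an edge at `0` commutes with pulling out forks, up to graphs with fewer large
vertices and up to the vertices with a triple edge to `0`. -/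
theorem pair_pull_contr_zero (hP : IsMono Γ P) (hxa : IsAntisymm x) (hap : IsApex Γ 0)
    (h3 : ∀ v, 3 ≤ valence Γ v)
    (hx : ∀ Γ', IsApex Γ' 0 → numLarge Γ' < numLarge Γ → MvPolynomial.coeff Γ' x = 0)
    {j : Fin (n + 2)} (hj : j ≠ 0) :
    (-1 : ℤ) ^ (j : ℕ) • pair x (pull (relabel (contr 0 j) (D 0 j P))) =
      contractTerm x (pull P) (0 : Fin (n + 2)).castSucc j.castSucc -
        (-1 : ℤ) ^ (n + 1) • (if IsTriple Γ j then 3 else 0) • pair x P := by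
  rw [pull_relabel_contr_zero hj, contractTerm, D_pull, Fin.val_castSucc]
  have h1 : ∀ u : Fin n, forkTerm u.succ (relabel (contr 0 j)
        (D j (j.succAbove u.succ) (D j (j.succAbove u.succ) (D 0 j P)))) = 0 := by
    intro u
    rw [D_D_eq_zero hj (Fin.succAbove_ne_zero hj (Fin.succ_ne_zero u)) (Fin.succAbove_ne j _).symm
      hP hap, map_zero, forkTerm_zero]
  have h2 : ∀ u : Fin n, pair x (forkTerm u.succ (relabel (contr 0 j)
        (D 0 (j.succAbove u.succ) (D j (j.succAbove u.succ) (D 0 j P))))) = 0 := fun u =>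
    pair_zeroEdgeTerm_eq_zero hj (Fin.succAbove_ne_zero hj (Fin.succ_ne_zero u)) rfl hP hap h3 hx
  have h3' : (-1 : ℤ) ^ (j : ℕ) • pair x (forkTerm 0 (relabel (contr 0 j)
      (D 0 j (D 0 j (D 0 j P))))) = (-1 : ℤ) ^ (n + 1) •
        (if IsTriple Γ j then 6 else 0) • pair x P := by
    split_ifs with ht
    · exact pair_tripleTerm_of_isTriple hj hP hxa ht
    · rw [pair_tripleTerm_eq_zero hj hP hap h3 hx ht]; simp
  simp only [h1, smul_zero, add_zero, map_sub, map_add, map_sum, h2, Finset.sum_const_zero]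
  rw [LinearMap.map_smul_of_tower, smul_sub, smul_comm _ (2⁻¹ : ℚ), h3', smul_comm (2⁻¹ : ℚ)]
  congr 2
  rw [← Nat.cast_smul_eq_nsmul ℚ, ← Nat.cast_smul_eq_nsmul ℚ, smul_smul]
  congr 1
  split_ifs <;> norm_num

/-- The pairs of vertices consist of the pairs of old vertices and the pairs with the new last one.
-/
theorem sum_sum_lt_castSucc {B : Type*} [AddCommMonoid B] {N : ℕ} (G : Fin (N + 1) → Fin (N + 1) → B) :
    ∑ j, ∑ i with i < j, G i j = ∑ j : Fin N, ∑ i with i < j, G i.castSucc j.castSucc +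
      ∑ u : Fin N, G u.castSucc (Fin.last N) := by
  rw [Fin.sum_univ_castSucc]
  congr 1
  · refine Finset.sum_congr rfl fun j _ => ?_
    rw [Finset.sum_filter, Finset.sum_filter, Fin.sum_univ_castSucc]
    simp [(Fin.castSucc_lt_last j).not_gt]
  · rw [Finset.sum_filter, Fin.sum_univ_castSucc]
    simp [Fin.castSucc_lt_last]

theorem two_le_valence_attach {w : Fin (n + 1)} {Γ : Multigraph (n + 1)} (hw : 0 ≠ w)
    (h3 : ∀ v, 3 ≤ valence (Γ + 2 • Multigraph.single 0 w) v) (v : Fin (n + 2)) :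
    2 ≤ valence (attach w Γ) v := by
  refine Fin.lastCases ?_ (fun v => ?_) v
  · rw [valence_attach_last]; omega
  · by_cases hv : v = 0
    · subst hv
      have h1 := mult_attach_last w Γ
      have h2 := mult_le_valence (attach w Γ) 0 (Fin.last (n + 1))
      rw [Fin.castSucc_zero]
      omega
    · have := h3 v
      rw [valence_add, valence_smul, valence_single hw, if_neg hv] at this
      rw [valence_attach_castSucc _ _ hv]
      split_ifs at this ⊢ <;> omega

/-- The key identity. Let `y` be minus the adjoint of pulling out forks, applied to `x`, on the
graphs that arise from `P` by contracting an edge. Then the differential of `y` at `P` is the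
eigenvalue times `x`: contracting an old edge in `pull P` is the same as pulling out forks after
contracting it in `P`, up to the edges with a fork at one end, and contracting the new edge of a
fork gives back `P`, in as many ways as there are pairs of edges between `0` and another vertex. A
vertex with a triple edge to `0` contributes `3` in the latter way and `-3` by the contraction of
its edges to `0`. -/
theorem pair_split_homotopy (hP : IsMono Γ P) (hxa : IsAntisymm x) (hap : IsApex Γ 0)
    (h3 : ∀ v, 3 ≤ valence Γ v)
    (hx : ∀ Γ', IsApex Γ' 0 → numLarge Γ' < numLarge Γ → MvPolynomial.coeff Γ' x = 0)
    (hcl : pair (split x) (pull P) = 0) {y : Gra A (n + 1)} (hya : IsAntisymm y)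
    (hy : ∀ i j, i ≠ j → j ≠ 0 → pair y (relabel (contr i j) (D i j P)) =
      -pair x (pull (relabel (contr i j) (D i j P)))) :
    pair (split y) P = eigenvalue Γ • pair x P := by
  classical
  set X := pair x P with hX
  set W : Fin (n + 2) → Fin (n + 2) → ℤ := fun i j =>
    if i = 0 then (if IsTriple Γ j then -3 else 0) else edgeWeight Γ i j with hW
  have hterm : ∀ j, ∀ i ∈ univ.filter (· < j), contractTerm y P i j =
      -contractTerm x (pull P) i.castSucc j.castSucc - (-1 : ℤ) ^ (n + 1) • W i j • X := by
    intro j i hi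
    have hij : i < j := (Finset.mem_filter.mp hi).2
    have hj : j ≠ 0 := (lt_of_le_of_lt (Fin.zero_le i) hij).ne'
    rw [contractTerm, hy i j hij.ne hj, smul_neg]
    by_cases hi0 : i = 0
    · subst hi0
      rw [pair_pull_contr_zero hP hxa hap h3 hx hj, hW]
      simp only [if_true]
      split_ifs
      · rw [neg_smul, smul_neg]; norm_num [ofNat_smul_eq_nsmul]; abel
      · simp
    · rw [pair_pull_contr hP hxa hap h3 hx hi0 hj hij.ne, hW]
      simp only [hi0, if_false, natCast_zsmul]
      abel
  have hwP : ∀ Γ' ∈ P.support, ∀ v, 2 ≤ valence Γ' v := fun Γ' hΓ' v => by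
    rw [hP.mem_support hΓ']; exact le_trans (by norm_num) (h3 v)
  have hwpull : ∀ Γ' ∈ (pull P).support, ∀ v, 2 ≤ valence Γ' v := fun Γ' hΓ' v => by
    obtain ⟨w, Γ₀, hw, rfl, rfl⟩ := exists_of_mem_support_pull hP hΓ'
    exact two_le_valence_attach hw h3 v
  -- The vanishing of the differential of `x` at `pull P` relates the contractions of old edges in
  -- `pull P` to those of the new edges of the forks.
  rw [pair_split hxa hwpull, sum_sum_lt_castSucc] at hcl
  have hlast : ∑ u : Fin (n + 2), contractTerm x (pull P) u.castSucc (Fin.last (n + 2)) =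
      (-1 : ℤ) ^ (n + 2) • (∑ w, (mult Γ 0 w).choose 2) • X := by
    simp only [contractTerm, Fin.val_last, ← Finset.smul_sum, ← map_sum]
    rw [sum_contr_last_pull hP, map_nsmul]
  rw [hlast] at hcl
  have hcl' := congrArg (fun z => (-1 : ℤ) ^ (n + 1) • z) hcl
  simp only [smul_smul, ← pow_add, Even.neg_one_pow ⟨n + 1, rfl⟩, one_smul, smul_zero] at hcl'
  have hS := eq_neg_of_add_eq_zero_left hcl'
  rw [pair_split hya hwP, Finset.sum_congr rfl fun j _ => Finset.sum_congr rfl (hterm j)]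
  simp only [Finset.sum_sub_distrib, Finset.sum_neg_distrib, hS, neg_neg, ← Finset.smul_sum,
    ← Finset.sum_smul]
  have hWsum : ((∑ w, (mult Γ 0 w).choose 2 : ℕ) : ℤ) + ∑ j, ∑ i with i < j, W i j =
      (eigenvalue Γ : ℤ) := by
    have h0 : ¬ IsTriple Γ 0 := fun h => by have := h.1; rw [mult_self] at this; omega
    have hj : ∀ j, ∑ i with i < j, W i j = (if IsTriple Γ j then -3 else 0) +
        ((∑ i with i < j, if i = 0 then 0 else edgeWeight Γ i j : ℕ) : ℤ) := by
      intro j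
      have hsplit : ∀ i, W i j = (if i = 0 then (if IsTriple Γ j then -3 else 0) else 0) +
          ((if i = 0 then 0 else edgeWeight Γ i j : ℕ) : ℤ) := by
        intro i; simp only [hW]; split_ifs <;> simp
      rw [Finset.sum_congr rfl fun i _ => hsplit i, Finset.sum_add_distrib, Nat.cast_sum]
      congr 1
      rw [Finset.sum_ite_eq']
      by_cases hj0 : j = 0
      · subst hj0; simp [h0]
      · have : (0 : Fin (n + 2)) < j := Fin.pos_iff_ne_zero.mpr hj0
        simp [this]
    rw [Finset.sum_congr rfl fun j _ => hj j, Finset.sum_add_distrib, eigenvalue, Nat.cast_add,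
      ← Nat.cast_sum, Nat.cast_sum, ← add_assoc, ← Finset.sum_add_distrib]
    congr 1
    rw [Nat.cast_sum]
    refine Finset.sum_congr rfl fun w _ => ?_
    split_ifs with ht
    · rw [ht.1]; simp [Nat.choose]
    · simp
  rw [← natCast_zsmul X (eigenvalue Γ), ← hWsum, add_smul, natCast_zsmul, smul_sub, smul_smul,
    smul_smul, ← pow_add, ← pow_add]
  rw [show n + (n + 2) = 2 * (n + 1) by ring, show n + (n + 1) = 2 * n + 1 by ring, pow_succ, pow_mul,
    pow_mul]
  simp

end Eigenvalue

open Multigraph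

section Coefficients

variable {A : Type*} [CommRing A] [Algebra ℚ A] {N L : ℕ}

set_option linter.unusedSectionVars false

/-! ### Rational coefficients -/

variable (A N) in
/-- The elements with rational coefficients. -/
def rational : Subalgebra ℚ (Gra A N) where
  carrier := {x | ∀ Γ, MvPolynomial.coeff Γ x ∈ (⊥ : Subalgebra ℚ A)}
  mul_mem' hx hy Γ := by
    classical
    rw [MvPolynomial.coeff_mul]
    exact sum_mem fun p _ => mul_mem (hx _) (hy _)
  add_mem' hx hy Γ := by
    rw [MvPolynomial.coeff_add]; exact add_mem (hx _) (hy _)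
  algebraMap_mem' q Γ := by
    classical
    rw [MvPolynomial.algebraMap_apply, MvPolynomial.coeff_C]
    split_ifs
    · exact algebraMap_mem _ q
    · exact zero_mem _

theorem monomial_mem_rational (Γ : Multigraph N) {a : A} (ha : a ∈ (⊥ : Subalgebra ℚ A)) :
    MvPolynomial.monomial Γ a ∈ rational A N := by
  classical
  intro Γ'
  rw [MvPolynomial.coeff_monomial]
  split_ifs
  · exact ha
  · exact zero_mem _

theorem e_mem_rational (i j : Fin N) : e i j ∈ rational A N := by
  unfold e
  split_ifs
  · exact monomial_mem_rational _ (one_mem _)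
  · exact neg_mem (monomial_mem_rational _ (one_mem _))
  · exact zero_mem _

theorem algHom_mem_rational {F : Gra A N →ₐ[A] Gra A L}
    (hF : ∀ p, F (MvPolynomial.X p) ∈ rational A L) {x : Gra A N} (hx : x ∈ rational A N) :
    F x ∈ rational A L := by
  rw [x.as_sum, map_sum]
  refine sum_mem fun Γ _ => ?_
  rw [MvPolynomial.monomial_eq, map_mul, Finsupp.prod, map_prod, ← MvPolynomial.algebraMap_eq,
    AlgHom.commutes]
  refine mul_mem (monomial_mem_rational _ (hx Γ)) (prod_mem fun p _ => ?_)
  rw [map_pow]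
  exact pow_mem (hF p) _

theorem relabel_mem_rational (φ : Fin N → Fin L) {x : Gra A N} (hx : x ∈ rational A N) :
    relabel φ x ∈ rational A L :=
  algHom_mem_rational (fun p => by rw [X_eq_e, relabel_e]; exact e_mem_rational _ _) hx

theorem expand_mem_rational (κ : Fin L → Fin N) {x : Gra A N} (hx : x ∈ rational A N) :
    expand κ x ∈ rational A L :=
  algHom_mem_rational (fun p => by
    rw [X_eq_e, expand_e _ p.2.ne]
    exact sum_mem fun i _ => sum_mem fun j _ => e_mem_rational _ _) hx

theorem D_mem_rational (i j : Fin N) {x : Gra A N} (hx : x ∈ rational A N) :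
    D i j x ∈ rational A N := by
  have key : ∀ {i j : Fin N}, i < j → D i j x ∈ rational A N := by
    intro i j h
    rw [D_eq_pderiv h, x.as_sum, map_sum]
    refine sum_mem fun Γ _ => ?_
    rw [MvPolynomial.pderiv_monomial]
    exact monomial_mem_rational _ (mul_mem (hx Γ) (natCast_mem _ _))
  rcases lt_trichotomy i j with h | h | h
  · exact key h
  · rw [h, D_self]; exact zero_mem _
  · rw [D_swap]; exact neg_mem (key h)

theorem pull_mem_rational {n : ℕ} {x : Gra A (n + 1)} (hx : x ∈ rational A (n + 1)) :
    pull x ∈ rational A (n + 2) := by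
  rw [pull_apply]
  refine Subalgebra.smul_mem _ (sum_mem fun w _ => ?_) _
  exact mul_mem (mul_mem (e_mem_rational _ _) (pow_mem (e_mem_rational _ _) 2))
    (relabel_mem_rational _ (D_mem_rational _ _ (D_mem_rational _ _ hx)))

theorem circ_mem_rational {M a L : ℕ} (h : M + a = L) {f : Gra A (a + 1)} {g : Gra A M}
    (hf : f ∈ rational A (a + 1)) (hg : g ∈ rational A M) : circ h f g ∈ rational A L := by
  rw [circ, insert_eq_collapse]
  refine Subalgebra.smul_mem _ (sum_mem fun σ _ => zsmul_mem (relabel_mem_rational _ ?_) _) _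
  exact mul_mem (expand_mem_rational _ hf) (relabel_mem_rational _ hg)

theorem pair_mem {S : Submodule ℚ A} {x P : Gra A N} (hx : ∀ Γ, MvPolynomial.coeff Γ x ∈ S)
    (hP : P ∈ rational A N) : pair x P ∈ S := by
  rw [P.as_sum, map_sum]
  refine sum_mem fun Γ _ => ?_
  obtain ⟨q, hq⟩ := Algebra.mem_bot.mp (hP Γ)
  rw [pair_monomial, ← hq, mul_assoc, mul_comm, ← map_natCast (algebraMap ℚ A), ← map_mul,
    ← Algebra.smul_def]
  exact S.smul_mem _ (hx Γ)

/-- Graph insertion has rational structure constants, so the coefficients of the product of series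
lie in the span of the products of their coefficients. -/
theorem coeff_circ_mem {S₁ S₂ S : Submodule ℚ A} (hS : ∀ a ∈ S₁, ∀ b ∈ S₂, a * b ∈ S)
    {M a L : ℕ} (h : M + a = L) {f : Gra A (a + 1)} {g : Gra A M}
    (hf : ∀ Γ, MvPolynomial.coeff Γ f ∈ S₁) (hg : ∀ Γ, MvPolynomial.coeff Γ g ∈ S₂)
    (Γ : Multigraph L) : MvPolynomial.coeff Γ (circ h f g) ∈ S := by
  have hmono : ∀ {N} (Γ : Multigraph N) (c : A),
      MvPolynomial.monomial Γ c = c • MvPolynomial.monomial Γ (1 : A) := by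
    intro N Γ c; rw [MvPolynomial.smul_monomial, smul_eq_mul, mul_one]
  have key : circ h f g = ∑ Γf ∈ f.support, ∑ Γg ∈ g.support,
      (MvPolynomial.coeff Γf f * MvPolynomial.coeff Γg g) •
        circ h (MvPolynomial.monomial Γf 1) (MvPolynomial.monomial Γg 1) := by
    conv_lhs => rw [f.as_sum, g.as_sum]
    simp only [circ, insert_eq_collapse, map_sum, Finset.sum_mul, Finset.mul_sum, symm_sum,
      Finset.smul_sum]
    rw [Finset.sum_comm]
    refine Finset.sum_congr rfl fun Γf _ => ?_
    refine Finset.sum_congr rfl fun Γg _ => ?_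
    rw [hmono Γf (MvPolynomial.coeff Γf f), hmono Γg (MvPolynomial.coeff Γg g), map_smul, map_smul,
      smul_mul_smul_comm, symm_smul, smul_comm]
  rw [key, MvPolynomial.coeff_sum]
  refine sum_mem fun Γf _ => ?_
  rw [MvPolynomial.coeff_sum]
  refine sum_mem fun Γg _ => ?_
  have hr : circ h (MvPolynomial.monomial Γf (1 : A)) (MvPolynomial.monomial Γg 1) ∈ rational A L :=
    circ_mem_rational h (monomial_mem_rational Γf (one_mem _)) (monomial_mem_rational Γg (one_mem _))
  obtain ⟨q, hq⟩ := Algebra.mem_bot.mp (hr Γ)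
  rw [MvPolynomial.coeff_smul, ← hq, smul_eq_mul, mul_comm, ← Algebra.smul_def]
  exact S.smul_mem _ (hS _ (hf _) _ (hg _))

theorem coeff_split_mem {S : Submodule ℚ A} {a : ℕ} {y : Gra A (a + 1)}
    (hy : ∀ Γ, MvPolynomial.coeff Γ y ∈ S) (Γ : Multigraph (a + 2)) :
    MvPolynomial.coeff Γ (split y) ∈ S := by
  have he : ∀ Γ : Multigraph 2, MvPolynomial.coeff Γ (e 0 1 : Gra A 2) ∈
      Subalgebra.toSubmodule (⊥ : Subalgebra ℚ A) := e_mem_rational (0 : Fin 2) 1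
  have hS : ∀ a ∈ S, ∀ q ∈ Subalgebra.toSubmodule (⊥ : Subalgebra ℚ A), a * q ∈ S := by
    intro a ha q hq
    obtain ⟨q, rfl⟩ := Algebra.mem_bot.mp hq
    rw [mul_comm, ← Algebra.smul_def]
    exact S.smul_mem _ ha
  rw [split, MvPolynomial.coeff_sub]
  refine sub_mem (coeff_circ_mem (fun q hq a ha => ?_) _ he hy Γ) ?_
  · rw [mul_comm]; exact hS a ha q hq
  · rw [← MvPolynomial.lcoeff_apply A, map_zsmul]
    exact zsmul_mem (coeff_circ_mem hS _ hy he Γ) _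

end Coefficients

open Multigraph

section Homotopy

variable {A : Type*} [CommRing A] [Algebra ℚ A] {n : ℕ}

set_option linter.unusedSectionVars false

/-! ### The eigenvalues are positive -/

/-- If all other vertices have a triple edge to `0` and no other edge, then exchanging two of them
is an odd symmetry of the graph. -/
theorem coeff_eq_zero_of_isTriple {Γ : Multigraph (n + 2)} {x : Gra A (n + 2)} (hn : 1 ≤ n)
    (hx : IsAntisymm x) (h : ∀ w, w ≠ 0 → IsTriple Γ w) : MvPolynomial.coeff Γ x = 0 := by
  obtain ⟨n, rfl⟩ := Nat.exists_eq_add_of_le' hn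
  have hΓ : Γ = ∑ u : Fin (n + 1 + 1), 3 • Multigraph.single 0 u.succ := by
    have hsum : ∀ i j, mult (∑ u : Fin (n + 1 + 1), 3 • Multigraph.single 0 u.succ) i j =
        ∑ u : Fin (n + 1 + 1), 3 * mult (Multigraph.single 0 u.succ) i j := by
      intro i j
      have : ∀ s : Finset (Fin (n + 1 + 1)),
          mult (∑ u ∈ s, 3 • Multigraph.single 0 u.succ) i j =
            ∑ u ∈ s, 3 * mult (Multigraph.single 0 u.succ) i j := by
        intro s
        induction s using Finset.cons_induction with
        | empty => simp [mult_zero]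
        | cons a s ha ih => rw [Finset.sum_cons, Finset.sum_cons, mult_add, ih, mult_smul]
      exact this univ
    have h0 : ∀ u : Fin (n + 1 + 1), mult Γ 0 u.succ =
        mult (∑ u : Fin (n + 1 + 1), 3 • Multigraph.single 0 u.succ) 0 u.succ := by
      intro u
      rw [hsum, (h _ (Fin.succ_ne_zero u)).1, Finset.sum_eq_single u]
      · rw [mult_single (Fin.succ_ne_zero u).symm]; simp [(Fin.succ_ne_zero u).symm]
      · intro v _ hv
        rw [mult_single (Fin.succ_ne_zero v).symm]
        simp [(Fin.succ_ne_zero v).symm, hv.symm]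
      · simp
    refine ext_mult fun i j hij => ?_
    rcases Fin.eq_zero_or_eq_succ i with rfl | ⟨u, rfl⟩
    · obtain ⟨v, rfl⟩ := Fin.exists_succ_eq.mpr hij.symm
      exact h0 v
    · rcases Fin.eq_zero_or_eq_succ j with rfl | ⟨v, rfl⟩
      · rw [mult_comm, h0, mult_comm]
      · have h1 := mult_add_mult_le_valence Γ v.succ (Fin.succ_ne_zero u).symm
        rw [(h _ (Fin.succ_ne_zero v)).1, (h _ (Fin.succ_ne_zero v)).2] at h1
        rw [hsum, Finset.sum_eq_zero]
        · omega
        · intro w _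
          rw [mult_single (Fin.succ_ne_zero w).symm]
          simp [Fin.succ_ne_zero]
  have hP : MvPolynomial.monomial Γ (1 : A) = ∏ u : Fin (n + 1 + 1), e 0 u.succ ^ 3 := by
    rw [hΓ, MvPolynomial.monomial_sum_one]
    refine Finset.prod_congr rfl fun u _ => ?_
    rw [e_of_lt (Fin.succ_pos u), single_of_lt (Fin.succ_pos u),
      MvPolynomial.X, MvPolynomial.monomial_pow, one_pow]
  set σ : Perm (Fin (n + 1 + 2)) := Perm.decomposeFin.symm (0, swap 0 1) with hσ
  have hrel : relabel σ (MvPolynomial.monomial Γ (1 : A)) = MvPolynomial.monomial Γ 1 := by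
    rw [hP, map_prod, ← Equiv.prod_comp (swap (0 : Fin (n + 1 + 1)) 1)]
    refine Finset.prod_congr rfl fun u _ => ?_
    rw [map_pow, relabel_e, hσ, Perm.decomposeFin_symm_apply_zero, Perm.decomposeFin_symm_apply_succ]
    simp
  have hs : Perm.sign σ = -1 := by
    rw [hσ, Perm.decomposeFin.symm_sign, if_pos rfl, one_mul, Perm.sign_swap]
    simp
  have h1 := hx.pair_relabel σ (MvPolynomial.monomial Γ 1)
  rw [hrel, hs] at h1
  rw [coeff_eq_zero_iff_pair]
  exact eq_zero_of_eq_neg (by simpa using h1)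

/-- If the eigenvalue vanishes, all vertices without a triple edge to the apex have at most one edge
to it, and then trivalence allows no such vertices. If there are none, the graph has an odd
symmetry. -/
theorem one_le_eigenvalue {Γ : Multigraph (n + 2)} {x : Gra A (n + 2)} (hn : 1 ≤ n)
    (hx : IsAntisymm x) (hap : IsApex Γ 0) (h3 : ∀ v, 3 ≤ valence Γ v)
    (hc : MvPolynomial.coeff Γ x ≠ 0) : 1 ≤ eigenvalue Γ := by
  classical
  by_contra! h0
  have h1 : ∀ w, ¬ IsTriple Γ w → mult Γ 0 w ≤ 1 := by
    intro w hw
    have : ∑ w, (if IsTriple Γ w then 0 else (mult Γ 0 w).choose 2) = 0 := by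
      unfold eigenvalue at h0
      convert Nat.eq_zero_of_add_eq_zero_right (Nat.lt_one_iff.mp h0)
    have := Finset.sum_eq_zero_iff.mp this w (mem_univ w)
    rw [if_neg hw, Nat.choose_eq_zero_iff] at this
    omega
  set T : Finset (Fin (n + 2)) := univ.filter fun w => w ≠ 0 ∧ ¬ IsTriple Γ w with hT
  rcases T.eq_empty_or_nonempty with hTe | hTn
  · refine hc (coeff_eq_zero_of_isTriple hn hx fun w hw => ?_)
    by_contra hw3
    have : w ∈ T := by simp [hT, hw, hw3]
    simp [hTe] at this
  · have h0T : (0 : Fin (n + 2)) ∉ T := by simp [hT]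
    -- Counting the ends of edges at the vertices of `T` gives `3 * #T ≤ (2 * #T - 2) + #T`, since
    -- `T` spans a forest and its vertices have at most one edge to `0`.
    have hs := sum_mult_eq_twoEdges Γ T 0 h0T fun i hi j hj hj0 => by
      have hj3 : IsTriple Γ j := by
        by_contra hj3
        exact hj (by simp [hT, hj0, hj3])
      have hi0 : i ≠ 0 := by rintro rfl; exact h0T hi
      have := mult_add_mult_le_valence Γ j hi0.symm
      rw [hj3.1, hj3.2] at this
      omega
    have ha := hap T hTn h0T
    have hb : #T * 3 ≤ ∑ i ∈ T, valence Γ i := by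
      rw [← smul_eq_mul]; exact Finset.card_nsmul_le_sum _ _ _ fun i _ => h3 i
    have hd : ∑ i ∈ T, mult Γ 0 i ≤ #T * 1 := by
      rw [← smul_eq_mul]
      exact Finset.sum_le_card_nsmul _ _ _ fun i hi => h1 i (by simp [hT] at hi; exact hi.2)
    omega

/-! ### The homotopy -/

theorem isApex_contract_perm_iff {N : ℕ} (σ : Perm (Fin N)) (Γ : Multigraph N) (v : Fin N) :
    IsApex (contract σ Γ) (σ v) ↔ IsApex Γ v := by
  refine ⟨IsApex.of_contract_perm, fun h => ?_⟩
  have h1 : contract (σ⁻¹ : Perm (Fin N)) (contract σ Γ) = Γ := by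
    refine ext_mult fun i j _ => ?_
    have h2 := mult_contract_perm σ⁻¹ (contract σ Γ) (σ i) (σ j)
    rwa [Perm.inv_def, Equiv.symm_apply_apply, Equiv.symm_apply_apply, mult_contract_perm] at h2
  have h2 : IsApex (contract (σ⁻¹ : Perm (Fin N)) (contract σ Γ)) (σ⁻¹ (σ v)) := by
    rwa [h1, Perm.inv_def, Equiv.symm_apply_apply]
  exact h2.of_contract_perm

/-- Relabelling by a permutation that fixes `0` commutes with pulling forks off the vertices. -/
theorem pair_pull_relabel {x : Gra A (n + 2)} (hx : IsAntisymm x) {σ : Perm (Fin (n + 1))}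
    (hσ : σ 0 = 0) (P : Gra A (n + 1)) :
    pair x (pull (relabel σ P)) = (Perm.sign σ : ℤ) • pair x (pull P) := by
  set τ : Perm (Fin (n + 2)) := σ.viaFintypeEmbedding Fin.castSuccEmb with hτ
  have h1 : ∀ u : Fin (n + 1), τ u.castSucc = (σ u).castSucc :=
    fun u => σ.viaFintypeEmbedding_apply_image Fin.castSuccEmb u
  have h2 : τ (Fin.last (n + 1)) = Fin.last (n + 1) :=
    σ.viaFintypeEmbedding_apply_notMem_range _ (by
      rintro ⟨u, hu⟩; exact (Fin.castSucc_lt_last u).ne hu)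
  have h3 : Perm.sign τ = Perm.sign σ := σ.viaFintypeEmbedding_sign _
  have h0 : τ 0 = 0 := by
    have := h1 0
    rwa [hσ, Fin.castSucc_zero] at this
  have hfork : ∀ w (Q : Gra A (n + 1)), forkTerm (σ w) (relabel σ Q) = relabel τ (forkTerm w Q) := by
    intro w Q
    have hc : (Fin.castSucc ∘ σ : Fin (n + 1) → Fin (n + 2)) = τ ∘ Fin.castSucc :=
      funext fun u => (h1 u).symm
    rw [forkTerm, forkTerm, map_mul, map_mul, map_pow, relabel_e, relabel_e, h0, h1, h2,
      relabel_relabel, relabel_relabel, hc]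
  have hpull : pull (relabel σ P) = relabel τ (pull P) := by
    rw [pull_apply, pull_apply, relabel_qsmul, map_sum, ← Equiv.sum_comp σ]
    have hσ' : σ.symm 0 = 0 := by rw [Equiv.symm_apply_eq, hσ]
    refine congrArg _ (Finset.sum_congr rfl fun w _ => ?_)
    rw [D_relabel_perm, D_relabel_perm, hσ', Equiv.symm_apply_apply, hfork]
  rw [hpull, hx.pair_relabel, h3]

/-- The pairing of `x` with the graphs obtained by pulling forks off the vertices, where the forks
are attached to `r`. -/
def pullAt (x : Gra A (n + 2)) (r : Fin (n + 1)) (P : Gra A (n + 1)) : A :=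
  (Perm.sign (swap 0 r) : ℤ) • pair x (pull (relabel (swap 0 r) P))

theorem pullAt_zero (x : Gra A (n + 2)) (P : Gra A (n + 1)) : pullAt x 0 P = pair x (pull P) := by
  have h : relabel (swap 0 (0 : Fin (n + 1))) P = P := by
    rw [swap_self]; exact relabel_id P
  rw [pullAt, h, swap_self, Perm.sign_refl, Units.val_one, one_smul]

theorem pullAt_smul (x : Gra A (n + 2)) (r : Fin (n + 1)) (c : A) (P : Gra A (n + 1)) :
    pullAt x r (c • P) = c • pullAt x r P := by
  simp only [pullAt, map_smul, smul_comm c]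

theorem pullAt_relabel {x : Gra A (n + 2)} (hx : IsAntisymm x) (σ : Perm (Fin (n + 1)))
    (r : Fin (n + 1)) (P : Gra A (n + 1)) :
    pullAt x (σ r) (relabel σ P) = (Perm.sign σ : ℤ) • pullAt x r P := by
  set ε : Perm (Fin (n + 1)) := swap 0 (σ r) * σ * swap 0 r with hε
  have h0 : ε 0 = 0 := by simp [hε]
  have h1 : relabel (swap 0 (σ r)) (relabel σ P) = relabel ε (relabel (swap 0 r) P) := by
    rw [relabel_perm_mul, relabel_perm_mul, hε, mul_assoc, swap_mul_self, mul_one]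
  have hs : Perm.sign (swap 0 (σ r)) * Perm.sign ε = Perm.sign σ * Perm.sign (swap 0 r) := by
    rw [hε, Perm.sign_mul, Perm.sign_mul, ← mul_assoc, ← mul_assoc, Int.units_mul_self, one_mul]
  rw [pullAt, h1, pair_pull_relabel hx h0, smul_smul, pullAt, smul_smul, ← Units.val_mul,
    ← Units.val_mul, hs]

open Classical in
/-- The functional that defines the homotopy, on multiples `P` of the graph `Γ`. The sum over apices
makes it equivariant under relabelling. -/
def apexSum (x : Gra A (n + 2)) (Γ : Multigraph (n + 1)) (P : Gra A (n + 1)) : A :=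
  ∑ r with IsApex Γ r, pullAt x r P

theorem apexSum_relabel {x : Gra A (n + 2)} (hx : IsAntisymm x) (σ : Perm (Fin (n + 1)))
    (Γ : Multigraph (n + 1)) (P : Gra A (n + 1)) :
    apexSum x (contract σ Γ) (relabel σ P) = (Perm.sign σ : ℤ) • apexSum x Γ P := by
  classical
  unfold apexSum
  rw [Finset.sum_filter, Finset.sum_filter, ← Equiv.sum_comp σ, Finset.smul_sum]
  refine Finset.sum_congr rfl fun r _ => ?_
  rw [isApex_contract_perm_iff, pullAt_relabel hx, smul_ite, smul_zero]

theorem exists_of_pullAt_ne_zero {x : Gra A (n + 2)} {r : Fin (n + 1)} {Γ : Multigraph (n + 1)}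
    {P : Gra A (n + 1)} (hP : IsMono Γ P) (h : pullAt x r P ≠ 0) :
    ∃ w Γ₀, 0 ≠ w ∧ contract (swap 0 r) Γ = Γ₀ + 2 • Multigraph.single 0 w ∧
      attach w Γ₀ ∈ x.support := by
  have h1 : pair x (pull (relabel (swap 0 r) P)) ≠ 0 := fun h0 => h (by rw [pullAt, h0, smul_zero])
  have h2 : ∃ Γ' ∈ (pull (relabel (swap 0 r) P)).support, Γ' ∈ x.support := by
    by_contra! h3
    exact h1 (pair_eq_zero_of_forall h3)
  obtain ⟨Γ', h3, h4⟩ := h2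
  obtain ⟨w, Γ₀, hw, hΓ, rfl⟩ := exists_of_mem_support_pull (hP.relabel _) h3
  exact ⟨w, Γ₀, hw, hΓ, h4⟩

/-- The contracting homotopy, up to sign and to graphs with fewer large vertices: it is adjoint to
pulling forks off the other vertices towards the apices. -/
def homotopy (k : ℕ) (x : Gra A (n + 2)) : Gra A (n + 1) :=
  -∑ Γ ∈ (univ : Finset (Edge (n + 1))).finsuppAntidiag k,
    MvPolynomial.monomial Γ ((multFactorial Γ : ℚ)⁻¹ • apexSum x Γ (MvPolynomial.monomial Γ 1))

theorem coeff_homotopy (k : ℕ) (x : Gra A (n + 2)) (Γ : Multigraph (n + 1)) :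
    MvPolynomial.coeff Γ (homotopy k x) = if numEdges Γ = k then
      -((multFactorial Γ : ℚ)⁻¹ • apexSum x Γ (MvPolynomial.monomial Γ 1)) else 0 := by
  classical
  have hm : ∀ Γ : Multigraph (n + 1), Γ ∈ (univ : Finset (Edge (n + 1))).finsuppAntidiag k ↔
      numEdges Γ = k := fun Γ => by
    rw [Finset.mem_finsuppAntidiag]
    exact ⟨fun h => h.1, fun h => ⟨h, Finset.subset_univ _⟩⟩
  rw [homotopy, MvPolynomial.coeff_neg, MvPolynomial.coeff_sum]
  simp only [MvPolynomial.coeff_monomial]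
  rw [Finset.sum_ite_eq' _ Γ]
  simp only [hm]
  split_ifs
  · rfl
  · exact neg_zero

theorem numEdges_smul {N : ℕ} (c : ℕ) (Γ : Multigraph N) : numEdges (c • Γ) = c * numEdges Γ := by
  simp [numEdges, Finset.mul_sum]

theorem numEdges_attach (w : Fin (n + 1)) (Γ : Multigraph (n + 1)) :
    numEdges (attach w Γ) = numEdges Γ + 3 := by
  rw [Multigraph.attach, numEdges_add, numEdges_add, numEdges_smul,
    numEdges_single (Fin.castSucc_lt_last w).ne, numEdges_single zero_ne_last,
    (noCollapse_of_injective (Fin.castSucc_injective _) Γ).numEdges_contract]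

theorem pair_homotopy {k : ℕ} {x : Gra A (n + 2)} (hk : ∀ Γ ∈ x.support, numEdges Γ = k + 1)
    {Γ : Multigraph (n + 1)} {P : Gra A (n + 1)} (hP : IsMono Γ P) :
    pair (homotopy k x) P = -apexSum x Γ P := by
  classical
  obtain ⟨c, rfl⟩ := hP
  have hc : MvPolynomial.monomial Γ c = c • MvPolynomial.monomial Γ (1 : A) := by
    rw [MvPolynomial.smul_monomial, smul_eq_mul, mul_one]
  have hs : apexSum x Γ (MvPolynomial.monomial Γ c) =
      c * apexSum x Γ (MvPolynomial.monomial Γ 1) := by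
    rw [hc, apexSum, apexSum, Finset.mul_sum]
    exact Finset.sum_congr rfl fun r _ => pullAt_smul _ _ _ _
  rw [pair_monomial, coeff_homotopy, hs]
  split_ifs with h
  · have h1 : ∀ z : A, ((multFactorial Γ : ℚ)⁻¹ • z) * (multFactorial Γ : A) = z := by
      intro z
      rw [mul_comm, ← nsmul_eq_mul, ← Nat.cast_smul_eq_nsmul ℚ, smul_smul, mul_inv_cancel₀, one_smul]
      exact_mod_cast multFactorial_ne_zero Γ
    rw [mul_right_comm, neg_mul, h1, neg_mul, mul_comm]
  · have h0 : apexSum x Γ (MvPolynomial.monomial Γ 1) = 0 := by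
      refine Finset.sum_eq_zero fun r _ => ?_
      by_contra hne
      obtain ⟨w, Γ₀, hw, h1, h2⟩ := exists_of_pullAt_ne_zero (isMono_monomial Γ (1 : A)) hne
      have h3 := hk _ h2
      have h4 := congrArg numEdges h1
      rw [numEdges_contract_perm, numEdges_add, numEdges_smul, numEdges_single hw] at h4
      rw [numEdges_attach] at h3
      omega
    rw [h0]; simp

theorem homotopy_isAntisymm {k : ℕ} {x : Gra A (n + 2)} (hk : ∀ Γ ∈ x.support, numEdges Γ = k + 1)
    (hx : IsAntisymm x) : IsAntisymm (homotopy k x) := by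
  intro σ
  rw [← sub_eq_zero]
  ext Γ
  rw [MvPolynomial.coeff_zero, coeff_eq_zero_iff_pair, map_sub, LinearMap.sub_apply,
    pair_relabel, expand_perm, map_zsmul, LinearMap.smul_apply, ← Perm.inv_def,
    pair_homotopy hk ((isMono_monomial Γ (1 : A)).relabel _), pair_homotopy hk (isMono_monomial Γ 1),
    apexSum_relabel hx, Perm.sign_inv, smul_neg, sub_self]

theorem exists_of_mem_support_homotopy {k : ℕ} {x : Gra A (n + 2)} {Γ : Multigraph (n + 1)}
    (hΓ : Γ ∈ (homotopy k x).support) : numEdges Γ = k ∧ ∃ r w Γ₀, IsApex Γ r ∧ 0 ≠ w ∧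
      contract (swap 0 r) Γ = Γ₀ + 2 • Multigraph.single 0 w ∧ attach w Γ₀ ∈ x.support := by
  classical
  rw [MvPolynomial.mem_support_iff, coeff_homotopy] at hΓ
  split_ifs at hΓ with h
  · have h1 : apexSum x Γ (MvPolynomial.monomial Γ 1) ≠ 0 := fun h0 => hΓ (by rw [h0]; simp)
    obtain ⟨r, hr, h2⟩ := Finset.exists_ne_zero_of_sum_ne_zero h1
    obtain ⟨w, Γ₀, h3⟩ := exists_of_pullAt_ne_zero (isMono_monomial Γ (1 : A)) h2
    exact ⟨h, r, w, Γ₀, (Finset.mem_filter.mp hr).2, h3⟩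
  · exact absurd rfl hΓ

theorem valence_attach_zero (w : Fin (n + 1)) (hw : 0 ≠ w) (Γ : Multigraph (n + 1)) :
    valence (attach w Γ) 0 = valence Γ 0 + 2 := by
  have h1 := valence_contract_inj (Fin.castSucc_injective (n + 1)) Γ 0
  rw [Fin.castSucc_zero] at h1
  have h2 : (0 : Fin (n + 2)) ≠ w.castSucc := by
    rw [← Fin.castSucc_zero]; exact fun h => hw (Fin.castSucc_injective _ h)
  rw [Multigraph.attach, valence_add, valence_add, valence_smul,
    valence_single (Fin.castSucc_lt_last w).ne, valence_single zero_ne_last, h1]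
  simp [h2]

theorem homotopy_trivalent {k : ℕ} {x : Gra A (n + 2)} (h3 : ∀ Γ ∈ x.support, ∀ v, 3 ≤ valence Γ v) :
    ∀ Γ ∈ (homotopy k x).support, ∀ v, 3 ≤ valence Γ v := by
  intro Γ hΓ v
  obtain ⟨-, r, w, Γ₀, -, hw, h1, h2⟩ := exists_of_mem_support_homotopy hΓ
  have h4 : valence Γ v = valence (Γ₀ + 2 • Multigraph.single 0 w) (swap 0 r v) := by
    rw [← h1, valence_contract_perm]
  rw [h4, valence_add, valence_smul, valence_single hw]
  set u := swap 0 r v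
  by_cases hu : u = 0
  · have h5 := h3 _ h2 0
    rw [valence_attach_zero w hw] at h5
    rw [hu]; simp; omega
  · have h5 := h3 _ h2 u.castSucc
    rw [valence_attach_castSucc w Γ₀ hu] at h5
    rw [if_neg hu]
    split_ifs at h5 ⊢ <;> omega

theorem homotopy_connected {k : ℕ} {x : Gra A (n + 2)} (h3 : ∀ Γ ∈ x.support, ∀ v, 3 ≤ valence Γ v) :
    ∀ Γ ∈ (homotopy k x).support, (toSimple Γ).Connected := by
  intro Γ hΓ
  obtain ⟨-, r, w, Γ₀, hr, -⟩ := exists_of_mem_support_homotopy hΓ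
  exact hr.connected fun u _ => homotopy_trivalent h3 Γ hΓ u

theorem coeff_homotopy_mem {S : Submodule ℚ A} {x : Gra A (n + 2)}
    (hx : ∀ Γ, MvPolynomial.coeff Γ x ∈ S) (k : ℕ) (Γ : Multigraph (n + 1)) :
    MvPolynomial.coeff Γ (homotopy k x) ∈ S := by
  classical
  rw [coeff_homotopy]
  split_ifs
  · refine neg_mem (S.smul_mem _ (sum_mem fun r _ => zsmul_mem (pair_mem hx ?_) _))
    exact pull_mem_rational (relabel_mem_rational _ (monomial_mem_rational _ (one_mem _)))
  · exact zero_mem _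

/-- The homotopy inverts the differential on graphs with apex `0`, up to graphs with fewer large
vertices and multiplication by the eigenvalues. -/
theorem pair_split_homotopy_of_closed {k : ℕ} {x : Gra A (n + 2)} (hn : 2 ≤ n) (hxa : IsAntisymm x)
    (hk : ∀ Γ ∈ x.support, numEdges Γ = k + 1)
    (hcl : ∀ Γ ∈ (split x).support, VeryLoopy Γ) {Γ : Multigraph (n + 2)}
    (hap : IsApex Γ 0) (h3 : ∀ v, 3 ≤ valence Γ v)
    (hx : ∀ Γ', IsApex Γ' 0 → numLarge Γ' < numLarge Γ → MvPolynomial.coeff Γ' x = 0)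
    {P : Gra A (n + 2)} (hP : IsMono Γ P) :
    pair (split (homotopy k x)) P = eigenvalue Γ • pair x P := by
  classical
  refine pair_split_homotopy hP hxa hap h3 hx ?_ (homotopy_isAntisymm hk hxa) ?_
  · refine pair_eq_zero_of_forall fun Γ' h1 h2 => ?_
    obtain ⟨w, Γ₀, -, rfl, rfl⟩ := exists_of_mem_support_pull hP h1
    exact (not_veryLoopy_iff _).mpr ⟨0, isApex_attach (IsApex.of_add hap)⟩ (hcl _ h2)
  -- A contraction of `P` still has the apex `0`, and no other one, so that the sum over apices in
  -- the homotopy has a single term.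
  · intro i j hij hj
    rcases hP.D_cases i j with h0 | ⟨-, Γ₀, rfl, hP'⟩
    · simp [h0]
    by_cases hn : NoCollapse (contr i j) Γ₀
    swap
    · rw [hP'.relabel_eq_zero hn]; simp
    have hap' : IsApex (contract (contr i j) Γ₀) 0 :=
      IsApex.contract_contr hj hij (R := 0) (by rw [add_zero]) hap hn
    rw [pair_homotopy hk (hP'.relabel (contr i j)), apexSum, Finset.sum_eq_single_of_mem 0,
      pullAt_zero]
    · simpa using hap'
    · intro r hr hr0
      refine absurd (IsApex.unique (by omega) (Finset.mem_filter.mp hr).2 hap' fun u hu hu0 => ?_) hr0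
      rw [valence_contract_contr hij hn]
      have hv : ∀ t, valence Γ₀ t + ((if t = i then 1 else 0) + (if t = j then 1 else 0)) ≥ 3 := by
        intro t
        have := h3 t
        rwa [valence_add, valence_single hij] at this
      have h1 := hv (j.succAbove u)
      have h2 := hv i
      have h4 := hv j
      rw [if_neg (Fin.succAbove_ne j u), add_zero] at h1
      rw [if_pos rfl, if_neg hij] at h2
      rw [if_neg hij.symm, if_pos rfl] at h4
      by_cases hui : u = contr i j i
      · rw [if_pos hui]; split_ifs at h1 <;> omega
      · rw [if_neg hui]
        have : j.succAbove u ≠ i := by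
          rintro h; exact hui (by rw [← h, contr_succAbove])
        rw [if_neg this] at h1
        omega

end Homotopy

open Multigraph

section Core

variable {A : Type*} [CommRing A] [Algebra ℚ A] {n N k : ℕ}

set_option linter.unusedSectionVars false

/-! ### Reduction to very loopy graphs -/

/-- Linear combinations of labelled connected graphs with `k` edges and all vertices at least
trivalent that are antisymmetric in the labels, with coefficients in `S`. -/
structure IsGraphElement (S : Submodule ℚ A) (k : ℕ) (x : Gra A N) : Prop where
  antisymm : IsAntisymm x
  numEdges_eq : ∀ Γ ∈ x.support, numEdges Γ = k
  connected : ∀ Γ ∈ x.support, (toSimple Γ).Connected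
  trivalent : ∀ Γ ∈ x.support, ∀ v, 3 ≤ valence Γ v
  coeff_mem : ∀ Γ, MvPolynomial.coeff Γ x ∈ S

variable {S : Submodule ℚ A}

theorem isGraphElement_zero : IsGraphElement S k (0 : Gra A N) where
  antisymm := isAntisymm_zero
  numEdges_eq := by simp
  connected := by simp
  trivalent := by simp
  coeff_mem := by simp

theorem mem_support_add {x y : Gra A N} {Γ : Multigraph N} (h : Γ ∈ (x + y).support) :
    Γ ∈ x.support ∨ Γ ∈ y.support := by
  classical
  exact Finset.mem_union.mp (MvPolynomial.support_add h)

theorem mem_support_qsmul {x : Gra A N} {c : ℚ} {Γ : Multigraph N} (h : Γ ∈ (c • x).support) :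
    Γ ∈ x.support := Finsupp.support_smul h

theorem IsGraphElement.add {x y : Gra A N} (hx : IsGraphElement S k x) (hy : IsGraphElement S k y) :
    IsGraphElement S k (x + y) where
  antisymm := hx.antisymm.add hy.antisymm
  numEdges_eq _ h := (mem_support_add h).elim (hx.numEdges_eq _) (hy.numEdges_eq _)
  connected _ h := (mem_support_add h).elim (hx.connected _) (hy.connected _)
  trivalent _ h := (mem_support_add h).elim (hx.trivalent _) (hy.trivalent _)
  coeff_mem Γ := by rw [MvPolynomial.coeff_add]; exact add_mem (hx.coeff_mem Γ) (hy.coeff_mem Γ)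

theorem IsGraphElement.qsmul {x : Gra A N} (c : ℚ) (hx : IsGraphElement S k x) :
    IsGraphElement S k (c • x) where
  antisymm := hx.antisymm.qsmul c
  numEdges_eq _ h := hx.numEdges_eq _ (mem_support_qsmul h)
  connected _ h := hx.connected _ (mem_support_qsmul h)
  trivalent _ h := hx.trivalent _ (mem_support_qsmul h)
  coeff_mem Γ := by rw [MvPolynomial.coeff_smul]; exact S.smul_mem _ (hx.coeff_mem Γ)

theorem IsGraphElement.sub {x y : Gra A N} (hx : IsGraphElement S k x) (hy : IsGraphElement S k y) :
    IsGraphElement S k (x - y) := by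
  have := hx.add (hy.qsmul (-1))
  rwa [neg_one_smul, ← sub_eq_add_neg] at this

theorem IsGraphElement.sum {ι : Type*} {s : Finset ι} {x : ι → Gra A N}
    (hx : ∀ i ∈ s, IsGraphElement S k (x i)) : IsGraphElement S k (∑ i ∈ s, x i) :=
  Finset.sum_induction _ _ (fun _ _ => IsGraphElement.add) isGraphElement_zero hx

/-! ### Vertex splitting -/

theorem split_add {a : ℕ} (y z : Gra A (a + 1)) : split (y + z) = split y + split z := by
  unfold split
  rw [circ_add_left, circ_add_right, smul_add]; abel

theorem split_qsmul {a : ℕ} (c : ℚ) (y : Gra A (a + 1)) : split (c • y) = c • split y := by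
  unfold split
  rw [circ_smul_left, circ_smul_right, smul_sub, smul_comm c]

theorem split_sub {a : ℕ} (y z : Gra A (a + 1)) : split (y - z) = split y - split z := by
  have h := split_add y ((-1 : ℚ) • z)
  rwa [split_qsmul, neg_one_smul, neg_one_smul, ← sub_eq_add_neg, ← sub_eq_add_neg] at h

theorem split_zero {a : ℕ} : split (0 : Gra A (a + 1)) = 0 := by
  simpa using split_qsmul 0 (0 : Gra A (a + 1))

theorem split_split (hn : Even n) {y : Gra A (n + 1)} (hy : IsAntisymm y) : split (split y) = 0 := by
  have hξ : IsEvenSeries (single (n + 1) 0 y) :=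
    { antisymm := fun N k => by
        by_cases h : N = n + 1 ∧ k = 0
        · obtain ⟨rfl, rfl⟩ := h; rwa [single_same]
        · rw [single_of_ne _ h]; exact isAntisymm_zero
      odd := fun N k h => by
        by_cases h' : N = n + 1 ∧ k = 0
        · rw [h'.1]; exact hn.add_one
        · exact absurd (single_of_ne _ h') h }
  have h := congrFun (congrFun hξ.delta_delta (n + 1 + 2)) (0 + 1 + 1)
  rw [delta_apply, delta_apply, single_same] at h
  exact h

theorem mem_support_split {a : ℕ} {y : Gra A (a + 1)} {Γ : Multigraph (a + 2)}
    (h : Γ ∈ (split y).support) : ∃ Γ₀ ∈ y.support, ∃ Γ', ∃ σ : Perm (Fin (a + 2)),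
      Γ = contract σ Γ' ∧ (IsInsertion (M := a + 1) (a := 1) rfl (Multigraph.single 0 1) Γ₀ Γ' ∨
        IsInsertion (M := 2) (a := a) (add_comm _ _) Γ₀ (Multigraph.single 0 1) Γ') := by
  rw [split, sub_eq_add_neg, ← neg_smul, ← Int.cast_smul_eq_zsmul ℚ] at h
  rcases mem_support_add h with h | h
  · obtain ⟨Γf, hf, Γg, hg, Γ', h1, σ, h2⟩ := exists_of_mem_support_circ h
    rw [(isMono_e 0 1).mem_support hf] at h1
    exact ⟨Γg, hg, Γ', σ, h2, Or.inl h1⟩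
  · obtain ⟨Γf, hf, Γg, hg, Γ', h1, σ, h2⟩ := exists_of_mem_support_circ (mem_support_qsmul h)
    rw [(isMono_e 0 1).mem_support hg] at h1
    exact ⟨Γf, hf, Γ', σ, h2, Or.inr h1⟩

theorem connected_single : (toSimple (Multigraph.single (0 : Fin 2) 1)).Connected := by
  rw [connected_iff]
  refine ⟨by norm_num, fun T hT hT' => ?_⟩
  obtain ⟨i, hi⟩ := hT
  obtain ⟨j, hj⟩ : ∃ j, j ∉ T := by
    by_contra! h; exact hT' (Finset.eq_univ_iff_forall.mpr h)
  refine ⟨i, hi, j, hj, ?_⟩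
  have hij : i ≠ j := fun h => hj (h ▸ hi)
  rw [mult_single (by decide)]
  fin_cases i <;> fin_cases j <;> simp_all

theorem IsGraphElement.split {a : ℕ} {y : Gra A (a + 1)} (hy : IsGraphElement S k y) :
    IsGraphElement S (k + 1) (split y) where
  antisymm := split_isAntisymm y
  numEdges_eq Γ h := by
    obtain ⟨Γ₀, h0, Γ', σ, rfl, h1 | h1⟩ := mem_support_split h <;>
    · rw [numEdges_contract_perm, h1.numEdges, hy.numEdges_eq _ h0, numEdges_single (by decide)]
      try rw [add_comm]
  connected Γ h := by
    obtain ⟨Γ₀, h0, Γ', σ, rfl, h1 | h1⟩ := mem_support_split h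
    · exact connected_contract_perm (h1.connected connected_single (hy.connected _ h0))
    · exact connected_contract_perm (h1.connected (hy.connected _ h0) connected_single)
  trivalent := split_trivalent hy.antisymm hy.trivalent
  coeff_mem := coeff_split_mem hy.coeff_mem

theorem IsGraphElement.homotopy {x : Gra A (n + 2)} (hx : IsGraphElement S (k + 1) x) :
    IsGraphElement S k (homotopy k x) where
  antisymm := homotopy_isAntisymm hx.numEdges_eq hx.antisymm
  numEdges_eq _ h := (exists_of_mem_support_homotopy h).1
  connected := homotopy_connected hx.trivalent
  trivalent := homotopy_trivalent hx.trivalent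
  coeff_mem := coeff_homotopy_mem hx.coeff_mem k

/-- On graphs with apex `0` all of whose predecessors, those with fewer large vertices, do not occur
in `x`, the differential of the homotopy multiplies by the eigenvalue. -/
theorem coeff_split_homotopy {x : Gra A (n + 2)} (hn : 2 ≤ n) (hx : IsGraphElement S (k + 1) x)
    (hcl : ∀ Γ ∈ (split x).support, VeryLoopy Γ) {Γ : Multigraph (n + 2)} (hap : IsApex Γ 0)
    (h : ∀ Γ', IsApex Γ' 0 → numLarge Γ' < numLarge Γ → MvPolynomial.coeff Γ' x = 0) :
    MvPolynomial.coeff Γ (OddGC.split (OddGC.homotopy k x)) =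
      eigenvalue Γ • MvPolynomial.coeff Γ x := by
  by_cases h3 : ∀ v, 3 ≤ valence Γ v
  · have h1 := pair_split_homotopy_of_closed hn hx.antisymm hx.numEdges_eq hcl hap h3 h
      (isMono_monomial Γ (1 : A))
    rw [← sub_eq_zero, ← MvPolynomial.coeff_smul, ← MvPolynomial.coeff_sub, coeff_eq_zero_iff_pair,
      map_sub, LinearMap.sub_apply, h1, map_nsmul, LinearMap.smul_apply, sub_self]
  · have h1 : MvPolynomial.coeff Γ x = 0 := by
      by_contra h0; exact h3 (hx.trivalent Γ (MvPolynomial.mem_support_iff.mpr h0))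
    have h2 : MvPolynomial.coeff Γ (OddGC.split (OddGC.homotopy k x)) = 0 := by
      by_contra h0
      exact h3 (hx.homotopy.split.trivalent Γ (MvPolynomial.mem_support_iff.mpr h0))
    rw [h1, h2, smul_zero]

/-- The coefficients of graphs with apex `0` and the smallest number of large vertices are removed
by successively killing the eigenvalues `1, 2, …, l`; they are positive, so that there is nothing to
do for `l = 0`. -/
theorem exists_kill_eigenvalues (hn : 2 ≤ n) (he : Even n) {x : Gra A (n + 2)}
    (hx : IsGraphElement S (k + 1) x) (hcl : ∀ Γ ∈ (split x).support, VeryLoopy Γ) {q : ℕ}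
    (hq : ∀ Γ, IsApex Γ 0 → numLarge Γ < q → MvPolynomial.coeff Γ x = 0) (l : ℕ) :
    ∃ y : Gra A (n + 1), IsGraphElement S k y ∧
      (∀ Γ, IsApex Γ 0 → numLarge Γ < q → MvPolynomial.coeff Γ (x - split y) = 0) ∧
      ∀ Γ, IsApex Γ 0 → numLarge Γ = q → MvPolynomial.coeff Γ (x - split y) ≠ 0 →
        l < eigenvalue Γ ∧ MvPolynomial.coeff Γ x ≠ 0 := by
  induction l with
  | zero =>
    refine ⟨0, isGraphElement_zero, ?_, ?_⟩
    · rw [split_zero, sub_zero]; exact hq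
    · rw [split_zero, sub_zero]
      intro Γ hap _ hc
      exact ⟨one_le_eigenvalue (by omega) hx.antisymm hap
        (hx.trivalent _ (MvPolynomial.mem_support_iff.mpr hc)) hc, hc⟩
  | succ l ih =>
    obtain ⟨y, hy, h1, h2⟩ := ih
    set z := x - split y with hz
    have hzx : IsGraphElement S (k + 1) z := hx.sub hy.split
    have hzc : ∀ Γ ∈ (split z).support, VeryLoopy Γ := by
      rw [hz, split_sub, split_split he hy.antisymm, sub_zero]; exact hcl
    -- This multiple of the homotopy kills the part with eigenvalue `l + 1`.
    set c : ℚ := ((l + 1 : ℕ) : ℚ)⁻¹ with hc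
    have hw : x - split (y + c • homotopy k z) = z - c • split (homotopy k z) := by
      rw [split_add, split_qsmul, hz, sub_sub]
    have hcoef : ∀ Γ, IsApex Γ 0 → numLarge Γ ≤ q →
        MvPolynomial.coeff Γ (x - split (y + c • homotopy k z)) =
          (1 - c * eigenvalue Γ : ℚ) • MvPolynomial.coeff Γ z := by
      intro Γ hap hl
      rw [hw, MvPolynomial.coeff_sub, MvPolynomial.coeff_smul,
        coeff_split_homotopy hn hzx hzc hap fun Γ' h h' => h1 Γ' h (h'.trans_le hl),
        ← Nat.cast_smul_eq_nsmul ℚ, smul_smul, sub_smul, one_smul]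
    refine ⟨y + c • homotopy k z, hy.add (hzx.homotopy.qsmul c), ?_, ?_⟩
    · intro Γ hap hl
      rw [hcoef Γ hap hl.le, h1 Γ hap hl, smul_zero]
    · intro Γ hap hl hne
      rw [hcoef Γ hap hl.le] at hne
      obtain ⟨h3, h4⟩ := h2 Γ hap hl fun h0 => hne (by rw [h0, smul_zero])
      refine ⟨lt_of_le_of_ne h3 fun h5 => hne ?_, h4⟩
      rw [← h5, hc, inv_mul_cancel₀ (by exact_mod_cast Nat.succ_ne_zero l), sub_self, zero_smul]

theorem numLarge_le (Γ : Multigraph (n + 2)) : numLarge Γ ≤ n + 1 := by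
  classical
  unfold numLarge
  refine (Finset.sum_le_card_nsmul _ _ 1 fun u _ => ?_).trans (by simp)
  split_ifs <;> omega

/-- The graphs with apex `0` and fewer than `q` large vertices are removed by induction on `q`. -/
theorem exists_kill_level (hn : 2 ≤ n) (he : Even n) {x : Gra A (n + 2)}
    (hx : IsGraphElement S (k + 1) x) (hcl : ∀ Γ ∈ (split x).support, VeryLoopy Γ) (q : ℕ) :
    ∃ y : Gra A (n + 1), IsGraphElement S k y ∧
      ∀ Γ, IsApex Γ 0 → numLarge Γ < q → MvPolynomial.coeff Γ (x - split y) = 0 := by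
  induction q with
  | zero => exact ⟨0, isGraphElement_zero, fun _ _ h => absurd h (Nat.not_lt_zero _)⟩
  | succ q ih =>
    obtain ⟨y, hy, h1⟩ := ih
    have hzc : ∀ Γ ∈ (split (x - split y)).support, VeryLoopy Γ := by
      rw [split_sub, split_split he hy.antisymm, sub_zero]; exact hcl
    -- Only finitely many eigenvalues occur.
    obtain ⟨z, hz, h2, h3⟩ := exists_kill_eigenvalues hn he (hx.sub hy.split) hzc h1
      ((x - split y).support.sup eigenvalue)
    have h4 : x - split (y + z) = x - split y - split z := by rw [split_add, sub_sub]
    refine ⟨y + z, hy.add hz, fun Γ hap hl => ?_⟩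
    rw [h4]
    rcases Nat.lt_succ_iff_lt_or_eq.mp hl with hl | hl
    · exact h2 Γ hap hl
    · by_contra hne
      obtain ⟨h5, h6⟩ := h3 Γ hap hl hne
      exact h5.not_ge (Finset.le_sup (MvPolynomial.mem_support_iff.mpr h6))

/-- An element on an even number `n + 2 ≥ 4` of vertices whose differential is very loopy is very
loopy up to a differential. -/
theorem exists_sub_split_veryLoopy (hn : 2 ≤ n) (he : Even n) {x : Gra A (n + 2)}
    (hx : IsGraphElement S (k + 1) x) (hcl : ∀ Γ ∈ (split x).support, VeryLoopy Γ) :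
    ∃ y : Gra A (n + 1), IsGraphElement S k y ∧ ∀ Γ ∈ (x - split y).support, VeryLoopy Γ := by
  obtain ⟨y, hy, h⟩ := exists_kill_level hn he hx hcl (n + 2)
  refine ⟨y, hy, fun Γ hΓ => ?_⟩
  by_contra hv
  obtain ⟨v, hv⟩ := (not_veryLoopy_iff Γ).mp hv
  have hz := (hx.sub hy.split).antisymm
  -- By antisymmetry the apex can be moved to the vertex `0`.
  rw [MvPolynomial.mem_support_iff, ne_eq, coeff_eq_zero_iff_pair] at hΓ
  have h1 := hz.pair_relabel (swap v 0) (MvPolynomial.monomial Γ 1)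
  have hap : IsApex (contract (swap v 0) Γ) 0 := by
    have := (isApex_contract_perm_iff (swap v 0) Γ v).mpr hv
    rwa [swap_apply_left] at this
  rw [((isMono_monomial Γ (1 : A)).relabel (swap v 0)).pair_eq_zero
    (h _ hap (Nat.lt_succ_of_le (numLarge_le _)))] at h1
  refine hΓ ?_
  have h2 := congrArg (fun z => (Perm.sign (swap v 0) : ℤ) • z) h1
  simp only [smul_zero, smul_smul, sign_mul_self, one_smul] at h2
  exact h2.symm

end Core

open Multigraph

section Series

variable {A : Type*} [CommRing A] [Algebra ℚ A] {N k : ℕ} {S T : ℕ → ℕ → Submodule ℚ A}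

set_option linter.unusedSectionVars false

/-! ### Series of graphs with prescribed coefficients -/

theorem IsGraphElement.mono {S T : Submodule ℚ A} (h : S ≤ T) {x : Gra A N}
    (hx : IsGraphElement S k x) : IsGraphElement T k x :=
  { hx with coeff_mem := fun Γ => h (hx.coeff_mem Γ) }

/-- Since there are no tadpoles, a graph all of whose vertices are at least trivalent has at least
two vertices; and `N` such vertices need at least `3 N / 2` edges. -/
theorem IsGraphElement.two_le_of_ne_zero {S : Submodule ℚ A} {x : Gra A N}
    (hx : IsGraphElement S k x) (h : x ≠ 0) : 2 ≤ N ∧ 3 * N ≤ 2 * k := by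
  obtain ⟨Γ, hΓ⟩ := MvPolynomial.support_nonempty.mpr h
  have h3 := hx.trivalent Γ hΓ
  have h0 : 0 < N := ((connected_iff Γ).mp (hx.connected Γ hΓ)).1
  have h1 : N ≠ 1 := by
    rintro rfl
    have := h3 0
    simp [valence, mult_self] at this
  have h4 := sum_valence Γ
  rw [hx.numEdges_eq Γ hΓ] at h4
  have h5 : N * 3 ≤ ∑ v, valence Γ v := by
    simpa using Finset.card_nsmul_le_sum univ (fun v => valence Γ v) 3 fun v _ => h3 v
  omega

theorem IsGraphElement.circ {S T U : Submodule ℚ A} (hS : ∀ u ∈ S, ∀ v ∈ T, u * v ∈ U)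
    {M a L l : ℕ} (h : M + a = L) {f : Gra A (a + 1)} {g : Gra A M} (hf : IsGraphElement S k f)
    (hg : IsGraphElement T l g) : IsGraphElement U (k + l) (circ h f g) where
  antisymm := circ_isAntisymm h f g
  numEdges_eq Γ hΓ := by
    obtain ⟨Γf, h1, Γg, h2, Γ', h3, σ, rfl⟩ := exists_of_mem_support_circ hΓ
    rw [numEdges_contract_perm, h3.numEdges, hf.numEdges_eq _ h1, hg.numEdges_eq _ h2]
  connected Γ hΓ := by
    obtain ⟨Γf, h1, Γg, h2, Γ', h3, σ, rfl⟩ := exists_of_mem_support_circ hΓ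
    exact connected_contract_perm (h3.connected (hf.connected _ h1) (hg.connected _ h2))
  trivalent Γ hΓ v := by
    obtain ⟨Γf, h1, Γg, h2, Γ', h3, σ, rfl⟩ := exists_of_mem_support_circ hΓ
    obtain ⟨u, rfl⟩ := σ.surjective v
    rw [valence_contract_perm]
    exact h3.trivalent (hf.trivalent _ h1) (hg.trivalent _ h2) u
  coeff_mem := coeff_circ_mem hS h hf.coeff_mem hg.coeff_mem

/-- Series of graphs where the coefficients of the graphs with `N` vertices and `k` edges lie in
`S N k`. -/
def IsSeries (S : ℕ → ℕ → Submodule ℚ A) (f : Cochain A) : Prop :=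
  ∀ N k, IsGraphElement (S N k) k (f N k)

theorem IsSeries.eq_zero_of_lt_two {f : Cochain A} (hf : IsSeries S f) (hN : N < 2) (k : ℕ) :
    f N k = 0 := by
  by_contra h
  have := ((hf N k).two_le_of_ne_zero h).1
  omega

theorem IsSeries.edges_eq_zero_of_lt_two {f : Cochain A} (hf : IsSeries S f) (N : ℕ) (hk : k < 2) :
    f N k = 0 := by
  by_contra h
  have := (hf N k).two_le_of_ne_zero h
  omega

theorem IsSeries.add {f g : Cochain A} (hf : IsSeries S f) (hg : IsSeries S g) :
    IsSeries S (f + g) := fun N k => (hf N k).add (hg N k)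

theorem IsSeries.bracket {U : ℕ → ℕ → Submodule ℚ A} {f g : Cochain A}
    (hS : ∀ M a k l, ∀ u ∈ S (a + 1) k, ∀ v ∈ T M l, u * v ∈ U (M + a) (k + l))
    (hT : ∀ M a k l, ∀ u ∈ T (a + 1) k, ∀ v ∈ S M l, u * v ∈ U (M + a) (k + l))
    (hf : IsSeries S f) (hg : IsSeries T g) : IsSeries U (bracket f g) := by
  intro L k
  refine IsGraphElement.sum fun x _ => IsGraphElement.sum fun y hy => ?_
  have hx := mem_antidiagonal.mp x.2
  rw [← mem_antidiagonal.mp hy]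
  rw [← Int.cast_smul_eq_zsmul ℚ]
  refine IsGraphElement.sub ?_ (IsGraphElement.qsmul _ ?_)
  · refine IsGraphElement.circ (fun u hu v hv => ?_) _ (hf _ _) (hg _ _)
    have := hS _ _ _ _ u hu v hv
    rwa [hx] at this
  · refine IsGraphElement.circ (fun u hu v hv => ?_) _ (hg _ _) (hf _ _)
    have := hT _ _ _ _ u hu v hv
    rwa [hx] at this

theorem IsSeries.delta {f : Cochain A} (hS : ∀ a k, S (a + 1) k ≤ T (a + 2) (k + 1))
    (hf : IsSeries S f) : IsSeries T (delta f) := by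
  intro N k
  rcases lt_or_ge N 2 with hN | hN
  · rw [delta_of_lt_two (fun k => hf.eq_zero_of_lt_two (by norm_num) k) hN]
    exact isGraphElement_zero
  obtain ⟨a, rfl⟩ := Nat.exists_eq_add_of_le' hN
  rcases k with _ | k
  · rw [delta_edges_zero]; exact isGraphElement_zero
  · rw [delta_apply]; exact ((hf _ _).split).mono (hS a k)

/-- The gauge action, for coefficients such that the bracket with `ξ` preserves series. -/
theorem IsSeries.gaugeAct {ξ m : Cochain A}
    (hS : ∀ f, IsSeries T f → IsSeries T (OddGC.bracket ξ f))
    (hδ : ∀ a k, S (a + 1) k ≤ T (a + 2) (k + 1)) (hξ : IsSeries S ξ) (hm : IsSeries T m) :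
    IsSeries T (gaugeAct ξ m) := by
  have hit : ∀ f, IsSeries T f → ∀ j, IsSeries T ((OddGC.bracket ξ)^[j] f) := by
    intro f hf j
    induction j with
    | zero => exact hf
    | succ j ih => rw [Function.iterate_succ_apply']; exact hS _ ih
  intro N k
  exact (IsGraphElement.sum fun j _ => (hit m hm j N k).qsmul _).sub
    (IsGraphElement.sum fun j _ => (hit _ (hξ.delta hδ) j N k).qsmul _)

theorem IsSeries.isEvenSeries {f : Cochain A} (hf : IsSeries S f)
    (h : ∀ N k, f N k ≠ 0 → Odd N) : IsEvenSeries f where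
  antisymm N k := (hf N k).antisymm
  odd := h

theorem IsSeries.isOddSeries {f : Cochain A} (hf : IsSeries S f)
    (h : ∀ N k, f N k ≠ 0 → Even N) : IsOddSeries f where
  antisymm N k := (hf N k).antisymm
  even := h
  zero := hf.eq_zero_of_lt_two (by norm_num)

/-! ### Locality of the gauge action in the number of edges -/

theorem bracket_congr {f f' g g' : Cochain A} {k : ℕ} (hf : ∀ N, ∀ l ≤ k, f N l = f' N l)
    (hg : ∀ N, ∀ l ≤ k, g N l = g' N l) (L : ℕ) : bracket f g L k = bracket f' g' L k := by
  refine Finset.sum_congr rfl fun x _ => Finset.sum_congr rfl fun y hy => ?_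
  have h1 : y.1 ≤ k := (mem_antidiagonal.mp hy) ▸ Nat.le_add_right _ _
  have h2 : y.2 ≤ k := (mem_antidiagonal.mp hy) ▸ Nat.le_add_left _ _
  rw [hf _ _ h1, hf _ _ h2, hg _ _ h1, hg _ _ h2]

theorem gaugeAct_congr {ξ ξ' : Cochain A} (m : Cochain A) {k : ℕ}
    (h : ∀ N, ∀ l ≤ k, ξ N l = ξ' N l) (N : ℕ) : gaugeAct ξ m N k = gaugeAct ξ' m N k := by
  have hit : ∀ (f f' : Cochain A), (∀ N, ∀ l ≤ k, f N l = f' N l) → ∀ j N, ∀ l ≤ k,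
      ((bracket ξ)^[j] f) N l = ((bracket ξ')^[j] f') N l := by
    intro f f' hf j
    induction j with
    | zero => exact hf
    | succ j ih =>
      intro N l hl
      rw [Function.iterate_succ_apply', Function.iterate_succ_apply']
      exact bracket_congr (fun N l' hl' => h N l' (hl'.trans hl))
        (fun N l' hl' => ih N l' (hl'.trans hl)) N
  refine congrArg₂ (· - ·) ?_ ?_
  · exact Finset.sum_congr rfl fun j _ => by rw [hit m m (fun _ _ _ => rfl) j N k le_rfl]
  · refine Finset.sum_congr rfl fun j _ => ?_
    rw [hit _ _ (fun N l hl => ?_) j N k le_rfl]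
    exact bracket_congr (fun _ _ _ => rfl) (fun N l' hl' => h N l' (hl'.trans hl)) N

/-- If `f` has no graphs without edges, then the bracket with `f` only sees graphs with fewer
edges. -/
theorem star_congr_of_edges {f g g' : Cochain A} {k : ℕ} (hf : ∀ N, f N 0 = 0)
    (hg : ∀ N, ∀ l < k, g N l = g' N l) (L : ℕ) :
    star f g L k = star f g' L k ∧ star g f L k = star g' f L k := by
  constructor
  · refine Finset.sum_congr rfl fun x _ => Finset.sum_congr rfl fun y hy => ?_
    rcases Nat.eq_zero_or_pos y.1 with h0 | h0
    · rw [h0, hf, circ_zero_left, circ_zero_left]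
    · rw [hg _ _ (by have := mem_antidiagonal.mp hy; omega)]
  · refine Finset.sum_congr rfl fun x _ => Finset.sum_congr rfl fun y hy => ?_
    rcases Nat.eq_zero_or_pos y.2 with h0 | h0
    · rw [h0, hf, circ_zero_right, circ_zero_right]
    · rw [hg _ _ (by have := mem_antidiagonal.mp hy; omega)]

theorem bracket_congr_of_edges {ξ g g' : Cochain A} (hξ : IsEvenSeries ξ) {k : ℕ}
    (h0 : ∀ N, ξ N 0 = 0) (hg : ∀ N, ∀ l < k, g N l = g' N l) (L : ℕ) :
    bracket ξ g L k = bracket ξ g' L k := by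
  rw [hξ.bracket_eq, hξ.bracket_eq, Pi.sub_apply, Pi.sub_apply, Pi.sub_apply, Pi.sub_apply,
    (star_congr_of_edges h0 hg L).1, (star_congr_of_edges h0 hg L).2]

theorem IsEvenSeries.add_bracket {ξ η : Cochain A} (hξ : IsEvenSeries ξ) (hη : IsEvenSeries η)
    (hs : IsEvenSeries (ξ + η)) (g : Cochain A) :
    OddGC.bracket (ξ + η) g = OddGC.bracket ξ g + OddGC.bracket η g := by
  rw [hs.bracket_eq, hξ.bracket_eq, hη.bracket_eq, star_add_left, star_add_right]; abel

/-- If `η` has only graphs with `j` edges, then `[η, g]` has no graphs with fewer edges. -/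
theorem bracket_concentrated {η g : Cochain A} (hη : IsEvenSeries η) {j k : ℕ}
    (h : ∀ N l, l ≠ j → η N l = 0) (hg : ∀ N, ∀ l, l + j = k → g N l = 0) (L : ℕ) :
    bracket η g L k = 0 := by
  rw [hη.bracket_eq, Pi.sub_apply, Pi.sub_apply]
  have h1 : star η g L k = 0 :=
    Finset.sum_eq_zero fun x _ => Finset.sum_eq_zero fun y hy => by
      by_cases h0 : y.1 = j
      · rw [hg _ y.2 (by have := mem_antidiagonal.mp hy; omega), circ_zero_right]
      · rw [h _ _ h0, circ_zero_left]
  have h2 : star g η L k = 0 :=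
    Finset.sum_eq_zero fun x _ => Finset.sum_eq_zero fun y hy => by
      by_cases h0 : y.2 = j
      · rw [hg _ y.1 (by have := mem_antidiagonal.mp hy; omega), circ_zero_left]
      · rw [h _ _ h0, circ_zero_right]
  rw [h1, h2, sub_zero]

/-- Changing `ξ` by `η` with `j` edges changes the gauge action on graphs with at most `j + 1` edges
only by the differential of `η`. -/
theorem gaugeAct_add {ξ η m : Cochain A} (hξ : IsEvenSeries ξ) (hη : IsEvenSeries η)
    (hs : IsEvenSeries (ξ + η)) (hξ2 : ∀ N < 2, ∀ k, ξ N k = 0) (hη2 : ∀ N < 2, ∀ k, η N k = 0)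
    (hξe : ∀ N, ∀ k < 2, ξ N k = 0) (hme : ∀ N, ∀ k < 2, m N k = 0) {j : ℕ} (hj : 1 ≤ j)
    (h : ∀ N l, l ≠ j → η N l = 0) {N : ℕ} (hN : 2 ≤ N) :
    (∀ l ≤ j, gaugeAct (ξ + η) m N l = gaugeAct ξ m N l) ∧
      gaugeAct (ξ + η) m N (j + 1) = gaugeAct ξ m N (j + 1) - delta η N (j + 1) := by
  -- The iterated brackets contain no graphs with at most one edge, except for the edge itself.
  have hae : ∀ i N, ∀ k ≤ 1, ((bracket ξ)^[i] (edge + m)) N k =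
      if i = 0 then (edge : Cochain A) N k else 0 := by
    intro i
    induction i with
    | zero =>
      intro N k hk
      simp [hme N k (by omega)]
    | succ i ih =>
      intro N k hk
      rw [Function.iterate_succ_apply',
        bracket_congr (f' := 0) (g' := (bracket ξ)^[i] (edge + m))
          (fun N l hl => hξe N l (by omega)) (fun _ _ _ => rfl)]
      have h0 : IsEvenSeries (0 : Cochain A) := ⟨fun _ _ => isAntisymm_zero, fun _ _ h => absurd rfl h⟩
      rw [h0.bracket_eq, star_zero_left, star_zero_right, sub_zero, if_neg (Nat.succ_ne_zero i)]
      rfl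
  -- A bracket with `η` adds `j` edges, so that up to `j + 1` edges `η` can only be bracketed once,
  -- and only with the edge.
  have key : ∀ i, (∀ N, ∀ k ≤ j, ((bracket (ξ + η))^[i] (edge + m)) N k =
      ((bracket ξ)^[i] (edge + m)) N k) ∧ ∀ N, ((bracket (ξ + η))^[i] (edge + m)) N (j + 1) =
        ((bracket ξ)^[i] (edge + m)) N (j + 1) + if i = 1 then bracket η edge N (j + 1) else 0 := by
    intro i
    induction i with
    | zero =>
      rw [Function.iterate_zero, Function.iterate_zero]
      exact ⟨fun _ _ _ => rfl, fun _ => by rw [if_neg zero_ne_one, add_zero]⟩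
    | succ i ih =>
      have hlow : ∀ N, ∀ k ≤ 1, ((bracket (ξ + η))^[i] (edge + m)) N k =
          if i = 0 then (edge : Cochain A) N k else 0 := fun N k hk => by
        rw [ih.1 N k (hk.trans hj), hae i N k hk]
      refine ⟨fun N k hk => ?_, fun N => ?_⟩
      · rw [Function.iterate_succ_apply', Function.iterate_succ_apply', hξ.add_bracket hη hs,
          Pi.add_apply, Pi.add_apply,
          bracket_congr_of_edges hξ (fun N => hξe N 0 (by norm_num))
            (fun N l hl => ih.1 N l (by omega)),
          bracket_concentrated hη h, add_zero]
        intro N l hl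
        obtain rfl : l = 0 := by omega
        rw [hlow N 0 (by norm_num)]
        split_ifs
        · exact edge_apply_of_ne (by omega)
        · rfl
      · rw [Function.iterate_succ_apply', Function.iterate_succ_apply', hξ.add_bracket hη hs,
          Pi.add_apply, Pi.add_apply,
          bracket_congr_of_edges hξ (fun N => hξe N 0 (by norm_num))
            (fun N l hl => ih.1 N l (by omega))]
        refine congrArg _ ?_
        by_cases hi : i = 0
        · subst hi
          rw [if_pos rfl, Function.iterate_zero_apply, ← sub_eq_zero, ← Pi.sub_apply,
            ← Pi.sub_apply, hη.bracket_add, add_sub_cancel_left]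
          exact bracket_concentrated hη h (fun N l hl => hme N l (by omega)) N
        · rw [if_neg (by omega)]
          refine bracket_concentrated hη h (fun N l hl => ?_) N
          rw [hlow N l (by omega), if_neg hi]
  have hs2 : ∀ N < 2, ∀ k, (ξ + η) N k = 0 := fun N hN k => by
    rw [Pi.add_apply, Pi.add_apply, hξ2 N hN, hη2 N hN, add_zero]
  refine ⟨fun l hl => ?_, ?_⟩
  · have h1 := gaugeAct_eq (m := m) hs hs2 N l
    have h2 := gaugeAct_eq (m := m) hξ hξ2 N l
    rw [Finset.sum_congr rfl fun i _ => by rw [(key i).1 N l hl], ← h2] at h1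
    simp only [Pi.add_apply] at h1
    exact add_left_cancel h1
  have h1 := gaugeAct_eq (m := m) hs hs2 N (j + 1)
  have h2 := gaugeAct_eq (m := m) hξ hξ2 N (j + 1)
  rw [Finset.sum_congr rfl fun i _ => by rw [(key i).2 N, smul_add], Finset.sum_add_distrib, ← h2]
    at h1
  simp only [smul_ite, smul_zero] at h1
  rw [Finset.sum_ite_eq' (range N) 1, if_pos (Finset.mem_range.mpr hN)] at h1
  rw [Nat.factorial_one, Nat.cast_one, inv_one, one_smul] at h1
  have h3 : bracket η edge = -delta η := by rw [hη.delta_eq, neg_neg]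
  rw [h3] at h1
  simp only [Pi.add_apply, Pi.neg_apply] at h1
  rw [add_assoc] at h1
  rw [add_left_cancel h1, sub_eq_add_neg]

/-- The gauge action does not change the part with two vertices. -/
theorem gaugeAct_two {ξ m : Cochain A} (hξ : ∀ N < 2, ∀ k, ξ N k = 0)
    (hm : ∀ N < 2, ∀ k, m N k = 0) (k : ℕ) : gaugeAct ξ m 2 k = m 2 k := by
  have hδ : ∀ N < 3, ∀ k, delta ξ N k = 0 := by
    intro N hN k
    rcases lt_or_ge N 2 with h | h
    · exact delta_of_lt_two (hξ 0 (by norm_num)) h k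
    · obtain rfl : N = 2 := by omega
      rcases k with _ | k
      · exact delta_edges_zero _ _
      · rw [delta_apply, hξ 1 (by norm_num), split_zero]
  have h1 := bracket_eq_zero hξ hm 2 (by norm_num) k
  have h2 := bracket_eq_zero hξ (fun N hN => hδ N (by omega)) (a := 2) 2 (by norm_num) k
  simp only [gaugeAct, Finset.sum_range_succ, Finset.sum_range_zero, Function.iterate_zero_apply,
    Function.iterate_one, h1, h2, hδ 2 (by norm_num)]
  simp

end Series

open Multigraph

section BGC

variable {K : Type*} [Field K] [CharZero K] {n : ℕ} {D : ℤ} {N k : ℕ}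

/-! ### The graded pieces of `BGC_n` -/

variable (K) in
/-- The possible coefficients of graphs with `N` vertices and `k` edges in degree `D` of `BGC_n`. -/
def homogeneousPart (n : ℕ) (D : ℤ) (N k : ℕ) : Submodule ℚ (HBSO K n) :=
  (MvPolynomial.weightedHomogeneousSubmodule K (pontryaginDegree n)
    (D - graphDegree n N k)).restrictScalars ℚ

theorem mem_homogeneousPart {a : HBSO K n} : a ∈ homogeneousPart K n D N k ↔
    MvPolynomial.IsWeightedHomogeneous (pontryaginDegree n) a (D - graphDegree n N k) := Iff.rfl

theorem isBGC_iff {f : Cochain (HBSO K n)} :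
    IsBGC n D f ↔ IsSeries (homogeneousPart K n D) f := by
  constructor
  · intro h N k
    exact ⟨h.antisymm N k, h.numEdges_eq N k, h.connected N k, h.trivalent N k, h.degree_eq N k⟩
  · intro h
    exact ⟨⟨fun N k => (h N k).numEdges_eq, fun N k => (h N k).antisymm,
      fun N k => (h N k).connected, fun N k => (h N k).trivalent⟩, fun N k => (h N k).coeff_mem⟩

theorem graphDegree_add (n M a k l : ℕ) :
    graphDegree n (M + a) (k + l) = graphDegree n (a + 1) k + graphDegree n M l := by
  unfold graphDegree; push_cast; ring

theorem mul_mem_homogeneousPart {D E : ℤ} (M a k l : ℕ) :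
    ∀ u ∈ homogeneousPart K n D (a + 1) k, ∀ v ∈ homogeneousPart K n E M l,
      u * v ∈ homogeneousPart K n (D + E) (M + a) (k + l) := by
  intro u hu v hv
  rw [mem_homogeneousPart] at hu hv ⊢
  have := hu.mul hv
  rwa [sub_add_sub_comm, ← graphDegree_add] at this

theorem homogeneousPart_split (n : ℕ) (D : ℤ) (a k : ℕ) :
    homogeneousPart K n (D + 1) (a + 2) (k + 1) = homogeneousPart K n D (a + 1) k := by
  have : D + 1 - graphDegree n (a + 2) (k + 1) = D - graphDegree n (a + 1) k := by
    unfold graphDegree; push_cast; ring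
  rw [homogeneousPart, this, homogeneousPart]

theorem bracket_isSeries {ξ f : Cochain (HBSO K n)} {E : ℤ}
    (hξ : IsSeries (homogeneousPart K n 0) ξ) (hf : IsSeries (homogeneousPart K n E) f) :
    IsSeries (homogeneousPart K n E) (bracket ξ f) := by
  refine IsSeries.bracket (fun M a k l u hu v hv => ?_) (fun M a k l u hu v hv => ?_) hξ hf
  · have := mul_mem_homogeneousPart M a k l u hu v hv
    rwa [zero_add] at this
  · have := mul_mem_homogeneousPart M a k l u hu v hv
    rwa [add_zero] at this

theorem gaugeAct_isSeries {ξ m : Cochain (HBSO K n)} (hξ : IsSeries (homogeneousPart K n 0) ξ)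
    (hm : IsSeries (homogeneousPart K n 1) m) : IsSeries (homogeneousPart K n 1) (gaugeAct ξ m) :=
  IsSeries.gaugeAct (fun _ hf => bracket_isSeries hξ hf)
    (fun a k => (homogeneousPart_split n 0 a k).symm.le.trans (by rw [zero_add])) hξ hm

/-- Since the Pontryagin classes have even degree and `n` is odd, the parity of the number of
vertices is determined by the degree. -/
theorem even_of_homogeneousPart (hodd : Odd n) {f : Cochain (HBSO K n)}
    (hf : IsSeries (homogeneousPart K n D) f) (h : f N k ≠ 0) : Even (D - ((N : ℤ) - 1)) := by
  obtain ⟨Γ, hΓ⟩ := MvPolynomial.support_nonempty.mpr h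
  obtain ⟨d, hd⟩ := MvPolynomial.support_nonempty.mpr (MvPolynomial.mem_support_iff.mp hΓ)
  have h1 := (mem_homogeneousPart.mp ((hf N k).coeff_mem Γ)) (MvPolynomial.mem_support_iff.mp hd)
  have h2 : Even (Finsupp.weight (pontryaginDegree n) d) := by
    rw [Finsupp.weight_apply, Finsupp.sum]
    refine Finset.even_sum _ fun i _ => ?_
    rw [pontryaginDegree, nsmul_eq_mul]
    exact ((show Even (4 : ℤ) by decide).mul_right _).mul_left _
  rw [h1] at h2
  obtain ⟨c, rfl⟩ := hodd
  unfold graphDegree at h2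
  have h3 : D - ((N : ℤ) - 1) = D - (((2 * c + 1 : ℕ) : ℤ) * ((N : ℤ) - 1) -
      (((2 * c + 1 : ℕ) : ℤ) - 1) * k) + 2 * (c * ((N : ℤ) - 1) - c * k) := by push_cast; ring
  rw [h3]
  exact h2.add (even_two_mul _)

theorem isEvenSeries_of_isSeries (hodd : Odd n) {f : Cochain (HBSO K n)}
    (hf : IsSeries (homogeneousPart K n 0) f) : IsEvenSeries f :=
  hf.isEvenSeries fun N k h => by
    have := even_of_homogeneousPart hodd hf h
    rw [zero_sub, even_neg, Int.even_sub_one, Int.not_even_iff_odd] at this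
    exact_mod_cast this

theorem isOddSeries_of_isSeries (hodd : Odd n) {f : Cochain (HBSO K n)}
    (hf : IsSeries (homogeneousPart K n 1) f) : IsOddSeries f :=
  hf.isOddSeries fun N k h => by
    have := even_of_homogeneousPart hodd hf h
    obtain ⟨c, hc⟩ := this
    have : Even (N : ℤ) := ⟨1 - c, by omega⟩
    exact_mod_cast this

/-! ### Gauge fixing -/

/-- In a Maurer–Cartan element, all of whose graphs with at most `k` edges and other than two
vertices are very loopy, the differential of the part with `k + 1` edges is very loopy. -/
theorem veryLoopy_split_of_isMaurerCartan {S : ℕ → ℕ → Submodule ℚ (HBSO K n)}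
    {m : Cochain (HBSO K n)} (hm : IsSeries S m) (hmc : IsMaurerCartan m) {k : ℕ}
    (hv : ∀ N, N ≠ 2 → ∀ l ≤ k, ∀ Γ ∈ (m N l).support, VeryLoopy Γ) {N : ℕ} (hN : 1 ≤ N) :
    ∀ Γ ∈ (split (m (N + 2) (k + 1))).support, VeryLoopy Γ := by
  intro Γ hΓ
  have h1 := congrFun (congrFun hmc (N + 1 + 2)) (k + 1 + 1)
  rw [Pi.add_apply, Pi.add_apply, delta_apply] at h1
  have h2 : split (m (N + 2) (k + 1)) =
      (-(2⁻¹ : ℚ)) • bracket m m (N + 1 + 2) (k + 1 + 1) := by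
    rw [neg_smul]; exact eq_neg_of_add_eq_zero_left h1
  rw [h2] at hΓ
  obtain ⟨M, a, k₁, k₂, h, hk, hc⟩ := exists_of_mem_support_bracket (mem_support_qsmul hΓ)
  rw [or_self] at hc
  obtain ⟨Γf, hf, Γg, hg, Γ', hi, σ, rfl⟩ := exists_of_mem_support_circ hc
  -- Both factors of a graph that is not very loopy are not very loopy. Since they have at most `k`
  -- edges, they have two vertices each, and their product has only three.
  by_contra hn
  have hn' : ¬ VeryLoopy Γ' := fun h => hn (veryLoopy_contract_perm h)
  obtain ⟨hnf, hng⟩ := hi.not_veryLoopy ((hm _ _).connected _ hg) hn'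
  have hf0 : m (a + 1) k₁ ≠ 0 := by rintro h0; rw [h0] at hf; simp at hf
  have hg0 : m M k₂ ≠ 0 := by rintro h0; rw [h0] at hg; simp at hg
  have hfe := (hm _ _).two_le_of_ne_zero hf0
  have hge := (hm _ _).two_le_of_ne_zero hg0
  have ha : a + 1 = 2 := by
    by_contra h0; exact hnf (hv _ h0 k₁ (by omega) _ hf)
  have hM : M = 2 := by
    by_contra h0; exact hng (hv _ h0 k₂ (by omega) _ hg)
  omega

/-- One step of the gauge fixing, which makes the graphs with `k + 1` edges very loopy. -/
theorem exists_gauge_step (hodd : Odd n) {m ξ : Cochain (HBSO K n)}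
    (hm : IsSeries (homogeneousPart K n 1) m) (hmc : IsMaurerCartan m)
    (hξ : IsSeries (homogeneousPart K n 0) ξ) {k : ℕ} (hk : 1 ≤ k)
    (hv : ∀ N, N ≠ 2 → ∀ l ≤ k, ∀ Γ ∈ (gaugeAct ξ m N l).support, VeryLoopy Γ) :
    ∃ ξ' : Cochain (HBSO K n), IsSeries (homogeneousPart K n 0) ξ' ∧
      (∀ N l, l ≠ k → ξ' N l = ξ N l) ∧
      ∀ N, N ≠ 2 → ∀ l ≤ k + 1, ∀ Γ ∈ (gaugeAct ξ' m N l).support, VeryLoopy Γ := by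
  set m' := gaugeAct ξ m with hm'
  have hms : IsSeries (homogeneousPart K n 1) m' := gaugeAct_isSeries hξ hm
  have hξe := isEvenSeries_of_isSeries hodd hξ
  have hmo := isOddSeries_of_isSeries hodd hm
  have hmo' := isOddSeries_of_isSeries hodd hms
  have hmc' : IsMaurerCartan m' :=
    gaugeAct_isMaurerCartan hξe (fun N hN k => hξ.eq_zero_of_lt_two hN k) hmo hmo' hmc
  have hex : ∀ N, ∃ y : Gra (HBSO K n) (N + 1), IsGraphElement (homogeneousPart K n 0 (N + 1) k) k y ∧
      (N ≠ 0 → ∀ Γ ∈ (m' (N + 2) (k + 1) - split y).support, VeryLoopy Γ) := by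
    intro N
    by_cases h0 : N = 0
    · exact ⟨0, isGraphElement_zero, fun h => absurd h0 h⟩
    by_cases hz : m' (N + 2) (k + 1) = 0
    · refine ⟨0, isGraphElement_zero, fun _ Γ hΓ => ?_⟩
      rw [hz, split_zero, sub_zero] at hΓ
      simp at hΓ
    have he : Even N := by
      have := hmo'.even _ _ hz
      rwa [Nat.even_add, iff_true_right even_two] at this
    have hx : IsGraphElement (homogeneousPart K n 0 (N + 1) k) (k + 1) (m' (N + 2) (k + 1)) := by
      rw [← homogeneousPart_split, zero_add]; exact hms _ _
    have hN : 2 ≤ N := by obtain ⟨c, rfl⟩ := he; omega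
    obtain ⟨y, hy, h⟩ := exists_sub_split_veryLoopy hN he hx
      (veryLoopy_split_of_isMaurerCartan hms hmc' hv (by omega))
    exact ⟨y, hy, fun _ => h⟩
  choose y hy hyv using hex
  -- The correction `η` of `ξ`, with `k` edges, whose differential is subtracted by the gauge
  -- action.
  let η : Cochain (HBSO K n)
    | 0, _ => 0
    | N + 1, l => if l = k then y N else 0
  have hηs : IsSeries (homogeneousPart K n 0) η := by
    intro N l
    rcases N with _ | N
    · exact isGraphElement_zero
    · change IsGraphElement _ l (if l = k then y N else 0)
      split_ifs with h
      · rw [h]; exact hy N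
      · exact isGraphElement_zero
  have hη0 : ∀ N l, l ≠ k → η N l = 0 := by
    intro N l hl
    rcases N with _ | N
    · rfl
    · exact if_neg hl
  have hηk : ∀ N, η (N + 1) k = y N := fun N => if_pos rfl
  have hs := hξ.add hηs
  have hadd : ∀ N l, l ≠ k → (ξ + η) N l = ξ N l := fun N l hl => by
    rw [Pi.add_apply, Pi.add_apply, hη0 N l hl, add_zero]
  refine ⟨ξ + η, hs, hadd, fun N hN l hl => ?_⟩
  have hss : IsSeries (homogeneousPart K n 1) (gaugeAct (ξ + η) m) := gaugeAct_isSeries hs hm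
  rcases lt_or_ge N 2 with hN2 | hN2
  · rw [hss.eq_zero_of_lt_two hN2]; simp
  obtain ⟨h1, h2⟩ := gaugeAct_add (m := m) hξe (isEvenSeries_of_isSeries hodd hηs)
    (isEvenSeries_of_isSeries hodd hs) (fun N hN k => hξ.eq_zero_of_lt_two hN k)
    (fun N hN k => hηs.eq_zero_of_lt_two hN k) (fun N k hk => hξ.edges_eq_zero_of_lt_two N hk)
    (fun N k hk => hm.edges_eq_zero_of_lt_two N hk) hk hη0 hN2
  rcases Nat.le_succ_iff.mp hl with hl | rfl
  · rw [h1 l hl]; exact hv N hN l hl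
  · obtain ⟨N, rfl⟩ := Nat.exists_eq_add_of_le' hN2
    rw [h2, delta_apply, hηk]
    exact hyv N (by omega)

/-- Every Maurer–Cartan element is gauge equivalent to one whose graphs with other than two vertices
are very loopy. -/
theorem exists_gaugeAct_veryLoopy (hodd : Odd n) {m : Cochain (HBSO K n)}
    (hm : IsSeries (homogeneousPart K n 1) m) (hmc : IsMaurerCartan m) :
    ∃ ξ : Cochain (HBSO K n), IsSeries (homogeneousPart K n 0) ξ ∧
      ∀ N, N ≠ 2 → ∀ k, ∀ Γ ∈ (gaugeAct ξ m N k).support, VeryLoopy Γ := by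
  let P : ℕ → Cochain (HBSO K n) → Prop := fun j ξ => IsSeries (homogeneousPart K n 0) ξ ∧
    ∀ N, N ≠ 2 → ∀ l ≤ j + 1, ∀ Γ ∈ (gaugeAct ξ m N l).support, VeryLoopy Γ
  have hstep : ∀ j ξ, P j ξ → ∃ ξ', P (j + 1) ξ' ∧ ∀ N l, l ≠ j + 1 → ξ' N l = ξ N l := by
    rintro j ξ ⟨hξ, hv⟩
    obtain ⟨ξ', h1, h2, h3⟩ := exists_gauge_step hodd hm hmc hξ (Nat.le_add_left 1 j) hv
    exact ⟨ξ', ⟨h1, h3⟩, h2⟩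
  have hbase : P 0 0 := by
    have h0 : IsSeries (homogeneousPart K n 0) (0 : Cochain (HBSO K n)) :=
      fun _ _ => isGraphElement_zero
    refine ⟨h0, fun N _ l hl => ?_⟩
    rw [(gaugeAct_isSeries h0 hm).edges_eq_zero_of_lt_two N (by omega)]
    simp
  choose! next hnext hnext_eq using hstep
  let ξ : ℕ → Cochain (HBSO K n) := fun j => Nat.rec 0 next j
  have hP : ∀ j, P j (ξ j) := fun j => by
    induction j with
    | zero => exact hbase
    | succ j ih => exact hnext j _ ih
  -- The part of `ξ j` with `l` edges is constant for `l ≤ j`.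
  have hstab : ∀ i j N l, l ≤ j → ξ (j + i) N l = ξ j N l := by
    intro i j N l hl
    induction i with
    | zero => rfl
    | succ i ih => rw [← ih]; exact hnext_eq (j + i) _ (hP _) N l (by omega)
  refine ⟨fun N k => ξ k N k, fun N k => (hP k).1 N k, fun N hN k => ?_⟩
  have h1 : gaugeAct (fun N k => ξ k N k) m N k = gaugeAct (ξ k) m N k :=
    gaugeAct_congr m (fun N l hl => by
      obtain ⟨i, rfl⟩ := Nat.exists_eq_add_of_le hl
      exact (hstab i l N l le_rfl).symm) N
  rw [h1]
  exact (hP k).2 N hN k (Nat.le_succ k)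

end BGC

open Multigraph

section GC

set_option linter.unusedSectionVars false

variable {K : Type*} [Field K] [CharZero K] {n : ℕ} {D : ℤ} {N k : ℕ}

/-! ### The graded pieces of `GC_n` -/

open Classical in
variable (K) in
/-- The possible coefficients of graphs with `N` vertices and `k` edges in degree `D` of `GC_n`. -/
def degreePart (n : ℕ) (D : ℤ) (N k : ℕ) : Submodule ℚ K :=
  if graphDegree n N k = D then ⊤ else ⊥

theorem isGC_iff {f : Cochain K} : IsGC n D f ↔ IsSeries (degreePart K n D) f := by
  constructor
  · intro h N k
    refine ⟨h.antisymm N k, h.numEdges_eq N k, h.connected N k, h.trivalent N k, fun Γ => ?_⟩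
    unfold degreePart
    split_ifs with hd
    · exact Submodule.mem_top
    · have : f N k = 0 := by by_contra h0; exact hd (h.degree_eq N k h0)
      rw [this, MvPolynomial.coeff_zero]; exact zero_mem _
  · intro h
    refine ⟨⟨fun N k => (h N k).numEdges_eq, fun N k => (h N k).antisymm,
      fun N k => (h N k).connected, fun N k => (h N k).trivalent⟩, fun N k h0 => ?_⟩
    by_contra hd
    refine h0 (MvPolynomial.ext _ _ fun Γ => ?_)
    have := (h N k).coeff_mem Γ
    rwa [degreePart, if_neg hd, Submodule.mem_bot] at this

theorem degreePart_split (n : ℕ) (D : ℤ) (a k : ℕ) :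
    degreePart K n (D - 1) (a + 1) k = degreePart K n D (a + 2) (k + 1) := by
  have : graphDegree n (a + 1) k = D - 1 ↔ graphDegree n (a + 2) (k + 1) = D := by
    have h : graphDegree n (a + 2) (k + 1) = graphDegree n (a + 1) k + 1 := by
      unfold graphDegree; push_cast; ring
    rw [h]; omega
  unfold degreePart
  rw [if_congr this rfl rfl]

theorem even_of_degreePart (hodd : Odd n) (hD : Odd D) {f : Cochain K}
    (hf : IsSeries (degreePart K n D) f) (h : f N k ≠ 0) : Even N := by
  have h1 := (isGC_iff.mpr hf).degree_eq N k h
  obtain ⟨c, rfl⟩ := hodd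
  obtain ⟨d, rfl⟩ := hD
  unfold graphDegree at h1
  have h2 : (N : ℤ) = 2 * (d + 1 - c * ((N : ℤ) - 1) + c * k) := by
    push_cast at h1; linear_combination h1
  have : Even (N : ℤ) := by rw [h2]; exact even_two_mul _
  exact_mod_cast this

/-! ### Graphs with two vertices -/

theorem isApex_two (Γ : Multigraph 2) : IsApex Γ 0 := by
  intro T hT h0
  have hT1 : T = {1} := by
    refine Finset.eq_singleton_iff_nonempty_unique_mem.mpr ⟨hT, fun v hv => ?_⟩
    have : v ≠ 0 := fun h => h0 (h ▸ hv)
    omega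
  rw [hT1]
  simp [twoEdges, mult_self]

variable {A : Type*} [CommRing A] [Algebra ℚ A]

theorem eq_smul_of_two {x : Gra A 2} (hx : ∀ Γ ∈ x.support, numEdges Γ = k) :
    ∃ c : A, x = c • (e 0 1 : Gra A 2) ^ k := by
  have huniv : ∀ p : Edge 2, p = ⟨(0, 1), by decide⟩ := by decide
  have h1 : ∀ Γ : Multigraph 2, numEdges Γ = k ↔ Γ = k • Multigraph.single 0 1 := by
    intro Γ
    have h2 : ∀ Γ : Multigraph 2, numEdges Γ = Γ ⟨(0, 1), by decide⟩ := fun Γ => by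
      unfold numEdges
      exact Fintype.sum_eq_single _ fun p hp => absurd (huniv p) hp
    rw [h2]
    constructor
    · rintro rfl
      ext p
      rw [huniv p, single_of_lt (by decide)]
      simp
    · rintro rfl
      rw [single_of_lt (by decide)]
      simp
  refine ⟨MvPolynomial.coeff (k • Multigraph.single 0 1) x, ?_⟩
  rw [e_of_lt (by decide), MvPolynomial.X_pow_eq_monomial, MvPolynomial.smul_monomial, smul_eq_mul,
    mul_one]
  have h3 : (Finsupp.single ⟨((0 : Fin 2), (1 : Fin 2)), by decide⟩ k : Multigraph 2) =
      k • Multigraph.single 0 1 := by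
    rw [single_of_lt (by decide), Finsupp.smul_single, smul_eq_mul, mul_one]
  rw [h3]
  ext Γ
  rw [MvPolynomial.coeff_monomial]
  split_ifs with h4
  · rw [h4]
  · by_contra h5
    exact h4 ((h1 Γ).mp (hx Γ (MvPolynomial.mem_support_iff.mpr h5))).symm

theorem isAntisymm_edge_pow (hk : Odd k) : IsAntisymm ((e 0 1 : Gra A 2) ^ k) := by
  intro σ
  rw [map_pow, isAntisymm_edge σ]
  rcases Int.units_eq_one_or (Perm.sign σ) with h | h <;> simp [h, hk.neg_pow]

theorem pair_edge_pow : pair ((e 0 1 : Gra A 2) ^ k) (e 0 1 ^ k) = (k.factorial : A) := by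
  rw [e_of_lt (by decide), MvPolynomial.X_pow_eq_monomial, pair_monomial,
    MvPolynomial.coeff_monomial, if_pos rfl, mul_one, one_mul, multFactorial,
    Fintype.prod_eq_single ⟨((0 : Fin 2), (1 : Fin 2)), by decide⟩]
  · simp
  · intro p hp
    exact absurd (show p = ⟨(0, 1), by decide⟩ by revert p; decide) hp

theorem relabel_contr_D_eq_zero {a : ℕ} {Γ : Multigraph (a + 2)} {P : Gra A (a + 2)}
    (hP : IsMono Γ P) {i j : Fin (a + 2)} (h : 2 ≤ mult Γ i j) :
    relabel (contr i j) (OddGC.D i j P) = 0 := by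
  rcases hP.D_cases i j with h0 | ⟨hij, Γ₀, rfl, h1⟩
  · rw [h0, map_zero]
  · refine h1.relabel_eq_zero fun hn => ?_
    have h2 := hn i j (contr_same hij).symm
    rw [mult_add, h2, mult_single hij] at h
    simp [hij] at h

/-- The differential of two vertices joined by `k ≥ 5` edges contains a triangle with a double and
a simple edge at one of its vertices, which is not very loopy. -/
theorem eq_zero_of_split_veryLoopy {c : A} (hk : Odd k) (h5 : 5 ≤ k)
    (hv : ∀ Γ ∈ (split (c • (e 0 1 : Gra A 2) ^ k)).support, VeryLoopy Γ) :
    c • (e 0 1 : Gra A 2) ^ k = 0 := by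
  obtain ⟨l, rfl⟩ := Nat.exists_eq_add_of_le' (show 2 ≤ k by omega)
  set y : Gra A 2 := c • e 0 1 ^ (l + 2) with hy
  have hya : IsAntisymm y := by
    intro σ; rw [hy, map_smul, isAntisymm_edge_pow hk σ, smul_comm]
  set Γ : Multigraph 3 := Multigraph.single 1 2 + 2 • Multigraph.single 0 1 +
    l • Multigraph.single 0 2 with hΓ
  set P : Gra A 3 := e 1 2 * e 0 1 ^ 2 * e 0 2 ^ l with hP
  have hPΓ : IsMono Γ P := ((isMono_e 1 2).mul ((isMono_e 0 1).pow 2)).mul ((isMono_e 0 2).pow l)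
  have hval : ∀ v, 2 ≤ valence Γ v := by
    intro v
    rw [hΓ, valence_add, valence_add, valence_smul, valence_smul, valence_single (by decide),
      valence_single (by decide), valence_single (by decide)]
    fin_cases v <;> simp <;> omega
  have hap : IsApex Γ 0 := by
    intro T hT h0
    have hT3 : T = {1} ∨ T = {2} ∨ T = {1, 2} := by revert T; decide
    rcases hT3 with rfl | rfl | rfl
    · simp [twoEdges, mult_self]
    · simp [twoEdges, mult_self]
    · have h1 : mult Γ 1 2 = 1 := by
        rw [hΓ, mult_add, mult_add, mult_smul, mult_smul, mult_single (by decide),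
          mult_single (by decide), mult_single (by decide)]
        simp
      have h2 : mult Γ 2 1 = 1 := by rw [mult_comm, h1]
      simp [twoEdges, mult_self, h1, h2]
  have h0 : pair (split y) P = 0 := pair_eq_zero_of_forall fun Γ' h1 h2 => by
    rw [hPΓ.mem_support h1] at h2
    exact (not_veryLoopy_iff Γ).mpr ⟨0, hap⟩ (hv _ h2)
  rw [pair_split hya (fun Γ' h => by rw [hPΓ.mem_support h]; exact hval)] at h0
  have hD01 : contractTerm y P 0 1 = 0 := by
    rw [contractTerm, relabel_contr_D_eq_zero hPΓ, map_zero, smul_zero]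
    rw [hΓ, mult_add, mult_add, mult_smul, mult_single (i := 0) (j := 1) (by decide)]
    simp
    omega
  have hD02 : contractTerm y P 0 2 = 0 := by
    rw [contractTerm, relabel_contr_D_eq_zero hPΓ, map_zero, smul_zero]
    rw [hΓ, mult_add, mult_smul l, mult_single (i := 0) (j := 2) (by decide)]
    simp
    omega
  have hD12 : contractTerm y P 1 2 = c * (l + 2).factorial := by
    have h1 : OddGC.D 1 2 P = e 0 1 ^ 2 * e 0 2 ^ l := by
      rw [hP, D_mul, D_mul, Derivation.leibniz_pow, Derivation.leibniz_pow, D_e, D_e, D_e]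
      simp
    have h2 : relabel (contr (1 : Fin 3) 2) (OddGC.D 1 2 P) = e 0 1 ^ (l + 2) := by
      rw [h1, map_mul, map_pow, map_pow, relabel_e, relabel_e,
        show contr (1 : Fin 3) 2 0 = 0 by decide, show contr (1 : Fin 3) 2 1 = 1 by decide,
        show contr (1 : Fin 3) 2 2 = 1 by decide, ← pow_add, Nat.add_comm 2 l]
    rw [contractTerm, h2, hy, map_smul, LinearMap.smul_apply, pair_edge_pow, smul_eq_mul]
    simp
  have hsum : ∑ j : Fin 3, ∑ i with i < j, contractTerm y P i j =
      contractTerm y P 0 1 + (contractTerm y P 0 2 + contractTerm y P 1 2) := by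
    simp [Fin.sum_univ_three, Finset.sum_filter]
  rw [hsum, hD01, hD02, hD12, zero_add, zero_add] at h0
  have h1 : c * ((l + 2).factorial : A) = 0 := by simpa using h0
  have h2 : c = 0 := by
    rw [mul_comm, ← nsmul_eq_mul, ← Nat.cast_smul_eq_nsmul ℚ] at h1
    have h3 := congrArg (fun z => ((l + 2).factorial : ℚ)⁻¹ • z) h1
    simpa [smul_smul, inv_mul_cancel₀ (show ((l + 2).factorial : ℚ) ≠ 0 by positivity)] using h3
  rw [hy, h2, zero_smul]

/-! ### The theta graph -/

theorem isGraphElement_theta : IsGraphElement ⊤ 3 (symm ((e 0 1 : Gra A 2) ^ 3)) := by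
  have hmono : IsMono (3 • Multigraph.single (0 : Fin 2) 1) ((e 0 1 : Gra A 2) ^ 3) :=
    (isMono_e 0 1).pow 3
  have hsupp : ∀ Γ ∈ (symm ((e 0 1 : Gra A 2) ^ 3)).support, ∃ σ : Perm (Fin 2),
      Γ = contract σ (3 • Multigraph.single 0 1) := by
    intro Γ hΓ
    obtain ⟨Γ', h, σ, rfl⟩ := exists_of_mem_support_symm hΓ
    exact ⟨σ, by rw [hmono.mem_support h]⟩
  refine ⟨symm_isAntisymm _, fun Γ hΓ => ?_, fun Γ hΓ => ?_, fun Γ hΓ v => ?_,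
    fun _ => Submodule.mem_top⟩
  · obtain ⟨σ, rfl⟩ := hsupp Γ hΓ
    rw [numEdges_contract_perm, numEdges_smul, numEdges_single (by decide)]
  · obtain ⟨σ, rfl⟩ := hsupp Γ hΓ
    refine connected_contract_perm (IsApex.connected (isApex_two _) fun u hu => ?_)
    rw [valence_smul, valence_single (by decide)]
    fin_cases u <;> simp
  · obtain ⟨σ, rfl⟩ := hsupp Γ hΓ
    obtain ⟨u, rfl⟩ := σ.surjective v
    rw [valence_contract_perm, valence_smul, valence_single (by decide)]
    fin_cases u <;> simp

theorem symm_edge_pow_three : symm ((e 0 1 : Gra A 2) ^ 3) = 2 • (e 0 1 : Gra A 2) ^ 3 :=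
  (isAntisymm_edge_pow (by decide)).symm_eq

theorem theta_apply_of_ne (h : ¬ (N = 2 ∧ k = 3)) : theta A N k = 0 := by
  unfold theta
  split
  · exact absurd ⟨rfl, rfl⟩ h
  · rfl

theorem isSeries_theta (n : ℕ) : IsSeries (degreePart K n (3 - 2 * n)) (theta K) := by
  intro N k
  by_cases h : N = 2 ∧ k = 3
  · obtain ⟨rfl, rfl⟩ := h
    refine isGraphElement_theta.mono ?_
    have : graphDegree n 2 3 = 3 - 2 * n := by unfold graphDegree; push_cast; ring
    rw [degreePart, if_pos this]
  · rw [theta_apply_of_ne h]; exact isGraphElement_zero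

/-- There are no trivalent graphs with three vertices and four edges. -/
theorem delta_theta : delta (theta K) = 0 := by
  funext N k
  have hs := isSeries_theta (K := K) 3
  rcases lt_or_ge N 2 with hN | hN
  · exact delta_of_lt_two (fun k => hs.eq_zero_of_lt_two (by norm_num) k) hN k
  obtain ⟨a, rfl⟩ := Nat.exists_eq_add_of_le' hN
  rcases k with _ | k
  · exact delta_edges_zero _ _
  rw [delta_apply]
  by_cases h : a + 1 = 2 ∧ k = 3
  · obtain ⟨ha, rfl⟩ := h
    obtain rfl : a = 1 := by omega
    by_contra h0
    have := (hs 2 3).split.two_le_of_ne_zero h0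
    omega
  · rw [theta_apply_of_ne h, split_zero]; rfl

theorem theta_not_exact (y : Cochain K) {S : ℕ → ℕ → Submodule ℚ K} (hy : IsSeries S y) :
    ¬ IsVeryLoopy (theta K - delta y) := by
  intro hv
  have h1 : (theta K - delta y) 2 3 = 2 • (e 0 1 : Gra K 2) ^ 3 := by
    rw [Pi.sub_apply, Pi.sub_apply, delta_apply (a := 0) (k := 2), hy.eq_zero_of_lt_two (by norm_num),
      split_zero, sub_zero]
    exact symm_edge_pow_three
  have h2 : (theta K - delta y) 2 3 ≠ 0 := by
    rw [h1, e_of_lt (by decide)]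
    exact smul_ne_zero two_ne_zero (pow_ne_zero 3 (MvPolynomial.X_ne_zero _))
  obtain ⟨Γ, hΓ⟩ := MvPolynomial.support_nonempty.mpr h2
  exact (not_veryLoopy_iff Γ).mpr ⟨0, isApex_two Γ⟩ (hv 2 3 Γ hΓ)

/-- The part with two vertices of an element with very loopy differential is a multiple of the
theta graph. -/
theorem exists_eq_smul_theta {S : ℕ → ℕ → Submodule ℚ K} {x : Cochain K} (hx : IsSeries S x)
    (hv : IsVeryLoopy (delta x)) : ∃ c : K, ∀ k, x 2 k = (c • theta K) 2 k := by
  obtain ⟨c, hc⟩ := eq_smul_of_two (hx 2 3).numEdges_eq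
  refine ⟨c / 2, fun k => ?_⟩
  rw [Pi.smul_apply, Pi.smul_apply]
  by_cases h3 : k = 3
  · subst h3
    rw [hc]
    change _ = (c / 2) • symm ((e 0 1 : Gra K 2) ^ 3)
    rw [symm_edge_pow_three, ← Nat.cast_smul_eq_nsmul K, smul_smul]
    congr 1
    push_cast
    rw [div_mul_cancel₀ _ two_ne_zero]
  rw [theta_apply_of_ne (by omega), smul_zero]
  by_contra h0
  have hk := (hx 2 k).two_le_of_ne_zero h0
  obtain ⟨d, hd⟩ := eq_smul_of_two (hx 2 k).numEdges_eq
  rcases Nat.even_or_odd k with he | ho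
  · have h1 := (hx 2 k).antisymm (swap 0 1)
    have h2 : relabel (swap 0 1) ((e 0 1 : Gra K 2) ^ k) = e 0 1 ^ k := by
      rw [map_pow, relabel_e, swap_apply_left, swap_apply_right, e_swap, he.neg_pow]
    rw [hd, map_smul, h2, Perm.sign_swap (by decide)] at h1
    exact h0 (by rw [hd]; exact eq_zero_of_eq_neg (by simpa using h1))
  · refine h0 ?_
    rw [hd]
    refine eq_zero_of_split_veryLoopy ho (by obtain ⟨i, rfl⟩ := ho; omega) ?_
    rw [← hd]
    have := hv 3 (k + 1)
    rwa [delta_apply (a := 1)] at this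

/-- Classes of odd degree are represented by multiples of the theta graph. -/
theorem exists_veryLoopy_sub (hodd : Odd n) (hD : Odd D) {x : Cochain K}
    (hx : IsSeries (degreePart K n D) x) (hv : IsVeryLoopy (delta x)) :
    ∃ (c : K) (y : Cochain K), IsSeries (degreePart K n (D - 1)) y ∧
      IsVeryLoopy (x - delta y - c • theta K) := by
  obtain ⟨c, hc⟩ := exists_eq_smul_theta hx hv
  have hex : ∀ N k, ∃ y : Gra K (N + 1), IsGraphElement (degreePart K n (D - 1) (N + 1) k) k y ∧
      (N ≠ 0 → ∀ Γ ∈ (x (N + 2) (k + 1) - split y).support, VeryLoopy Γ) := by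
    intro N k
    by_cases h0 : N = 0
    · exact ⟨0, isGraphElement_zero, fun h => absurd h0 h⟩
    by_cases hz : x (N + 2) (k + 1) = 0
    · refine ⟨0, isGraphElement_zero, fun _ Γ hΓ => ?_⟩
      rw [hz, split_zero, sub_zero] at hΓ
      simp at hΓ
    have he : Even N := by
      have := even_of_degreePart hodd hD hx hz
      rwa [Nat.even_add, iff_true_right even_two] at this
    have hN : 2 ≤ N := by obtain ⟨c, rfl⟩ := he; omega
    rw [degreePart_split]
    obtain ⟨y, hy, h⟩ := exists_sub_split_veryLoopy hN he (hx (N + 2) (k + 1)) (by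
      have := hv (N + 1 + 2) (k + 1 + 1)
      rwa [delta_apply] at this)
    exact ⟨y, hy, fun _ => h⟩
  choose y hy hyv using hex
  let η : Cochain K
    | 0, _ => 0
    | N + 1, l => y N l
  have hη : IsSeries (degreePart K n (D - 1)) η := by
    rintro (_ | N) k
    · exact isGraphElement_zero
    · exact hy N k
  refine ⟨c, η, hη, fun N k Γ hΓ => ?_⟩
  rw [Pi.sub_apply, Pi.sub_apply, Pi.sub_apply, Pi.sub_apply] at hΓ
  have hzero : ∀ z : Gra K N, z = 0 → Γ ∈ z.support → VeryLoopy Γ := by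
    rintro z rfl h; simp at h
  rcases lt_or_ge N 2 with hN | hN
  · refine hzero _ ?_ hΓ
    rw [hx.eq_zero_of_lt_two hN, delta_of_lt_two (fun k => rfl) hN, Pi.smul_apply, Pi.smul_apply,
      theta_apply_of_ne (by omega), smul_zero, sub_zero, sub_zero]
  obtain ⟨a, rfl⟩ := Nat.exists_eq_add_of_le' hN
  rcases k with _ | k
  · refine hzero _ ?_ hΓ
    rw [hx.edges_eq_zero_of_lt_two _ (by norm_num), delta_edges_zero, Pi.smul_apply, Pi.smul_apply,
      theta_apply_of_ne (by omega), smul_zero, sub_zero, sub_zero]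
  rw [delta_apply] at hΓ
  by_cases ha : a = 0
  · subst ha
    refine hzero _ ?_ hΓ
    have hη1 : η (0 + 1) k = 0 := hη.eq_zero_of_lt_two (N := 0 + 1) (by norm_num) k
    rw [hη1, split_zero, sub_zero, sub_eq_zero]
    exact hc (k + 1)
  · rw [Pi.smul_apply, Pi.smul_apply, theta_apply_of_ne (by omega), smul_zero, sub_zero] at hΓ
    exact hyv a k ha Γ hΓ

end GC

end OddGC

end

theorem propositionB1 (K : Type*) [Field K] [CharZero K] (n : ℕ) (hodd : Odd n) (hn : 3 ≤ n) :
    (∀ m : OddGC.Cochain (OddGC.HBSO K n),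
      OddGC.IsBGC n 1 m → OddGC.IsMaurerCartan m →
      (∀ k, m 2 k = OddGC.thetaSeries K n hn 2 k) →
      ∃ m' : OddGC.Cochain (OddGC.HBSO K n),
        OddGC.IsBGC n 1 m' ∧ OddGC.IsMaurerCartan m' ∧ OddGC.GaugeEquivalent n m m' ∧
        (∀ k, m' 2 k = OddGC.thetaSeries K n hn 2 k) ∧
        ∀ N, N ≠ 2 → ∀ k, ∀ Γ ∈ (m' N k).support, OddGC.Multigraph.VeryLoopy Γ) ∧
    (OddGC.IsGC n (3 - 2 * n) (OddGC.theta K) ∧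
      OddGC.IsVeryLoopy (OddGC.delta (OddGC.theta K)) ∧
      (¬ ∃ y : OddGC.Cochain K, OddGC.IsGC n (2 - 2 * n) y ∧
        OddGC.IsVeryLoopy (OddGC.theta K - OddGC.delta y)) ∧
      ∀ D : ℤ, Odd D → ∀ x : OddGC.Cochain K, OddGC.IsGC n D x →
        OddGC.IsVeryLoopy (OddGC.delta x) →
        ∃ (c : K) (y : OddGC.Cochain K), OddGC.IsGC n (D - 1) y ∧
          OddGC.IsVeryLoopy (x - OddGC.delta y - c • OddGC.theta K)) := by
  refine ⟨fun m hm hmc hm2 => ?_, OddGC.isGC_iff.mpr (OddGC.isSeries_theta n), ?_, ?_, ?_⟩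
  · have hms := OddGC.isBGC_iff.mp hm
    obtain ⟨ξ, hξ, hv⟩ := OddGC.exists_gaugeAct_veryLoopy hodd hms hmc
    have hs := OddGC.gaugeAct_isSeries hξ hms
    refine ⟨OddGC.gaugeAct ξ m, OddGC.isBGC_iff.mpr hs, ?_, ⟨ξ, OddGC.isBGC_iff.mpr hξ, rfl⟩,
      fun k => ?_, hv⟩
    · exact OddGC.gaugeAct_isMaurerCartan (OddGC.isEvenSeries_of_isSeries hodd hξ)
        (fun N hN k => hξ.eq_zero_of_lt_two hN k) (OddGC.isOddSeries_of_isSeries hodd hms)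
        (OddGC.isOddSeries_of_isSeries hodd hs) hmc
    · rw [OddGC.gaugeAct_two (fun N hN k => hξ.eq_zero_of_lt_two hN k)
        (fun N hN k => hms.eq_zero_of_lt_two hN k), hm2]
  · rw [OddGC.delta_theta]
    intro N k Γ hΓ
    exact absurd hΓ (by simp)
  · rintro ⟨y, hy, hv⟩
    exact OddGC.theta_not_exact y (OddGC.isGC_iff.mp hy) hv
  · intro D hD x hx hv
    obtain ⟨c, y, hy, h⟩ := OddGC.exists_veryLoopy_sub hodd hD (OddGC.isGC_iff.mp hx) hv
    exact ⟨c, y, OddGC.isGC_iff.mpr hy, h⟩
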